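/- **Setting.** Let $D=\{(1,0),(0,1),(0,-1),(-1,0)\}$ be the set of directions of $\mathbb Z^2$ and let $\Gamma$ be a finite set of glues. A *tile type* is a map $t:D\to\Gamma$, $d\mapsto t_d$. A *(temperature-1) tile assembly system* is a pair $\mathcal T=(T,\sigma)$ of a finite set $T$ of tile types and a tile type $\sigma$ (the seed, not necessarily in $T$). An *assembly* is a partial map $\alpha:\mathbb Z^2\to T\cup\{\sigma\}$ which, if $\sigma\notin T$, takes the value $\sigma$ at most once. Its *binding graph* has vertex set $\operatorname{dom}\alpha$ and an edge between $v$ and $v+d$ ($d\in D$) iff $\alpha(v)_d=\alpha(v+d)_{-d}$. An assembly is *producible* if its binding graph is connected and $\alpha(0,0)=\sigma$. The system is *confluent* if any two producible assemblies agree on the intersection of their domains; then $\alpha_{\max}$ denotes the union of all producible assemblies, i.e. the maximal producible assembly. Paths in $\alpha_{\max}$ are paths without repeated vertices in its binding graph. **Quipus.** A *quipu* associated to $\mathcal T$ is a finite directed graph $Q=(V,E)$ with a root $r\in V$, vertex labels $\eta:V\to T\cup\{\sigma\}$ and arc labels $\lambda:E\to D$ such that: (1) $r$ has in-degree $0$,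 $\eta(r)=\sigma$, and no other vertex has label $\sigma$ unless $\sigma\in T$; (2) $\eta(x)_d=\eta(y)_{-d}$ for every arc $(x,y)$ with label $d$; (3) there is a unique path from $r$ to every vertex, and different arcs leaving the same vertex have different labels; (4) no two cycles share a vertex, and exactly one arc enters each cycle from outside (its end is the *entry* of the cycle); (5) every path meets at most two cycles; (6) the arc labels of every walk from $r$, read from the origin, form a self-avoiding lattice path; (7) distinct walks from $r$ have distinct displacement vectors (sums of arc labels). For $x\in V$ let $\operatorname{cov}_Q(x)\subseteq\mathbb Z^2$ be the set of displacement vectors of the walks from $r$ to $x$; for $X\subseteq V$ let $\operatorname{cov}_Q(X)=\bigcup_{x\in X}\operatorname{cov}_Q(x)$, and $\operatorname{dom}(\alpha_Q)=\operatorname{cov}_Q(V)$. **Single-direction extensions.** Let $c$ be a cycle of $Q$ with entry $e$. The *one-step unrolling* of $c$ adds a copy $e'$ of $e$, together with a copy of the subgraph that hangs at $e$ off the cycle $c$, redirects the arc that enters $c$ from outside to $e'$, and adds an arc from $e'$ to the successor of $e$ in $c$. The *$k$-multiple* of $c$ ($k\ge1$) replaces $c$, together with the subgraphs that hang at its vertices,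 by $k$ copies, joined so that the $k$ copies of $c$ form a single cycle $c^k$. Labels are copied. A quipu $Q'$ is an *extension* of $Q$ if the arc label sequence of every walk of $Q$ from the root is also that of some walk of $Q'$ from its root, and every cycle of $Q$ is, possibly unrolled or replaced by a $k$-multiple, a cycle of $Q'$. Let $X$ be a set of vertices of $Q$ that all have the same label $t$, and let $d\in D$. A quipu $Q'$ is a *single-direction extension* $Q[X,d,t]$ if it is an extension of $Q$ that arises from $Q$ as follows: first perform finitely many one-step unrollings and $k$-multiples of cycles, adding to $X$ all copies of its members; then, for one tile type $t'\in T$ with $t_d=t'_{-d}$, attach to some members of $X$ an arc with label $d$ to a new vertex with label $t'$; and if moreover $\operatorname{cov}_Q(X)+d\subseteq\operatorname{dom}(\alpha_{Q'})$. **Theorem.** Let $\mathcal T$ be a confluent tile assembly system and let $Q$ be a quipu associated to $\mathcal T$ with $\operatorname{dom}(\alpha_Q)\subsetneq\operatorname{dom}(\alpha_{\max})$. Suppose that for every infinite path $\pi$ in $\alpha_{\max}$ with $\operatorname{dom}(\pi)\not\subseteq\operatorname{dom}(\alpha_Q)$ the intersection $\operatorname{dom}(\pi)\cap\operatorname{dom}(\alpha_Q)$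 is infinite. Then there is a finite sequence of quipus $Q=Q_0,Q_1,\dots,Q_n=Q'$, $n\ge1$, in which each $Q_{i+1}$ is a single-direction extension $Q_i[X_i,d_i,t_i]$ of $Q_i$, such that $\operatorname{dom}(\alpha_{Q'})=\operatorname{dom}(\alpha_{\max})$. -/

import Mathlib

/-! ### Directions, tiles, assemblies -/

/-- The four directions of the lattice `ℤ × ℤ`. -/
inductive Dir : Type
  | east | north | south | west

/-- The unit vector of a direction. -/
def Dir.vec : Dir → ℤ × ℤ
  | .east => (1, 0)
  | .north => (0, 1)
  | .south => (0, -1)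
  | .west => (-1, 0)

/-- The opposite direction. -/
def Dir.opp : Dir → Dir
  | .east => .west
  | .north => .south
  | .south => .north
  | .west => .east

theorem Dir.opp_opp (d : Dir) : d.opp.opp = d := by cases d <;> rfl

theorem Dir.vec_opp (d : Dir) : d.opp.vec = -d.vec := by cases d <;> simp [Dir.vec, Dir.opp]

theorem Dir.vec_ne_zero (d : Dir) : d.vec ≠ 0 := by cases d <;> simp [Dir.vec]

/-- A tile type assigns a glue to every direction. -/
abbrev Tile (Γ : Type*) := Dir → Γ

/-- A (temperature-1) tile assembly system: a finite set of tile types and a seed, which need not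
belong to that set. -/
structure TAS (Γ : Type*) where
  tiles : Finset (Tile Γ)
  seed : Tile Γ

/-- A partial map from the lattice to tile types. -/
abbrev PartialTiling (Γ : Type*) := ℤ × ℤ → Option (Tile Γ)

namespace PartialTiling

variable {Γ : Type*}

def dom (α : PartialTiling Γ) : Set (ℤ × ℤ) := {v | ∃ t, α v = some t}

/-- The binding graph: neighbouring tiles are joined iff the glues on their common side agree.
(Lattice points outside the domain are isolated.) -/
def bindingGraph (α : PartialTiling Γ) : SimpleGraph (ℤ × ℤ) where
  Adj v w := ∃ (d : Dir) (t t' : Tile Γ),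
    w = v + d.vec ∧ α v = some t ∧ α w = some t' ∧ t d = t' d.opp
  symm := ⟨by
    rintro v w ⟨d, t, t', hw, ht, ht', h⟩
    refine ⟨d.opp, t', t, ?_, ht', ht, ?_⟩
    · rw [hw, Dir.vec_opp]; abel
    · rw [Dir.opp_opp]; exact h.symm⟩
  loopless := ⟨by
    rintro v ⟨d, t, t', hw, -⟩
    exact d.vec_ne_zero (left_eq_add.mp hw)⟩

/-- The binding graph on the domain is connected. -/
def Stable (α : PartialTiling Γ) : Prop :=
  α.dom.Nonempty ∧ ∀ v ∈ α.dom, ∀ w ∈ α.dom, α.bindingGraph.Reachable v w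

end PartialTiling

namespace TAS

variable {Γ : Type*}

/-- An assembly uses only tile types of the system and the seed; if the seed is not one of the tile
types, it is used at most once. -/
def IsAssembly (S : TAS Γ) (α : PartialTiling Γ) : Prop :=
  (∀ v t, α v = some t → t ∈ S.tiles ∨ t = S.seed) ∧
  (S.seed ∉ S.tiles → {v | α v = some S.seed}.Subsingleton)

/-- A producible assembly: stable, with the seed at the origin. -/
def Producible (S : TAS Γ) (α : PartialTiling Γ) : Prop :=
  S.IsAssembly α ∧ α.Stable ∧ α 0 = some S.seed

/-- Any two producible assemblies agree on the intersection of their domains. -/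
def Confluent (S : TAS Γ) : Prop :=
  ∀ α β, S.Producible α → S.Producible β → ∀ v ∈ α.dom ∩ β.dom, α v = β v

open Classical in
/-- The maximal assembly: the union of all producible assemblies. (For a confluent system the
chosen tile does not depend on the choice.) -/
noncomputable def alphaMax (S : TAS Γ) : PartialTiling Γ := fun v =>
  if h : ∃ t, ∃ α, S.Producible α ∧ α v = some t then some h.choose else none

theorem alphaMax_eq {S : TAS Γ} (hS : S.Confluent) {α : PartialTiling Γ} (hα : S.Producible α)
    {v : ℤ × ℤ} (hv : v ∈ α.dom) : S.alphaMax v = α v := by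
  obtain ⟨t, ht⟩ := hv
  have h : ∃ t, ∃ β, S.Producible β ∧ β v = some t := ⟨t, α, hα, ht⟩
  obtain ⟨β, hβ, hβv⟩ := h.choose_spec
  rw [alphaMax, dif_pos h, ← hβv]
  exact hS β α hβ hα v ⟨⟨_, hβv⟩, ⟨t, ht⟩⟩

end TAS

/-! ### Finite labelled directed graphs -/

/-- A finite directed graph with a root, tile types on its vertices and directions on its arcs
(`lab x y` is only meaningful if `arc x y`). -/
structure LGraph (Γ : Type*) where
  V : Type
  finite : Finite V
  root : V
  arc : V → V → Prop
  tile : V → Tile Γ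
  lab : V → V → Dir

namespace LGraph

variable {Γ : Type*}

/-- Finite directed walks starting at `u`. -/
inductive Walk (G : LGraph Γ) (u : G.V) : G.V → Type
  | nil : Walk G u u
  | snoc {x y : G.V} (w : Walk G u x) (h : G.arc x y) : Walk G u y

namespace Walk

variable {G : LGraph Γ} {u : G.V}

/-- The vertices visited (last one first). -/
def support : {v : G.V} → Walk G u v → List G.V
  | _, nil => [u]
  | v, snoc w _ => v :: w.support

/-- The sequence of arc labels (last one first). -/
def labels : {v : G.V} → Walk G u v → List Dir
  | _, nil => []
  | v, @snoc _ _ _ x _ w _ => G.lab x v :: w.labels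

/-- The displacement vector: the sum of the arc labels. -/
def disp : {v : G.V} → Walk G u v → ℤ × ℤ
  | _, nil => 0
  | v, @snoc _ _ _ x _ w _ => w.disp + (G.lab x v).vec

/-- The lattice points visited by the walk of arc labels that starts at the origin (last one
first). -/
def positions : {v : G.V} → Walk G u v → List (ℤ × ℤ)
  | _, nil => [0]
  | _, w@(snoc w' _) => w.disp :: w'.positions

/-- A path is a walk without repeated vertices. -/
def IsPath {v : G.V} (w : Walk G u v) : Prop := w.support.Nodup

end Walk

/-- A directed cycle (a loop is a cycle of length one). -/
structure Cycle (G : LGraph Γ) where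
  len : ℕ
  len_pos : 0 < len
  vert : ZMod len → G.V
  injective : Function.Injective vert
  arc : ∀ i, G.arc (vert i) (vert (i + 1))

/-- The set of vertices of a cycle. -/
def Cycle.support {G : LGraph Γ} (c : G.Cycle) : Set G.V := Set.range c.vert

/-- `e` is the vertex at which the cycle `c` is entered from outside. -/
def IsEntry (G : LGraph Γ) (c : G.Cycle) (e : G.V) : Prop :=
  e ∈ c.support ∧ ∃ y, y ∉ c.support ∧ G.arc y e

/-- The set of lattice points that are displacement vectors of rooted walks ending in `x`. -/
def cover (G : LGraph Γ) (x : G.V) : Set (ℤ × ℤ) :=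
  {v | ∃ w : Walk G G.root x, w.disp = v}

/-- The set of all lattice points covered by the graph: the domain of the assembly that corresponds
to it. -/
def dom (G : LGraph Γ) : Set (ℤ × ℤ) := {v | ∃ x, v ∈ G.cover x}

/-! ### Operations on labelled graphs -/

/-- The vertices of the subgraph that hangs at the vertex `e` of `c` off the cycle `c`
(`e` itself included). -/
def branch (G : LGraph Γ) (c : G.Cycle) (e : G.V) : Set G.V :=
  {g | Relation.ReflTransGen (fun u v => G.arc u v ∧ v ∉ c.support) e g}

theorem self_mem_branch (G : LGraph Γ) (c : G.Cycle) (e : G.V) : e ∈ G.branch c e :=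
  Relation.ReflTransGen.refl

/-- One-step unrolling of the cycle `c` with entry vertex `e`. The vertices `Sum.inr g` are the new
ones: `Sum.inr e` is the new copy of `e`, and with it comes a copy of the subgraph that hangs at `e`
off the cycle. Arcs that enter `c` from outside are redirected to the new copy of `e`, from which
there is an arc to the successor of `e` in `c`. -/
def unroll (G : LGraph Γ) (c : G.Cycle) (e : G.V) : LGraph Γ where
  V := G.V ⊕ G.branch c e
  finite := by have := G.finite; infer_instance
  root := Sum.inl G.root
  arc
    | .inl u, .inl v => G.arc u v ∧ ¬ (u ∉ c.support ∧ v = e)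
    | .inl u, .inr g => G.arc u e ∧ u ∉ c.support ∧ g.1 = e
    | .inr g, .inr h => G.arc g.1 h.1 ∧ h.1 ∉ c.support
    | .inr g, .inl z => G.arc e z ∧ z ∈ c.support ∧ g.1 = e
  tile p := G.tile (Sum.elim id Subtype.val p)
  lab p q := G.lab (Sum.elim id Subtype.val p) (Sum.elim id Subtype.val q)

/-- The vertex of which a vertex of the unrolled graph is a copy. -/
def unrollOrig (G : LGraph Γ) (c : G.Cycle) (e : G.V) : (G.unroll c e).V → G.V :=
  Sum.elim id Subtype.val

/-- The `k`-multiple of the cycle `c` with entry vertex `e`: all vertices that can be reached from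
`c` (the cycle and the subgraphs that hang off it) are taken `k` times, and the arc of `c` back to
`e` leads from each copy to the next one, cyclically. The pair `(v, 0)` is the original vertex
`v`. -/
def multiple (G : LGraph Γ) (c : G.Cycle) (e : G.V) (k : ℕ) [NeZero k] : LGraph Γ where
  V := {p : G.V × ZMod k // ¬ Relation.ReflTransGen G.arc e p.1 → p.2 = 0}
  finite := by
    have := G.finite
    infer_instance
  root := ⟨(G.root, 0), fun _ => rfl⟩
  arc p q := G.arc p.1.1 q.1.1 ∧
    ((p.1.1 ∈ c.support ∧ q.1.1 = e → q.1.2 = p.1.2 + 1) ∧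
     (¬ (p.1.1 ∈ c.support ∧ q.1.1 = e) → q.1.2 = p.1.2))
  tile p := G.tile p.1.1
  lab p q := G.lab p.1.1 q.1.1

/-- The vertex of which a vertex of the `k`-multiple is a copy. -/
def multipleOrig (G : LGraph Γ) (c : G.Cycle) (e : G.V) (k : ℕ) [NeZero k] :
    (G.multiple c e k).V → G.V := fun p => p.1.1

/-- Adding to every vertex `y ∈ Y` an arc labelled `d` to a new vertex labelled `t`. -/
def addLeaves (G : LGraph Γ) (Y : Set G.V) (d : Dir) (t : Tile Γ) : LGraph Γ where
  V := G.V ⊕ Y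
  finite := by have := G.finite; infer_instance
  root := Sum.inl G.root
  arc
    | .inl u, .inl v => G.arc u v
    | .inl u, .inr y => u = y.1
    | .inr _, _ => False
  tile := Sum.elim G.tile fun _ => t
  lab
    | .inl u, .inl v => G.lab u v
    | _, _ => d

/-- `Reshape G X H Y`: the graph `H` arises from `G` by finitely many one-step unrollings and
`k`-multiples of cycles, and `Y` is the set of vertices of `H` that are copies of vertices in
`X`. -/
inductive Reshape (G : LGraph Γ) (X : Set G.V) : (H : LGraph Γ) → Set H.V → Prop
  | refl : Reshape G X G X
  | unroll {H : LGraph Γ} {Y : Set H.V} (h : Reshape G X H Y) (c : H.Cycle) (e : H.V)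
      (he : H.IsEntry c e) : Reshape G X (H.unroll c e) (H.unrollOrig c e ⁻¹' Y)
  | multiple {H : LGraph Γ} {Y : Set H.V} (h : Reshape G X H Y) (c : H.Cycle) (e : H.V)
      (he : H.IsEntry c e) (k : ℕ) [NeZero k] :
      Reshape G X (H.multiple c e k) (H.multipleOrig c e k ⁻¹' Y)

end LGraph

/-! ### Quipus -/

/-- A quipu associated to the tile assembly system `S`. -/
structure Quipu {Γ : Type*} (S : TAS Γ) extends LGraph Γ where
  root_no_in : ∀ x, ¬ arc x root
  tile_root : tile root = S.seed
  tile_mem : ∀ x, tile x ∈ S.tiles ∨ tile x = S.seed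
  tile_seed : S.seed ∉ S.tiles → ∀ x, tile x = S.seed → x = root
  glue : ∀ x y, arc x y → tile x (lab x y) = tile y (lab x y).opp
  unique_path : ∀ x, ∃! w : LGraph.Walk toLGraph root x, w.IsPath
  deterministic : ∀ x y z, arc x y → arc x z → lab x y = lab x z → y = z
  /-- Two cycles that share a vertex are the same cycle. -/
  cycles_disjoint : ∀ (c c' : toLGraph.Cycle) (i : ZMod c.len) (j : ZMod c'.len),
    c.vert i = c'.vert j → c.vert (i + 1) = c'.vert (j + 1)
  one_arc_to_cycle : ∀ c : toLGraph.Cycle,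
    ∃! a : V × V, a.1 ∉ c.support ∧ a.2 ∈ c.support ∧ arc a.1 a.2
  /-- Among three cycles that are met by one path, two have the same set of vertices (hence are
  the same). -/
  two_cycles : ∀ (u v : V) (w : LGraph.Walk toLGraph u v), w.IsPath →
    ∀ c₁ c₂ c₃ : toLGraph.Cycle,
      (∃ x ∈ w.support, x ∈ c₁.support) → (∃ x ∈ w.support, x ∈ c₂.support) →
      (∃ x ∈ w.support, x ∈ c₃.support) →
      c₁.support = c₂.support ∨ c₁.support = c₃.support ∨ c₂.support = c₃.support
  /-- The arc labels of a rooted walk form a self-avoiding lattice path (an infinite walk is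
  self-avoiding iff all its finite prefixes are). -/
  free_path : ∀ (x : V) (w : LGraph.Walk toLGraph root x), w.positions.Nodup
  /-- Distinct rooted walks have distinct displacement vectors. -/
  unique_walk : ∀ w₁ w₂ : (x : V) × LGraph.Walk toLGraph root x,
    w₁ ≠ w₂ → w₁.2.disp ≠ w₂.2.disp

namespace Quipu

variable {Γ : Type*} {S : TAS Γ}

/-- `Q'` is an extension of `Q`: every label sequence of a rooted walk of `Q` is one of `Q'`, and
every cycle of `Q` (possibly unrolled, which moves its starting point by `r`) or a `k`-multiple of
it is a cycle of `Q'`. -/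
def IsExtension (Q Q' : Quipu S) : Prop :=
  (∀ (x : Q.V) (w : Q.toLGraph.Walk Q.root x),
    ∃ (x' : Q'.V) (w' : Q'.toLGraph.Walk Q'.root x'), w'.labels = w.labels) ∧
  ∀ c : Q.toLGraph.Cycle, ∃ (c' : Q'.toLGraph.Cycle) (k r : ℕ), 0 < k ∧ c'.len = k * c.len ∧
    ∀ i : ℕ,
      Q'.tile (c'.vert (i : ZMod c'.len)) = Q.tile (c.vert ((r + i : ℕ) : ZMod c.len)) ∧
      Q'.lab (c'.vert (i : ZMod c'.len)) (c'.vert ((i + 1 : ℕ) : ZMod c'.len)) =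
        Q.lab (c.vert ((r + i : ℕ) : ZMod c.len)) (c.vert ((r + i + 1 : ℕ) : ZMod c.len))

/-- `Q'` is a single-direction extension `Q[X, d, t]` of `Q`: all vertices in `X` carry the tile
type `t`; cycles are unrolled or multiplied, where copies of vertices in `X` count as members of
`X`; then new vertices, labelled with one tile type `t'` whose glue fits, are attached in direction
`d` to some of the members of `X`, so that the translate by `d` of the cover of `X` gets covered. -/
def IsSingleDirExt (Q : Quipu S) (X : Set Q.V) (d : Dir) (t : Tile Γ) (Q' : Quipu S) : Prop :=
  (∀ x ∈ X, Q.tile x = t) ∧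
  (∃ t' ∈ S.tiles, t d = t' d.opp ∧
    ∃ (H : LGraph Γ) (Y : Set H.V), LGraph.Reshape Q.toLGraph X H Y ∧
      ∃ Z ⊆ Y, Q'.toLGraph = H.addLeaves Z d t') ∧
  IsExtension Q Q' ∧
  ∀ x ∈ X, ∀ v ∈ Q.cover x, v + d.vec ∈ Q'.dom

end Quipu

/-! Two facts carry the proof. Extension step: for a tile type `t`, a direction `d` and a tile type
that fits there, the quipu has a single-direction extension for the set of all vertices labelled `t`
(`exists_isSingleDirExt`). Boundedness: the points of the maximal assembly have bounded distance
from the domain of the quipu (`exists_subset_level`). Running through all pairs `(t, d)` adds all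
neighbours of the domain, so finitely many rounds fill the maximal assembly.

Extension step. A leaf in direction `d` can be attached to a vertex only if the translate by `d` of
its whole cover lies outside the domain. Rooted runs to a vertex wind around at most two cycles, so
covers are points, rays `a + n p` or fans `a + m p + k q` (`words_cases`). Uniqueness of
displacements makes their position in the plane rigid: no ray points into the interior of a fan
(`exterior`), since it would have to cross the lines of words that make up the fan. By separation of
cones, membership in the domain is then eventually periodic along rays and along the edges of fans.
Replacing a cycle by its multiple for the period and unrolling it beyond the preperiod makes
membership of the translate constant on the cover of each vertex (`exists_reshape_neutral`). Both
operations are coverings of graphs, and this transports most of the quipu conditions.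

Boundedness. Arbitrarily long excursions outside the domain give, by compactness, one infinite word
that can be followed arbitrarily far from the points of a single ray or fan. For a ray, the word is
followed from `a + m p` until it hits the domain (`Chase`). The path condition makes late chases
avoid every finite set. Infinitely many hits fall into one piece of the domain. A chase can cross a
line of words only where that line is not part of the domain, which confines a crossing to a finite
box; this excludes hits deep in a fan. For hits on a ray transversal to `p`, the path condition is
used once more: translates of that ray must return to the domain, so a fan lies beside it, and the
chases would have to cross a line of this fan in a finite box. Fans as starting pieces are reduced
to the rays they consist of. -/

/-! ### Words of directions -/

/-- The displacement vector of a word of directions. -/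
def wordDisp (l : List Dir) : ℤ × ℤ := (l.map Dir.vec).sum

@[simp] theorem wordDisp_nil : wordDisp [] = 0 := rfl

@[simp] theorem wordDisp_cons (d : Dir) (l : List Dir) :
    wordDisp (d :: l) = d.vec + wordDisp l := by simp [wordDisp]

@[simp] theorem wordDisp_append (l l' : List Dir) :
    wordDisp (l ++ l') = wordDisp l + wordDisp l' := by simp [wordDisp]

/-- The `n`-th power of a word. -/
def wordPow {α : Type*} (B : List α) (n : ℕ) : List α := (List.replicate n B).flatten

section wordPow
variable {α : Type*} (B : List α)

@[simp] theorem wordPow_zero : wordPow B 0 = [] := rfl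

theorem wordPow_succ (n : ℕ) : wordPow B (n + 1) = B ++ wordPow B n := by
  simp [wordPow, List.replicate_succ]

@[simp] theorem wordPow_one : wordPow B 1 = B := by simp [wordPow]

theorem wordPow_add (m n : ℕ) : wordPow B (m + n) = wordPow B m ++ wordPow B n := by
  rw [wordPow, ← List.replicate_append_replicate, List.flatten_append]; rfl

theorem wordPow_succ' (n : ℕ) : wordPow B (n + 1) = wordPow B n ++ B := by
  rw [wordPow_add, wordPow_one]

theorem wordPow_mul (m n : ℕ) : wordPow B (m * n) = wordPow (wordPow B m) n := by
  induction n with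
  | zero => simp
  | succ n ih => rw [Nat.mul_succ, wordPow_add, ih, wordPow_succ']

@[simp] theorem wordPow_nil (n : ℕ) : wordPow ([] : List α) n = [] := by
  induction n with
  | zero => rfl
  | succ n ih => rw [wordPow_succ, ih]; rfl

theorem length_wordPow (n : ℕ) : (wordPow B n).length = n * B.length := by
  simp [wordPow]

theorem wordPow_ne_nil {B : List α} (hB : B ≠ []) {n : ℕ} (hn : n ≠ 0) : wordPow B n ≠ [] := by
  obtain ⟨n, rfl⟩ := Nat.exists_eq_succ_of_ne_zero hn
  rw [wordPow_succ]; simp [hB]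

end wordPow

@[simp] theorem wordDisp_wordPow (B : List Dir) (n : ℕ) : wordDisp (wordPow B n) = n • wordDisp B := by
  induction n with
  | zero => simp
  | succ n ih => rw [wordPow_succ, wordDisp_append, ih, succ_nsmul']

/-! ### Runs -/

namespace LGraph

variable {Γ : Type*} {G : LGraph Γ}

/-- `Run G u l v`: there is a walk from `u` to `v` with label sequence `l`. -/
def Run (G : LGraph Γ) : G.V → List Dir → G.V → Prop
  | u, [], v => u = v
  | u, d :: l, v => ∃ y, G.arc u y ∧ G.lab u y = d ∧ Run G y l v

/-- Reachability along arcs. -/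
def Reach (G : LGraph Γ) : G.V → G.V → Prop := Relation.ReflTransGen G.arc

@[simp] theorem run_nil {u v : G.V} : G.Run u [] v ↔ u = v := Iff.rfl

theorem run_cons {u v : G.V} {d : Dir} {l : List Dir} :
    G.Run u (d :: l) v ↔ ∃ y, G.arc u y ∧ G.lab u y = d ∧ G.Run y l v := Iff.rfl

theorem run_append {u v : G.V} {l l' : List Dir} :
    G.Run u (l ++ l') v ↔ ∃ y, G.Run u l y ∧ G.Run y l' v := by
  induction l generalizing u with
  | nil => simp
  | cons d l ih =>
    simp only [List.cons_append, run_cons, ih]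
    constructor
    · rintro ⟨y, h1, h2, z, h3, h4⟩; exact ⟨z, ⟨y, h1, h2, h3⟩, h4⟩
    · rintro ⟨z, ⟨y, h1, h2, h3⟩, h4⟩; exact ⟨y, h1, h2, z, h3, h4⟩

theorem Run.append {u v w : G.V} {l l' : List Dir} (h : G.Run u l v) (h' : G.Run v l' w) :
    G.Run u (l ++ l') w := run_append.2 ⟨v, h, h'⟩

theorem run_singleton {u v : G.V} {d : Dir} : G.Run u [d] v ↔ G.arc u v ∧ G.lab u v = d := by
  simp only [run_cons, run_nil]
  constructor
  · rintro ⟨y, h1, h2, rfl⟩; exact ⟨h1, h2⟩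
  · rintro ⟨h1, h2⟩; exact ⟨v, h1, h2, rfl⟩

theorem Run.of_arc {u v : G.V} (h : G.arc u v) : G.Run u [G.lab u v] v := run_singleton.2 ⟨h, rfl⟩

theorem Run.pow {u : G.V} {l : List Dir} (h : G.Run u l u) (n : ℕ) : G.Run u (wordPow l n) u := by
  induction n with
  | zero => rfl
  | succ n ih => rw [wordPow_succ]; exact h.append ih

theorem Run.reach {u v : G.V} {l : List Dir} (h : G.Run u l v) : G.Reach u v := by
  induction l generalizing u with
  | nil => rw [run_nil] at h; subst h; exact Relation.ReflTransGen.refl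
  | cons d l ih => obtain ⟨y, h1, -, h3⟩ := h; exact Relation.ReflTransGen.head h1 (ih h3)

theorem reach_iff {u v : G.V} : G.Reach u v ↔ ∃ l, G.Run u l v := by
  refine ⟨fun h => ?_, fun ⟨l, h⟩ => h.reach⟩
  induction h with
  | refl => exact ⟨[], rfl⟩
  | tail _ h ih => obtain ⟨l, hl⟩ := ih; exact ⟨_, hl.append (Run.of_arc h)⟩

theorem Reach.refl (u : G.V) : G.Reach u u := Relation.ReflTransGen.refl

theorem Reach.trans {u v w : G.V} (h : G.Reach u v) (h' : G.Reach v w) : G.Reach u w :=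
  Relation.ReflTransGen.trans h h'

theorem Reach.of_arc {u v : G.V} (h : G.arc u v) : G.Reach u v := Relation.ReflTransGen.single h

/-- A vertex that lies on a cycle. -/
def Cyc (G : LGraph Γ) (a : G.V) : Prop := ∃ b, G.arc a b ∧ G.Reach b a

theorem cyc_iff {a : G.V} : G.Cyc a ↔ ∃ l, l ≠ [] ∧ G.Run a l a := by
  constructor
  · rintro ⟨b, h1, h2⟩
    obtain ⟨l, hl⟩ := reach_iff.1 h2
    exact ⟨_ :: l, by simp, b, h1, rfl, hl⟩
  · rintro ⟨l, h0, h⟩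
    cases l with
    | nil => exact absurd rfl h0
    | cons d l => obtain ⟨y, h1, -, h3⟩ := h; exact ⟨y, h1, h3.reach⟩

theorem Cyc.of_reach_ne {a b : G.V} (h : G.Reach a b) (h' : G.Reach b a) (hne : a ≠ b) : G.Cyc a := by
  rcases Relation.ReflTransGen.cases_head h with h | ⟨c, hc, hc'⟩
  · exact absurd h hne
  · exact ⟨c, hc, Reach.trans hc' h'⟩

theorem Cyc.congr {a b : G.V} (ha : G.Cyc a) (h : G.Reach a b) (h' : G.Reach b a) : G.Cyc b := by
  by_cases hne : a = b
  · exact hne ▸ ha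
  · exact Cyc.of_reach_ne h' h (Ne.symm hne)

theorem run_det (hdet : ∀ x y z, G.arc x y → G.arc x z → G.lab x y = G.lab x z → y = z)
    {u x x' : G.V} {l : List Dir} (h : G.Run u l x) (h' : G.Run u l x') : x = x' := by
  induction l generalizing u with
  | nil => rw [run_nil] at h h'; rw [← h, ← h']
  | cons d l ih =>
    obtain ⟨y, h1, h2, h3⟩ := h
    obtain ⟨y', h1', h2', h3'⟩ := h'
    have := hdet u y y' h1 h1' (h2.trans h2'.symm)
    subst this
    exact ih h3 h3'

/-! ### Runs and walks -/

theorem Walk.run {u v : G.V} (w : Walk G u v) : G.Run u w.labels.reverse v := by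
  induction w with
  | nil => rfl
  | snoc w h ih =>
    simp only [Walk.labels, List.reverse_cons]
    exact ih.append (Run.of_arc h)

theorem Walk.disp_eq {u v : G.V} (w : Walk G u v) : w.disp = wordDisp w.labels.reverse := by
  induction w with
  | nil => rfl
  | snoc w h ih => simp [Walk.labels, Walk.disp, ih]

theorem Run.exists_walk {u v : G.V} {l : List Dir} (h : G.Run u l v) :
    ∃ w : Walk G u v, w.labels = l.reverse := by
  induction l using List.reverseRecOn generalizing v with
  | nil => rw [run_nil] at h; subst h; exact ⟨.nil, rfl⟩
  | append_singleton l d ih =>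
    obtain ⟨y, h1, h2⟩ := run_append.1 h
    obtain ⟨w, hw⟩ := ih h1
    obtain ⟨h3, h4⟩ := run_singleton.1 h2
    exact ⟨.snoc w h3, by simp [Walk.labels, hw, h4]⟩

theorem mem_cover {x : G.V} {v : ℤ × ℤ} : v ∈ G.cover x ↔ ∃ l, G.Run G.root l x ∧ wordDisp l = v := by
  constructor
  · rintro ⟨w, rfl⟩; exact ⟨_, w.run, w.disp_eq.symm⟩
  · rintro ⟨l, h, rfl⟩
    obtain ⟨w, hw⟩ := h.exists_walk
    exact ⟨w, by rw [w.disp_eq, hw, List.reverse_reverse]⟩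

theorem mem_dom {v : ℤ × ℤ} : v ∈ G.dom ↔ ∃ x l, G.Run G.root l x ∧ wordDisp l = v := by
  simp only [LGraph.dom, Set.mem_ofPred_eq, mem_cover]

theorem Run.mem_dom {x : G.V} {l : List Dir} (h : G.Run G.root l x) : wordDisp l ∈ G.dom :=
  LGraph.mem_dom.2 ⟨x, l, h, rfl⟩

theorem Run.exists_of_prefix {u x : G.V} {l l' : List Dir} (h : G.Run u l x) (h' : l' <+: l) :
    ∃ y, G.Run u l' y := by
  obtain ⟨t, rfl⟩ := h'
  obtain ⟨y, h1, -⟩ := run_append.1 h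
  exact ⟨y, h1⟩

end LGraph

/-! ### A structural form of the quipu conditions -/

/-- The conditions on a quipu, expressed by reachability: every vertex is reachable from the root,
from a vertex at most one arc can be completed to a cycle, at most one arc enters a strongly
connected component, at most two cycles lie on a chain, and words of rooted walks are determined by
their displacement. -/
structure IsQuipu {Γ : Type*} (S : TAS Γ) (G : LGraph Γ) : Prop where
  root_no_in : ∀ x, ¬ G.arc x G.root
  tile_root : G.tile G.root = S.seed
  tile_mem : ∀ x, G.tile x ∈ S.tiles ∨ G.tile x = S.seed
  tile_seed : S.seed ∉ S.tiles → ∀ x, G.tile x = S.seed → x = G.root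
  glue : ∀ x y, G.arc x y → G.tile x (G.lab x y) = G.tile y (G.lab x y).opp
  det : ∀ x y z, G.arc x y → G.arc x z → G.lab x y = G.lab x z → y = z
  reach : ∀ x, G.Reach G.root x
  ret : ∀ x y z, G.arc x y → G.arc x z → G.Reach y x → G.Reach z x → y = z
  entry : ∀ y x y' x', G.arc y x → G.arc y' x' → G.Reach x x' → G.Reach x' x →
    ¬ G.Reach x y → ¬ G.Reach x' y' → y = y' ∧ x = x'
  three : ∀ a b c, G.Cyc a → G.Cyc b → G.Cyc c → G.Reach a b → G.Reach b c →
    G.Reach b a ∨ G.Reach c b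
  uniq : ∀ l l' x x', G.Run G.root l x → G.Run G.root l' x' → wordDisp l = wordDisp l' → l = l'

namespace IsQuipu

variable {Γ : Type*} {S : TAS Γ} {G : LGraph Γ} (hG : IsQuipu S G)
include hG

theorem run_det {u x x' : G.V} {l : List Dir} (h : G.Run u l x) (h' : G.Run u l x') : x = x' :=
  LGraph.run_det hG.det h h'

theorem run_of_append {u x y : G.V} {l l' : List Dir} (h : G.Run u (l ++ l') x) (h' : G.Run u l y) :
    G.Run y l' x := by
  obtain ⟨z, h1, h2⟩ := LGraph.run_append.1 h
  rwa [hG.run_det h' h1]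

theorem reach_root {x : G.V} (h : G.Reach x G.root) : x = G.root := by
  rcases Relation.ReflTransGen.cases_tail h with h | ⟨y, -, h⟩
  · exact h.symm
  · exact absurd h (hG.root_no_in y)

/-- Runs that stay in the strongly connected component of their start are comparable. -/
theorem prefix_or_prefix {u x x' : G.V} {l l' : List Dir} (h : G.Run u l x) (h' : G.Run u l' x')
    (hx : G.Reach x u) (hx' : G.Reach x' u) : l <+: l' ∨ l' <+: l := by
  induction l generalizing u l' with
  | nil => exact Or.inl (List.nil_prefix)
  | cons d l ih =>
    cases l' with
    | nil => exact Or.inr (List.nil_prefix)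
    | cons d' l' =>
      obtain ⟨y, h1, h2, h3⟩ := h
      obtain ⟨y', h1', h2', h3'⟩ := h'
      have := hG.ret u y y' h1 h1' (h3.reach.trans hx) (h3'.reach.trans hx')
      subst this
      have hd : d = d' := h2.symm.trans h2'
      subst hd
      simp only [List.cons_prefix_cons, true_and]
      exact ih h3 h3' (hx.trans (.of_arc h1)) (hx'.trans (.of_arc h1))

theorem eq_of_run_of_length {u x x' : G.V} {l l' : List Dir} (h : G.Run u l x) (h' : G.Run u l' x')
    (hx : G.Reach x u) (hx' : G.Reach x' u) (hl : l.length = l'.length) : l = l' := by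
  rcases hG.prefix_or_prefix h h' hx hx' with h | h
  · exact h.eq_of_length hl
  · exact (h.eq_of_length hl.symm).symm

/-- The runs between two vertices of a strongly connected component. -/
theorem exists_lap {e x : G.V} (he : G.Cyc e) (h : G.Reach e x) (h' : G.Reach x e) :
    ∃ B s, B ≠ [] ∧ G.Run e B e ∧ G.Run e s x ∧
      (∀ B', G.Run e B' e → B' ≠ [] → B.length ≤ B'.length) ∧
      ∀ r, G.Run e r x → ∃ m, r = wordPow B m ++ s := by
  classical
  obtain ⟨B, ⟨hB0, hB⟩, hBmin⟩ : ∃ B, (B ≠ [] ∧ G.Run e B e) ∧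
      ∀ B', (B' ≠ [] ∧ G.Run e B' e) → B.length ≤ B'.length := by
    obtain ⟨B, hB⟩ := LGraph.cyc_iff.1 he
    obtain ⟨B, h1, h2⟩ := (measure (List.length (α := Dir))).wf.has_min
      {B | B ≠ [] ∧ G.Run e B e} ⟨B, hB⟩
    exact ⟨B, h1, fun B' hB' => not_lt.1 (h2 B' hB')⟩
  obtain ⟨s, hs, hsmin⟩ : ∃ s, G.Run e s x ∧ ∀ s', G.Run e s' x → s.length ≤ s'.length := by
    obtain ⟨s, hs⟩ := LGraph.reach_iff.1 h
    obtain ⟨s, h1, h2⟩ := (measure (List.length (α := Dir))).wf.has_min {s | G.Run e s x} ⟨s, hs⟩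
    exact ⟨s, h1, fun B' hB' => not_lt.1 (h2 B' hB')⟩
  refine ⟨B, s, hB0, hB, hs, fun B' h1 h2 => hBmin B' ⟨h2, h1⟩, ?_⟩
  intro r
  induction hn : r.length using Nat.strong_induction_on generalizing r with
  | _ n ih =>
  intro hr
  subst hn
  by_cases hBr : B <+: r
  · obtain ⟨r', rfl⟩ := hBr
    obtain ⟨m, hm⟩ := ih r'.length (by simp [List.length_pos_iff.2 hB0]) r' rfl (hG.run_of_append hr hB)
    exact ⟨m + 1, by rw [wordPow_succ, List.append_assoc, ← hm]⟩
  -- A run without a full lap is a prefix `r` of `B`, with rest `y`. Then `s ++ y` is closed, and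
  -- minimality of the lap forces `s` and `r` to have equal length.
  · have hrB : r <+: B := (hG.prefix_or_prefix hB hr (.refl e) h').resolve_left hBr
    obtain ⟨y, rfl⟩ := hrB
    have hy := hG.run_of_append hB hr
    have hsy := hBmin (s ++ y) ⟨?_, hs.append hy⟩
    · have hsr : s.length = r.length := le_antisymm (hsmin r hr) (by simpa using hsy)
      exact ⟨0, by simpa using (hG.eq_of_run_of_length hs hr h' h' hsr).symm⟩
    · intro hnil
      obtain ⟨rfl, rfl⟩ := List.append_eq_nil_iff.1 hnil
      simp at hBr

/-- All closed runs at a vertex are powers of one of them. -/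
theorem exists_closed {v : G.V} : ∃ B, G.Run v B v ∧ ∀ r, G.Run v r v → ∃ m, r = wordPow B m := by
  by_cases hv : G.Cyc v
  · obtain ⟨B, s, h0, h1, h2, -, h3⟩ := hG.exists_lap hv (.refl v) (.refl v)
    obtain ⟨m, hm⟩ := h3 [] rfl
    have hs : s = [] := (List.append_eq_nil_iff.1 hm.symm).2
    subst hs
    exact ⟨B, h1, fun r hr => by simpa using h3 r hr⟩
  · refine ⟨[], rfl, fun r hr => ⟨0, ?_⟩⟩
    by_contra hne
    exact hv (LGraph.cyc_iff.2 ⟨r, hne, hr⟩)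

end IsQuipu

namespace LGraph

variable {Γ : Type*} {G : LGraph Γ}

/-! ### Cycles -/

theorem Cycle.reach (c : G.Cycle) (i j : ZMod c.len) : G.Reach (c.vert i) (c.vert j) := by
  have : NeZero c.len := ⟨c.len_pos.ne'⟩
  have key : ∀ n : ℕ, G.Reach (c.vert i) (c.vert (i + n)) := by
    intro n
    induction n with
    | zero => simpa using Reach.refl _
    | succ n ih =>
      have := c.arc (i + n)
      rw [Nat.cast_succ, ← add_assoc]
      exact ih.trans (.of_arc this)
  have := key (j - i).val
  rwa [ZMod.natCast_zmod_val, add_sub_cancel] at this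

theorem Cycle.reach_of_mem {c : G.Cycle} {x y : G.V} (hx : x ∈ c.support) (hy : y ∈ c.support) :
    G.Reach x y := by
  obtain ⟨i, rfl⟩ := hx
  obtain ⟨j, rfl⟩ := hy
  exact c.reach i j

theorem Cycle.cyc {c : G.Cycle} {x : G.V} (hx : x ∈ c.support) : G.Cyc x := by
  obtain ⟨i, rfl⟩ := hx
  exact ⟨_, c.arc i, c.reach _ _⟩

theorem exists_arc_seq {u v : G.V} (h : G.Reach u v) :
    ∃ (n : ℕ) (f : ℕ → G.V), f 0 = u ∧ f n = v ∧ ∀ i < n, G.arc (f i) (f (i + 1)) := by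
  induction h using Relation.ReflTransGen.head_induction_on with
  | refl => exact ⟨0, fun _ => v, rfl, rfl, by simp⟩
  | @head a b hab _ ih =>
    obtain ⟨n, f, h0, hn, hf⟩ := ih
    refine ⟨n + 1, fun i => Nat.casesOn i a f, rfl, hn, ?_⟩
    rintro (_ | i) hi
    · simpa [h0] using hab
    · exact hf i (by omega)

/-- A shortest closed walk among those that begin with the given arc repeats no vertex: a loop away
from the start can be cut out without touching the first arc, and an early return to the start ends
the walk. -/
theorem exists_cycle {g g₁ : G.V} (h : G.arc g g₁) (h' : G.Reach g₁ g) :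
    ∃ c : G.Cycle, c.vert 0 = g ∧ c.vert 1 = g₁ := by
  classical
  have hex : ∃ n : ℕ, 0 < n ∧ ∃ f : ℕ → G.V, f 0 = g ∧ f 1 = g₁ ∧ f n = g ∧
      ∀ i < n, G.arc (f i) (f (i + 1)) := by
    obtain ⟨n, f, h0, hn, hf⟩ := exists_arc_seq h'
    refine ⟨n + 1, n.succ_pos, fun i => Nat.casesOn i g f, rfl, h0, hn, ?_⟩
    rintro (_ | i) hi
    · simpa [h0] using h
    · exact hf i (by omega)
  obtain ⟨hpos, f, h0, h1, hn, hf⟩ := Nat.find_spec hex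
  have hmin := fun m => @Nat.find_min _ _ hex m
  generalize Nat.find hex = n at *
  have hinj : ∀ i j, i < j → j < n → f i ≠ f j := by
    intro i j hij hj heq
    rcases Nat.eq_zero_or_pos i with rfl | hi
    · exact hmin j hj ⟨hij, f, h0, h1, by rw [← heq, h0], fun k hk => hf k (hk.trans hj)⟩
    · refine hmin (n - (j - i)) (by omega) ⟨by omega, fun k => if k ≤ i then f k else f (k + (j - i)),
        by simp [h0], by simp [h1, Nat.succ_le_iff.2 hi], ?_, ?_⟩
      · have : ¬ n - (j - i) ≤ i := by omega
        simp only [this, if_false]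
        rw [← hn]; congr 1; omega
      · intro k hk
        by_cases h1 : k + 1 ≤ i
        · simp only [h1, (by omega : k ≤ i), if_true]; exact hf k (by omega)
        · by_cases h2 : k = i
          · subst h2
            simp only [le_refl, if_true, (by omega : ¬ k + 1 ≤ k), if_false]
            rw [heq, (by omega : k + 1 + (j - k) = j + 1)]
            exact hf j hj
          · have e1 : ¬ k ≤ i := by omega
            simp only [if_neg e1, if_neg h1]
            rw [(by omega : k + 1 + (j - i) = k + (j - i) + 1)]
            exact hf _ (by omega)
  have : NeZero n := ⟨hpos.ne'⟩
  refine ⟨⟨n, hpos, fun i => f i.val, ?_, ?_⟩, ?_, ?_⟩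
  · intro i j hij
    apply ZMod.val_injective n
    rcases lt_trichotomy i.val j.val with h | h | h
    · exact absurd hij (hinj _ _ h (ZMod.val_lt j))
    · exact h
    · exact absurd hij.symm (hinj _ _ h (ZMod.val_lt i))
  · intro i
    have hi := ZMod.val_lt i
    have hv : (i + 1).val = (i.val + 1) % n := by
      rw [ZMod.val_add, ZMod.val_one_eq_one_mod, Nat.add_mod_mod]
    simp only [hv]
    rcases Nat.lt_or_ge (i.val + 1) n with h | h
    · rw [Nat.mod_eq_of_lt h]; exact hf _ hi
    · have : i.val + 1 = n := by omega
      rw [this, Nat.mod_self, h0, ← hn]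
      have := hf _ hi
      rwa [‹i.val + 1 = n›] at this
  · simp [h0]
  · simp only [ZMod.val_one_eq_one_mod]
    rcases Nat.lt_or_ge 1 n with h | h
    · rw [Nat.mod_eq_of_lt h, h1]
    · have : n = 1 := by omega
      subst this
      rw [Nat.mod_self, h0, ← hn, h1]

/-! ### Walks and their supports -/

namespace Walk

variable {u : G.V}

theorem mem_support_self {v : G.V} (w : Walk G u v) : v ∈ w.support := by
  cases w <;> simp [support]

theorem exists_of_mem_support {v z : G.V} (w : Walk G u v) (hz : z ∈ w.support) :
    ∃ l₁ l₂, w.labels.reverse = l₁ ++ l₂ ∧ G.Run u l₁ z ∧ G.Run z l₂ v := by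
  induction w with
  | nil =>
    simp only [support, List.mem_singleton] at hz
    exact ⟨[], [], rfl, hz.symm, hz⟩
  | @snoc x y w h ih =>
    simp only [support, List.mem_cons] at hz
    rcases hz with rfl | hz
    · exact ⟨_, [], (List.append_nil _).symm, (w.snoc h).run, rfl⟩
    · obtain ⟨l₁, l₂, h1, h2, h3⟩ := ih hz
      exact ⟨l₁, l₂ ++ [G.lab x y], by simp [labels, h1], h2, h3.append (Run.of_arc h)⟩

theorem reach_of_mem_support {v z : G.V} (w : Walk G u v) (hz : z ∈ w.support) : G.Reach z v := by
  obtain ⟨l₁, l₂, -, -, h⟩ := w.exists_of_mem_support hz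
  exact h.reach

theorem reach_or_reach {v y z : G.V} (w : Walk G u v) (hy : y ∈ w.support) (hz : z ∈ w.support) :
    G.Reach y z ∨ G.Reach z y := by
  induction w with
  | nil =>
    simp only [support, List.mem_singleton] at hy hz
    subst hy hz; exact Or.inl (.refl _)
  | snoc w h ih =>
    have hw := (w.snoc h)
    simp only [support, List.mem_cons] at hy hz
    rcases hy with rfl | hy
    · rcases hz with rfl | hz
      · exact Or.inl (.refl _)
      · exact Or.inr ((w.reach_of_mem_support hz).trans (.of_arc h))
    · rcases hz with rfl | hz
      · exact Or.inl ((w.reach_of_mem_support hy).trans (.of_arc h))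
      · exact ih hy hz

theorem exists_loop {v : G.V} (w : Walk G u v) (hw : ¬ w.IsPath) :
    ∃ z l₁ l₂ l₃, w.labels.reverse = l₁ ++ l₂ ++ l₃ ∧ l₂ ≠ [] ∧ G.Run u l₁ z ∧ G.Run z l₂ z ∧
      G.Run z l₃ v := by
  induction w with
  | nil => simp [IsPath, support] at hw
  | @snoc x y w h ih =>
    simp only [IsPath, support, List.nodup_cons, not_and_or, not_not] at hw
    rcases hw with hy | hw
    · obtain ⟨l₁, l₂, h1, h2, h3⟩ := w.exists_of_mem_support hy
      exact ⟨y, l₁, l₂ ++ [G.lab x y], [], by simp [labels, h1], by simp, h2,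
        h3.append (Run.of_arc h), rfl⟩
    · obtain ⟨z, l₁, l₂, l₃, h1, h2, h3, h4, h5⟩ := ih hw
      exact ⟨z, l₁, l₂, l₃ ++ [G.lab x y], by simp [labels, h1], h2, h3, h4,
        h5.append (Run.of_arc h)⟩

theorem mem_support_of_run (hdet : ∀ x y z, G.arc x y → G.arc x z → G.lab x y = G.lab x z → y = z)
    {v z : G.V} (w : Walk G u v) {l₁ l₂ : List Dir} (hl : w.labels.reverse = l₁ ++ l₂)
    (hz : G.Run u l₁ z) : z ∈ w.support := by
  induction w generalizing l₂ with
  | nil =>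
    have : l₁ = [] := by
      simp only [labels, List.reverse_nil] at hl
      exact (List.append_eq_nil_iff.1 hl.symm).1
    subst this
    rw [run_nil] at hz
    simp [support, hz]
  | @snoc x y w h ih =>
    rcases List.eq_nil_or_concat' l₂ with rfl | ⟨l₂, d, rfl⟩
    · rw [List.append_nil] at hl
      have := (w.snoc h).run
      rw [hl] at this
      rw [run_det hdet hz this]
      exact mem_support_self _
    · simp only [labels, List.reverse_cons] at hl
      rw [← List.append_assoc] at hl
      exact List.mem_cons_of_mem _ (ih (List.append_inj_left' hl rfl))

theorem sigma_ext (hdet : ∀ x y z, G.arc x y → G.arc x z → G.lab x y = G.lab x z → y = z)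
    {v v' : G.V} (w : Walk G u v) (w' : Walk G u v') (h : w.labels = w'.labels) :
    (⟨v, w⟩ : (x : G.V) × Walk G u x) = ⟨v', w'⟩ := by
  induction w generalizing v' with
  | nil =>
    cases w' with
    | nil => rfl
    | snoc w' h' => simp [labels] at h
  | snoc w h1 ih =>
    cases w' with
    | nil => simp [labels] at h
    | snoc w' h1' =>
      simp only [labels, List.cons.injEq] at h
      have := ih w' h.2
      obtain ⟨rfl, this⟩ := Sigma.mk.inj this
      have := eq_of_heq this
      subst this
      have := hdet _ _ _ h1 h1' h.1
      subst this
      rfl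

theorem exists_of_mem_positions {v : G.V} (w : Walk G u v) {p : ℤ × ℤ} (hp : p ∈ w.positions) :
    ∃ l z, l.length ≤ w.labels.length ∧ G.Run u l z ∧ wordDisp l = p := by
  induction w with
  | nil =>
    simp only [positions, List.mem_singleton] at hp
    exact ⟨[], u, by simp, rfl, by simp [hp]⟩
  | @snoc x y w h ih =>
    simp only [positions, List.mem_cons] at hp
    rcases hp with rfl | hp
    · exact ⟨_, y, by simp, (w.snoc h).run, (disp_eq _).symm⟩
    · obtain ⟨l, z, h1, h2, h3⟩ := ih hp
      exact ⟨l, z, by simp [labels]; omega, h2, h3⟩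

end Walk

end LGraph

/-! ### Equivalence of the two forms of the definition of a quipu -/

namespace Quipu

open LGraph

variable {Γ : Type*} {S : TAS Γ} (Q : Quipu S)

/-- Both arcs lie on cycles through `x`, and cycles that share a vertex have the same successor
there. -/
theorem ret {x y z : Q.V} (hy : Q.arc x y) (hz : Q.arc x z) (hy' : Q.toLGraph.Reach y x)
    (hz' : Q.toLGraph.Reach z x) : y = z := by
  obtain ⟨c, h0, h1⟩ := exists_cycle hy hy'
  obtain ⟨c', h0', h1'⟩ := exists_cycle hz hz'
  have := Q.cycles_disjoint c c' 0 0 (h0.trans h0'.symm)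
  simpa [h1, h1'] using this

theorem mem_support_of_reach (c : Q.toLGraph.Cycle) {x y : Q.V} (hx : x ∈ c.support)
    (h : Q.toLGraph.Reach x y) (h' : Q.toLGraph.Reach y x) : y ∈ c.support := by
  induction h with
  | refl => exact hx
  | @tail b z hb hbz ih =>
    obtain ⟨i, hi⟩ := ih ((Reach.of_arc hbz).trans h')
    have : z = c.vert (i + 1) := by
      subst hi
      exact Q.ret hbz (c.arc i) (h'.trans hb) (c.reach _ _)
    exact ⟨i + 1, this.symm⟩

/-- On a cycle this is the condition on the entering arc. A component without a cycle is a single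
vertex, and two arcs into it would extend paths to their tails to two paths with the same end. -/
theorem entry {y x y' x' : Q.V} (h : Q.arc y x) (h' : Q.arc y' x') (hxx' : Q.toLGraph.Reach x x')
    (hx'x : Q.toLGraph.Reach x' x) (hy : ¬ Q.toLGraph.Reach x y) (hy' : ¬ Q.toLGraph.Reach x' y') :
    y = y' ∧ x = x' := by
  by_cases hx : Q.toLGraph.Cyc x
  · obtain ⟨b, hb, hb'⟩ := hx
    obtain ⟨c, hc, -⟩ := exists_cycle hb hb'
    have hxc : x ∈ c.support := ⟨0, hc⟩
    have hx'c : x' ∈ c.support := Q.mem_support_of_reach c hxc hxx' hx'x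
    obtain ⟨a, -, ha⟩ := Q.one_arc_to_cycle c
    have h1 := ha (y, x) ⟨fun hm => hy (Cycle.reach_of_mem hxc hm), hxc, h⟩
    have h2 := ha (y', x') ⟨fun hm => hy' (Cycle.reach_of_mem hx'c hm), hx'c, h'⟩
    have := h1.trans h2.symm
    exact ⟨congrArg Prod.fst this, congrArg Prod.snd this⟩
  · have hxx : x = x' := by
      by_contra hne
      exact hx (Cyc.of_reach_ne hxx' hx'x hne)
    subst hxx
    refine ⟨?_, rfl⟩
    obtain ⟨w, hw, -⟩ := Q.unique_path y
    obtain ⟨w', hw', -⟩ := Q.unique_path y'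
    have h1 : (w.snoc h).IsPath :=
      List.nodup_cons.2 ⟨fun hm => hy (w.reach_of_mem_support hm), hw⟩
    have h2 : (w'.snoc h').IsPath :=
      List.nodup_cons.2 ⟨fun hm => hy' (w'.reach_of_mem_support hm), hw'⟩
    have := (Q.unique_path x).unique h1 h2
    injection this

/-- The condition on three cycles speaks of paths. A shortest run from `a` to `c` among those
through the component of `b` is a path, since a loop can be cut out without leaving this class of
runs. -/
theorem three {a b c : Q.V} (ha : Q.toLGraph.Cyc a) (hb : Q.toLGraph.Cyc b) (hc : Q.toLGraph.Cyc c)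
    (hab : Q.toLGraph.Reach a b) (hbc : Q.toLGraph.Reach b c) :
    Q.toLGraph.Reach b a ∨ Q.toLGraph.Reach c b := by
  obtain ⟨l₁, hl₁⟩ := reach_iff.1 hab
  obtain ⟨l₂, hl₂⟩ := reach_iff.1 hbc
  let P : Set (List Dir) := {l | ∃ l₁ l₂ b', l = l₁ ++ l₂ ∧ Q.toLGraph.Run a l₁ b' ∧
    Q.toLGraph.Run b' l₂ c ∧ Q.toLGraph.Reach b b' ∧ Q.toLGraph.Reach b' b}
  obtain ⟨l, ⟨m₁, m₂, b', rfl, h1, h2, h3, h4⟩, hmin⟩ :=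
    (measure (List.length (α := Dir))).wf.has_min P
      ⟨l₁ ++ l₂, l₁, l₂, b, rfl, hl₁, hl₂, .refl b, .refl b⟩
  have hmin' : ∀ l ∈ P, (m₁ ++ m₂).length ≤ l.length := fun l hl => not_lt.1 (hmin l hl)
  obtain ⟨w, hw⟩ := (h1.append h2).exists_walk
  have hw' : w.labels.reverse = m₁ ++ m₂ := by rw [hw, List.reverse_reverse]
  have hpath : w.IsPath := by
    by_contra hnp
    obtain ⟨z, k₁, k₂, k₃, e1, e2, e3, e4, e5⟩ := w.exists_loop hnp
    rw [hw'] at e1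
    have hlen : (m₁ ++ m₂).length = (k₁ ++ k₂ ++ k₃).length := by rw [e1]
    have hpos := List.length_pos_iff.2 e2
    suffices k₁ ++ k₃ ∈ P by
      have := hmin' _ this
      simp only [List.length_append] at this hlen
      omega
    rw [List.append_assoc] at e1
    -- The marker `b'` lies before, after or inside the loop; in the last case the base point `z` of
    -- the loop belongs to the component of `b` and replaces it.
    rcases List.append_eq_append_iff.1 e1 with ⟨t, ht, ht'⟩ | ⟨t, ht, ht'⟩
    · refine ⟨m₁, t ++ k₃, b', by rw [ht, List.append_assoc], h1, ?_, h3, h4⟩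
      rw [ht] at e3
      obtain ⟨b'', f1, f2⟩ := run_append.1 e3
      rw [run_det Q.deterministic h1 f1]
      exact f2.append e5
    · rcases List.append_eq_append_iff.1 ht' with ⟨s, hs, hs'⟩ | ⟨s, hs, hs'⟩
      · subst hs
        rw [ht] at h1
        refine ⟨k₁ ++ s, m₂, b', by rw [hs', List.append_assoc], ?_, h2, h3, h4⟩
        obtain ⟨z', f3, f4⟩ := run_append.1 h1
        obtain rfl := run_det Q.deterministic e3 f3
        obtain ⟨z'', f5, f6⟩ := run_append.1 f4
        obtain rfl := run_det Q.deterministic e4 f5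
        exact e3.append f6
      · refine ⟨k₁, k₃, z, rfl, e3, e5, ?_, ?_⟩
        · subst ht hs
          obtain ⟨z', f3, f4⟩ := run_append.1 h1
          obtain rfl := run_det Q.deterministic e3 f3
          obtain ⟨z'', f5, f6⟩ := run_append.1 e4
          obtain rfl := run_det Q.deterministic f4 f5
          exact h3.trans f6.reach
        · subst ht
          obtain ⟨z', f3, f4⟩ := run_append.1 h1
          obtain rfl := run_det Q.deterministic e3 f3
          exact f4.reach.trans h4
  obtain ⟨a', ha1, ha2⟩ := ha
  obtain ⟨c₁, hc₁, -⟩ := exists_cycle ha1 ha2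
  obtain ⟨d', hb1, hb2⟩ := hb.congr h3 h4
  obtain ⟨c₂, hc₂, -⟩ := exists_cycle hb1 hb2
  obtain ⟨c', hc1, hc2⟩ := hc
  obtain ⟨c₃, hc₃, -⟩ := exists_cycle hc1 hc2
  have m1 : a ∈ c₁.support := ⟨0, hc₁⟩
  have m2 : b' ∈ c₂.support := ⟨0, hc₂⟩
  have m3 : c ∈ c₃.support := ⟨0, hc₃⟩
  rcases Q.two_cycles _ _ w hpath c₁ c₂ c₃
    ⟨a, w.mem_support_of_run Q.deterministic (l₁ := []) (l₂ := m₁ ++ m₂) hw' rfl, m1⟩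
    ⟨b', w.mem_support_of_run Q.deterministic hw' h1, m2⟩ ⟨c, w.mem_support_self, m3⟩
    with h | h | h
  · exact Or.inl (h3.trans (Cycle.reach_of_mem m2 (h ▸ m1)))
  · exact Or.inl (hbc.trans (Cycle.reach_of_mem m3 (h ▸ m1)))
  · exact Or.inr ((Cycle.reach_of_mem m3 (h ▸ m2)).trans h4)

theorem isQuipu : IsQuipu S Q.toLGraph where
  root_no_in := Q.root_no_in
  tile_root := Q.tile_root
  tile_mem := Q.tile_mem
  tile_seed := Q.tile_seed
  glue := Q.glue
  det := Q.deterministic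
  reach x := by
    obtain ⟨w, -⟩ := Q.unique_path x
    exact w.run.reach
  ret _ _ _ := Q.ret
  entry _ _ _ _ := Q.entry
  three _ _ _ := Q.three
  uniq l l' x x' h h' hd := by
    obtain ⟨w, hw⟩ := h.exists_walk
    obtain ⟨w', hw'⟩ := h'.exists_walk
    by_contra hne
    refine Q.unique_walk ⟨x, w⟩ ⟨x', w'⟩ ?_ ?_
    · intro heq
      obtain ⟨rfl, heq⟩ := Sigma.mk.inj heq
      obtain rfl := eq_of_heq heq
      exact hne (List.reverse_injective (hw.symm.trans hw'))
    · simp only [Walk.disp_eq, hw, hw', List.reverse_reverse, hd]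

end Quipu

/-! ### From the reachability conditions back to the conditions on a quipu -/

namespace IsQuipu

open LGraph

variable {Γ : Type*} {S : TAS Γ} {G : LGraph Γ} (hG : IsQuipu S G)
include hG

/-- All closed runs at `x` are powers of one word `B`, so a predecessor in the component of `x` is
reached from `x` by `B` without its last letter. -/
theorem ret_pred {x y y' : G.V} (h : G.arc y x) (h' : G.arc y' x) (hy : G.Reach x y)
    (hy' : G.Reach x y') : y = y' := by
  obtain ⟨B, hB, hpow⟩ := hG.exists_closed (v := x)
  have key : ∀ z, G.arc z x → G.Reach x z → ∃ B₀ d, B = B₀ ++ [d] ∧ G.Run x B₀ z := by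
    intro z hz hxz
    obtain ⟨r, hr⟩ := reach_iff.1 hxz
    obtain ⟨m, hm⟩ := hpow _ (hr.append (Run.of_arc hz))
    have hm0 : m ≠ 0 := by rintro rfl; simp at hm
    obtain ⟨m, rfl⟩ := Nat.exists_eq_succ_of_ne_zero hm0
    rcases List.eq_nil_or_concat' B with rfl | ⟨B₀, d, rfl⟩
    · simp at hm
    · refine ⟨B₀, d, rfl, ?_⟩
      rw [Nat.succ_eq_add_one, wordPow_succ', ← List.append_assoc] at hm
      have := List.append_inj_left' hm rfl
      subst this
      exact hG.run_of_append hr (hB.pow m)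
  obtain ⟨B₀, d, e1, e2⟩ := key y h hy
  obtain ⟨B₀', d', e1', e2'⟩ := key y' h' hy'
  have := List.append_inj_left' (e1.symm.trans e1') rfl
  subst this
  exact hG.run_det e2 e2'

/-- The vertex `x` is the only entry of its component, so every rooted walk that ends in the
component passes it. -/
theorem entry_mem {y x v : G.V} (h : G.arc y x) (hy : ¬ G.Reach x y) (w : Walk G G.root v)
    (hv : G.Reach x v) (hv' : G.Reach v x) : x ∈ w.support := by
  induction w with
  | nil =>
    have := hG.reach_root hv
    subst this
    exact absurd h (hG.root_no_in y)
  | @snoc z v w hz ih =>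
    by_cases hxz : G.Reach x z
    · exact List.mem_cons_of_mem _ (ih hxz ((Reach.of_arc hz).trans hv'))
    · obtain ⟨-, rfl⟩ := hG.entry z v y x hz h hv' hv (fun h => hxz (hv.trans h)) hy
      exact Walk.mem_support_self _

/-- Compare the last arcs. If just one of their tails lies in the component of `x`, then `x` is the
entry, and the path that arrives from inside has met `x` before. -/
theorem eq_of_isPath {x : G.V} (w w' : Walk G G.root x) (hw : w.IsPath) (hw' : w'.IsPath) :
    w = w' := by
  induction w with
  | nil =>
    cases w' with
    | nil => rfl
    | snoc w' h => exact absurd h (hG.root_no_in _)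
  | @snoc y x w h ih =>
    cases w' with
    | nil => exact absurd h (hG.root_no_in _)
    | @snoc y' _ w' h' =>
      obtain ⟨hx, hw⟩ := List.nodup_cons.1 hw
      obtain ⟨hx', hw'⟩ := List.nodup_cons.1 hw'
      have : y = y' := by
        by_cases hy : G.Reach x y
        · by_cases hy' : G.Reach x y'
          · exact hG.ret_pred h h' hy hy'
          · exact absurd (hG.entry_mem h' hy' w hy (.of_arc h)) hx
        · by_cases hy' : G.Reach x y'
          · exact absurd (hG.entry_mem h hy w' hy' (.of_arc h')) hx'
          · exact (hG.entry y x y' x h h' (.refl x) (.refl x) hy hy').1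
      subst this
      rw [ih w' hw hw']

theorem exists_isPath (x : G.V) : ∃ w : Walk G G.root x, w.IsPath := by
  obtain ⟨l, hl⟩ := reach_iff.1 (hG.reach x)
  obtain ⟨l, hl, hmin⟩ := (measure (List.length (α := Dir))).wf.has_min {l | G.Run G.root l x} ⟨l, hl⟩
  obtain ⟨w, hw⟩ := hl.exists_walk
  refine ⟨w, ?_⟩
  by_contra hnp
  obtain ⟨z, k₁, k₂, k₃, e1, e2, e3, e4, e5⟩ := w.exists_loop hnp
  rw [hw, List.reverse_reverse] at e1
  refine hmin (k₁ ++ k₃) (e3.append e5) ?_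
  have := List.length_pos_iff.2 e2
  simp only [InvImage, WellFoundedRelation.rel, e1, List.length_append]
  change _ < _
  omega

theorem mem_support_of_reach (c : G.Cycle) {x y : G.V} (hx : x ∈ c.support)
    (h : G.Reach x y) (h' : G.Reach y x) : y ∈ c.support := by
  induction h with
  | refl => exact hx
  | @tail b z hb hbz ih =>
    obtain ⟨i, hi⟩ := ih ((Reach.of_arc hbz).trans h')
    have : z = c.vert (i + 1) := by
      subst hi
      exact hG.ret _ _ _ hbz (c.arc i) (h'.trans hb) (c.reach _ _)
    exact ⟨i + 1, this.symm⟩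

theorem exists_entry (c : G.Cycle) : ∃ y x, y ∉ c.support ∧ x ∈ c.support ∧ G.arc y x := by
  by_contra hcon
  push Not at hcon
  have h1 : ∀ z, G.Reach G.root z → z ∉ c.support := by
    intro z hz
    induction hz with
    | refl =>
      rintro ⟨i, hi⟩
      have := c.arc (i - 1)
      rw [sub_add_cancel, hi] at this
      exact hG.root_no_in _ this
    | tail _ h ih => exact fun hm => hcon _ _ ih hm h
  exact h1 (c.vert 0) (hG.reach _) ⟨0, rfl⟩

theorem unique_entry (c : G.Cycle) {y x y' x' : G.V} (hy : y ∉ c.support) (hx : x ∈ c.support)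
    (h : G.arc y x) (hy' : y' ∉ c.support) (hx' : x' ∈ c.support) (h' : G.arc y' x') :
    y = y' ∧ x = x' :=
  hG.entry y x y' x' h h' (Cycle.reach_of_mem hx hx') (Cycle.reach_of_mem hx' hx)
    (fun hr => hy (hG.mem_support_of_reach c hx hr (.of_arc h)))
    (fun hr => hy' (hG.mem_support_of_reach c hx' hr (.of_arc h')))

theorem support_eq (c c' : G.Cycle) {x y : G.V} (hx : x ∈ c.support) (hy : y ∈ c'.support)
    (h : G.Reach x y) (h' : G.Reach y x) : c.support = c'.support := by
  ext z
  constructor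
  · intro hz
    exact hG.mem_support_of_reach c' hy (h'.trans (Cycle.reach_of_mem hx hz))
      ((Cycle.reach_of_mem hz hx).trans h)
  · intro hz
    exact hG.mem_support_of_reach c hx (h.trans (Cycle.reach_of_mem hy hz))
      ((Cycle.reach_of_mem hz hy).trans h')

/-- The quipu with a given underlying graph. -/
def toQuipu : Quipu S where
  toLGraph := G
  root_no_in := hG.root_no_in
  tile_root := hG.tile_root
  tile_mem := hG.tile_mem
  tile_seed := hG.tile_seed
  glue := hG.glue
  unique_path x := by
    obtain ⟨w, hw⟩ := hG.exists_isPath x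
    exact ⟨w, hw, fun w' hw' => hG.eq_of_isPath w' w hw' hw⟩
  deterministic := hG.det
  cycles_disjoint c c' i j h := by
    refine hG.ret (c.vert i) _ _ (c.arc i) ?_ (c.reach _ _) ?_
    · rw [h]; exact c'.arc j
    · rw [h]; exact c'.reach _ _
  one_arc_to_cycle c := by
    obtain ⟨y, x, h1, h2, h3⟩ := hG.exists_entry c
    refine ⟨(y, x), ⟨h1, h2, h3⟩, ?_⟩
    rintro ⟨y', x'⟩ ⟨h1', h2', h3'⟩
    obtain ⟨rfl, rfl⟩ := hG.unique_entry c h1 h2 h3 h1' h2' h3'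
    rfl
  two_cycles u v w hw c₁ c₂ c₃ := by
    rintro ⟨x₁, h1, k1⟩ ⟨x₂, h2, k2⟩ ⟨x₃, h3, k3⟩
    have key := fun {a b c} (ha : G.Cyc a) (hb : G.Cyc b) (hc : G.Cyc c) => hG.three a b c ha hb hc
    have y1 := Cycle.cyc k1
    have y2 := Cycle.cyc k2
    have y3 := Cycle.cyc k3
    suffices (G.Reach x₁ x₂ ∧ G.Reach x₂ x₁) ∨ (G.Reach x₁ x₃ ∧ G.Reach x₃ x₁) ∨
        (G.Reach x₂ x₃ ∧ G.Reach x₃ x₂) by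
      rcases this with ⟨h, h'⟩ | ⟨h, h'⟩ | ⟨h, h'⟩
      · exact Or.inl (hG.support_eq _ _ k1 k2 h h')
      · exact Or.inr (Or.inl (hG.support_eq _ _ k1 k3 h h'))
      · exact Or.inr (Or.inr (hG.support_eq _ _ k2 k3 h h'))
    rcases w.reach_or_reach h1 h2 with a | a <;> rcases w.reach_or_reach h1 h3 with b | b <;>
      rcases w.reach_or_reach h2 h3 with d | d
    · rcases key y1 y2 y3 a d with e | e <;> tauto
    · rcases key y1 y3 y2 b d with e | e <;> tauto
    · exact Or.inl ⟨a, d.trans b⟩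
    · rcases key y3 y1 y2 b a with e | e <;> tauto
    · rcases key y2 y1 y3 a b with e | e <;> tauto
    · exact Or.inr (Or.inl ⟨b, d.trans a⟩)
    · rcases key y2 y3 y1 d b with e | e <;> tauto
    · rcases key y3 y2 y1 d a with e | e <;> tauto
  -- A point visited earlier is the displacement of a shorter rooted walk, so self-avoidance is a
  -- case of uniqueness of displacements.
  free_path x w := by
    induction w with
    | nil => simp [Walk.positions]
    | @snoc y x w h ih =>
      refine List.nodup_cons.2 ⟨fun hm => ?_, ih⟩
      obtain ⟨l, z, h1, h2, h3⟩ := w.exists_of_mem_positions hm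
      have := hG.uniq _ _ _ _ h2 (w.snoc h).run (by rw [h3, Walk.disp_eq])
      rw [this] at h1
      simp [Walk.labels] at h1
  unique_walk w₁ w₂ hne hd := by
    apply hne
    rw [Walk.disp_eq, Walk.disp_eq] at hd
    exact Walk.sigma_ext hG.det _ _
      (List.reverse_injective (hG.uniq _ _ _ _ w₁.2.run w₂.2.run hd))

end IsQuipu

/-! ### Coverings -/

/-- A map of rooted labelled graphs with unique lifting of arcs. -/
structure IsCovering {Γ : Type*} (H G : LGraph Γ) (φ : H.V → G.V) : Prop where
  root : φ H.root = G.root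
  arc : ∀ x y, H.arc x y → G.arc (φ x) (φ y)
  tile : ∀ x, H.tile x = G.tile (φ x)
  lab : ∀ x y, H.arc x y → H.lab x y = G.lab (φ x) (φ y)
  lift : ∀ x z, G.arc (φ x) z → ∃ y, H.arc x y ∧ φ y = z
  inj : ∀ x y y', H.arc x y → H.arc x y' → φ y = φ y' → y = y'

namespace IsCovering

open LGraph

variable {Γ : Type*} {S : TAS Γ} {H G K : LGraph Γ} {φ : H.V → G.V}

theorem id (G : LGraph Γ) : IsCovering G G id where
  root := rfl
  arc _ _ h := h
  tile _ := rfl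
  lab _ _ _ := rfl
  lift _ z h := ⟨z, h, rfl⟩
  inj _ _ _ _ _ h := h

theorem comp {ψ : K.V → H.V} (hφ : IsCovering H G φ) (hψ : IsCovering K H ψ) :
    IsCovering K G (φ ∘ ψ) where
  root := by rw [Function.comp_apply, hψ.root, hφ.root]
  arc x y h := hφ.arc _ _ (hψ.arc _ _ h)
  tile x := by rw [hψ.tile, hφ.tile]; rfl
  lab x y h := by rw [hψ.lab _ _ h, hφ.lab _ _ (hψ.arc _ _ h)]; rfl
  lift x z h := by
    obtain ⟨y, h1, h2⟩ := hφ.lift _ _ h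
    obtain ⟨y', h3, rfl⟩ := hψ.lift _ _ h1
    exact ⟨y', h3, h2⟩
  inj x y y' h h' he := hψ.inj _ _ _ h h' (hφ.inj _ _ _ (hψ.arc _ _ h) (hψ.arc _ _ h') he)

variable (hφ : IsCovering H G φ)
include hφ

theorem run {x y : H.V} {l : List Dir} (h : H.Run x l y) : G.Run (φ x) l (φ y) := by
  induction l generalizing x with
  | nil => rw [run_nil] at h; rw [h, run_nil]
  | cons d l ih =>
    obtain ⟨z, h1, h2, h3⟩ := h
    exact ⟨φ z, hφ.arc _ _ h1, by rw [← hφ.lab _ _ h1, h2], ih h3⟩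

theorem run_root {y : H.V} {l : List Dir} (h : H.Run H.root l y) : G.Run G.root l (φ y) :=
  hφ.root ▸ hφ.run h

theorem lift_run {x : H.V} {z : G.V} {l : List Dir} (h : G.Run (φ x) l z) :
    ∃ y, H.Run x l y ∧ φ y = z := by
  induction l generalizing x with
  | nil => exact ⟨x, rfl, h⟩
  | cons d l ih =>
    obtain ⟨w, h1, h2, h3⟩ := h
    obtain ⟨y, h4, rfl⟩ := hφ.lift _ _ h1
    obtain ⟨y', h5, h6⟩ := ih h3
    exact ⟨y', ⟨y, h4, by rw [hφ.lab _ _ h4, h2], h5⟩, h6⟩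

theorem lift_run_root {z : G.V} {l : List Dir} (h : G.Run G.root l z) :
    ∃ y, H.Run H.root l y ∧ φ y = z := hφ.lift_run (hφ.root.symm ▸ h)

theorem reach {x y : H.V} (h : H.Reach x y) : G.Reach (φ x) (φ y) := by
  obtain ⟨l, hl⟩ := reach_iff.1 h
  exact (hφ.run hl).reach

theorem lift_reach {x : H.V} {z : G.V} (h : G.Reach (φ x) z) : ∃ y, H.Reach x y ∧ φ y = z := by
  obtain ⟨l, hl⟩ := reach_iff.1 h
  obtain ⟨y, h1, h2⟩ := hφ.lift_run hl
  exact ⟨y, h1.reach, h2⟩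

theorem cyc {x : H.V} (h : H.Cyc x) : G.Cyc (φ x) := by
  obtain ⟨b, h1, h2⟩ := h
  exact ⟨φ b, hφ.arc _ _ h1, hφ.reach h2⟩

theorem dom_eq : H.dom = G.dom := by
  ext v
  simp only [mem_dom]
  constructor
  · rintro ⟨x, l, h, rfl⟩; exact ⟨_, l, hφ.run_root h, rfl⟩
  · rintro ⟨x, l, h, rfl⟩
    obtain ⟨y, h1, -⟩ := hφ.lift_run_root h
    exact ⟨y, l, h1, rfl⟩

variable (hG : IsQuipu S G)
include hG

theorem det (x y z : H.V) (h : H.arc x y) (h' : H.arc x z) (hl : H.lab x y = H.lab x z) : y = z := by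
  rw [hφ.lab _ _ h, hφ.lab _ _ h'] at hl
  exact hφ.inj _ _ _ h h' (hG.det _ _ _ (hφ.arc _ _ h) (hφ.arc _ _ h') hl)

/-- In `G` the run from `a` to `b` stays in one component, so it is a prefix of a high power of a
closed run at `a`; by determinism `b` lies on the lifted closed run. -/
theorem reach_of_cyc {a b : H.V} (ha : H.Cyc a) (hab : H.Reach a b) (h : G.Reach (φ b) (φ a)) :
    H.Reach b a := by
  obtain ⟨l, hl0, hl⟩ := cyc_iff.1 ha
  obtain ⟨r, hr⟩ := reach_iff.1 hab
  have hp := hl.pow r.length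
  have hlen : r.length ≤ (wordPow l r.length).length := by
    rw [length_wordPow]
    exact Nat.le_mul_of_pos_right _ (List.length_pos_iff.2 hl0)
  have hpre : r <+: wordPow l r.length := by
    rcases hG.prefix_or_prefix (hφ.run hr) (hφ.run hp) h (.refl _) with h | h
    · exact h
    · rw [h.eq_of_length (le_antisymm h.length_le hlen)]
  obtain ⟨t, ht⟩ := hpre
  rw [← ht] at hp
  obtain ⟨z, h1, h2⟩ := run_append.1 hp
  rw [run_det (hφ.det hG) hr h1]
  exact h2.reach

/-- The covering graph of a quipu is a quipu, provided that it is connected and that its strongly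
connected components have a unique entry. -/
theorem isQuipu (hreach : ∀ x, H.Reach H.root x)
    (hentry : ∀ y x y' x', H.arc y x → H.arc y' x' → H.Reach x x' → H.Reach x' x →
      ¬ H.Reach x y → ¬ H.Reach x' y' → y = y' ∧ x = x') : IsQuipu S H where
  root_no_in x h := hG.root_no_in _ (hφ.root ▸ hφ.arc _ _ h)
  tile_root := by rw [hφ.tile, hφ.root, hG.tile_root]
  tile_mem x := by rw [hφ.tile]; exact hG.tile_mem _
  tile_seed hS x hx := by
    rw [hφ.tile] at hx
    have h1 := hG.tile_seed hS _ hx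
    rcases Relation.ReflTransGen.cases_tail (hreach x) with h | ⟨y, -, h⟩
    · exact h
    · exact absurd (hφ.arc _ _ h) (h1 ▸ hG.root_no_in _)
  glue x y h := by
    rw [hφ.tile, hφ.tile, hφ.lab _ _ h]
    exact hG.glue _ _ (hφ.arc _ _ h)
  det := hφ.det hG
  reach := hreach
  ret x y z h h' hy hz := hφ.inj _ _ _ h h'
    (hG.ret _ _ _ (hφ.arc _ _ h) (hφ.arc _ _ h') (hφ.reach hy) (hφ.reach hz))
  entry := hentry
  three a b c ha hb hc hab hbc := by
    rcases hG.three _ _ _ (hφ.cyc ha) (hφ.cyc hb) (hφ.cyc hc) (hφ.reach hab) (hφ.reach hbc) with h | h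
    · exact Or.inl (hφ.reach_of_cyc hG ha hab h)
    · exact Or.inr (hφ.reach_of_cyc hG hb hbc h)
  uniq l l' x x' h h' hd := hG.uniq l l' _ _ (hφ.run_root h) (hφ.run_root h') hd

/-- Every cycle is covered by a cycle. -/
theorem exists_cycle (c : G.Cycle) : ∃ (c' : H.Cycle) (k r : ℕ), 0 < k ∧ c'.len = k * c.len ∧
    ∀ i : ℕ, φ (c'.vert (i : ZMod c'.len)) = c.vert ((r + i : ℕ) : ZMod c.len) := by
  obtain ⟨l, hl⟩ := reach_iff.1 (hG.reach (c.vert 0))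
  obtain ⟨h0, -, h00⟩ := hφ.lift_run_root hl
  have hstep : ∀ (n : ℕ) (p : {x : H.V // φ x = c.vert n}), ∃ q : {x : H.V // φ x = c.vert (n + 1 : ℕ)},
      H.arc p.1 q.1 := by
    intro n p
    obtain ⟨y, h1, h2⟩ := hφ.lift p.1 (c.vert (n + 1 : ℕ))
      (by rw [p.2, Nat.cast_succ]; exact c.arc n)
    exact ⟨⟨y, h2⟩, h1⟩
  choose nxt hnxt using hstep
  -- The infinite walk around `c` is lifted. Since `H` is finite, the lift repeats a vertex, and
  -- this gives a cycle above `c`.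
  let f : (n : ℕ) → {x : H.V // φ x = c.vert n} := fun n =>
    Nat.rec ⟨h0, by rw [h00, Nat.cast_zero]⟩ (fun n p => nxt n p) n
  have hf : ∀ n, H.arc (f n).1 (f (n + 1)).1 := fun n => hnxt n (f n)
  have hreach : ∀ n k, H.Reach (f n).1 (f (n + k)).1 := by
    intro n k
    induction k with
    | zero => exact .refl _
    | succ k ih => exact ih.trans (.of_arc (hf _))
  have := H.finite
  obtain ⟨n, m, hne, heq⟩ := Finite.exists_ne_map_eq_of_infinite (fun n => (f n).1)
  wlog hnm : n < m generalizing n m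
  · exact this m n hne.symm heq.symm (lt_of_le_of_ne (not_lt.1 hnm) hne.symm)
  have hback : H.Reach (f (n + 1)).1 (f n).1 := by
    have := hreach (n + 1) (m - (n + 1))
    rw [(by omega : n + 1 + (m - (n + 1)) = m)] at this
    rw [show (f n).1 = (f m).1 from heq]
    exact this
  obtain ⟨c', e0, -⟩ := LGraph.exists_cycle (hf n) hback
  have hφc : ∀ i : ℕ, φ (c'.vert (i : ZMod c'.len)) = c.vert ((n + i : ℕ) : ZMod c.len) := by
    intro i
    induction i with
    | zero => rw [Nat.cast_zero, e0, (f n).2]; rfl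
    | succ i ih =>
      refine hG.ret (φ (c'.vert i)) _ _ ?_ ?_ ?_ ?_
      · rw [Nat.cast_succ]; exact hφ.arc _ _ (c'.arc i)
      · rw [ih, ← add_assoc, Nat.cast_succ]; exact c.arc _
      · exact hφ.reach (c'.reach _ _)
      · rw [ih]; exact c.reach _ _
  -- One turn around `c'` comes back to the same vertex of `c`.
  have hdvd : c.len ∣ c'.len := by
    have h1 := hφc c'.len
    have h2 := hφc 0
    rw [ZMod.natCast_self] at h1
    rw [Nat.cast_zero] at h2
    have := c.injective (h1.symm.trans h2)
    rw [Nat.cast_add, Nat.cast_add, add_right_inj, Nat.cast_zero] at this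
    exact (ZMod.natCast_eq_zero_iff _ _).1 this
  obtain ⟨k, hk⟩ := hdvd
  refine ⟨c', k, n, ?_, by rw [hk, mul_comm], hφc⟩
  rcases Nat.eq_zero_or_pos k with rfl | h
  · have := c'.len_pos; omega
  · exact h

end IsCovering

/-! ### Entries of cycles -/

namespace IsQuipu

open LGraph

variable {Γ : Type*} {S : TAS Γ} {G : LGraph Γ} (hG : IsQuipu S G) {c : G.Cycle} {e : G.V}
include hG

theorem not_mem_of_arc (he : G.IsEntry c e) {u : G.V} (hu : u ∉ c.support) (h : G.Reach e u) {z : G.V}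
    (hz : z ∈ c.support) : ¬ G.Reach u z := fun huz =>
  hu (hG.mem_support_of_reach c he.1 h (huz.trans (Cycle.reach_of_mem hz he.1)))

theorem eq_entry (he : G.IsEntry c e) {u z : G.V} (hu : u ∉ c.support) (hz : z ∈ c.support)
    (h : G.arc u z) : z = e := by
  obtain ⟨h1, y, h2, h3⟩ := he
  exact (hG.unique_entry c hu hz h h2 h1 h3).2

theorem not_reach_of_entry (he : G.IsEntry c e) {u : G.V} (hu : u ∉ c.support)
    (h : G.arc u e) : ¬ G.Reach e u := fun hr =>
  hG.not_mem_of_arc he hu hr he.1 (.of_arc h)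

end IsQuipu

/-! ### Unrolling -/

namespace LGraph

variable {Γ : Type*} {S : TAS Γ} {G : LGraph Γ} {c : G.Cycle} {e : G.V}

theorem reach_of_mem_branch {g : G.V} (h : g ∈ G.branch c e) : G.Reach e g :=
  Relation.ReflTransGen.mono (fun _ _ h => h.1) _ _ h

theorem eq_or_not_mem_of_mem_branch {g : G.V} (h : g ∈ G.branch c e) : g = e ∨ g ∉ c.support := by
  rcases Relation.ReflTransGen.cases_tail h with h | ⟨y, -, h⟩
  · exact Or.inl h
  · exact Or.inr h.2

theorem branch_step {g z : G.V} (h : g ∈ G.branch c e) (h' : G.arc g z) (hz : z ∉ c.support) :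
    z ∈ G.branch c e := Relation.ReflTransGen.tail h ⟨h', hz⟩

/-- The new copy of a vertex of the branch. -/
def unrollNew {g : G.V} (h : g ∈ G.branch c e) : (G.unroll c e).V := Sum.inr ⟨g, h⟩

/-- The original vertex in the unrolled graph. -/
def unrollOld (c : G.Cycle) (e : G.V) (v : G.V) : (G.unroll c e).V := Sum.inl v

theorem unroll_cases (p : (G.unroll c e).V) :
    (∃ v, p = unrollOld c e v) ∨ ∃ g, ∃ h : g ∈ G.branch c e, p = unrollNew h := by
  rcases p with v | ⟨g, h⟩
  · exact Or.inl ⟨v, rfl⟩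
  · exact Or.inr ⟨g, h, rfl⟩

@[simp] theorem unrollOrig_old (v : G.V) : G.unrollOrig c e (unrollOld c e v) = v := rfl

@[simp] theorem unrollOrig_new {g : G.V} (h : g ∈ G.branch c e) :
    G.unrollOrig c e (unrollNew h) = g := rfl

theorem unroll_arc_old_old {u v : G.V} : (G.unroll c e).arc (unrollOld c e u) (unrollOld c e v) ↔
    G.arc u v ∧ ¬ (u ∉ c.support ∧ v = e) := Iff.rfl

theorem unroll_arc_old_new {u g : G.V} {h : g ∈ G.branch c e} :
    (G.unroll c e).arc (unrollOld c e u) (unrollNew h) ↔ G.arc u e ∧ u ∉ c.support ∧ g = e := Iff.rfl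

theorem unroll_arc_new_new {g z : G.V} {h : g ∈ G.branch c e} {h' : z ∈ G.branch c e} :
    (G.unroll c e).arc (unrollNew h) (unrollNew h') ↔ G.arc g z ∧ z ∉ c.support := Iff.rfl

theorem unroll_arc_new_old {g z : G.V} {h : g ∈ G.branch c e} :
    (G.unroll c e).arc (unrollNew h) (unrollOld c e z) ↔ G.arc e z ∧ z ∈ c.support ∧ g = e := Iff.rfl

/-- For the lifting of arcs, note that a vertex of the branch off the cycle cannot reach the cycle
again; so the only new vertex with an arc into the old cycle is the copy of `e`. -/
theorem unroll_covering (hG : IsQuipu S G) (he : G.IsEntry c e) :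
    IsCovering (G.unroll c e) G (G.unrollOrig c e) where
  root := rfl
  arc p q h := by
    rcases unroll_cases p with ⟨u, rfl⟩ | ⟨u, hu, rfl⟩ <;>
      rcases unroll_cases q with ⟨v, rfl⟩ | ⟨v, hv, rfl⟩
    · exact h.1
    · obtain ⟨h1, -, rfl⟩ := unroll_arc_old_new.1 h; exact h1
    · obtain ⟨h1, -, rfl⟩ := unroll_arc_new_old.1 h; exact h1
    · exact h.1
  tile p := rfl
  lab p q _ := rfl
  lift p z h := by
    rcases unroll_cases p with ⟨u, rfl⟩ | ⟨u, hu, rfl⟩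
    · by_cases hc : u ∉ c.support ∧ z = e
      · obtain ⟨hc, rfl⟩ := hc
        exact ⟨unrollNew (G.self_mem_branch c z), ⟨h, hc, rfl⟩, rfl⟩
      · exact ⟨unrollOld c e z, ⟨h, hc⟩, rfl⟩
    · by_cases hz : z ∈ c.support
      · have hue : u = e := by
          rcases eq_or_not_mem_of_mem_branch hu with hue | huc
          · exact hue
          · exact absurd (Reach.of_arc h)
              (hG.not_mem_of_arc he huc (reach_of_mem_branch hu) hz)
        subst hue
        exact ⟨unrollOld c u z, ⟨h, hz, rfl⟩, rfl⟩
      · exact ⟨unrollNew (branch_step hu h hz), ⟨h, hz⟩, rfl⟩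
  inj p q q' h h' heq := by
    rcases unroll_cases p with ⟨u, rfl⟩ | ⟨u, hu, rfl⟩ <;>
      rcases unroll_cases q with ⟨v, rfl⟩ | ⟨v, hv, rfl⟩ <;>
      rcases unroll_cases q' with ⟨v', rfl⟩ | ⟨v', hv', rfl⟩ <;>
      simp only [unrollOrig_old, unrollOrig_new] at heq <;> subst heq
    · rfl
    · exact absurd ⟨h'.2.1, h'.2.2⟩ h.2
    · exact absurd ⟨h.2.1, h.2.2⟩ h'.2
    · rfl
    · rfl
    · exact absurd h.2.1 h'.2
    · exact absurd h'.2.1 h.2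
    · rfl

/-- The arc lost by redirection starts at a vertex that `e` cannot reach. A run that used it would
end within reach of `e`, hence by `hab` start within reach of `e`, and so would the tail of that
arc. -/
theorem unroll_reach_old (hG : IsQuipu S G) (he : G.IsEntry c e) {a b : G.V} (h : G.Reach a b)
    (hab : G.Reach e b → G.Reach e a) :
    (G.unroll c e).Reach (unrollOld c e a) (unrollOld c e b) := by
  suffices ∀ b', G.Reach a b' → G.Reach b' b →
      (G.unroll c e).Reach (unrollOld c e a) (unrollOld c e b') from this b h (.refl b)
  intro b' hb'
  induction hb' with
  | refl => intro; exact .refl _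
  | @tail w z haw hwz ih =>
    intro hzb
    refine (ih ((Reach.of_arc hwz).trans hzb)).trans (.of_arc ⟨hwz, ?_⟩)
    rintro ⟨hw, rfl⟩
    exact hG.not_reach_of_entry he hw hwz ((hab hzb).trans haw)

theorem unroll_reach_new (hG : IsQuipu S G) (he : G.IsEntry c e) {g z : G.V} (hg : g ∈ G.branch c e)
    (hgc : g ∉ c.support) (h : G.Reach g z) :
    ∃ hz : z ∈ G.branch c e, (G.unroll c e).Reach (unrollNew hg) (unrollNew hz) := by
  induction h with
  | refl => exact ⟨hg, .refl _⟩
  | @tail w z hw hwz ih =>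
    obtain ⟨hwb, hr⟩ := ih
    have hz : z ∉ c.support := fun hz => hG.not_mem_of_arc he hgc (reach_of_mem_branch hg) hz
      (Reach.trans hw (.of_arc hwz))
    exact ⟨branch_step hwb hwz hz, hr.trans (.of_arc ⟨hwz, hz⟩)⟩

/-- From old vertices the new ones are entered only by the redirected arc, whose tail is not
reachable from `e`; but everything behind `g` lies above vertices reachable from `e`. -/
theorem unroll_no_return (hG : IsQuipu S G) (he : G.IsEntry c e) {g g' v : G.V}
    {hg : g ∈ G.branch c e} {hg' : g' ∈ G.branch c e}
    (h : (G.unroll c e).Reach (unrollNew hg) (unrollOld c e v)) :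
    ¬ (G.unroll c e).Reach (unrollOld c e v) (unrollNew hg') := by
  intro h'
  have key : ∀ p, (G.unroll c e).Reach (unrollOld c e v) p →
      (∃ w, p = unrollOld c e w) ∨ ∃ u, u ∉ c.support ∧ G.arc u e ∧
        (G.unroll c e).Reach (unrollOld c e v) (unrollOld c e u) := by
    intro p hp
    induction hp with
    | refl => exact Or.inl ⟨v, rfl⟩
    | @tail q p hq hqp ih =>
      rcases ih with ⟨w, rfl⟩ | ih
      · rcases unroll_cases p with ⟨u, rfl⟩ | ⟨u, hu, rfl⟩
        · exact Or.inl ⟨u, rfl⟩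
        · exact Or.inr ⟨w, hqp.2.1, hqp.1, hq⟩
      · exact Or.inr ih
  have hφ := unroll_covering hG he
  rcases key _ h' with ⟨w, hw⟩ | ⟨u, hu, hue, hr⟩
  · cases hw
  · have h1 : G.Reach e g := reach_of_mem_branch hg
    have h2 : G.Reach g v := hφ.reach h
    have h3 : G.Reach v u := hφ.reach hr
    exact hG.not_reach_of_entry he hu hue ((h1.trans h2).trans h3)

theorem unroll_isQuipu (hG : IsQuipu S G) (he : G.IsEntry c e) : IsQuipu S (G.unroll c e) := by
  have hφ := unroll_covering hG he
  obtain ⟨y₀, hy₀, hy₀e⟩ := he.2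
  obtain ⟨i, hi⟩ := he.1
  have hsucc : G.arc e (c.vert (i + 1)) := hi ▸ c.arc i
  have hsm : c.vert (i + 1) ∈ c.support := ⟨_, rfl⟩
  have hr1 : ∀ v, ¬ G.Reach e v → (G.unroll c e).Reach (unrollOld c e G.root) (unrollOld c e v) :=
    fun v hv => unroll_reach_old hG he (hG.reach v) (fun h => absurd h hv)
  have hr2 : (G.unroll c e).Reach (unrollOld c e G.root) (unrollNew (G.self_mem_branch c e)) :=
    (hr1 y₀ (hG.not_reach_of_entry he hy₀ hy₀e)).trans (.of_arc ⟨hy₀e, hy₀, rfl⟩)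
  refine hφ.isQuipu hG ?_ ?_
  · intro p
    rcases unroll_cases p with ⟨v, rfl⟩ | ⟨g, hg, rfl⟩
    · by_cases hv : G.Reach e v
      · refine (hr2.trans (.of_arc (unroll_arc_new_old.2 ⟨hsucc, hsm, rfl⟩))).trans ?_
        exact unroll_reach_old hG he ((Cycle.reach_of_mem hsm he.1).trans hv)
          (fun _ => .of_arc hsucc)
      · exact hr1 v hv
    · refine hr2.trans ?_
      have : ∀ g, G.Reach e g → Relation.ReflTransGen (fun u v => G.arc u v ∧ v ∉ c.support) e g →
          ∃ hg : g ∈ G.branch c e,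
            (G.unroll c e).Reach (unrollNew (G.self_mem_branch c e)) (unrollNew hg) := by
        intro g _ h
        induction h with
        | refl => exact ⟨G.self_mem_branch c e, .refl _⟩
        | @tail w z hw hwz ih =>
          obtain ⟨hwb, hr⟩ := ih (reach_of_mem_branch hw)
          exact ⟨branch_step hwb hwz.1 hwz.2, hr.trans (.of_arc hwz)⟩
      exact (this g (reach_of_mem_branch hg) hg).2
  -- An arc that enters a component of the unrolled graph is either the one from the copy of `e`
  -- into the cycle or lies above an arc that enters a component of `G`.
  · have hcls : ∀ p q, (G.unroll c e).arc p q → ¬ (G.unroll c e).Reach q p →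
        (p = unrollNew (G.self_mem_branch c e) ∧ ∃ z, q = unrollOld c e z ∧ z ∈ c.support ∧ G.arc e z) ∨
          ¬ G.Reach (G.unrollOrig c e q) (G.unrollOrig c e p) := by
      intro p q h hn
      rcases unroll_cases p with ⟨u, rfl⟩ | ⟨u, hu, rfl⟩ <;>
        rcases unroll_cases q with ⟨v, rfl⟩ | ⟨v, hv, rfl⟩
      · exact Or.inr fun hr => hn (unroll_reach_old hG he hr (fun h' => h'.trans (.of_arc h.1)))
      · obtain ⟨h1, h2, rfl⟩ := unroll_arc_old_new.1 h
        exact Or.inr (hG.not_reach_of_entry he h2 h1)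
      · obtain ⟨h1, h2, rfl⟩ := unroll_arc_new_old.1 h
        exact Or.inl ⟨rfl, v, rfl, h2, h1⟩
      · refine Or.inr fun hr => hn ?_
        exact (unroll_reach_new hG he hv h.2 hr).2
    -- The component of the old cycle is not entered by an arc of the second kind.
    have hEN : ∀ z p q, z ∈ c.support → (G.unroll c e).arc p q →
        (G.unroll c e).Reach (unrollOld c e z) q → (G.unroll c e).Reach q (unrollOld c e z) →
        ¬ G.Reach (G.unrollOrig c e q) (G.unrollOrig c e p) → False := by
      intro z p q hz h h1 h2 hn
      rcases unroll_cases q with ⟨v, rfl⟩ | ⟨v, hv, rfl⟩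
      · have hvc : v ∈ c.support := hG.mem_support_of_reach c hz (hφ.reach h1) (hφ.reach h2)
        rcases unroll_cases p with ⟨u, rfl⟩ | ⟨u, hu, rfl⟩
        · have huc : u ∉ c.support := fun hu => hn (Cycle.reach_of_mem hvc hu)
          exact h.2 ⟨huc, hG.eq_entry he huc hvc h.1⟩
        · have hue : u = e := h.2.2
          subst hue
          exact hn (Cycle.reach_of_mem hvc he.1)
      · exact unroll_no_return hG he h2 h1
    intro y x y' x' h h' hxx' hx'x hn hn'
    rcases hcls y x h hn with ⟨rfl, z, rfl, hz, hez⟩ | hN <;>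
      rcases hcls y' x' h' hn' with ⟨rfl, z', rfl, hz', hez'⟩ | hN'
    · rw [hG.ret _ _ _ hez hez' (Cycle.reach_of_mem hz he.1) (Cycle.reach_of_mem hz' he.1)]
      exact ⟨rfl, rfl⟩
    · exact (hEN z y' x' hz h' hxx' hx'x hN').elim
    · exact (hEN z' y x hz' h hx'x hxx' hN).elim
    · obtain ⟨hy, hx⟩ := hG.entry _ _ _ _ (hφ.arc _ _ h) (hφ.arc _ _ h') (hφ.reach hxx')
        (hφ.reach hx'x) hN hN'
      have hxx : x = x' := by
        rcases unroll_cases x with ⟨v, rfl⟩ | ⟨v, hv, rfl⟩ <;>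
          rcases unroll_cases x' with ⟨v', rfl⟩ | ⟨v', hv', rfl⟩ <;>
          simp only [unrollOrig_old, unrollOrig_new] at hx <;> subst hx
        · rfl
        · exact absurd hxx' (unroll_no_return hG he hx'x)
        · exact absurd hx'x (unroll_no_return hG he hxx')
        · rfl
      subst hxx
      refine ⟨?_, rfl⟩
      have hmix : ∀ u (hu : u ∈ G.branch c e), (G.unroll c e).arc (unrollOld c e u) x →
          (G.unroll c e).arc (unrollNew hu) x → ¬ G.Reach (G.unrollOrig c e x) u → False := by
        intro u hu h1 h2 h3
        rcases unroll_cases x with ⟨v, rfl⟩ | ⟨v, hv, rfl⟩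
        · obtain ⟨-, h4, rfl⟩ := unroll_arc_new_old.1 h2
          exact h3 (Cycle.reach_of_mem h4 he.1)
        · obtain ⟨-, -, rfl⟩ := unroll_arc_old_new.1 h1
          exact h2.2 he.1
      rcases unroll_cases y with ⟨v, rfl⟩ | ⟨v, hv, rfl⟩ <;>
        rcases unroll_cases y' with ⟨v', rfl⟩ | ⟨v', hv', rfl⟩ <;>
        simp only [unrollOrig_old, unrollOrig_new] at hy <;> subst hy
      · rfl
      · exact (hmix _ hv' h h' hN).elim
      · exact (hmix _ hv h' h hN).elim
      · rfl

end LGraph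

/-! ### Multiples -/

namespace LGraph

variable {Γ : Type*} {S : TAS Γ} {G : LGraph Γ} {c : G.Cycle} {e : G.V} {k : ℕ} [NeZero k]

/-- The copy with number `i` of a vertex in the `k`-multiple. -/
def multipleMk (c : G.Cycle) (e v : G.V) (i : ZMod k) (h : ¬ G.Reach e v → i = 0) :
    (G.multiple c e k).V := ⟨(v, i), h⟩

theorem multiple_cases (p : (G.multiple c e k).V) : ∃ v i h, p = multipleMk c e v i h :=
  ⟨p.1.1, p.1.2, p.2, rfl⟩

@[simp] theorem multipleOrig_mk {v : G.V} {i : ZMod k} (h : ¬ G.Reach e v → i = 0) :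
    G.multipleOrig c e k (multipleMk c e v i h) = v := rfl

theorem multiple_arc {u v : G.V} {i j : ZMod k} {hu : ¬ G.Reach e u → i = 0}
    {hv : ¬ G.Reach e v → j = 0} :
    (G.multiple c e k).arc (multipleMk c e u i hu) (multipleMk c e v j hv) ↔
      G.arc u v ∧ ((u ∈ c.support ∧ v = e → j = i + 1) ∧ (¬ (u ∈ c.support ∧ v = e) → j = i)) :=
  Iff.rfl

theorem multiple_covering (c : G.Cycle) (e : G.V) (k : ℕ) [NeZero k] :
    IsCovering (G.multiple c e k) G (G.multipleOrig c e k) where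
  root := rfl
  arc p q h := h.1
  tile p := rfl
  lab p q _ := rfl
  lift p z h := by
    obtain ⟨u, i, hu, rfl⟩ := multiple_cases p
    by_cases hw : u ∈ c.support ∧ z = e
    · exact ⟨multipleMk c e z (i + 1) (fun hz => absurd (hw.2 ▸ .refl _) hz),
        ⟨h, fun _ => rfl, fun h => absurd hw h⟩, rfl⟩
    · refine ⟨multipleMk c e z i (fun hz => hu fun hr => hz (hr.trans (.of_arc h))),
        ⟨h, fun h => absurd h hw, fun _ => rfl⟩, rfl⟩
  inj p q q' h h' heq := by
    obtain ⟨u, i, hu, rfl⟩ := multiple_cases p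
    obtain ⟨v, j, hv, rfl⟩ := multiple_cases q
    obtain ⟨v', j', hv', rfl⟩ := multiple_cases q'
    simp only [multipleOrig_mk] at heq
    subst heq
    have : j = j' := by
      by_cases hw : u ∈ c.support ∧ v = e
      · exact (h.2.1 hw).trans (h'.2.1 hw).symm
      · exact (h.2.2 hw).trans (h'.2.2 hw).symm
    subst this
    rfl

/-- One lap from `e` stays in copy `i` until its last arc, the arc back to `e`, which leads to the
next copy. -/
theorem multiple_reach_succ (he : e ∈ c.support) (i : ZMod k) :
    (G.multiple c e k).Reach (multipleMk c e e i (absurd (.refl e)))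
      (multipleMk c e e (i + 1) (absurd (.refl e))) := by
  obtain ⟨a, ha⟩ := he
  have hre : ∀ b, G.Reach e (c.vert b) := fun b => ha ▸ c.reach _ _
  have h1 : ∀ n : ℕ, n < c.len → (G.multiple c e k).Reach (multipleMk c e e i (absurd (.refl e)))
      (multipleMk c e (c.vert (a + n)) i (absurd (hre _))) := by
    intro n
    induction n with
    | zero =>
      intro _
      have : c.vert (a + (0 : ℕ)) = e := by rw [Nat.cast_zero, add_zero, ha]
      simp only [this]
      exact .refl _
    | succ n ih =>
      intro hn
      refine (ih (by omega)).trans (.of_arc ⟨?_, ?_, fun _ => rfl⟩)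
      · change G.arc (c.vert (a + n)) (c.vert (a + (n + 1 : ℕ)))
        rw [Nat.cast_succ, ← add_assoc]; exact c.arc _
      · rintro ⟨-, h⟩
        exfalso
        change c.vert (a + (n + 1 : ℕ)) = e at h
        rw [← ha] at h
        have := c.injective h
        rw [add_eq_left, ZMod.natCast_eq_zero_iff] at this
        exact absurd (Nat.le_of_dvd n.succ_pos this) (by omega)
  have hpos := c.len_pos
  refine (h1 (c.len - 1) (by omega)).trans
    (.of_arc ⟨?_, fun _ => rfl, fun h => absurd ⟨⟨_, rfl⟩, rfl⟩ h⟩)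
  change G.arc (c.vert (a + (c.len - 1 : ℕ))) e
  have := c.arc (a + (c.len - 1 : ℕ))
  rwa [add_assoc, ← Nat.cast_succ, (by omega : (c.len - 1).succ = c.len), ZMod.natCast_self,
    add_zero, ha] at this

theorem multiple_reach_entry (he : e ∈ c.support) (i j : ZMod k) :
    (G.multiple c e k).Reach (multipleMk c e e i (absurd (.refl e)))
      (multipleMk c e e j (absurd (.refl e))) := by
  have h : ∀ n : ℕ, (G.multiple c e k).Reach (multipleMk c e e i (absurd (.refl e)))
      (multipleMk c e e (i + n) (absurd (.refl e))) := by
    intro n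
    induction n with
    | zero => simp only [Nat.cast_zero, add_zero]; exact .refl _
    | succ n ih =>
      simp only [Nat.cast_succ, ← add_assoc]
      exact ih.trans (multiple_reach_succ he _)
  have := h (j - i).val
  simpa only [ZMod.natCast_zmod_val, add_sub_cancel] using this

theorem multiple_exists_reach {v : G.V} (h : G.Reach e v) (i : ZMod k) :
    ∃ j, (G.multiple c e k).Reach (multipleMk c e e j (absurd (.refl e)))
      (multipleMk c e v i (absurd h)) := by
  induction h generalizing i with
  | refl => exact ⟨i, .refl _⟩
  | @tail w z hw hwz ih =>
    by_cases hc : w ∈ c.support ∧ z = e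
    · obtain ⟨j, hj⟩ := ih (i - 1)
      exact ⟨j, hj.trans (.of_arc ⟨hwz, fun _ => (sub_add_cancel i 1).symm, fun h => absurd hc h⟩)⟩
    · obtain ⟨j, hj⟩ := ih i
      exact ⟨j, hj.trans (.of_arc ⟨hwz, fun h => absurd h hc, fun _ => rfl⟩)⟩

theorem multiple_reach_of_mem (he : e ∈ c.support) {x y : G.V} (hx : x ∈ c.support) (hy : G.Reach e y)
    {i j : ZMod k} {hi : ¬ G.Reach e x → i = 0} {hj : ¬ G.Reach e y → j = 0} :
    (G.multiple c e k).Reach (multipleMk c e x i hi) (multipleMk c e y j hj) := by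
  obtain ⟨q, h1, h2⟩ := (multiple_covering c e k).lift_reach (x := multipleMk c e x i hi)
    (z := e) (Cycle.reach_of_mem hx he)
  obtain ⟨v, i', hv, rfl⟩ := multiple_cases q
  simp only [multipleOrig_mk] at h2
  subst h2
  obtain ⟨j', h3⟩ := multiple_exists_reach (c := c) hy j
  exact (h1.trans (multiple_reach_entry he i' j')).trans h3

theorem multiple_reach_of_not_mem {x y : G.V} (h : G.Reach x y)
    (hc : ∀ w, G.Reach x w → G.Reach w y → w ∉ c.support) {i : ZMod k} {hx : ¬ G.Reach e x → i = 0}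
    {hy : ¬ G.Reach e y → i = 0} :
    (G.multiple c e k).Reach (multipleMk c e x i hx) (multipleMk c e y i hy) := by
  induction h with
  | refl => exact .refl _
  | @tail w z hw hwz ih =>
    refine (ih (fun u h1 h2 => hc u h1 (h2.trans (.of_arc hwz)))
      (hy := fun hr => hx fun hr' => hr (hr'.trans hw))).trans
      (.of_arc ⟨hwz, fun h => absurd h.1 (hc w hw (.of_arc hwz)), fun _ => rfl⟩)

theorem multiple_index_eq (hG : IsQuipu S G) (he : G.IsEntry c e) {x y : G.V} {i j : ZMod k}
    {hi : ¬ G.Reach e x → i = 0} {hj : ¬ G.Reach e y → j = 0}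
    (h : (G.multiple c e k).Reach (multipleMk c e x i hi) (multipleMk c e y j hj))
    (hx : x ∉ c.support) (hex : G.Reach e x) : j = i := by
  have key : ∀ q, (G.multiple c e k).Reach (multipleMk c e x i hi) q → q.1.2 = i := by
    intro q hq
    induction hq with
    | refl => rfl
    | @tail p q hp hpq ih =>
      rw [← ih]
      refine hpq.2.2 fun hc => ?_
      exact hG.not_mem_of_arc he hx hex hc.1 ((multiple_covering c e k).reach hp)
  exact key _ h

theorem multiple_isQuipu (hG : IsQuipu S G) (he : G.IsEntry c e) : IsQuipu S (G.multiple c e k) := by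
  have hφ := multiple_covering c e k
  obtain ⟨y₀, hy₀, hy₀e⟩ := he.2
  have hr1 : ∀ v (hv : ¬ G.Reach e v), (G.multiple c e k).Reach (G.multiple c e k).root
      (multipleMk c e v 0 fun _ => rfl) := by
    intro v hv
    obtain ⟨q, h1, h2⟩ := hφ.lift_reach (x := (G.multiple c e k).root) (hG.reach v)
    obtain ⟨v, i, hi, rfl⟩ := multiple_cases q
    simp only [multipleOrig_mk] at h2
    subst h2
    have := hi hv
    subst this
    exact h1
  refine hφ.isQuipu hG ?_ ?_
  · intro p
    obtain ⟨v, i, hi, rfl⟩ := multiple_cases p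
    by_cases hv : G.Reach e v
    · obtain ⟨j, hj⟩ := multiple_exists_reach (c := c) hv i
      refine Reach.trans ?_ ((multiple_reach_entry he.1 0 j).trans hj)
      exact (hr1 y₀ (hG.not_reach_of_entry he hy₀ hy₀e)).trans
        (.of_arc ⟨hy₀e, fun h => absurd h.1 hy₀, fun _ => rfl⟩)
    · have := hi hv
      subst this
      exact hr1 v hv
  -- If an arc has a return in `G`, it has one in the multiple: on the cycle all copies communicate,
  -- and a return that avoids the cycle keeps the number of the copy.
  · have hret : ∀ p q, (G.multiple c e k).arc p q → ¬ (G.multiple c e k).Reach q p →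
        ¬ G.Reach (G.multipleOrig c e k q) (G.multipleOrig c e k p) := by
      intro p q h hn hr
      obtain ⟨u, i, hu, rfl⟩ := multiple_cases p
      obtain ⟨v, j, hv, rfl⟩ := multiple_cases q
      simp only [multipleOrig_mk] at hr
      by_cases hvc : v ∈ c.support
      · exact hn (multiple_reach_of_mem he.1 hvc ((Cycle.reach_of_mem he.1 hvc).trans hr))
      · have hav : ∀ w, G.Reach v w → G.Reach w u → w ∉ c.support := fun w h1 h2 hw =>
          hvc (hG.mem_support_of_reach c hw (h2.trans (.of_arc h.1)) h1)
        have : j = i := h.2.2 fun hc => hav u hr (.refl u) hc.1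
        subst this
        exact hn (multiple_reach_of_not_mem hr hav)
    intro y x y' x' h h' hxx' hx'x hn hn'
    obtain ⟨hy, hx⟩ := hG.entry _ _ _ _ (hφ.arc _ _ h) (hφ.arc _ _ h') (hφ.reach hxx')
      (hφ.reach hx'x) (hret _ _ h hn) (hret _ _ h' hn')
    have hN := hret _ _ h hn
    obtain ⟨u, i, hu, rfl⟩ := multiple_cases y
    obtain ⟨v, j, hv, rfl⟩ := multiple_cases x
    obtain ⟨u', i', hu', rfl⟩ := multiple_cases y'
    obtain ⟨v', j', hv', rfl⟩ := multiple_cases x'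
    simp only [multipleOrig_mk] at hy hx hN
    subst hy hx
    have huv := h.1
    change G.arc u v at huv
    suffices i = i' ∧ j = j' by obtain ⟨rfl, rfl⟩ := this; exact ⟨rfl, rfl⟩
    by_cases hev : G.Reach e v
    · by_cases hvc : v ∈ c.support
      · have huc : u ∉ c.support := fun hc => hN (Cycle.reach_of_mem hvc hc)
        have hue : ¬ G.Reach e u := fun hr => hG.not_mem_of_arc he huc hr hvc (.of_arc huv)
        have e1 := h.2.2 fun hc => huc hc.1
        have e2 := h'.2.2 fun hc => huc hc.1
        change j = i at e1
        change j' = i' at e2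
        rw [e1, e2, hu hue, hu' hue]
        exact ⟨rfl, rfl⟩
      · have e3 : ¬ (u ∈ c.support ∧ v = e) := fun hc => hvc (hc.2 ▸ he.1)
        have e1 : j = i := h.2.2 e3
        have e2 : j' = i' := h'.2.2 e3
        have e4 := multiple_index_eq hG he hxx' hvc hev
        exact ⟨by rw [← e1, ← e2, e4], e4.symm⟩
    · have hue : ¬ G.Reach e u := fun hr => hev (hr.trans (.of_arc huv))
      exact ⟨(hu hue).trans (hu' hue).symm, (hv hev).trans (hv' hev).symm⟩

/-! ### Adding leaves -/

section addLeaves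

variable {Y : Set G.V} {d : Dir} {t : Tile Γ}

theorem addLeaves_run_inl {u v : G.V} {l : List Dir} :
    (G.addLeaves Y d t).Run (Sum.inl u) l (Sum.inl v) ↔ G.Run u l v := by
  induction l generalizing u with
  | nil => exact Sum.inl_injective.eq_iff
  | cons a l ih =>
    constructor
    · rintro ⟨y | y, h1, h2, h3⟩
      · exact ⟨y, h1, h2, ih.1 h3⟩
      · cases l with
        | nil => cases h3
        | cons b l => obtain ⟨z, h4, -⟩ := h3; exact h4.elim
    · rintro ⟨y, h1, h2, h3⟩
      exact ⟨Sum.inl y, h1, h2, ih.2 h3⟩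

theorem addLeaves_run_inr {u : G.V} {y : Y} {l : List Dir} :
    (G.addLeaves Y d t).Run (Sum.inl u) l (Sum.inr y) ↔ ∃ l', l = l' ++ [d] ∧ G.Run u l' y.1 := by
  constructor
  · intro h
    rcases List.eq_nil_or_concat' l with rfl | ⟨l', a, rfl⟩
    · cases h
    · obtain ⟨z | z, h1, h2⟩ := run_append.1 h
      · obtain ⟨h3, h4⟩ := run_singleton.1 h2
        change z = y.1 at h3
        change d = a at h4
        subst h3 h4
        exact ⟨l', rfl, addLeaves_run_inl.1 h1⟩
      · exact (run_singleton.1 h2).1.elim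
  · rintro ⟨l', rfl, h⟩
    exact (addLeaves_run_inl.2 h).append (run_singleton.2 ⟨rfl, rfl⟩)

theorem addLeaves_reach {u v : G.V} :
    (G.addLeaves Y d t).Reach (Sum.inl u) (Sum.inl v) ↔ G.Reach u v :=
  (reach_iff.trans (exists_congr fun _ => addLeaves_run_inl)).trans reach_iff.symm

theorem addLeaves_reach_inr {y : Y} {p : (G.addLeaves Y d t).V}
    (h : (G.addLeaves Y d t).Reach (Sum.inr y) p) : p = Sum.inr y := by
  rcases Relation.ReflTransGen.cases_head h with h | ⟨z, h, -⟩
  · exact h.symm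
  · exact h.elim

theorem addLeaves_cyc {p : (G.addLeaves Y d t).V} (h : (G.addLeaves Y d t).Cyc p) :
    ∃ v, p = Sum.inl v ∧ G.Cyc v := by
  obtain ⟨q, h1, h2⟩ := h
  rcases p with v | y
  · rcases q with u | y
    · exact ⟨v, rfl, u, h1, addLeaves_reach.1 h2⟩
    · cases addLeaves_reach_inr h2
  · exact h1.elim

/-- The new points lie outside the old domain, which yields determinism at the members of `Y` and
uniqueness of displacements. The leaves lie on no cycle, so the conditions on cycles are not
affected. -/
theorem addLeaves_isQuipu (hG : IsQuipu S G) (ht : t ∈ S.tiles) (hY : ∀ y ∈ Y, G.tile y d = t d.opp)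
    (hdom : ∀ y ∈ Y, ∀ v ∈ G.cover y, v + d.vec ∉ G.dom) : IsQuipu S (G.addLeaves Y d t) where
  root_no_in := by
    rintro (x | x) h
    · exact hG.root_no_in x h
    · exact h
  tile_root := hG.tile_root
  tile_mem := by
    rintro (x | x)
    · exact hG.tile_mem x
    · exact Or.inl ht
  tile_seed := by
    rintro hS (x | x) hx
    · exact congrArg Sum.inl (hG.tile_seed hS x hx)
    · change t = S.seed at hx
      exact absurd (hx ▸ ht) hS
  glue := by
    rintro (x | x) (y | y) h
    · exact hG.glue x y h
    · change x = y.1 at h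
      subst h
      exact hY _ y.2
    · exact h.elim
    · exact h.elim
  det := by
    have key : ∀ y ∈ Y, ∀ z, G.arc y z → G.lab y z ≠ d := by
      rintro y hy z hz rfl
      obtain ⟨l, hl⟩ := reach_iff.1 (hG.reach y)
      refine hdom y hy _ (mem_cover.2 ⟨l, hl, rfl⟩) (mem_dom.2 ⟨z, _, hl.append (Run.of_arc hz), ?_⟩)
      simp
    rintro (x | x) (y | y) (z | z) h h' hl
    · exact congrArg Sum.inl (hG.det x y z h h' hl)
    · change x = z.1 at h'
      subst h'
      exact absurd hl (key _ z.2 y h)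
    · change x = y.1 at h
      subst h
      exact absurd hl.symm (key _ y.2 z h')
    · exact congrArg Sum.inr (Subtype.ext (Eq.trans (Eq.symm h) h'))
    all_goals exact h.elim
  reach := by
    rintro (x | x)
    · exact addLeaves_reach.2 (hG.reach x)
    · exact (addLeaves_reach.2 (hG.reach x.1)).trans (.of_arc rfl)
  ret := by
    rintro (x | x) (y | y) (z | z) h h' hy hz
    · exact congrArg Sum.inl
        (hG.ret x y z h h' (addLeaves_reach.1 hy) (addLeaves_reach.1 hz))
    · cases addLeaves_reach_inr hz
    · cases addLeaves_reach_inr hy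
    · cases addLeaves_reach_inr hy
    all_goals exact h.elim
  entry := by
    rintro (y | y) x (y' | y') x' h h' hxx' hx'x hn hn'
    · rcases x with x | x
      · rcases x' with x' | x'
        · obtain ⟨rfl, rfl⟩ := hG.entry y x y' x' h h' (addLeaves_reach.1 hxx')
            (addLeaves_reach.1 hx'x) (fun h => hn (addLeaves_reach.2 h))
            (fun h => hn' (addLeaves_reach.2 h))
          exact ⟨rfl, rfl⟩
        · cases addLeaves_reach_inr hx'x
      · have := addLeaves_reach_inr hxx'
        subst this
        exact ⟨congrArg Sum.inl (Eq.trans h (Eq.symm h')), rfl⟩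
    · cases x' <;> exact h'.elim
    · cases x <;> exact h.elim
    · cases x <;> exact h.elim
  three := by
    intro a b c ha hb hc hab hbc
    obtain ⟨a, rfl, ha'⟩ := addLeaves_cyc ha
    obtain ⟨b, rfl, hb'⟩ := addLeaves_cyc hb
    obtain ⟨c, rfl, hc'⟩ := addLeaves_cyc hc
    exact (hG.three a b c ha' hb' hc' (addLeaves_reach.1 hab) (addLeaves_reach.1 hbc)).imp
      addLeaves_reach.2 addLeaves_reach.2
  uniq := by
    have key : ∀ l l' x (y : Y), G.Run G.root l x → G.Run G.root l' y.1 →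
        wordDisp l ≠ wordDisp (l' ++ [d]) := by
      intro l l' x y h h' heq
      refine hdom y.1 y.2 _ (mem_cover.2 ⟨l', h', rfl⟩) (mem_dom.2 ⟨x, l, h, ?_⟩)
      simpa using heq
    rintro l l' (x | x) (x' | x') h h' hd
    · exact hG.uniq l l' x x' (addLeaves_run_inl.1 h) (addLeaves_run_inl.1 h') hd
    · obtain ⟨m, rfl, hm⟩ := addLeaves_run_inr.1 h'
      exact absurd hd (key _ _ _ _ (addLeaves_run_inl.1 h) hm)
    · obtain ⟨m, rfl, hm⟩ := addLeaves_run_inr.1 h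
      exact absurd hd.symm (key _ _ _ _ (addLeaves_run_inl.1 h') hm)
    · obtain ⟨m, rfl, hm⟩ := addLeaves_run_inr.1 h
      obtain ⟨m', rfl, hm'⟩ := addLeaves_run_inr.1 h'
      rw [hG.uniq m m' _ _ hm hm' (by simpa using hd)]

end addLeaves

end LGraph

/-! ### Making the covers of vertices homogeneous -/

namespace LGraph

variable {Γ : Type*} {S : TAS Γ} {G H K : LGraph Γ}

/-- Inserting closed runs at `v` does not change the validity of `P`. -/
def Neutral (G : LGraph Γ) (P : ℤ × ℤ → Prop) (v : G.V) : Prop :=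
  ∀ w l w' x, G.Run G.root w v → G.Run v l v → G.Run v w' x →
    (P (wordDisp (w ++ w')) ↔ P (wordDisp (w ++ l ++ w')))

/-- Inserting closed runs at `v` after a closed run of length at least `N` does not change the
validity of `P`. -/
def NeutralFrom (G : LGraph Γ) (P : ℤ × ℤ → Prop) (N : ℕ) (v : G.V) : Prop :=
  ∀ w z l w' x, G.Run G.root w v → G.Run v z v → N ≤ z.length → G.Run v l v → G.Run v w' x →
    (P (wordDisp (w ++ z ++ w')) ↔ P (wordDisp (w ++ z ++ l ++ w')))

/-- Inserting `L`-th powers of closed runs after closed runs of length at least `N` does not change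
the validity of `P`. -/
def EventuallyPeriodic (G : LGraph Γ) (P : ℤ × ℤ → Prop) (L N : ℕ) : Prop :=
  ∀ v w z l w' x, G.Run G.root w v → G.Run v z v → N ≤ z.length → G.Run v l v → G.Run v w' x →
    (P (wordDisp (w ++ z ++ w')) ↔ P (wordDisp (w ++ z ++ wordPow l L ++ w')))

variable {P : ℤ × ℤ → Prop} {φ : H.V → G.V}

theorem Neutral.of_covering (hφ : IsCovering H G φ) {v : H.V} (h : G.Neutral P (φ v)) :
    H.Neutral P v := fun w l w' x h1 h2 h3 =>
  h w l w' (φ x) (hφ.run_root h1) (hφ.run h2) (hφ.run h3)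

theorem EventuallyPeriodic.of_covering (hφ : IsCovering H G φ) {L N : ℕ}
    (h : G.EventuallyPeriodic P L N) : H.EventuallyPeriodic P L N :=
  fun v w z l w' x h1 h2 h3 h4 h5 =>
    h (φ v) w z l w' (φ x) (hφ.run_root h1) (hφ.run h2) h3 (hφ.run h4) (hφ.run h5)

theorem neutral_of_not_cyc {v : G.V} (h : ¬ G.Cyc v) : G.Neutral P v := by
  intro w l w' x h1 h2 h3
  have : l = [] := by
    by_contra hl
    exact h (cyc_iff.2 ⟨l, hl, h2⟩)
  simp [this]

theorem exists_isPath_iff (hn : ∀ v, G.Neutral P v) {l : List Dir} {x : G.V}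
    (h : G.Run G.root l x) : ∃ w : Walk G G.root x, w.IsPath ∧ (P (wordDisp l) ↔ P w.disp) := by
  induction hl : l.length using Nat.strong_induction_on generalizing l with
  | _ n ih =>
  obtain ⟨w, hw⟩ := h.exists_walk
  by_cases hp : w.IsPath
  · exact ⟨w, hp, by rw [w.disp_eq, hw, List.reverse_reverse]⟩
  · obtain ⟨z, l₁, l₂, l₃, e1, e2, e3, e4, e5⟩ := w.exists_loop hp
    rw [hw, List.reverse_reverse] at e1
    have := List.length_pos_iff.2 e2
    obtain ⟨w', h1, h2⟩ := ih (l₁ ++ l₃).length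
      (by rw [← hl, e1]; simp only [List.length_append]; omega) (e3.append e5) rfl
    exact ⟨w', h1, by rw [← h2, e1, hn z l₁ l₂ l₃ x e3 e4 e5]⟩

/-- Cutting out loops reduces both words to the unique path from the root to `x`, and neutrality
preserves `P` on the way. -/
theorem iff_of_neutral (hG : IsQuipu S G) (hn : ∀ v, G.Neutral P v) {l l' : List Dir} {x : G.V}
    (h : G.Run G.root l x) (h' : G.Run G.root l' x) : P (wordDisp l) ↔ P (wordDisp l') := by
  obtain ⟨w, h1, h2⟩ := exists_isPath_iff hn h
  obtain ⟨w', h1', h2'⟩ := exists_isPath_iff hn h'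
  rw [h2, h2', hG.eq_of_isPath w w' h1 h1']

/-! ### Closed runs in multiples -/

section multiple

variable {c : G.Cycle} {e : G.V} {k : ℕ} [NeZero k]

theorem multiple_run_shift {a b : G.V} {i j : ZMod k} {l : List Dir} (ha : G.Reach e a)
    (hb : G.Reach e b)
    (h : (G.multiple c e k).Run (multipleMk c e a i (absurd ha)) l (multipleMk c e b j (absurd hb)))
    (t : ZMod k) :
    (G.multiple c e k).Run (multipleMk c e a (i + t) (absurd ha)) l
      (multipleMk c e b (j + t) (absurd hb)) := by
  induction l generalizing a i with
  | nil =>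
    have := congrArg Subtype.val h
    simp only [multipleMk, Prod.mk.injEq] at this
    obtain ⟨rfl, rfl⟩ := this
    rfl
  | cons d l ih =>
    obtain ⟨q, h1, h2, h3⟩ := h
    obtain ⟨w, n, hw, rfl⟩ := multiple_cases q
    have haw := (multiple_arc.1 h1).1
    have hew : G.Reach e w := ha.trans (.of_arc haw)
    refine ⟨multipleMk c e w (n + t) (absurd hew), ?_, h2, ih hew h3⟩
    refine multiple_arc.2 ⟨haw, fun hc => ?_, fun hc => ?_⟩
    · rw [(multiple_arc.1 h1).2.1 hc]; ring
    · rw [(multiple_arc.1 h1).2.2 hc]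

variable (hG : IsQuipu S G) (he : G.IsEntry c e)
include hG he

/-- The number of the copy changes only at the arc back to `e`; if this arc occurred before the end
of the lap, there would be a shorter closed run. -/
theorem multiple_run_lap {B : List Dir} (hB0 : B ≠ []) (hB : G.Run e B e)
    (hmin : ∀ B', G.Run e B' e → B' ≠ [] → B.length ≤ B'.length) (i : ZMod k) :
    (G.multiple c e k).Run (multipleMk c e e i (absurd (.refl e))) B
      (multipleMk c e e (i + 1) (absurd (.refl e))) := by
  have hφ := multiple_covering c e k
  have key : ∀ r, r <+: B → r ≠ B → ∀ w (j : ZMod k) (hw : G.Reach e w),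
      (G.multiple c e k).Run (multipleMk c e e i (absurd (.refl e))) r
        (multipleMk c e w j (absurd hw)) → j = i := by
    intro r
    induction r using List.reverseRecOn with
    | nil =>
      intro _ _ w j hw h
      have := congrArg Subtype.val h
      simp only [multipleMk, Prod.mk.injEq] at this
      exact this.2.symm
    | append_singleton r d ih =>
      intro hr hrB w j hw h
      obtain ⟨q, h1, h2⟩ := run_append.1 h
      obtain ⟨u, n, hu, rfl⟩ := multiple_cases q
      have h1' := hφ.run h1
      have hn := ih ((List.prefix_append r [d]).trans hr) (by
        rintro rfl
        have := hr.length_le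
        simp at this) u n h1'.reach h1
      have h3 := multiple_arc.1 (run_singleton.1 h2).1
      rw [← hn]
      refine h3.2.2 fun hc => hrB ?_
      have := hφ.run h
      simp only [multipleOrig_mk, hc.2] at this
      exact hr.eq_of_length (le_antisymm hr.length_le (hmin _ this (by simp)))
  obtain ⟨q, h1, h2⟩ := hφ.lift_run (x := multipleMk c e e i (absurd (.refl e))) hB
  obtain ⟨w, n, hw, rfl⟩ := multiple_cases q
  simp only [multipleOrig_mk] at h2
  subst h2
  suffices n = i + 1 by subst this; exact h1
  rcases List.eq_nil_or_concat' B with rfl | ⟨B, d, rfl⟩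
  · exact absurd rfl hB0
  · obtain ⟨q, h3, h4⟩ := run_append.1 h1
    obtain ⟨u, m, hu, rfl⟩ := multiple_cases q
    have h3' := hφ.run h3
    have h4' := hφ.run h4
    have hn := key B (List.prefix_append _ _) (by simp) u m h3'.reach h3
    rw [← hn]
    exact (multiple_arc.1 (run_singleton.1 h4).1).2.1
      ⟨hG.mem_support_of_reach c he.1 h3'.reach h4'.reach, rfl⟩

/-- Let `B` be the lap at `e` and `s` a run from `e` to `v`. Below, `s ++ l` equals `wordPow B m ++
s` for some `m`. It raises the number of the copy by `m`, so `k` divides `m`; conjugation by `s`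
turns `B` into the lap `z` at `v`. -/
theorem multiple_closed_run {v : G.V} (hv : v ∈ c.support) {i : ZMod k} {hi : ¬ G.Reach e v → i = 0}
    {l : List Dir}
    (h : (G.multiple c e k).Run (multipleMk c e v i hi) l (multipleMk c e v i hi)) :
    ∃ l', G.Run v l' v ∧ l = wordPow l' k := by
  have hφ := multiple_covering c e k
  have hev := Cycle.reach_of_mem he.1 hv
  have hve := Cycle.reach_of_mem hv he.1
  obtain ⟨B, s, hB0, hB, hs, hmin, hall⟩ := hG.exists_lap (Cycle.cyc he.1) hev hve
  obtain ⟨z, hz⟩ : s <+: B ++ s := by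
    rcases hG.prefix_or_prefix hs (hB.append hs) hve hve with h | h
    · exact h
    · have h1 := h.length_le
      have h2 := List.length_pos_iff.2 hB0
      simp only [List.length_append] at h1
      omega
  have hzv : G.Run v z v := hG.run_of_append (hz ▸ hB.append hs) hs
  have hlv := hφ.run h
  simp only [multipleOrig_mk] at hlv
  obtain ⟨m, hm⟩ := hall _ (hs.append hlv)
  obtain ⟨q, h1, h2⟩ := hφ.lift_run (x := multipleMk c e e 0 (absurd (.refl e))) hs
  obtain ⟨w, j, hw, rfl⟩ := multiple_cases q
  simp only [multipleOrig_mk] at h2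
  subst h2
  have hBm : ∀ (m : ℕ) (a : ZMod k), (G.multiple c e k).Run (multipleMk c e e a (absurd (.refl e)))
      (wordPow B m) (multipleMk c e e (a + m) (absurd (.refl e))) := by
    intro m
    induction m with
    | zero => intro a; simp only [Nat.cast_zero, add_zero]; rfl
    | succ m ih =>
      intro a
      rw [wordPow_succ]
      refine (multiple_run_lap hG he hB0 hB hmin a).append ?_
      have := ih (a + 1)
      simp only [add_assoc, add_comm (1 : ZMod k)] at this
      simpa only [Nat.cast_succ] using this
  have r1 := multiple_run_shift (.refl e) hev h1 (i - j)
  have r2 := multiple_run_shift (.refl e) hev h1 (i - j + m)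
  have r3 := (hBm m (0 + (i - j))).append (by simpa only [add_assoc] using r2)
  simp only [add_sub_cancel] at r1
  have r4 := r1.append h
  rw [hm] at r4
  have := congrArg (fun q => q.1.2) (run_det (hφ.det hG) r3 r4)
  simp only [multipleMk] at this
  have hm0 : ((m : ℕ) : ZMod k) = 0 := by linear_combination this
  rw [ZMod.natCast_eq_zero_iff] at hm0
  obtain ⟨m', rfl⟩ := hm0
  refine ⟨wordPow z m', hzv.pow m', ?_⟩
  have hcomm : ∀ n, wordPow B n ++ s = s ++ wordPow z n := by
    intro n
    induction n with
    | zero => simp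
    | succ n ih =>
      rw [wordPow_succ, List.append_assoc, ih, ← List.append_assoc, ← hz, wordPow_succ,
        List.append_assoc]
  rw [hcomm] at hm
  rw [List.append_cancel_left hm, mul_comm, wordPow_mul]

theorem multiple_neutralFrom {N : ℕ} (h : G.EventuallyPeriodic P k N) {p : (G.multiple c e k).V}
    (hp : p.1.1 ∈ c.support) : (G.multiple c e k).NeutralFrom P N p := by
  have hφ := multiple_covering c e k
  obtain ⟨v, i, hi, rfl⟩ := multiple_cases p
  intro w z l w' x h1 h2 h3 h4 h5
  obtain ⟨l', h6, rfl⟩ := multiple_closed_run hG he hp h4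
  exact h v w z l' w' _ (hφ.run_root h1) (hφ.run h2) h3 h6 (hφ.run h5)

end multiple

/-! ### Repeated unrolling -/

theorem exists_run_length_le (G : LGraph Γ) :
    ∃ b, ∀ u v, G.Reach u v → ∃ s, G.Run u s v ∧ s.length ≤ b := by
  have := G.finite
  have : ∀ p : G.V × G.V, ∃ n, G.Reach p.1 p.2 → ∃ s, G.Run p.1 s p.2 ∧ s.length = n := by
    intro p
    by_cases h : G.Reach p.1 p.2
    · obtain ⟨s, hs⟩ := reach_iff.1 h
      exact ⟨s.length, fun _ => ⟨s, hs, rfl⟩⟩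
    · exact ⟨0, fun h' => absurd h' h⟩
  choose f hf using this
  obtain ⟨b, hb⟩ := (Set.finite_range f).bddAbove
  refine ⟨b, fun u v h => ?_⟩
  obtain ⟨s, h1, h2⟩ := hf (u, v) h
  exact ⟨s, h1, h2 ▸ hb ⟨_, rfl⟩⟩

theorem exists_entering {C : Set G.V} {w : List Dir} {v : G.V} (h : G.Run G.root w v) (hv : v ∈ C)
    (hr : G.root ∉ C) : ∃ w₁ y d x w₂, w = w₁ ++ ([d] ++ w₂) ∧ G.Run G.root w₁ y ∧ G.Run y [d] x ∧
      G.Run x w₂ v ∧ y ∉ C ∧ x ∈ C := by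
  induction w using List.reverseRecOn generalizing v with
  | nil => rw [run_nil] at h; subst h; exact absurd hv hr
  | append_singleton w d ih =>
    obtain ⟨y, h1, h2⟩ := run_append.1 h
    by_cases hy : y ∈ C
    · obtain ⟨w₁, y', d', x', w₂, rfl, e1, e2, e3, e4, e5⟩ := ih h1 hy
      exact ⟨w₁, y', d', x', w₂ ++ [d], by simp, e1, e2, e3.append h2, e4, e5⟩
    · exact ⟨w, y, d, v, [], by simp, h1, h2, rfl, hy, hv⟩

/-- Rooted runs of `H` to the cycle `c` end, after projection to `G`, with at least `n` steps in a
strongly connected component. -/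
def Deep (φ : H.V → G.V) (c : H.Cycle) (n : ℕ) : Prop :=
  ∀ w v, v ∈ c.support → H.Run H.root w v → ∃ w₀ s u, w = w₀ ++ s ∧ G.Run G.root w₀ u ∧
    G.Run u s (φ v) ∧ G.Reach (φ v) u ∧ n ≤ s.length

/-- The vertices that are not neutral. -/
def bad (G : LGraph Γ) (P : ℤ × ℤ → Prop) : Set G.V := {v | ¬ G.Neutral P v}

theorem not_cyc_unrollNew (hG : IsQuipu S G) {c : G.Cycle} {e : G.V} (he : G.IsEntry c e) :
    ¬ (G.unroll c e).Cyc (unrollNew (G.self_mem_branch c e)) := by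
  rintro ⟨q, h1, h2⟩
  have hφ := unroll_covering hG he
  have h3 : G.Reach e (G.unrollOrig c e q) := .of_arc (hφ.arc _ _ h1)
  rcases Relation.ReflTransGen.cases_tail h2 with rfl | ⟨p, h4, h5⟩
  · exact (unroll_arc_new_new.1 h1).2 he.1
  · rcases unroll_cases p with ⟨u, rfl⟩ | ⟨u, hu, rfl⟩
    · obtain ⟨h6, h7, -⟩ := unroll_arc_old_new.1 h5
      exact hG.not_reach_of_entry he h7 h6 (h3.trans (hφ.reach h4))
    · exact (unroll_arc_new_new.1 h5).2 he.1

/-- The cycle `c` in the unrolled graph. -/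
def unrollCycle (c : G.Cycle) (e : G.V) : (G.unroll c e).Cycle where
  len := c.len
  len_pos := c.len_pos
  vert i := unrollOld c e (c.vert i)
  injective := Sum.inl_injective.comp c.injective
  arc i := unroll_arc_old_old.2 ⟨c.arc i, fun h => h.1 ⟨i, rfl⟩⟩

theorem mem_unrollCycle {c : G.Cycle} {e : G.V} {p : (G.unroll c e).V} :
    p ∈ (unrollCycle c e).support ↔ ∃ v ∈ c.support, p = unrollOld c e v := by
  constructor
  · rintro ⟨i, rfl⟩; exact ⟨_, ⟨i, rfl⟩, rfl⟩
  · rintro ⟨_, ⟨i, rfl⟩, rfl⟩; exact ⟨i, rfl⟩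

theorem Cycle.root_not_mem (hG : IsQuipu S G) (c : G.Cycle) : G.root ∉ c.support := by
  rintro ⟨i, hi⟩
  have := c.arc (i - 1)
  rw [sub_add_cancel, hi] at this
  exact hG.root_no_in _ this

/-- Each unrolling makes rooted runs to the cycle pass one more copy of the entry, which adds a step
in the component below. No bad vertex appears off the cycle: the new copy of `e` lies on no cycle,
and the other new vertices are copies of neutral ones. -/
theorem exists_unroll_deep {X : Set G.V} {Y : Set H.V} (hGH : Reshape G X H Y) (hH : IsQuipu S H)
    (c : H.Cycle) (hbelow : ∀ v ∈ c.support, ∀ u, H.Reach v u → u ∉ c.support → H.Neutral P u)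
    (n : ℕ) :
    ∃ (K : LGraph Γ) (Z : Set K.V) (ψ : K.V → H.V) (c' : K.Cycle), Reshape G X K Z ∧ IsQuipu S K ∧
      IsCovering K H ψ ∧ Z = ψ ⁻¹' Y ∧ (∀ v ∈ c'.support, ψ v ∈ c.support) ∧ Deep ψ c' n ∧
      (∀ v ∈ c'.support, ∀ u, K.Reach v u → u ∉ c'.support → K.Neutral P u) ∧
      (K.bad P \ c'.support).ncard ≤ (H.bad P \ c.support).ncard := by
  induction n with
  | zero =>
    exact ⟨H, Y, id, c, hGH, hH, .id H, rfl, fun _ h => h,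
      fun w v _ h => ⟨w, [], v, by simp, h, rfl, .refl _, Nat.zero_le _⟩, hbelow, le_rfl⟩
  | succ n ih =>
    obtain ⟨K, Z, ψ, c', h1, h2, h3, rfl, h5, h6, h7, h8⟩ := ih
    obtain ⟨y, e, hy, hec, hye⟩ := h2.exists_entry c'
    have he : K.IsEntry c' e := ⟨hec, y, hy, hye⟩
    have hφ := unroll_covering h2 he
    have hnew : ∀ g (hg : g ∈ K.branch c' e), (K.unroll c' e).Neutral P (unrollNew hg) := by
      intro g hg
      rcases eq_or_not_mem_of_mem_branch hg with rfl | hgc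
      · exact neutral_of_not_cyc (not_cyc_unrollNew h2 he)
      · exact Neutral.of_covering hφ (h7 e hec g (reach_of_mem_branch hg) hgc)
    refine ⟨K.unroll c' e, K.unrollOrig c' e ⁻¹' (ψ ⁻¹' Y), ψ ∘ K.unrollOrig c' e, unrollCycle c' e,
      .unroll h1 c' e he, unroll_isQuipu h2 he, h3.comp hφ, rfl, ?_, ?_, ?_, ?_⟩
    · intro p hp
      obtain ⟨v, hv, rfl⟩ := mem_unrollCycle.1 hp
      exact h5 v hv
    · intro w p hp hw
      obtain ⟨w₁, q, d, x, w₂, rfl, e1, e2, e3, e4, e5⟩ := exists_entering hw hp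
        (Cycle.root_not_mem (unroll_isQuipu h2 he) _)
      obtain ⟨v, hv, rfl⟩ := mem_unrollCycle.1 hp
      obtain ⟨z, hz, rfl⟩ := mem_unrollCycle.1 e5
      have hq : K.unrollOrig c' e q = e := by
        have harc := (run_singleton.1 e2).1
        rcases unroll_cases q with ⟨u, rfl⟩ | ⟨u, hu, rfl⟩
        · obtain ⟨a1, a2⟩ := unroll_arc_old_old.1 harc
          have huc : u ∉ c'.support := fun hu => e4 (mem_unrollCycle.2 ⟨u, hu, rfl⟩)
          exact absurd ⟨huc, h2.eq_entry he huc hz a1⟩ a2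
        · exact (unroll_arc_new_old.1 harc).2.2
      obtain ⟨w₀, s, u, rfl, a1, a2, a3, a4⟩ := h6 w₁ e hec (hq ▸ hφ.run_root e1)
      refine ⟨w₀, s ++ ([d] ++ w₂), u, by simp, a1, ?_, ?_, ?_⟩
      · refine a2.append ?_
        have := h3.run (hφ.run (e2.append e3))
        rwa [hq] at this
      · exact (h3.reach (Cycle.reach_of_mem hv hec)).trans a3
      · simp only [List.length_append, List.length_singleton]; omega
    · intro p hp q hpq hq
      obtain ⟨v, hv, rfl⟩ := mem_unrollCycle.1 hp
      rcases unroll_cases q with ⟨u, rfl⟩ | ⟨u, hu, rfl⟩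
      · refine Neutral.of_covering hφ (h7 v hv u (hφ.reach hpq) fun hu => hq ?_)
        exact mem_unrollCycle.2 ⟨u, hu, rfl⟩
      · exact hnew u hu
    · refine le_trans ?_ h8
      have := K.finite
      refine (Set.ncard_le_ncard ?_ ((Set.toFinite _).image (unrollOld c' e))).trans
        (Set.ncard_image_le (Set.toFinite (K.bad P \ c'.support)))
      rintro p ⟨hp, hpc⟩
      rcases unroll_cases p with ⟨u, rfl⟩ | ⟨u, hu, rfl⟩
      · exact ⟨u, ⟨fun hn => hp (Neutral.of_covering hφ hn),
          fun hc => hpc (mem_unrollCycle.2 ⟨u, hc, rfl⟩)⟩, rfl⟩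
      · exact absurd (hnew u hu) hp

/-- A run `s₁` of length at most `b` leads from the point of entrance to `φ v`. Runs in a component
are comparable, so the long part of the given run begins with `s₁`, and what remains is a closed run
at `φ v` of length at least `N`. -/
theorem neutral_of_deep (hG : IsQuipu S G) (hφ : IsCovering H G φ) {N b : ℕ}
    (hb : ∀ u v, G.Reach u v → ∃ s, G.Run u s v ∧ s.length ≤ b) {c : H.Cycle}
    (hc : Deep φ c (b + N)) {v : H.V} (hv : v ∈ c.support) (hn : G.NeutralFrom P N (φ v)) :
    H.Neutral P v := by
  intro w l w' x h1 h2 h3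
  obtain ⟨w₀, s, u, rfl, e1, e2, e3, e4⟩ := hc w v hv h1
  obtain ⟨s₁, e5, e6⟩ := hb u (φ v) e2.reach
  obtain ⟨z, rfl⟩ : s₁ <+: s := by
    rcases hG.prefix_or_prefix e5 e2 e3 e3 with h | h
    · exact h
    · rw [h.eq_of_length (le_antisymm h.length_le (by omega))]
  have := hn (w₀ ++ s₁) z l w' (φ x) (e1.append e5) (hG.run_of_append e2 e5)
    (by simp only [List.length_append] at e4; omega) (hφ.run h2) (hφ.run h3)
  simpa only [List.append_assoc] using this

/-- Choose a bad vertex with no bad vertex strictly below it; it lies on a cycle. In the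
`L`-multiple of this cycle closed runs are `L`-th powers, and `b + N` unrollings put the preperiod
in front of the cycle, so its vertices become neutral. Off the cycle only neutral vertices get
additional copies. -/
theorem exists_fewer_bad {X : Set G.V} {Y : Set H.V} (hGH : Reshape G X H Y) (hH : IsQuipu S H)
    {L N : ℕ} [NeZero L] (hP : H.EventuallyPeriodic P L N) (hbad : (H.bad P).Nonempty) :
    ∃ (K : LGraph Γ) (Z : Set K.V) (ψ : K.V → H.V), Reshape G X K Z ∧ IsQuipu S K ∧
      IsCovering K H ψ ∧ Z = ψ ⁻¹' Y ∧ (K.bad P).ncard < (H.bad P).ncard := by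
  have hfin := H.finite
  let r : H.V → H.V → Prop := fun u v => H.Reach v u ∧ ¬ H.Reach u v
  have : Std.Irrefl r := ⟨fun u h => h.2 h.1⟩
  have : IsTrans H.V r := ⟨fun a b c h h' => ⟨h'.1.trans h.1, fun hc => h'.2 (h.1.trans hc)⟩⟩
  obtain ⟨v, hv, hmin⟩ := (Finite.wellFounded_of_trans_of_irrefl r).has_min _ hbad
  have hcyc : H.Cyc v := by
    by_contra hc
    exact hv (neutral_of_not_cyc hc)
  obtain ⟨a, ha, ha'⟩ := hcyc
  obtain ⟨c, hc, -⟩ := exists_cycle ha ha'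
  have hvc : v ∈ c.support := ⟨0, hc⟩
  obtain ⟨y, e, hy, hec, hye⟩ := hH.exists_entry c
  have he : H.IsEntry c e := ⟨hec, y, hy, hye⟩
  have hbelow : ∀ u, H.Reach e u → u ∉ c.support → H.Neutral P u := by
    intro u hu huc
    by_contra hn
    have hvu : H.Reach v u := (Cycle.reach_of_mem hvc hec).trans hu
    exact hmin u hn ⟨hvu, fun hr => huc (hH.mem_support_of_reach c hvc hvu hr)⟩
  have hφ := multiple_covering c e L
  have hH' : IsQuipu S (H.multiple c e L) := multiple_isQuipu hH he
  let p₀ : (H.multiple c e L).V := multipleMk c e v 0 fun _ => rfl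
  have hp₀ : (H.multiple c e L).Cyc p₀ := by
    refine Cyc.congr (a := multipleMk c e e 0 fun _ => rfl) ?_
      (multiple_reach_of_mem hec hec (Cycle.reach_of_mem hec hvc))
      (multiple_reach_of_mem hec hvc (.refl e))
    obtain ⟨z, hz, hze⟩ := Cycle.cyc hec
    obtain ⟨q, h1, h2⟩ := hφ.lift (multipleMk c e e 0 fun _ => rfl) z hz
    obtain ⟨z', i, hi, rfl⟩ := multiple_cases q
    simp only [multipleOrig_mk] at h2
    subst h2
    exact ⟨_, h1, multiple_reach_of_mem hec
      (hH.mem_support_of_reach c hec (.of_arc hz) hze) (.refl e)⟩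
  obtain ⟨q, hq, hq'⟩ := hp₀
  obtain ⟨c', hc', -⟩ := exists_cycle hq hq'
  have hp₀c : p₀ ∈ c'.support := ⟨0, hc'⟩
  have hsupp : ∀ p, p ∈ c'.support ↔ p.1.1 ∈ c.support := by
    intro p
    constructor
    · intro hp
      exact hH.mem_support_of_reach c hvc (hφ.reach (Cycle.reach_of_mem hp₀c hp))
        (hφ.reach (Cycle.reach_of_mem hp hp₀c))
    · intro hp
      obtain ⟨u, i, hu, rfl⟩ := multiple_cases p
      exact hH'.mem_support_of_reach c' hp₀c
        (multiple_reach_of_mem hec hvc (Cycle.reach_of_mem hec hp))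
        (multiple_reach_of_mem hec hp (Cycle.reach_of_mem hec hvc))
  have hbelow' : ∀ p ∈ c'.support, ∀ u, (H.multiple c e L).Reach p u → u ∉ c'.support →
      (H.multiple c e L).Neutral P u := by
    intro p hp u hpu hu
    rw [hsupp] at hp hu
    exact Neutral.of_covering hφ (hbelow _ ((Cycle.reach_of_mem hec hp).trans (hφ.reach hpu)) hu)
  obtain ⟨b, hb⟩ := exists_run_length_le (H.multiple c e L)
  obtain ⟨K, Z, ψ, c'', h1, h2, h3, h4, h5, h6, -, h8⟩ :=
    exists_unroll_deep (.multiple hGH c e he L) hH' c' hbelow' (b + N)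
  refine ⟨K, Z, H.multipleOrig c e L ∘ ψ, h1, h2, hφ.comp h3, h4, ?_⟩
  have hneut : ∀ v ∈ c''.support, K.Neutral P v := fun v hv =>
    neutral_of_deep hH' h3 hb h6 hv (multiple_neutralFrom hH he hP ((hsupp _).1 (h5 v hv)))
  have e1 : (K.bad P \ c''.support).ncard = (K.bad P).ncard := by
    congr 1
    ext u
    exact ⟨fun h => h.1, fun h => ⟨h, fun hu => h (hneut u hu)⟩⟩
  have e2 : ((H.multiple c e L).bad P \ c'.support).ncard ≤ (H.bad P \ c.support).ncard := by
    refine (Set.ncard_le_ncard ?_ ((Set.toFinite _).image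
      (fun u => multipleMk c e u (0 : ZMod L) fun _ => rfl))).trans
      (Set.ncard_image_le (Set.toFinite (H.bad P \ c.support)))
    rintro p ⟨hp, hpc⟩
    rw [hsupp] at hpc
    obtain ⟨u, i, hu, rfl⟩ := multiple_cases p
    have hub : ¬ H.Neutral P u := fun hn => hp (Neutral.of_covering hφ hn)
    have hi : i = 0 := hu fun hr => hub (hbelow u hr hpc)
    subst hi
    exact ⟨u, ⟨hub, hpc⟩, rfl⟩
  have e3 : (H.bad P \ c.support).ncard < (H.bad P).ncard := by
    refine Set.ncard_lt_ncard ⟨Set.sdiff_subset, fun h => ?_⟩ (Set.toFinite _)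
    exact (h hv).2 hvc
  omega

theorem exists_reshape_neutral (hG : IsQuipu S G) (X : Set G.V) {L N : ℕ} [NeZero L]
    (hP : G.EventuallyPeriodic P L N) :
    ∃ (H : LGraph Γ) (φ : H.V → G.V), Reshape G X H (φ ⁻¹' X) ∧ IsQuipu S H ∧ IsCovering H G φ ∧
      ∀ v, H.Neutral P v := by
  suffices ∀ (n : ℕ) (H : LGraph Γ) (φ : H.V → G.V), Reshape G X H (φ ⁻¹' X) → IsQuipu S H →
      IsCovering H G φ → (H.bad P).ncard ≤ n →
      ∃ (H : LGraph Γ) (φ : H.V → G.V), Reshape G X H (φ ⁻¹' X) ∧ IsQuipu S H ∧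
        IsCovering H G φ ∧ ∀ v, H.Neutral P v from this _ G id .refl hG (.id G) le_rfl
  intro n
  induction n with
  | zero =>
    intro H φ h1 h2 h3 h4
    have := H.finite
    refine ⟨H, φ, h1, h2, h3, fun v => ?_⟩
    by_contra hv
    have : H.bad P = ∅ := (Set.ncard_eq_zero (Set.toFinite _)).1 (Nat.le_zero.1 h4)
    exact Set.notMem_empty v (this ▸ hv)
  | succ n ih =>
    intro H φ h1 h2 h3 h4
    by_cases hb : (H.bad P).Nonempty
    · obtain ⟨K, Z, ψ, k1, k2, k3, rfl, k5⟩ := exists_fewer_bad h1 h2 (hP.of_covering h3) hb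
      exact ih K (φ ∘ ψ) k1 k2 (h3.comp k3) (by omega)
    · refine ⟨H, φ, h1, h2, h3, fun v => ?_⟩
      by_contra hv
      exact hb ⟨v, hv⟩

end LGraph

/-! ### Planar geometry of the lattice -/

/-- The determinant of two lattice vectors. -/
def cross (a b : ℤ × ℤ) : ℤ := a.1 * b.2 - a.2 * b.1

/-- The sum norm of a lattice vector. -/
def latNorm (a : ℤ × ℤ) : ℕ := a.1.natAbs + a.2.natAbs

@[simp] theorem cross_add_right (a b c : ℤ × ℤ) : cross a (b + c) = cross a b + cross a c := by
  simp only [cross, Prod.fst_add, Prod.snd_add]; ring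

@[simp] theorem cross_sub_right (a b c : ℤ × ℤ) : cross a (b - c) = cross a b - cross a c := by
  simp only [cross, Prod.fst_sub, Prod.snd_sub]; ring

@[simp] theorem cross_nsmul_right (a b : ℤ × ℤ) (n : ℕ) : cross a (n • b) = n * cross a b := by
  simp only [cross, Prod.smul_fst, Prod.smul_snd]; simp only [nsmul_eq_mul]; ring

@[simp] theorem cross_natCast_mul_right (a b : ℤ × ℤ) (n : ℕ) :
    cross a (n * b) = n * cross a b := by
  rw [← nsmul_eq_mul, cross_nsmul_right]

@[simp] theorem cross_zsmul_right (a b : ℤ × ℤ) (n : ℤ) : cross a (n • b) = n * cross a b := by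
  simp only [cross, Prod.smul_fst, Prod.smul_snd, smul_eq_mul]; ring

@[simp] theorem cross_zsmul_left (a b : ℤ × ℤ) (n : ℤ) : cross (n • a) b = n * cross a b := by
  simp only [cross, Prod.smul_fst, Prod.smul_snd, smul_eq_mul]; ring

@[simp] theorem cross_intCast_mul_left (a b : ℤ × ℤ) (n : ℤ) :
    cross (n * a) b = n * cross a b := by
  rw [← zsmul_eq_mul, cross_zsmul_left]

@[simp] theorem cross_neg_right (a b : ℤ × ℤ) : cross a (-b) = -cross a b := by
  simp only [cross, Prod.fst_neg, Prod.snd_neg]; ring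

@[simp] theorem cross_neg_left (a b : ℤ × ℤ) : cross (-a) b = -cross a b := by
  simp only [cross, Prod.fst_neg, Prod.snd_neg]; ring

@[simp] theorem cross_same (a : ℤ × ℤ) : cross a a = 0 := by simp only [cross]; ring

@[simp] theorem cross_zero_right (a : ℤ × ℤ) : cross a 0 = 0 := by simp [cross]

theorem cross_comm (a b : ℤ × ℤ) : cross a b = -cross b a := by simp only [cross]; ring

theorem exists_cross_neg {p : ℤ × ℤ} (hp : p ≠ 0) : ∃ w, cross w p < 0 := by
  refine ⟨(-p.2, p.1), ?_⟩
  have : p.1 ≠ 0 ∨ p.2 ≠ 0 := by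
    by_contra h
    push Not at h
    exact hp (Prod.ext h.1 h.2)
  simp only [cross]
  rcases this with h | h
  · nlinarith [mul_self_pos.2 h, mul_self_nonneg p.2]
  · nlinarith [mul_self_pos.2 h, mul_self_nonneg p.1]

theorem latNorm_nsmul (n : ℕ) (p : ℤ × ℤ) : latNorm (n • p) = n * latNorm p := by
  simp only [latNorm, Prod.smul_fst, Prod.smul_snd]
  simp only [nsmul_eq_mul, Int.natAbs_mul, Int.natAbs_natCast]
  ring

theorem latNorm_pos {p : ℤ × ℤ} (hp : p ≠ 0) : 0 < latNorm p := by
  rw [latNorm]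
  by_contra h
  refine hp (Prod.ext ?_ ?_) <;> simp <;> omega

/-- Parallel vectors of equal sum norm have coordinates of equal absolute values. For this reason
the vectors of all pieces are later brought to a common norm `N`. -/
theorem eq_or_eq_neg_of_cross_eq_zero {p q : ℤ × ℤ} (h : cross p q = 0) {N : ℕ} (hN : 0 < N)
    (hp : latNorm p = N) (hq : latNorm q = N) : q = p ∨ q = -p := by
  obtain ⟨a, b⟩ := p
  obtain ⟨c, d⟩ := q
  simp only [cross, latNorm] at h hp hq
  have h1 : |a| + |b| = N := by rw [Int.abs_eq_natAbs, Int.abs_eq_natAbs]; exact_mod_cast hp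
  have h2 : |c| + |d| = N := by rw [Int.abs_eq_natAbs, Int.abs_eq_natAbs]; exact_mod_cast hq
  have h3 : |a| * |d| = |b| * |c| := by
    rw [← abs_mul, ← abs_mul, sub_eq_zero.1 h]
  have hN' : (N : ℤ) ≠ 0 := by exact_mod_cast hN.ne'
  have h4 : |a| = |c| := by
    have : (N : ℤ) * (|a| - |c|) = 0 := by linear_combination |c| * h1 - |a| * h2 + h3
    have := (mul_eq_zero.1 this).resolve_left hN'
    omega
  have h5 : |b| = |d| := by omega
  simp only [Prod.mk.injEq, Prod.neg_mk]
  by_cases ha : a = 0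
  · subst ha
    have : c = 0 := by simpa using h4.symm
    subst this
    rcases abs_eq_abs.1 h5 with h | h <;> omega
  · rcases abs_eq_abs.1 h4 with h6 | h6
    · left
      have h7 : a * (d - b) = 0 := by rw [h6] at h ⊢; linear_combination h
      have := (mul_eq_zero.1 h7).resolve_left ha
      omega
    · right
      have h7 : a * (d + b) = 0 := by
        have : c = -a := by omega
        rw [this] at h; linear_combination h
      have := (mul_eq_zero.1 h7).resolve_left ha
      omega

/-- The vector `r` does not lie in the interior of the cone that is spanned by `p` and `q`. -/
def Exterior (r p q : ℤ × ℤ) : Prop := ¬ (0 < cross r q * cross p q ∧ 0 < cross p r * cross p q)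

theorem Exterior.symm {r p q : ℤ × ℤ} (h : Exterior r p q) : Exterior r q p := by
  rintro ⟨h1, h2⟩
  rw [cross_comm q p] at h1 h2
  rw [cross_comm r p] at h1
  rw [cross_comm q r] at h2
  exact h ⟨by linarith, by linarith⟩

/-- Used with `a = cross p q`, `b = cross p' q'` and with `u`, `v`, `s`, `t` the determinants of
`p`, `q` with `p'`, `q'`. If no edge of one cone lies inside the other, a separating line can be
taken along `q'`, `p'` or `q`; these are the three alternatives. -/
theorem sign_lemma {a b u v s t : ℤ} (hb : b ≠ 0) (h1 : ¬ (0 < v * b ∧ 0 < -u * b))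
    (h3 : ¬ (0 < -s * a ∧ 0 < u * a)) (h2 : ¬ (0 < t * b ∧ 0 < -s * b))
    (h4 : ¬ (0 < -t * a ∧ 0 < v * a)) (hu : u = 0 → v * b < 0) (hv : v = 0 → 0 < u * b) :
    (v * b < 0 ∧ t * b ≤ 0) ∨ (0 < u * b ∧ 0 ≤ s * b) ∨ (0 ≤ s * a ∧ 0 ≤ t * a) := by
  simp only [mul_pos_iff, mul_neg_iff, mul_nonneg_iff, mul_nonpos_iff] at *
  omega

section separation

variable {N : ℕ} (hN : 0 < N) {p q r p' q' : ℤ × ℤ} (hp : latNorm p = N) (hq : latNorm q = N)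
  (hr : latNorm r = N) (hp' : latNorm p' = N) (hq' : latNorm q' = N)
include hN hp

theorem ne_zero_of_latNorm : p ≠ 0 := by
  rintro rfl
  simp [latNorm] at hp
  omega

theorem cross_cases (hp' : latNorm p' = N) (hne : p ≠ p') (h : cross p p' = 0) : p' = -p :=
  (eq_or_eq_neg_of_cross_eq_zero h hN hp hp').resolve_left (Ne.symm hne)

include hp' hq' in
-- Otherwise `p` lies in the closed cone. It is not interior, and on the line of an edge equality of
-- norms leaves only the vectors opposite to `p'` and `q'`, which are outside.
theorem fan_cases (hb : cross p' q' ≠ 0) (hext : Exterior p p' q') (h1 : p ≠ p') (h2 : p ≠ q') :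
    cross p q' * cross p' q' < 0 ∨ cross p' p * cross p' q' < 0 := by
  have hb2 : 0 < cross p' q' * cross p' q' := mul_self_pos.2 hb
  by_contra hc
  push Not at hc
  obtain ⟨c1, c2⟩ := hc
  rcases c1.eq_or_lt with c1 | c1
  · have := cross_cases hN hp hq' h2 ((mul_eq_zero.1 c1.symm).resolve_right hb)
    rw [eq_neg_iff_add_eq_zero, add_comm, ← eq_neg_iff_add_eq_zero] at this
    rw [this] at c2
    simp only [cross_neg_right] at c2
    linarith
  · rcases c2.eq_or_lt with c2 | c2
    · have := cross_cases hN hp hp' h1 (by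
        rw [cross_comm]; simp [(mul_eq_zero.1 c2.symm).resolve_right hb])
      rw [eq_neg_iff_add_eq_zero, add_comm, ← eq_neg_iff_add_eq_zero] at this
      rw [this] at c1
      simp only [cross_neg_left] at c1
      linarith
    · exact hext ⟨c1, c2⟩

include hp' hq' in
theorem exists_sep_fan (hb : cross p' q' ≠ 0) (hext : Exterior p p' q') (h1 : p ≠ p')
    (h2 : p ≠ q') : ∃ w, cross w p < 0 ∧ 0 ≤ cross w p' ∧ 0 ≤ cross w q' := by
  have hb2 : 0 < cross p' q' * cross p' q' := mul_self_pos.2 hb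
  rcases fan_cases hN hp hp' hq' hb hext h1 h2 with h | h
  · refine ⟨(-cross p' q') • q', ?_, ?_, ?_⟩
    · rw [cross_zsmul_left, cross_comm q']; linarith
    · rw [cross_zsmul_left, cross_comm q']; linarith
    · simp
  · refine ⟨cross p' q' • p', ?_, ?_, ?_⟩ <;> simp <;> linarith

include hp' hq' in
theorem exists_sep_fan_fan (ha : cross p q ≠ 0) (hb : cross p' q' ≠ 0) (e1 : Exterior p p' q')
    (e2 : Exterior q p' q') (e3 : Exterior p' p q) (e4 : Exterior q' p q) (h1 : p ≠ p')
    (h2 : p ≠ q') :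
    ∃ w, cross w p < 0 ∧ cross w q ≤ 0 ∧ 0 ≤ cross w p' ∧ 0 ≤ cross w q' := by
  have ha2 : 0 < cross p q * cross p q := mul_self_pos.2 ha
  have hb2 : 0 < cross p' q' * cross p' q' := mul_self_pos.2 hb
  have hu : cross p p' = 0 → cross p q' * cross p' q' < 0 := fun h => by
    have := cross_cases hN hp hp' h1 h
    rw [this] at hb hb2 ⊢
    simp only [cross_neg_left] at hb hb2 ⊢
    linarith
  have hv : cross p q' = 0 → 0 < cross p p' * cross p' q' := fun h => by
    have := cross_cases hN hp hq' h2 h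
    rw [this, cross_comm p'] at hb hb2 ⊢
    simp only [cross_neg_left] at hb hb2 ⊢
    linarith
  rw [Exterior] at e1 e2 e3 e4
  rw [cross_comm p' p] at e1
  rw [cross_comm p' q] at e2 e3
  rw [cross_comm q' q] at e4
  rcases sign_lemma hb e1 e3 e2 e4 hu hv with ⟨c1, c2⟩ | ⟨c1, c2⟩ | ⟨c1, c2⟩
  · refine ⟨(-cross p' q') • q', ?_, ?_, ?_, ?_⟩ <;>
      rw [cross_zsmul_left] <;> (try rw [cross_same]) <;> (try rw [cross_comm q']) <;> linarith
  · refine ⟨cross p' q' • p', ?_, ?_, ?_, ?_⟩ <;>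
      rw [cross_zsmul_left] <;> (try rw [cross_same]) <;> (try rw [cross_comm p' p]) <;>
      (try rw [cross_comm p' q]) <;> linarith
  · refine ⟨cross p q • q, ?_, ?_, ?_, ?_⟩ <;> rw [cross_zsmul_left] <;>
      (try rw [cross_same]) <;> (try rw [cross_comm q p]) <;> linarith

include hr in
theorem exists_sep_ray (h : r ≠ p) : ∃ w, cross w p < 0 ∧ 0 ≤ cross w r := by
  rcases lt_trichotomy (cross r p) 0 with h1 | h1 | h1
  · exact ⟨r, h1, by simp⟩
  · have := cross_cases hN hp hr (Ne.symm h) (by rw [cross_comm, h1, neg_zero])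
    obtain ⟨w, hw⟩ := exists_cross_neg (ne_zero_of_latNorm hN hp)
    exact ⟨w, hw, by rw [this, cross_neg_right]; linarith⟩
  · exact ⟨-r, by simpa using h1, by simp⟩

include hr in
theorem exists_sep_fan_ray (ha : cross p q ≠ 0) (e : Exterior r p q) (h : r ≠ p) :
    ∃ w, cross w p < 0 ∧ cross w q ≤ 0 ∧ 0 ≤ cross w r := by
  have ha2 : 0 < cross p q * cross p q := mul_self_pos.2 ha
  by_cases h1 : cross r q * cross p q ≤ 0
  · refine ⟨cross p q • q, ?_, ?_, ?_⟩ <;> rw [cross_zsmul_left] <;>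
      (try rw [cross_same]) <;> (try rw [cross_comm q]) <;> linarith
  · have h2 : cross p r * cross p q ≤ 0 := by
      by_contra h2
      exact e ⟨by linarith, by linarith⟩
    have h3 : cross p r ≠ 0 := by
      intro h3
      have := cross_cases hN hp hr (Ne.symm h) h3
      rw [this] at h1
      simp only [cross_neg_left] at h1
      linarith
    have h4 : cross p r * cross p q < 0 := lt_of_le_of_ne h2 (mul_ne_zero h3 ha)
    refine ⟨(-cross p q) • r, ?_, ?_, ?_⟩
    · rw [cross_zsmul_left, cross_comm r]; linarith
    · rw [cross_zsmul_left]; linarith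
    · simp

end separation

/-! ### Rays and fans -/

/-- The points `a + n p`. -/
def raySet (a p : ℤ × ℤ) : Set (ℤ × ℤ) := {z | ∃ n : ℕ, z = a + n • p}

/-- The points `a + m p + k q`. -/
def fanSet (a p q : ℤ × ℤ) : Set (ℤ × ℤ) := {z | ∃ m k : ℕ, z = a + m • p + k • q}

theorem fanSet_symm (a p q : ℤ × ℤ) : fanSet a p q = fanSet a q p := by
  ext z
  constructor <;> rintro ⟨m, k, rfl⟩ <;> exact ⟨k, m, by abel⟩

theorem bound_of_sep {w a c p q z : ℤ × ℤ} (h1 : cross w p < 0) (h2 : cross w q ≤ 0)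
    (h : cross w a ≤ cross w z) {m k : ℕ} (hz : z = c + m • p + k • q) :
    m ≤ (cross w c - cross w a).toNat := by
  have : cross w z = cross w c + m * cross w p + k * cross w q := by rw [hz]; simp
  have h3 : (m : ℤ) * cross w p ≤ -m := by nlinarith
  have h4 : (k : ℤ) * cross w q ≤ 0 := by nlinarith
  omega

theorem cross_le_of_mem_raySet {w a p z : ℤ × ℤ} (h : 0 ≤ cross w p) (hz : z ∈ raySet a p) :
    cross w a ≤ cross w z := by
  obtain ⟨n, rfl⟩ := hz
  simp only [cross_add_right, cross_nsmul_right, le_add_iff_nonneg_right]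
  positivity

theorem cross_le_of_mem_fanSet {w a p q z : ℤ × ℤ} (h : 0 ≤ cross w p) (h' : 0 ≤ cross w q)
    (hz : z ∈ fanSet a p q) : cross w a ≤ cross w z := by
  obtain ⟨m, k, rfl⟩ := hz
  simp only [cross_add_right, cross_nsmul_right]
  have : 0 ≤ (m : ℤ) * cross w p := by positivity
  have : 0 ≤ (k : ℤ) * cross w q := by positivity
  linarith

/-- For large `m`, membership of `c + m p + k q` in `T` does not depend on `m`. -/
def StableAlong (T : Set (ℤ × ℤ)) (c p q : ℤ × ℤ) : Prop :=
  ∃ K, ∀ m ≥ K, ∀ k : ℕ, (c + m • p + k • q ∈ T ↔ c + (m + 1) • p + k • q ∈ T)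

theorem StableAlong.iff {T : Set (ℤ × ℤ)} {c p q : ℤ × ℤ} (h : StableAlong T c p q) :
    ∃ K : ℕ, ∀ m ≥ K, ∀ m' ≥ K, ∀ k : ℕ, (c + m • p + k • q ∈ T ↔ c + m' • p + k • q ∈ T) := by
  obtain ⟨K, hK⟩ := h
  have key : ∀ n k : ℕ, (c + (K + n) • p + k • q ∈ T ↔ c + K • p + k • q ∈ T) := by
    intro n k
    induction n with
    | zero => rfl
    | succ n ih => rw [← ih, ← add_assoc, ← hK (K + n) (by omega) k]
  refine ⟨K, fun m hm m' hm' k => ?_⟩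
  obtain ⟨n, rfl⟩ := Nat.exists_eq_add_of_le hm
  obtain ⟨n', rfl⟩ := Nat.exists_eq_add_of_le hm'
  rw [key, key]

theorem StableAlong.biUnion {ι : Type*} {I : Set ι} (hI : I.Finite) {T : ι → Set (ℤ × ℤ)}
    {c p q : ℤ × ℤ} (h : ∀ i ∈ I, StableAlong (T i) c p q) :
    StableAlong (⋃ i ∈ I, T i) c p q := by
  unfold StableAlong at h
  choose! K hK using h
  obtain ⟨b, hb⟩ := (hI.image K).bddAbove
  refine ⟨b, fun m hm k => ?_⟩
  simp only [Set.mem_iUnion]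
  exact exists_congr fun i => exists_congr fun hi => hK i hi m ((hb ⟨i, hi, rfl⟩).trans hm) k

theorem stableAlong_of_sep {T : Set (ℤ × ℤ)} {a c p q w : ℤ × ℤ} (h1 : cross w p < 0)
    (h2 : cross w q ≤ 0) (h : ∀ z ∈ T, cross w a ≤ cross w z) : StableAlong T c p q := by
  refine ⟨(cross w c - cross w a).toNat + 1, fun m hm k => ⟨fun hz => ?_, fun hz => ?_⟩⟩
  · have := bound_of_sep h1 h2 (h _ hz) rfl
    omega
  · have := bound_of_sep h1 h2 (h _ hz) rfl
    omega

theorem stableAlong_singleton {a c p q w : ℤ × ℤ} (h1 : cross w p < 0) (h2 : cross w q ≤ 0) :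
    StableAlong {a} c p q :=
  stableAlong_of_sep (a := a) h1 h2 fun z hz => by rw [Set.mem_singleton_iff.1 hz]

theorem stableAlong_raySet {a c p q r w : ℤ × ℤ} (h1 : cross w p < 0) (h2 : cross w q ≤ 0)
    (h : r ≠ p → ∃ w, cross w p < 0 ∧ cross w q ≤ 0 ∧ 0 ≤ cross w r) :
    StableAlong (raySet a r) c p q := by
  by_cases hr : r = p
  · subst hr
    refine ⟨(cross w c - cross w a).toNat + 1, fun m hm k => ⟨?_, ?_⟩⟩
    · rintro ⟨n, hn⟩
      exact ⟨n + 1, by rw [add_smul, add_smul, ← add_assoc a, ← hn]; abel⟩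
    · rintro ⟨n, hn⟩
      cases n with
      | zero =>
        have := bound_of_sep (a := a) h1 h2 (by simp) hn.symm
        omega
      | succ n =>
        refine ⟨n, add_right_cancel (b := 1 • r) ?_⟩
        rw [add_assoc a, ← add_smul, ← hn, add_smul]
        abel
  · obtain ⟨w, h1, h2, h3⟩ := h hr
    exact stableAlong_of_sep h1 h2 fun z hz => cross_le_of_mem_raySet h3 hz

/-- Adding `p` maps the fan into itself. Conversely, a point of the fan without a summand `p` lies
on a ray with vector `q'`, from which `c + m p + k q` is separated for large `m`. -/
theorem stableAlong_fanSet_of_left {a c p q q' : ℤ × ℤ}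
    (h : ∃ w, cross w p < 0 ∧ cross w q ≤ 0 ∧ 0 ≤ cross w q') :
    StableAlong (fanSet a p q') c p q := by
  obtain ⟨w, h1, h2, h3⟩ := h
  refine ⟨(cross w c - cross w a).toNat + 1, fun m hm k => ⟨?_, ?_⟩⟩
  · rintro ⟨i, j, hn⟩
    exact ⟨i + 1, j, by
      rw [add_smul, add_smul, ← add_assoc, add_right_comm _ (1 • p), hn]; abel⟩
  · rintro ⟨i, j, hn⟩
    cases i with
    | zero =>
      have := bound_of_sep (a := a) h1 h2 (cross_le_of_mem_raySet h3 ⟨j, by rw [hn, zero_smul, add_zero]⟩) rfl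
      omega
    | succ i =>
      refine ⟨i, j, add_right_cancel (b := 1 • p) ?_⟩
      have e : a + i • p + j • q' + 1 • p = a + (i + 1) • p + j • q' := by rw [add_smul]; abel
      rw [e, ← hn, add_smul]
      abel

/-! ### Lattice paths and periodic lattice lines -/

/-- The indicator function of the upper half plane. -/
def upper (z : ℤ × ℤ) : ℤ := if 1 ≤ z.2 then 1 else 0

/-- The crossing number of an edge with a horizontal half line that starts next to the origin. -/
def edgeCrossing (a b : ℤ × ℤ) : ℤ := if 1 ≤ a.1 then upper b - upper a else 0

/-- Homotopy across a unit square: the half line starts in the middle of the square with corners `0`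
and `(1, 1)`, which is excluded because it has the origin as a corner. -/
theorem edgeCrossing_square {z : ℤ × ℤ} {d e : Dir} (h1 : z ≠ 0) (h2 : z + d.vec ≠ 0)
    (h3 : z - e.vec ≠ 0) (h4 : z + d.vec - e.vec ≠ 0) :
    edgeCrossing z (z + d.vec) + edgeCrossing (z + d.vec) (z + d.vec - e.vec) =
      edgeCrossing z (z - e.vec) + edgeCrossing (z - e.vec) (z + d.vec - e.vec) := by
  obtain ⟨x, y⟩ := z
  have h0 : (0 : ℤ × ℤ) = (0, 0) := rfl
  cases d <;> cases e <;>
    simp only [Dir.vec, edgeCrossing, upper, Prod.mk_add_mk, Prod.mk_sub_mk, ne_eq, h0,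
      Prod.mk.injEq] at * <;>
    split_ifs <;> omega

/-- Moving the base point by one step slides the path across unit squares. The difference of the
counts comes from the two end edges, which do not cross the height of the half line. -/
theorem sum_edgeCrossing_eq {f y : ℕ → ℤ × ℤ} {n N : ℕ}
    (hf : ∀ i < n, ∃ d : Dir, f (i + 1) = f i + d.vec)
    (hy : ∀ j < N, ∃ d : Dir, y (j + 1) = y j + d.vec)
    (hne : ∀ i ≤ n, ∀ j ≤ N, f i ≠ y j) {c c' : ℤ}
    (h0 : ∀ j ≤ N, upper (f 0 - y j) = c) (h1 : ∀ j ≤ N, upper (f n - y j) = c')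
    {j : ℕ} (hj : j ≤ N) :
    ∑ i ∈ Finset.range n, edgeCrossing (f i - y j) (f (i + 1) - y j) =
      ∑ i ∈ Finset.range n, edgeCrossing (f i - y 0) (f (i + 1) - y 0) := by
  induction j with
  | zero => rfl
  | succ j ih =>
    rw [← ih (by omega)]
    obtain ⟨e, he⟩ := hy j (by omega)
    have key : ∀ m ≤ n, ∑ i ∈ Finset.range m, edgeCrossing (f i - y (j + 1)) (f (i + 1) - y (j + 1)) +
        edgeCrossing (f 0 - y j) (f 0 - y (j + 1)) =
        ∑ i ∈ Finset.range m, edgeCrossing (f i - y j) (f (i + 1) - y j) +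
        edgeCrossing (f m - y j) (f m - y (j + 1)) := by
      intro m
      induction m with
      | zero => intro _; simp
      | succ m ihm =>
        intro hm
        obtain ⟨d, hd⟩ := hf m (by omega)
        have := ihm (by omega)
        rw [Finset.sum_range_succ, Finset.sum_range_succ]
        have e1 : f (m + 1) - y j = f m - y j + d.vec := by rw [hd]; abel
        have e2 : f m - y (j + 1) = f m - y j - e.vec := by rw [he]; abel
        have e3 : f (m + 1) - y (j + 1) = f m - y j + d.vec - e.vec := by rw [hd, he]; abel
        have sq := edgeCrossing_square (z := f m - y j) (d := d) (e := e)
          (sub_ne_zero.2 (hne _ (by omega) _ (by omega)))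
          (e1 ▸ sub_ne_zero.2 (hne _ (by omega) _ (by omega)))
          (e2 ▸ sub_ne_zero.2 (hne _ (by omega) _ (by omega)))
          (e3 ▸ sub_ne_zero.2 (hne _ (by omega) _ (by omega)))
        rw [← e3, ← e1, ← e2] at sq
        linarith
    have := key n le_rfl
    have z1 : edgeCrossing (f 0 - y j) (f 0 - y (j + 1)) = 0 := by
      rw [edgeCrossing, h0 j (by omega), h0 _ hj]; simp
    have z2 : edgeCrossing (f n - y j) (f n - y (j + 1)) = 0 := by
      rw [edgeCrossing, h1 j (by omega), h1 _ hj]; simp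
    linarith

/-- At the two heights next to the half line the path lies to the right of its start, so every
change of height is counted and the sum telescopes. -/
theorem sum_edgeCrossing_right {g : ℕ → ℤ × ℤ} {n : ℕ}
    (hg : ∀ i < n, ∃ d : Dir, g (i + 1) = g i + d.vec)
    (h : ∀ i ≤ n, (g i).2 = 0 ∨ (g i).2 = 1 → 1 ≤ (g i).1) :
    ∑ i ∈ Finset.range n, edgeCrossing (g i) (g (i + 1)) = upper (g n) - upper (g 0) := by
  rw [← Finset.sum_range_sub (fun i => upper (g i))]
  refine Finset.sum_congr rfl fun i hi => ?_
  rw [Finset.mem_range] at hi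
  obtain ⟨d, hd⟩ := hg i hi
  have h1 := h i (by omega)
  rw [hd, edgeCrossing]
  split_ifs with h2
  · rfl
  · simp only [upper]
    cases d <;> simp only [Dir.vec, Prod.snd_add] <;> split_ifs <;> omega

theorem sum_edgeCrossing_left {g : ℕ → ℤ × ℤ} {n : ℕ}
    (hg : ∀ i < n, ∃ d : Dir, g (i + 1) = g i + d.vec)
    (h : ∀ i ≤ n, (g i).2 = 0 ∨ (g i).2 = 1 → (g i).1 ≤ 0) :
    ∑ i ∈ Finset.range n, edgeCrossing (g i) (g (i + 1)) = 0 := by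
  refine Finset.sum_eq_zero fun i hi => ?_
  rw [Finset.mem_range] at hi
  obtain ⟨d, hd⟩ := hg i hi
  have h1 := h i (by omega)
  rw [hd, edgeCrossing]
  split_ifs with h2
  · simp only [upper]
    cases d <;> simp only [Dir.vec, Prod.snd_add] <;> split_ifs <;> omega
  · rfl

theorem periodic_add_mul {f : ℤ → ℤ × ℤ} {ℓ : ℕ} {p : ℤ × ℤ} (hper : ∀ n, f (n + ℓ) = f n + p)
    (k : ℕ) (n : ℤ) : f (n + k * ℓ) = f n + k • p := by
  induction k with
  | zero => simp
  | succ k ih =>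
    have : n + ((k + 1 : ℕ) : ℤ) * ℓ = n + k * ℓ + ℓ := by push_cast; ring
    rw [this, hper, ih, add_smul, one_smul, add_assoc]

/-- Count the crossings of a long stretch `g` of the line with the half line that starts next to `y
j`. If `y` avoids the line, the count does not depend on `j`; but it vanishes on exactly one side of
the line. -/
theorem exists_crossing_of_snd_ne {f : ℤ → ℤ × ℤ} {ℓ : ℕ} {p : ℤ × ℤ} (hp : p.2 ≠ 0)
    (hf : ∀ n, ∃ d : Dir, f (n + 1) = f n + d.vec) (hper : ∀ n, f (n + ℓ) = f n + p) {B : ℤ}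
    (hB : ∀ n, |cross p (f n)| ≤ B) {y : ℕ → ℤ × ℤ} {N : ℕ}
    (hy : ∀ j < N, ∃ d : Dir, y (j + 1) = y j + d.vec)
    (h : (cross p (y 0) < -(B + |p.1| + |p.2|) ∧ B + |p.1| + |p.2| < cross p (y N)) ∨
      (B + |p.1| + |p.2| < cross p (y 0) ∧ cross p (y N) < -(B + |p.1| + |p.2|))) :
    ∃ i ≤ N, ∃ n, y i = f n := by
  by_contra! hne
  obtain ⟨b, hb⟩ := ((Finset.range (N + 1)).image fun j => |(y j - f 0).2|).exists_le
  have hb' : ∀ j ≤ N, |(y j - f 0).2| ≤ b := fun j hj =>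
    hb _ (Finset.mem_image.2 ⟨j, Finset.mem_range.2 (by omega), rfl⟩)
  -- As `p.2` is a nonzero integer, `k` periods in either direction lead above and below all the `y
  -- j`.
  obtain ⟨k, hk⟩ : ∃ k : ℕ, b + 2 ≤ k := ⟨(b + 2).toNat, Int.self_le_toNat _⟩
  let g : ℕ → ℤ × ℤ := fun n => f (n - k * ℓ)
  have hg : ∀ i < 2 * k * ℓ, ∃ d : Dir, g (i + 1) = g i + d.vec := fun i _ => by
    obtain ⟨d, hd⟩ := hf (i - k * ℓ)
    refine ⟨d, ?_⟩
    simp only [g]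
    rw [← hd]
    congr 1
    push_cast; ring
  have g0 : g 0 = f 0 - k • p := by
    rw [eq_sub_iff_add_eq, ← periodic_add_mul hper k]
    simp
  have gn : g (2 * k * ℓ) = f 0 + k • p := by
    rw [← periodic_add_mul hper k]
    simp only [g]
    congr 1
    push_cast; ring
  have e0 : ∀ j ≤ N, upper (g 0 - y j) = if 0 < p.2 then 0 else 1 := fun j hj => by
    have := abs_le.1 (hb' j hj)
    have e : (g 0 - y j).2 = -(y j - f 0).2 - k * p.2 := by
      rw [g0]; simp only [Prod.snd_sub, Prod.smul_snd]; simp only [nsmul_eq_mul]; ring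
    rw [upper, e]
    rcases lt_or_gt_of_ne hp with h1 | h1
    · rw [if_pos (by nlinarith), if_neg (by omega)]
    · rw [if_neg (by nlinarith), if_pos h1]
  have e1 : ∀ j ≤ N, upper (g (2 * k * ℓ) - y j) = if 0 < p.2 then 1 else 0 := fun j hj => by
    have := abs_le.1 (hb' j hj)
    have e : (g (2 * k * ℓ) - y j).2 = -(y j - f 0).2 + k * p.2 := by
      rw [gn]; simp only [Prod.snd_sub, Prod.snd_add, Prod.smul_snd]; simp only [nsmul_eq_mul]; ring
    rw [upper, e]
    rcases lt_or_gt_of_ne hp with h1 | h1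
    · rw [if_neg (by nlinarith), if_neg (by omega)]
    · rw [if_pos (by nlinarith), if_pos h1]
  have key := sum_edgeCrossing_eq hg hy (fun i _ j hj => Ne.symm (hne j hj _)) e0 e1 (le_refl N)
  have hg' : ∀ j, ∀ i < 2 * k * ℓ, ∃ d : Dir, g (i + 1) - y j = g i - y j + d.vec := fun j i hi => by
    obtain ⟨d, hd⟩ := hg i hi
    exact ⟨d, by rw [hd]; abel⟩
  have hc : ∀ i j, cross p (g i - y j) = cross p (g i) - cross p (y j) := fun i j => by simp
  have hgB : ∀ i, |cross p (g i)| ≤ B := fun i => hB _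
  have a1 := abs_nonneg p.1
  have a2 := abs_nonneg p.2
  have a3 := le_abs_self p.1
  have a4 := neg_abs_le p.1
  -- Where the line has the height of `y j` or one more, the bound on `cross p` tells on which side
  -- of `y j` it passes; `|p.1|` absorbs the difference in height.
  have up : ∀ j ≤ N, B + |p.1| + |p.2| < cross p (y j) → ∀ i,
      (g i - y j).2 = 0 ∨ (g i - y j).2 = 1 → 0 < p.2 * (g i - y j).1 := by
    intro j hj h1 i h2
    have h3 := hc i j
    have h4 := abs_le.1 (hgB i)
    rw [cross] at h3
    rcases h2 with h2 | h2 <;> rw [h2] at h3 <;> linarith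
  have down : ∀ j ≤ N, cross p (y j) < -(B + |p.1| + |p.2|) → ∀ i,
      (g i - y j).2 = 0 ∨ (g i - y j).2 = 1 → p.2 * (g i - y j).1 < 0 := by
    intro j hj h1 i h2
    have h3 := hc i j
    have h4 := abs_le.1 (hgB i)
    rw [cross] at h3
    rcases h2 with h2 | h2 <;> rw [h2] at h3 <;> linarith
  have right : ∀ j ≤ N, (∀ i, (g i - y j).2 = 0 ∨ (g i - y j).2 = 1 → 1 ≤ (g i - y j).1) →
      ∑ i ∈ Finset.range (2 * k * ℓ), edgeCrossing (g i - y j) (g (i + 1) - y j) ≠ 0 := by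
    intro j hj h1
    rw [sum_edgeCrossing_right (g := fun i => g i - y j) (hg' j) fun i _ => h1 i, e0 j hj, e1 j hj]
    split_ifs <;> norm_num
  have left : ∀ j ≤ N, (∀ i, (g i - y j).2 = 0 ∨ (g i - y j).2 = 1 → (g i - y j).1 ≤ 0) →
      ∑ i ∈ Finset.range (2 * k * ℓ), edgeCrossing (g i - y j) (g (i + 1) - y j) = 0 :=
    fun j _ h1 => sum_edgeCrossing_left (g := fun i => g i - y j) (hg' j) fun i _ => h1 i
  have pos : ∀ j ≤ N, B + |p.1| + |p.2| < cross p (y j) →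
      (∑ i ∈ Finset.range (2 * k * ℓ), edgeCrossing (g i - y j) (g (i + 1) - y j) = 0 ↔
        p.2 < 0) := by
    intro j hj h1
    rcases lt_or_gt_of_ne hp with h2 | h2
    · exact iff_of_true (left j hj fun i h3 => by nlinarith [up j hj h1 i h3]) h2
    · exact iff_of_false (right j hj fun i h3 => by nlinarith [up j hj h1 i h3]) (by omega)
  have neg : ∀ j ≤ N, cross p (y j) < -(B + |p.1| + |p.2|) →
      (∑ i ∈ Finset.range (2 * k * ℓ), edgeCrossing (g i - y j) (g (i + 1) - y j) = 0 ↔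
        0 < p.2) := by
    intro j hj h1
    rcases lt_or_gt_of_ne hp with h2 | h2
    · exact iff_of_false (right j hj fun i h3 => by nlinarith [down j hj h1 i h3]) (by omega)
    · exact iff_of_true (left j hj fun i h3 => by nlinarith [down j hj h1 i h3]) h2
  rcases h with ⟨h1, h2⟩ | ⟨h1, h2⟩
  · have c1 := neg 0 (by omega) h1
    have c2 := pos N le_rfl h2
    rw [key, c1] at c2
    omega
  · have c1 := pos 0 (by omega) h1
    have c2 := neg N le_rfl h2
    rw [key, c1] at c2
    omega

/-- A lattice path that changes sides of a periodic lattice line meets this line. -/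
theorem exists_crossing {f : ℤ → ℤ × ℤ} {ℓ : ℕ} {p : ℤ × ℤ} (hp : p ≠ 0)
    (hf : ∀ n, ∃ d : Dir, f (n + 1) = f n + d.vec) (hper : ∀ n, f (n + ℓ) = f n + p) {B : ℤ}
    (hB : ∀ n, |cross p (f n)| ≤ B) {y : ℕ → ℤ × ℤ} {N : ℕ}
    (hy : ∀ j < N, ∃ d : Dir, y (j + 1) = y j + d.vec)
    (h : (cross p (y 0) < -(B + |p.1| + |p.2|) ∧ B + |p.1| + |p.2| < cross p (y N)) ∨
      (B + |p.1| + |p.2| < cross p (y 0) ∧ cross p (y N) < -(B + |p.1| + |p.2|))) :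
    ∃ i ≤ N, ∃ n, y i = f n := by
  by_cases h2 : p.2 = 0
  -- A horizontal period becomes vertical by exchanging the coordinates, which reverses the sign of
  -- `cross`.
  · have hswap : ∀ a b : ℤ × ℤ, (∃ d : Dir, b = a + d.vec) → ∃ d : Dir, b.swap = a.swap + d.vec := by
      rintro a b ⟨d, rfl⟩
      cases d
      exacts [⟨.north, by simp [Dir.vec]⟩, ⟨.east, by simp [Dir.vec]⟩, ⟨.west, by simp [Dir.vec]⟩,
        ⟨.south, by simp [Dir.vec]⟩]
    have hcs : ∀ a b : ℤ × ℤ, cross a.swap b.swap = -cross a b := fun a b => by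
      simp only [cross, Prod.fst_swap, Prod.snd_swap]; ring
    have h1 : p.swap.2 ≠ 0 := fun h1 => hp (Prod.ext h1 h2)
    obtain ⟨i, hi, n, hn⟩ := exists_crossing_of_snd_ne (f := fun n => (f n).swap) (ℓ := ℓ) h1
      (fun n => hswap _ _ (hf n)) (fun n => by rw [hper]; rfl) (B := B)
      (fun n => by rw [hcs, abs_neg]; exact hB n) (y := fun j => (y j).swap) (N := N)
      (fun j hj => hswap _ _ (hy j hj)) (by
        simp only [hcs, Prod.fst_swap, Prod.snd_swap]
        rcases h with ⟨h1, h2⟩ | ⟨h1, h2⟩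
        · right; constructor <;> linarith
        · left; constructor <;> linarith)
    exact ⟨i, hi, n, Prod.swap_injective hn⟩
  · exact exists_crossing_of_snd_ne h2 hf hper hB hy h

/-! ### Lines of words -/

theorem abs_cross_vec_le (w : ℤ × ℤ) (d : Dir) : |cross w d.vec| ≤ latNorm w := by
  have h : (latNorm w : ℤ) = |w.1| + |w.2| := by
    rw [Int.abs_eq_natAbs, Int.abs_eq_natAbs]; rfl
  rw [h]
  have := abs_nonneg w.1
  have := abs_nonneg w.2
  cases d <;> simp [cross, Dir.vec]

theorem abs_cross_wordDisp_le (w : ℤ × ℤ) (l : List Dir) :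
    |cross w (wordDisp l)| ≤ latNorm w * l.length := by
  induction l with
  | nil => simp
  | cons d l ih =>
    rw [wordDisp_cons, cross_add_right, List.length_cons]
    have := abs_add_le (cross w d.vec) (cross w (wordDisp l))
    have := abs_cross_vec_le w d
    push_cast
    linarith

theorem abs_cross_take_le (w : ℤ × ℤ) (l : List Dir) (i : ℕ) :
    |cross w (wordDisp (l.take i))| ≤ latNorm w * l.length := by
  refine (abs_cross_wordDisp_le w _).trans ?_
  have : (l.take i).length ≤ l.length := by simp
  gcongr

theorem wordDisp_take_succ (l : List Dir) {i : ℕ} (hi : i < l.length) :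
    wordDisp (l.take (i + 1)) = wordDisp (l.take i) + (l[i]).vec := by
  rw [List.take_succ_eq_append_getElem hi, wordDisp_append]
  simp

/-- The points of the doubly infinite lattice line `… V V V …` through `U`. -/
def linePoint (U V : List Dir) (j : ℤ) (k : ℕ) : ℤ × ℤ :=
  wordDisp U + j • wordDisp V + wordDisp (V.take k)

theorem linePoint_natCast (U V : List Dir) (j k : ℕ) :
    linePoint U V j k = wordDisp (U ++ wordPow V j ++ V.take k) := by
  simp [linePoint, add_assoc]

/-- This is `exists_crossing` for lines of words. The margin `c` does not depend on `U`, so it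
serves for all parallel lines of a fan; it also bounds the deviation of the line from its axis,
whence the meeting is strictly between the ends. -/
theorem exists_mem_line {V : List Dir} (hV : wordDisp V ≠ 0) {s : ℤ} (hs : s ≠ 0) :
    ∃ c : ℤ, 0 ≤ c ∧ (∀ k, |s * cross (wordDisp V) (wordDisp (V.take k))| ≤ c) ∧
    ∀ (U : List Dir) (y : ℕ → ℤ × ℤ) (N : ℕ),
      (∀ j < N, ∃ d : Dir, y (j + 1) = y j + d.vec) →
      ((s * cross (wordDisp V) (y 0) < s * cross (wordDisp V) (wordDisp U) - c ∧
          s * cross (wordDisp V) (wordDisp U) + c < s * cross (wordDisp V) (y N)) ∨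
        (s * cross (wordDisp V) (wordDisp U) + c < s * cross (wordDisp V) (y 0) ∧
          s * cross (wordDisp V) (y N) < s * cross (wordDisp V) (wordDisp U) - c)) →
      ∃ i, 0 < i ∧ i < N ∧ ∃ j k, y i = linePoint U V j k := by
  set p := wordDisp V with hp
  have hV0 : 0 < V.length := by
    rw [List.length_pos_iff]
    rintro rfl
    exact hV rfl
  set B : ℤ := latNorm p * V.length with hB
  have hBk : ∀ k, |cross p (wordDisp (V.take k))| ≤ B := fun k => abs_cross_take_le p V k
  have hN : (latNorm p : ℤ) = |p.1| + |p.2| := by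
    rw [Int.abs_eq_natAbs, Int.abs_eq_natAbs]; rfl
  have hB0 : 0 ≤ B := by positivity
  have hck : ∀ k, |s * cross p (wordDisp (V.take k))| ≤ |s| * (B + |p.1| + |p.2|) := by
    intro k
    rw [abs_mul]
    have := hBk k
    have := abs_nonneg p.1
    have := abs_nonneg p.2
    gcongr
    linarith
  refine ⟨|s| * (B + |p.1| + |p.2|), by positivity, hck, ?_⟩
  intro U y N hy h
  -- The line through the origin, counted by letters: whole periods and a remainder. The offset `U`
  -- is subtracted from `y` instead.
  let f : ℤ → ℤ × ℤ := fun n =>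
    (n / V.length) • p + wordDisp (V.take (n % V.length).toNat)
  have hℓ : (V.length : ℤ) ≠ 0 := by omega
  have hf : ∀ n, ∃ d : Dir, f (n + 1) = f n + d.vec := by
    intro n
    obtain ⟨r, hr⟩ : ∃ r : ℕ, n % V.length = r := ⟨_, (Int.toNat_of_nonneg (Int.emod_nonneg _ hℓ)).symm⟩
    have hr' : r < V.length := by
      have := Int.emod_lt_of_pos n (b := V.length) (by omega)
      omega
    have hn : n = V.length * (n / V.length) + r := by
      rw [← hr]; exact (Int.mul_ediv_add_emod n V.length).symm
    by_cases h1 : r + 1 < V.length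
    · refine ⟨V[r], ?_⟩
      obtain ⟨e2, e1⟩ : (n + 1) / V.length = n / V.length ∧ (n + 1) % V.length = (r + 1 : ℕ) := by
        rw [Int.ediv_emod_unique (by omega)]
        omega
      simp only [f]
      rw [e1, e2, hr, Int.toNat_natCast, Int.toNat_natCast, wordDisp_take_succ V hr']
      abel
    · refine ⟨V[r], ?_⟩
      have h2 : (r : ℤ) + 1 = V.length := by omega
      obtain ⟨e2, e1⟩ : (n + 1) / V.length = n / V.length + 1 ∧ (n + 1) % V.length = (0 : ℕ) := by
        rw [Int.ediv_emod_unique (by omega), mul_add]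
        omega
      simp only [f]
      rw [e1, e2, hr, Int.toNat_natCast, Int.toNat_natCast, add_assoc (_ • p),
        ← wordDisp_take_succ V hr', List.take_of_length_le (l := V) (i := r + 1) (by omega), ← hp,
        add_smul]
      simp
  have hper : ∀ n, f (n + V.length) = f n + p := by
    intro n
    simp only [f]
    rw [Int.add_emod_right, Int.add_ediv_of_dvd_right (dvd_refl _), Int.ediv_self hℓ, add_smul,
      one_smul]
    abel
  have hfB : ∀ n, |cross p (f n)| ≤ B := by
    intro n
    simp only [f, cross_add_right, cross_zsmul_right, cross_same, mul_zero, zero_add]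
    exact hBk _
  have hu : ∀ i, cross p (y i - wordDisp U) = cross p (y i) - cross p (wordDisp U) :=
    fun i => by simp
  obtain ⟨i, hi, n, hn⟩ := exists_crossing hV hf hper hfB (y := fun j => y j - wordDisp U) (N := N)
    (fun j hj => by
      obtain ⟨d, hd⟩ := hy j hj
      exact ⟨d, by rw [hd]; abel⟩) (by
    simp only [hu]
    rcases lt_or_gt_of_ne hs with hs | hs
    · rw [abs_of_neg hs] at h
      rcases h with ⟨h1, h2⟩ | ⟨h1, h2⟩
      · right; constructor <;> nlinarith
      · left; constructor <;> nlinarith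
    · rw [abs_of_pos hs] at h
      rcases h with ⟨h1, h2⟩ | ⟨h1, h2⟩
      · left; constructor <;> nlinarith
      · right; constructor <;> nlinarith)
  have hyi : y i = linePoint U V (n / V.length) (n % V.length).toNat := by
    rw [sub_eq_iff_eq_add] at hn
    rw [hn, linePoint]
    simp only [f]
    rw [← hp]
    abel
  have hyc : |s * cross p (y i) - s * cross p (wordDisp U)| ≤ |s| * (B + |p.1| + |p.2|) := by
    have := hck (n % V.length).toNat
    rw [hyi, linePoint, ← hp]
    simp only [cross_add_right, cross_zsmul_right, cross_same]
    convert this using 2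
    ring
  have := abs_le.1 hyc
  refine ⟨i, ?_, ?_, _, _, hyi⟩
  · rw [Nat.pos_iff_ne_zero]
    rintro rfl
    rcases h with ⟨h1, h2⟩ | ⟨h1, h2⟩ <;> linarith
  · refine lt_of_le_of_ne hi ?_
    rintro rfl
    rcases h with ⟨h1, h2⟩ | ⟨h1, h2⟩ <;> linarith

theorem prefix_append_cases {α : Type*} {l a b : List α} (h : l <+: a ++ b) :
    l <+: a ∨ ∃ t, t <+: b ∧ l = a ++ t := by
  rcases List.prefix_or_prefix_of_prefix h (List.prefix_append a b) with h' | ⟨t, rfl⟩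
  · exact Or.inl h'
  · exact Or.inr ⟨t, (List.prefix_append_right_inj a).1 h, rfl⟩

theorem prefix_append_wordPow {α : Type*} {l U V : List α} {T : ℕ} (h : l <+: U ++ wordPow V T) :
    l <+: U ∨ ∃ n k, n < T ∧ l = U ++ wordPow V n ++ V.take k := by
  induction T with
  | zero => left; simpa using h
  | succ T ih =>
    rw [wordPow_succ', ← List.append_assoc] at h
    rcases prefix_append_cases h with h | ⟨t, h1, rfl⟩
    · rcases ih h with h | ⟨n, k, h1, h2⟩
      · exact Or.inl h
      · exact Or.inr ⟨n, k, by omega, h2⟩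
    · refine Or.inr ⟨T, t.length, by omega, ?_⟩
      rw [List.prefix_iff_eq_take.1 h1]
      simp

theorem abs_cross_prefix_le {l U V : List Dir} {T : ℕ} (h : l <+: U ++ wordPow V T) :
    |cross (wordDisp V) (wordDisp l)| ≤ latNorm (wordDisp V) * (U.length + V.length) := by
  rcases prefix_append_wordPow h with h | ⟨n, k, -, rfl⟩
  · refine (abs_cross_wordDisp_le _ _).trans ?_
    have := h.length_le
    gcongr
    omega
  · simp only [wordDisp_append, wordDisp_wordPow, cross_add_right, cross_nsmul_right, cross_same,
      mul_zero, add_zero]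
    refine (abs_add_le _ _).trans ?_
    have := abs_cross_wordDisp_le (wordDisp V) U
    have := abs_cross_take_le (wordDisp V) V k
    linarith

theorem prefix_wordPow_mono {α : Type*} (U V : List α) {m n : ℕ} (h : m ≤ n) :
    U ++ wordPow V m <+: U ++ wordPow V n := by
  obtain ⟨k, rfl⟩ := Nat.exists_eq_add_of_le h
  rw [wordPow_add, ← List.append_assoc]
  exact List.prefix_append _ _

/-! ### Rays and fans of words -/

namespace LGraph

variable {Γ : Type*} {S : TAS Γ} {G : LGraph Γ}

/-- The words `U V ^ n W` belong to rooted runs that end in `x`. -/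
def IsRay (G : LGraph Γ) (U V W : List Dir) (x : G.V) : Prop :=
  ∃ e, G.Run G.root U e ∧ G.Run e V e ∧ V ≠ [] ∧ G.Run e W x

/-- The words `A B ^ m C E ^ k F` belong to rooted runs that end in `x` and wind around two
different cycles. -/
def IsFan (G : LGraph Γ) (A B C E F : List Dir) (x : G.V) : Prop :=
  ∃ e₁ e₂, G.Run G.root A e₁ ∧ G.Run e₁ B e₁ ∧ B ≠ [] ∧ G.Run e₁ C e₂ ∧ G.Run e₂ E e₂ ∧ E ≠ [] ∧
    G.Run e₂ F x ∧ ¬ G.Reach e₂ e₁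

variable {U V W A B C E F : List Dir} {x y : G.V}

theorem IsRay.run (h : G.IsRay U V W x) (n : ℕ) : G.Run G.root (U ++ wordPow V n ++ W) x := by
  obtain ⟨e, h1, h2, -, h3⟩ := h
  exact (h1.append (h2.pow n)).append h3

theorem IsFan.run (h : G.IsFan A B C E F x) (m k : ℕ) :
    G.Run G.root (A ++ wordPow B m ++ C ++ wordPow E k ++ F) x := by
  obtain ⟨e₁, e₂, h1, h2, -, h3, h4, -, h5, -⟩ := h
  exact (((h1.append (h2.pow m)).append h3).append (h4.pow k)).append h5

theorem IsFan.ray_left (h : G.IsFan A B C E F x) (k : ℕ) :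
    G.IsRay A B (C ++ wordPow E k ++ F) x := by
  obtain ⟨e₁, e₂, h1, h2, h0, h3, h4, -, h5, -⟩ := h
  exact ⟨e₁, h1, h2, h0, (h3.append (h4.pow k)).append h5⟩

theorem IsFan.ray_right (h : G.IsFan A B C E F x) (m : ℕ) :
    G.IsRay (A ++ wordPow B m ++ C) E F x := by
  obtain ⟨e₁, e₂, h1, h2, h0, h3, h4, h00, h5, -⟩ := h
  exact ⟨e₂, (h1.append (h2.pow m)).append h3, h4, h00, h5⟩

theorem IsRay.linePoint_mem (h : G.IsRay U V W x) (j k : ℕ) : linePoint U V j k ∈ G.dom := by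
  rw [linePoint_natCast]
  obtain ⟨e, h1, h2, -, -⟩ := h
  have := (((h1.append (h2.pow j)).append h2).exists_of_prefix
    (l' := U ++ wordPow V j ++ V.take k)
    ((List.prefix_append_right_inj _).2 (List.take_prefix _ _)))
  obtain ⟨y, hy⟩ := this
  exact hy.mem_dom

theorem IsRay.linePoint_mem' (h : G.IsRay U V W x) {j : ℤ} (hj : 0 ≤ j) (k : ℕ) :
    linePoint U V j k ∈ G.dom := by
  lift j to ℕ using hj
  exact h.linePoint_mem j k

end LGraph

/-! ### Planar position of rays and fans -/

namespace IsQuipu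

open LGraph

variable {Γ : Type*} {S : TAS Γ} {G : LGraph Γ} (hG : IsQuipu S G)
  {U V W A B C E F : List Dir} {x y : G.V}
include hG

theorem disp_ne_zero (h : G.IsRay U V W x) : wordDisp V ≠ 0 := by
  intro h0
  have h1 := h.run 1
  have h2 := h.run 0
  have h3 := congrArg List.length (hG.uniq _ _ _ _ h1 h2 (by simp [h0]))
  obtain ⟨e, -, -, hV, -⟩ := h
  have := List.length_pos_iff.2 hV
  simp only [List.length_append, length_wordPow] at h3
  omega

/-- A run that has left the first cycle for the second would continue back to the first. -/
theorem not_prefix_of_isFan (h : G.IsFan A B C E F x) {m n : ℕ} :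
    ¬ A ++ wordPow B m ++ C <+: A ++ wordPow B n := by
  rintro ⟨t, ht⟩
  obtain ⟨e₁, e₂, h1, h2, -, h3, -, -, -, h6⟩ := h
  have := h1.append (h2.pow n)
  rw [← ht] at this
  exact h6 (hG.run_of_append this ((h1.append (h2.pow m)).append h3)).reach

/-- For parallel vectors, different numbers of turns give the same displacement: turns around one
cycle against turns around the other if the vectors point the same way, turns around both against
none if they are opposite. -/
theorem cross_ne_zero (h : G.IsFan A B C E F x) : cross (wordDisp B) (wordDisp E) ≠ 0 := by
  intro h0
  have hp := hG.disp_ne_zero (h.ray_left 0)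
  have hq := hG.disp_ne_zero (h.ray_right 0)
  set p := wordDisp B with hp'
  set q := wordDisp E with hq'
  have hB : B ≠ [] := by rintro rfl; exact hp rfl
  have hBl := List.length_pos_iff.2 hB
  have hpn := latNorm_pos hp
  have hqn := latNorm_pos hq
  have h1 : cross (latNorm q • p) (latNorm p • q) = 0 := by
    rw [cross_nsmul_right, cross_comm, cross_nsmul_right, cross_comm q, h0]; simp
  rcases eq_or_eq_neg_of_cross_eq_zero h1 (Nat.mul_pos hqn hpn) (latNorm_nsmul _ _)
    ((latNorm_nsmul _ _).trans (mul_comm _ _)) with h2 | h2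
  -- The factor `C.length + 1` makes the power of `B` at least as long as `C`, so equality of the
  -- words makes `A ++ C` a prefix of `A` followed by turns of `B`.
  · have r1 := h.run (latNorm q * (C.length + 1)) 0
    have r2 := h.run 0 (latNorm p * (C.length + 1))
    have e := hG.uniq _ _ _ _ r1 r2 (by
      simp only [wordDisp_append, wordDisp_wordPow, zero_smul, add_zero]
      rw [mul_comm (latNorm q), mul_comm (latNorm p), mul_smul, mul_smul, ← hp', ← hq', h2]
      abel)
    simp only [wordPow_zero, List.append_nil] at e
    refine hG.not_prefix_of_isFan h (m := 0) (n := latNorm q * (C.length + 1)) ?_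
    refine List.prefix_of_prefix_length_le (l₃ := A ++ wordPow B (latNorm q * (C.length + 1)) ++ C ++ F)
      ?_ ?_ ?_
    · rw [e]
      simp only [wordPow_zero, List.append_nil, List.append_assoc]
      exact ⟨wordPow E (latNorm p * (C.length + 1)) ++ F, by simp⟩
    · exact ⟨C ++ F, by simp⟩
    · simp only [wordPow_zero, List.append_nil, List.length_append, length_wordPow]
      have : C.length ≤ latNorm q * (C.length + 1) * B.length := by
        calc C.length ≤ 1 * (C.length + 1) * 1 := by omega
          _ ≤ _ := by gcongr <;> omega
      omega
  · have r1 := h.run (latNorm q) (latNorm p)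
    have r2 := h.run 0 0
    have e := hG.uniq _ _ _ _ r1 r2 (by
      simp only [wordDisp_append, wordDisp_wordPow, zero_smul, add_zero, ← hp', ← hq', h2]
      abel)
    have := congrArg List.length e
    simp only [wordPow_zero, List.append_nil, List.length_append, length_wordPow] at this
    have := Nat.mul_pos hqn hBl
    omega

set_option maxHeartbeats 800000 in
-- A ray into the interior must cross the line with period `E` through `A ++ wordPow B t ++ C`. It
-- stays close to its axis, so for large `t` it crosses at a nonnegative index, where the line
-- consists of points of the fan; there uniqueness identifies the word of the fan with a prefix of
-- the word of the ray.
theorem exists_prefix_of_interior (hr : G.IsRay U V W x) (h : G.IsFan A B C E F y)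
    (hX : 0 < cross (wordDisp V) (wordDisp E) * cross (wordDisp B) (wordDisp E))
    (hY : 0 < cross (wordDisp B) (wordDisp V) * cross (wordDisp B) (wordDisp E)) :
    ∃ t₀, ∀ t ≥ t₀, ∃ T, A ++ wordPow B t ++ C <+: U ++ wordPow V T := by
  have hδ := hG.cross_ne_zero h
  have hq := hG.disp_ne_zero (h.ray_right 0)
  set p := wordDisp B with hp'
  set q := wordDisp E with hq'
  set r := wordDisp V with hr'
  set δ := cross p q with hδ'
  obtain ⟨c, hc0, hck, hcross⟩ := exists_mem_line (V := E) hq (neg_ne_zero.2 hδ)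
  rw [← hq'] at hck hcross
  -- Up to the factor `δ * δ`, `X` and `Y` are the coordinates with respect to `p` and `q`.
  let X : ℤ × ℤ → ℤ := fun z => -δ * cross q z
  let Y : ℤ × ℤ → ℤ := fun z => δ * cross p z
  have hXr : 0 < X r := by simp only [X]; rw [cross_comm]; linarith
  have hYr : 0 < Y r := by simp only [Y]; linarith
  have hXp : X p = δ * δ := by simp only [X]; rw [cross_comm q p]; ring
  have hYq : Y q = δ * δ := rfl
  have hδ2 : 0 < δ * δ := mul_self_pos.2 hδ
  have hXadd : ∀ a b, X (a + b) = X a + X b := fun a b => by simp only [X, cross_add_right]; ring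
  have hYadd : ∀ a b, Y (a + b) = Y a + Y b := fun a b => by simp only [Y, cross_add_right]; ring
  have hXn : ∀ (n : ℕ) a, X (n • a) = n * X a := fun n a => by
    simp only [X, cross_nsmul_right]; ring
  have hYn : ∀ (n : ℤ) a, Y (n • a) = n * Y a := fun n a => by
    simp only [Y, cross_zsmul_right]; ring
  have hYn' : ∀ (n : ℕ) a, Y (n • a) = n * Y a := fun n a => by
    simp only [Y, cross_nsmul_right]; ring
  have hYp : Y p = 0 := by simp [Y]
  have hXq : X q = 0 := by simp [X]
  -- This combination measures the distance from the axis of the ray; on the ray it is at most `R`.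
  have hid : ∀ z, Y r * X z - X r * Y z = -(δ * δ * δ) * cross r z := fun z => by
    simp only [X, Y, hδ', cross]; ring
  set c₃ : ℤ := Y (wordDisp A) + Y (wordDisp C) + |δ| * (latNorm p * E.length) with hc₃
  set R : ℤ := |δ * δ * δ| * (latNorm r * (U.length + V.length)) with hR
  set D : ℤ := |X r * c₃| + R + c + |X (wordDisp A) + X (wordDisp C)| + 1 with hD
  refine ⟨D.toNat, fun t ht => ?_⟩
  have ht' : D ≤ t := Int.toNat_le.1 ht
  have hDt : D ≤ t * (δ * δ) := by nlinarith
  have hR0 : 0 ≤ R := by positivity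
  have a1 := abs_nonneg (X r * c₃)
  have a2 := abs_nonneg (X (wordDisp A) + X (wordDisp C))
  have a3 := neg_abs_le (X (wordDisp A) + X (wordDisp C))
  have hM : X (wordDisp (A ++ wordPow B t ++ C)) =
      X (wordDisp A) + t * (δ * δ) + X (wordDisp C) := by
    simp only [wordDisp_append, wordDisp_wordPow, hXadd, hXn, ← hp', hXp]
  obtain ⟨T, hT⟩ : ∃ T : ℕ, X (wordDisp (A ++ wordPow B t ++ C)) + c - X (wordDisp U) + 1 ≤ T :=
    ⟨_, Int.self_le_toNat _⟩
  have hUT : X (wordDisp (U ++ wordPow V T)) = X (wordDisp U) + T * X r := by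
    simp only [wordDisp_append, wordDisp_wordPow, hXadd, hXn, ← hr']
  obtain ⟨i, -, -, j, k, hi⟩ := hcross (A ++ wordPow B t ++ C)
    (fun i => wordDisp ((U ++ wordPow V T).take i)) (U ++ wordPow V T).length
    (fun j hj => ⟨_, wordDisp_take_succ _ hj⟩) (by
      left
      change X _ < X _ - c ∧ X _ + c < X _
      rw [List.take_zero, List.take_length, hM, hUT]
      refine ⟨?_, ?_⟩
      · simp only [X, wordDisp_nil, cross_zero_right, mul_zero]
        linarith
      · rw [hM] at hT
        nlinarith)
  refine ⟨T, ?_⟩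
  have hXi : X (wordDisp ((U ++ wordPow V T).take i)) ≥ t * (δ * δ) + (X (wordDisp A) +
      X (wordDisp C)) - c := by
    rw [hi, linePoint, hXadd, hXadd, hM]
    have e1 := neg_le_of_abs_le (hck k)
    have e2 : X (j • wordDisp E) = 0 := by simp only [X, cross_zsmul_right, ← hq', cross_same]; ring
    change -c ≤ X _ at e1
    linarith
  -- At a negative index `Y` is at most `c₃`, too small for a point of the ray with so large a value
  -- of `X`.
  rcases lt_or_ge j 0 with hj | hj
  · exfalso
    have e1 : Y (wordDisp ((U ++ wordPow V T).take i)) ≤ c₃ := by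
      rw [hi, linePoint]
      simp only [wordDisp_append, wordDisp_wordPow, hYadd, hYn, hYn', ← hp', hYp, ← hq', hYq]
      have e2 : Y (wordDisp (E.take k)) ≤ |δ| * (latNorm p * E.length) := by
        simp only [Y]
        refine (le_abs_self _).trans ?_
        rw [abs_mul]
        exact mul_le_mul_of_nonneg_left (abs_cross_take_le p E k) (abs_nonneg _)
      nlinarith
    have e3 := hid (wordDisp ((U ++ wordPow V T).take i))
    have e4 : |-(δ * δ * δ) * cross r (wordDisp ((U ++ wordPow V T).take i))| ≤ R := by
      rw [abs_mul, abs_neg]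
      exact mul_le_mul_of_nonneg_left
        (abs_cross_prefix_le (List.take_prefix i (U ++ wordPow V T))) (abs_nonneg _)
    have e5 := le_of_abs_le e4
    have e6 := neg_le_of_abs_le e4
    have e7 := le_abs_self (X r * c₃)
    have e8 := mul_le_mul_of_nonneg_left e1 hXr.le
    have e9 : 1 * (|X r * c₃| + R + 1) ≤ Y r * X (wordDisp ((U ++ wordPow V T).take i)) :=
      mul_le_mul hYr (by linarith) (by positivity) hYr.le
    linarith
  · lift j to ℕ using hj
    have hrun := (h.run t (j + 1)).exists_of_prefix
      (l' := A ++ wordPow B t ++ C ++ wordPow E j ++ E.take k) (by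
        rw [wordPow_succ', ← List.append_assoc _ (wordPow E j)]
        rw [List.append_assoc _ E F, List.prefix_append_right_inj]
        exact (List.take_prefix k E).trans (List.prefix_append _ _))
    obtain ⟨z, hz⟩ := hrun
    obtain ⟨z', hz'⟩ := (hr.run T).exists_of_prefix (l' := (U ++ wordPow V T).take i)
      ((List.take_prefix _ _).trans (List.prefix_append _ _))
    rw [linePoint_natCast] at hi
    have := hG.uniq _ _ _ _ hz' hz hi
    refine (List.IsPrefix.trans ?_ (List.take_prefix i (U ++ wordPow V T)))
    rw [this]
    exact ⟨wordPow E j ++ E.take k, by simp⟩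

/-- The vector of a ray does not point to the interior of a fan. -/
theorem exterior (hr : G.IsRay U V W x) (h : G.IsFan A B C E F y) :
    Exterior (wordDisp V) (wordDisp B) (wordDisp E) := by
  rintro ⟨hX, hY⟩
  obtain ⟨t₀, ht₀⟩ := hG.exists_prefix_of_interior hr h hX hY
  have hB : B ≠ [] := by obtain ⟨e₁, e₂, -, -, h0, -⟩ := h; exact h0
  have hBl := List.length_pos_iff.2 hB
  -- For two values of `t` the words are prefixes of one power of `V`. With `C.length` more turns
  -- the second is long enough for `not_prefix_of_isFan`.
  obtain ⟨T, hT⟩ := ht₀ t₀ le_rfl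
  obtain ⟨T', hT'⟩ := ht₀ (t₀ + C.length) (by omega)
  refine hG.not_prefix_of_isFan h (m := t₀) (n := t₀ + C.length) ?_
  refine List.prefix_of_prefix_length_le (l₃ := U ++ wordPow V (T + T')) ?_ ?_ ?_
  · exact hT.trans (prefix_wordPow_mono _ _ (by omega))
  · exact ((List.prefix_append _ _).trans hT').trans (prefix_wordPow_mono _ _ (by omega))
  · simp only [List.length_append, length_wordPow]
    nlinarith

end IsQuipu

open LGraph

/-- A common multiple of the norms of the vectors of the rays and fans that describe the rooted
runs to the vertices. -/
def LGraph.IsModulus {Γ : Type*} (G : LGraph Γ) (N : ℕ) : Prop := 0 < N ∧ ∀ x : G.V,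
  (∃ A, G.Run G.root A x ∧ ∀ l, G.Run G.root l x → l = A) ∨
  (∃ U V W, G.IsRay U V W x ∧ latNorm (wordDisp V) ∣ N ∧
    ∀ l, G.Run G.root l x → ∃ n, l = U ++ wordPow V n ++ W) ∨
  ∃ A B C E F, G.IsFan A B C E F x ∧ latNorm (wordDisp B) ∣ N ∧ latNorm (wordDisp E) ∣ N ∧
    ∀ l, G.Run G.root l x → ∃ m k, l = A ++ wordPow B m ++ C ++ wordPow E k ++ F

namespace IsQuipu

variable {Γ : Type*} {S : TAS Γ} {G : LGraph Γ} (hG : IsQuipu S G)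
include hG

/-! ### The words of the rooted runs to a vertex -/

/-- The component of `x` is entered by a single arc, at which every rooted run to `x` splits. -/
theorem run_cases {x : G.V} : x = G.root ∨ ∃ y d e, ¬ G.Reach x y ∧ G.Reach e x ∧ G.Reach x e ∧
    G.Run y [d] e ∧ ∀ l, G.Run G.root l x → ∃ w s, l = w ++ [d] ++ s ∧ G.Run G.root w y ∧
      G.Run e s x := by
  by_cases hx : x = G.root
  · exact Or.inl hx
  right
  have key : ∀ l, G.Run G.root l x → ∃ w y d e s, l = w ++ ([d] ++ s) ∧ G.Run G.root w y ∧
      G.Run y [d] e ∧ G.Run e s x ∧ ¬ G.Reach x y ∧ G.Reach x e := fun l hl => by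
    obtain ⟨w, y, d, e, s, h1, h2, h3, h4, h5, h6⟩ :=
      exists_entering (C := {u | G.Reach x u}) hl (Reach.refl x) fun h => hx (hG.reach_root h)
    exact ⟨w, y, d, e, s, h1, h2, h3, h4, h5, h6⟩
  obtain ⟨l₀, hl₀⟩ := reach_iff.1 (hG.reach x)
  obtain ⟨w₀, y, d, e, s₀, -, -, h2, h3, h4, h5⟩ := key l₀ hl₀
  refine ⟨y, d, e, h4, h3.reach, h5, h2, fun l hl => ?_⟩
  obtain ⟨w, y', d', e', s, rfl, k1, k2, k3, k4, k5⟩ := key l hl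
  obtain ⟨rfl, rfl⟩ := hG.entry y e y' e' (run_singleton.1 h2).1 (run_singleton.1 k2).1
    (h3.reach.trans k5) (k3.reach.trans h5) (fun h => h4 (h5.trans h)) (fun h => k4 (k5.trans h))
  have hd : d = d' := (run_singleton.1 h2).2.symm.trans (run_singleton.1 k2).2
  subst hd
  exact ⟨w, s, by simp, k1, k3⟩

/-- The rooted runs to a vertex form a point, a ray or a fan. -/
theorem words_cases (x : G.V) : (∃ A, G.Run G.root A x ∧ ∀ l, G.Run G.root l x → l = A) ∨
    (∃ U V W, G.IsRay U V W x ∧ ∀ l, G.Run G.root l x → ∃ n, l = U ++ wordPow V n ++ W) ∨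
    ∃ A B C E F, G.IsFan A B C E F x ∧ ∀ l, G.Run G.root l x →
      ∃ m k, l = A ++ wordPow B m ++ C ++ wordPow E k ++ F := by
  have hfin := G.finite
  let r : G.V → G.V → Prop := fun u v => G.Reach u v ∧ ¬ G.Reach v u
  have : Std.Irrefl r := ⟨fun u h => h.2 h.1⟩
  have : IsTrans G.V r := ⟨fun a b c h h' => ⟨h.1.trans h'.1, fun hc => h.2 (h'.1.trans hc)⟩⟩
  induction x using (Finite.wellFounded_of_trans_of_irrefl r).induction with
  | _ x ih =>
  rcases hG.run_cases (x := x) with rfl | ⟨y, d, e, h1, h2, h3, h4, h5⟩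
  · refine Or.inl ⟨[], rfl, fun l hl => ?_⟩
    rcases List.eq_nil_or_concat' l with h | ⟨l, d, rfl⟩
    · exact h
    · obtain ⟨y, -, h⟩ := run_append.1 hl
      exact absurd (run_singleton.1 h).1 (hG.root_no_in y)
  have hyx : G.Reach y x := h4.reach.trans h2
  have ihy := ih y ⟨hyx, h1⟩
  by_cases hx : G.Cyc x
  · obtain ⟨B, s, hB0, hB, hs, -, hall⟩ := hG.exists_lap (hx.congr h3 h2) h2 h3
    rcases ihy with ⟨A, k1, k2⟩ | ⟨U, V, W, ⟨z, k1, k2, k3, k4⟩, k5⟩ |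
      ⟨A, B', C, E, F, ⟨e₁, e₂, k1, k2, k3, k4, k5, k6, k7, k8⟩, -⟩
    · refine Or.inr (Or.inl ⟨A ++ [d], B, s, ⟨e, k1.append h4, hB, hB0, hs⟩, fun l hl => ?_⟩)
      obtain ⟨w, s', rfl, h6, h7⟩ := h5 l hl
      obtain ⟨m, rfl⟩ := hall s' h7
      exact ⟨m, by rw [k2 w h6]; simp⟩
    · refine Or.inr (Or.inr ⟨U, V, W ++ [d], B, s, ⟨z, e, k1, k2, k3, k4.append h4, hB, hB0, hs,
        fun h => h1 (h3.trans (h.trans k4.reach))⟩, fun l hl => ?_⟩)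
      obtain ⟨w, s', rfl, h6, h7⟩ := h5 l hl
      obtain ⟨m, rfl⟩ := hall s' h7
      obtain ⟨n, rfl⟩ := k5 w h6
      exact ⟨n, m, by simp⟩
    -- A cycle below a fan would be the third cycle on a chain.
    · exfalso
      have c1 : G.Cyc e₁ := cyc_iff.2 ⟨B', k3, k2⟩
      have c2 : G.Cyc e₂ := cyc_iff.2 ⟨E, k6, k5⟩
      rcases hG.three e₁ e₂ x c1 c2 hx k4.reach (k7.reach.trans hyx) with h | h
      · exact k8 h
      · exact h1 (h.trans k7.reach)
  · have hex : e = x := by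
      by_contra hne
      exact hx (Cyc.of_reach_ne h3 h2 (Ne.symm hne))
    subst hex
    have hs : ∀ s, G.Run e s e → s = [] := fun s hs => by
      by_contra h0
      exact hx (cyc_iff.2 ⟨s, h0, hs⟩)
    rcases ihy with ⟨A, k1, k2⟩ | ⟨U, V, W, ⟨z, k1, k2, k3, k4⟩, k5⟩ |
      ⟨A, B', C, E, F, ⟨e₁, e₂, k1, k2, k3, k4, k5, k6, k7, k8⟩, k9⟩
    · refine Or.inl ⟨A ++ [d], k1.append h4, fun l hl => ?_⟩
      obtain ⟨w, s', rfl, h6, h7⟩ := h5 l hl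
      rw [k2 w h6, hs s' h7]; simp
    · refine Or.inr (Or.inl ⟨U, V, W ++ [d], ⟨z, k1, k2, k3, k4.append h4⟩, fun l hl => ?_⟩)
      obtain ⟨w, s', rfl, h6, h7⟩ := h5 l hl
      obtain ⟨n, rfl⟩ := k5 w h6
      exact ⟨n, by rw [hs s' h7]; simp⟩
    · refine Or.inr (Or.inr ⟨A, B', C, E, F ++ [d], ⟨e₁, e₂, k1, k2, k3, k4, k5, k6,
        k7.append h4, k8⟩, fun l hl => ?_⟩)
      obtain ⟨w, s', rfl, h6, h7⟩ := h5 l hl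
      obtain ⟨m, k, rfl⟩ := k9 w h6
      exact ⟨m, k, by rw [hs s' h7]; simp⟩

theorem exists_isModulus : ∃ N, G.IsModulus N := by
  have hfin' := G.finite
  have hfin := Fintype.ofFinite G.V
  have : ∀ x : G.V, ∃ n, 0 < n ∧ ∀ N, n ∣ N →
      (∃ A, G.Run G.root A x ∧ ∀ l, G.Run G.root l x → l = A) ∨
      (∃ U V W, G.IsRay U V W x ∧ latNorm (wordDisp V) ∣ N ∧
        ∀ l, G.Run G.root l x → ∃ n, l = U ++ wordPow V n ++ W) ∨
      ∃ A B C E F, G.IsFan A B C E F x ∧ latNorm (wordDisp B) ∣ N ∧ latNorm (wordDisp E) ∣ N ∧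
        ∀ l, G.Run G.root l x → ∃ m k, l = A ++ wordPow B m ++ C ++ wordPow E k ++ F := by
    intro x
    rcases hG.words_cases x with h | ⟨U, V, W, h1, h2⟩ | ⟨A, B, C, E, F, h1, h2⟩
    · exact ⟨1, one_pos, fun N _ => Or.inl h⟩
    · exact ⟨latNorm (wordDisp V), latNorm_pos (hG.disp_ne_zero h1),
        fun N hN => Or.inr (Or.inl ⟨U, V, W, h1, hN, h2⟩)⟩
    · exact ⟨latNorm (wordDisp B) * latNorm (wordDisp E),
        Nat.mul_pos (latNorm_pos (hG.disp_ne_zero (h1.ray_left 0)))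
          (latNorm_pos (hG.disp_ne_zero (h1.ray_right 0))),
        fun N hN => Or.inr (Or.inr ⟨A, B, C, E, F, h1, (Nat.dvd_mul_right _ _).trans hN,
          (Nat.dvd_mul_left _ _).trans hN, h2⟩)⟩
  choose n hn h using this
  exact ⟨∏ x, n x, Finset.prod_pos fun x _ => hn x,
    fun x => h x _ (Finset.dvd_prod_of_mem n (Finset.mem_univ x))⟩

end IsQuipu

/-! ### Normalised pieces -/

namespace LGraph

variable {Γ : Type*} {S : TAS Γ} {G : LGraph Γ}

/-- Families of words that belong to rooted runs. -/
inductive Piece : Type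
  | point (A : List Dir)
  | ray (U V W : List Dir)
  | fan (A B C E F : List Dir)

/-- The points that belong to a piece. -/
def Piece.pts : Piece → Set (ℤ × ℤ)
  | point A => {wordDisp A}
  | ray U V W => raySet (wordDisp U + wordDisp W) (wordDisp V)
  | fan A B C E F => fanSet (wordDisp A + wordDisp C + wordDisp F) (wordDisp B) (wordDisp E)

/-- The words of the piece are words of rooted runs to `x`, and its vectors have norm `N`. -/
def Piece.Valid (G : LGraph Γ) (N : ℕ) (x : G.V) : Piece → Prop
  | point A => G.Run G.root A x
  | ray U V W => G.IsRay U V W x ∧ latNorm (wordDisp V) = N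
  | fan A B C E F => G.IsFan A B C E F x ∧ latNorm (wordDisp B) = N ∧ latNorm (wordDisp E) = N

/-- The domain is the union of the finitely many pieces in `I`. -/
structure IsDecomposition (G : LGraph Γ) (N : ℕ) (I : Set (G.V × Piece)) : Prop where
  pos : 0 < N
  finite : I.Finite
  valid : ∀ i ∈ I, i.2.Valid G N i.1
  dom_eq : G.dom = ⋃ i ∈ I, i.2.pts

theorem disp_ray (U V W : List Dir) (n : ℕ) :
    wordDisp (U ++ wordPow V n ++ W) = wordDisp U + wordDisp W + n • wordDisp V := by
  simp only [wordDisp_append, wordDisp_wordPow]; abel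

theorem disp_fan (A B C E F : List Dir) (m k : ℕ) :
    wordDisp (A ++ wordPow B m ++ C ++ wordPow E k ++ F) =
      wordDisp A + wordDisp C + wordDisp F + m • wordDisp B + k • wordDisp E := by
  simp only [wordDisp_append, wordDisp_wordPow]; abel

theorem Piece.Valid.subset {N : ℕ} {x : G.V} {P : Piece} (h : P.Valid G N x) :
    P.pts ⊆ G.cover x := by
  intro z hz
  rw [mem_cover]
  cases P with
  | point A => exact ⟨A, h, hz.symm⟩
  | ray U V W =>
    obtain ⟨n, rfl⟩ := hz
    exact ⟨_, h.1.run n, disp_ray ..⟩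
  | fan A B C E F =>
    obtain ⟨m, k, rfl⟩ := hz
    exact ⟨_, h.1.run m k, disp_fan ..⟩

end LGraph

namespace IsQuipu

variable {Γ : Type*} {S : TAS Γ} {G : LGraph Γ} (hG : IsQuipu S G)
include hG

/-- The domain is a finite union of normalised pieces. -/
theorem exists_pieces : ∃ N, G.IsModulus N ∧ ∃ I, G.IsDecomposition N I := by
  obtain ⟨N, hN, h⟩ := hG.exists_isModulus
  refine ⟨N, ⟨hN, h⟩, ?_⟩
  have hfin := G.finite
  have key : ∀ x : G.V, ∃ J : Set Piece, J.Finite ∧ (∀ P ∈ J, P.Valid G N x) ∧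
      G.cover x ⊆ ⋃ P ∈ J, P.pts := by
    intro x
    rcases h x with ⟨A, h1, h2⟩ | ⟨U, V, W, h1, ⟨a, ha⟩, h2⟩ |
      ⟨A, B, C, E, F, h1, ⟨a, ha⟩, ⟨b, hb⟩, h2⟩
    · refine ⟨{.point A}, Set.finite_singleton _, fun P hP => ?_, fun z hz => ?_⟩
      · rw [Set.mem_singleton_iff.1 hP]; exact h1
      · obtain ⟨l, hl, rfl⟩ := mem_cover.1 hz
        simp only [Set.mem_iUnion]
        exact ⟨_, rfl, by rw [h2 l hl]; rfl⟩
    · have ha0 : 0 < a := Nat.pos_of_ne_zero (by rintro rfl; omega)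
      -- The numbers of turns are sorted by their residue modulo `a`, the quotient of `N` by the
      -- norm of the vector; each class is a ray whose vector has norm `N`.
      refine ⟨(fun i => .ray (U ++ wordPow V i) (wordPow V a) W) '' Set.Iio a,
        (Set.finite_Iio a).image _, ?_, fun z hz => ?_⟩
      · rintro _ ⟨i, hi, rfl⟩
        obtain ⟨e, k1, k2, k3, k4⟩ := h1
        refine ⟨⟨e, k1.append (k2.pow i), k2.pow a, wordPow_ne_nil k3 ha0.ne', k4⟩, ?_⟩
        rw [wordDisp_wordPow, latNorm_nsmul, ha, mul_comm]
      · obtain ⟨l, hl, rfl⟩ := mem_cover.1 hz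
        obtain ⟨n, rfl⟩ := h2 l hl
        simp only [Set.mem_iUnion]
        refine ⟨_, ⟨n % a, Nat.mod_lt _ ha0, rfl⟩, n / a, ?_⟩
        rw [← disp_ray]
        congr 2
        rw [← wordPow_mul, List.append_assoc, ← wordPow_add, Nat.mod_add_div]
    · have ha0 : 0 < a := Nat.pos_of_ne_zero (by rintro rfl; omega)
      have hb0 : 0 < b := Nat.pos_of_ne_zero (by rintro rfl; omega)
      refine ⟨(fun i : ℕ × ℕ => .fan (A ++ wordPow B i.1) (wordPow B a) (C ++ wordPow E i.2)
        (wordPow E b) F) '' (Set.Iio a ×ˢ Set.Iio b),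
        ((Set.finite_Iio a).prod (Set.finite_Iio b)).image _, ?_, fun z hz => ?_⟩
      · rintro _ ⟨i, hi, rfl⟩
        obtain ⟨e₁, e₂, k1, k2, k3, k4, k5, k6, k7, k8⟩ := h1
        refine ⟨⟨e₁, e₂, k1.append (k2.pow i.1), k2.pow a, wordPow_ne_nil k3 ha0.ne',
          k4.append (k5.pow i.2), k5.pow b, wordPow_ne_nil k6 hb0.ne', k7, k8⟩, ?_, ?_⟩
        · rw [wordDisp_wordPow, latNorm_nsmul, ha, mul_comm]
        · rw [wordDisp_wordPow, latNorm_nsmul, hb, mul_comm]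
      · obtain ⟨l, hl, rfl⟩ := mem_cover.1 hz
        obtain ⟨m, k, rfl⟩ := h2 l hl
        simp only [Set.mem_iUnion]
        refine ⟨_, ⟨(m % a, k % b), ⟨Nat.mod_lt _ ha0, Nat.mod_lt _ hb0⟩, rfl⟩, m / a, k / b, ?_⟩
        rw [← disp_fan]
        have hm : ∀ (B : List Dir) (m a : ℕ),
            wordPow B m = wordPow B (m % a) ++ wordPow (wordPow B a) (m / a) := fun B m a => by
          rw [← wordPow_mul, ← wordPow_add, Nat.mod_add_div]
        rw [hm B m a, hm E k b]
        simp only [List.append_assoc]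
  choose J hJ hJ' hJ'' using key
  refine ⟨⋃ x, (fun P => (x, P)) '' J x, hN, Set.finite_iUnion fun x => (hJ x).image _, ?_, ?_⟩
  · simp only [Set.mem_iUnion]
    rintro _ ⟨x, P, hP, rfl⟩
    exact hJ' x P hP
  · ext z
    simp only [Set.mem_iUnion]
    constructor
    · rintro ⟨x, hz⟩
      obtain ⟨P, hP, h1⟩ := Set.mem_iUnion₂.1 (hJ'' x hz)
      exact ⟨(x, P), ⟨x, P, hP, rfl⟩, h1⟩
    · rintro ⟨_, ⟨x, P, hP, rfl⟩, h1⟩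
      exact ⟨x, (hJ' x P hP).subset h1⟩

end IsQuipu

/-! ### Eventual periodicity of the domain along rays and fans -/

theorem StableAlong.residues {T : Set (ℤ × ℤ)} {p q : ℤ × ℤ} {a b : ℕ} (ha : 0 < a) (hb : 0 < b)
    (h : ∀ c, StableAlong T c (a • p) (b • q)) (c : ℤ × ℤ) :
    ∃ K, ∀ m ≥ K, ∀ n k : ℕ, (c + m • p + k • q ∈ T ↔ c + (m + a * n) • p + k • q ∈ T) := by
  have h' := fun c => (h c).iff
  choose K hK using h'
  -- One bound serves for the finitely many pairs of residues of `m` and `k`.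
  obtain ⟨M, hM⟩ := ((Finset.range a ×ˢ Finset.range b).image
    fun i => K (c + i.1 • p + i.2 • q)).exists_le
  refine ⟨a * M, fun m hm n k => ?_⟩
  have e : ∀ m, c + m • p + k • q =
      c + (m % a) • p + (k % b) • q + (m / a) • (a • p) + (k / b) • (b • q) := by
    intro m
    conv_lhs => rw [← Nat.mod_add_div m a, ← Nat.mod_add_div k b]
    rw [add_smul, add_smul, mul_comm a, mul_comm b, mul_smul, mul_smul]
    abel
  have hM' := hM _ (Finset.mem_image.2 ⟨(m % a, k % b), Finset.mem_product.2
    ⟨Finset.mem_range.2 (Nat.mod_lt _ ha), Finset.mem_range.2 (Nat.mod_lt _ hb)⟩, rfl⟩)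
  have h1 : M ≤ m / a := (Nat.le_div_iff_mul_le ha).2 (by rwa [mul_comm])
  have h2 : M ≤ (m + a * n) / a := h1.trans (Nat.div_le_div_right (by omega))
  rw [e m, e (m + a * n), Nat.add_mul_mod_self_left]
  exact hK _ _ (hM'.trans h1) _ (hM'.trans h2) _

namespace IsQuipu

variable {Γ : Type*} {S : TAS Γ} {G : LGraph Γ} (hG : IsQuipu S G) {N : ℕ}
  {I : Set (G.V × Piece)} (hI : G.IsDecomposition N I) {U V W A B C E F : List Dir} {x : G.V}
include hG hI

/-- The finitely many pieces are treated one by one: those with vector `p` are invariant under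
adding `p`, and all others are left for good when one moves along `p`, uniformly in the multiple of
`q`. -/
theorem stableAlong_dom {p q : ℤ × ℤ} (hw : ∃ w, cross w p < 0 ∧ cross w q ≤ 0)
    (hray : ∀ U V W x, G.IsRay U V W x → latNorm (wordDisp V) = N → wordDisp V ≠ p →
      ∃ w, cross w p < 0 ∧ cross w q ≤ 0 ∧ 0 ≤ cross w (wordDisp V))
    (hfan : ∀ A B C E F x, G.IsFan A B C E F x → latNorm (wordDisp B) = N →
      latNorm (wordDisp E) = N → p ≠ wordDisp B → p ≠ wordDisp E →
      ∃ w, cross w p < 0 ∧ cross w q ≤ 0 ∧ 0 ≤ cross w (wordDisp B) ∧ 0 ≤ cross w (wordDisp E))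
    (c : ℤ × ℤ) : StableAlong G.dom c p q := by
  obtain ⟨w, hw1, hw2⟩ := hw
  rw [hI.dom_eq]
  refine StableAlong.biUnion hI.finite ?_
  rintro ⟨x, P⟩ hP
  have hv := hI.valid _ hP
  cases P with
  | point A => exact stableAlong_singleton hw1 hw2
  | ray U V W => exact stableAlong_raySet hw1 hw2 fun h => hray U V W x hv.1 hv.2 h
  | fan A B C E F =>
    have hne : wordDisp B ≠ wordDisp E := by
      intro h
      have := hG.cross_ne_zero hv.1
      rw [h] at this
      simp at this
    by_cases h1 : p = wordDisp B
    · subst h1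
      exact stableAlong_fanSet_of_left (hray _ _ _ _ (hv.1.ray_right 0) hv.2.2 hne.symm)
    · by_cases h2 : p = wordDisp E
      · subst h2
        simp only [Piece.pts]
        rw [fanSet_symm]
        exact stableAlong_fanSet_of_left (hray _ _ _ _ (hv.1.ray_left 0) hv.2.1 hne)
      · obtain ⟨w, h3, h4, h5, h6⟩ := hfan A B C E F x hv.1 hv.2.1 hv.2.2 h1 h2
        exact stableAlong_of_sep h3 h4 fun z hz => cross_le_of_mem_fanSet h5 h6 hz

/-- Membership in the domain is eventually constant along the vector of a ray. -/
theorem stableAlong_ray (h : G.IsRay U V W x) (hV : latNorm (wordDisp V) = N) (c : ℤ × ℤ) :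
    StableAlong G.dom c (wordDisp V) 0 := by
  refine hG.stableAlong_dom hI ?_ ?_ ?_ c
  · obtain ⟨w, hw⟩ := exists_cross_neg (hG.disp_ne_zero h)
    exact ⟨w, hw, by simp⟩
  · intro U' V' W' x' _ h2 h3
    obtain ⟨w, h4, h5⟩ := exists_sep_ray hI.pos hV h2 h3
    exact ⟨w, h4, by simp, h5⟩
  · intro A B C E F x' h1 h2 h3 h4 h5
    obtain ⟨w, h6, h7, h8⟩ := exists_sep_fan hI.pos hV h2 h3 (hG.cross_ne_zero h1)
      (hG.exterior h h1) h4 h5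
    exact ⟨w, h6, by simp, h7, h8⟩

/-- Exteriority, applied with the given fan in either role, provides the separating vectors for
`stableAlong_dom`. -/
theorem stableAlong_fan (h : G.IsFan A B C E F x) (hB : latNorm (wordDisp B) = N)
    (hE : latNorm (wordDisp E) = N) (c : ℤ × ℤ) :
    StableAlong G.dom c (wordDisp B) (wordDisp E) := by
  have h0 := hG.cross_ne_zero h
  refine hG.stableAlong_dom hI ?_ ?_ ?_ c
  · obtain ⟨w, h1, h2, -⟩ := exists_sep_fan_ray hI.pos hB hE h0 (hG.exterior (h.ray_right 0) h)
      (by rintro h1; rw [h1] at h0; simp at h0)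
    exact ⟨w, h1, h2⟩
  · intro U' V' W' x' h1 h2 h3
    exact exists_sep_fan_ray hI.pos hB h2 h0 (hG.exterior h1 h) h3
  · intro A' B' C' E' F' x' h1 h2 h3 h4 h5
    exact exists_sep_fan_fan hI.pos hB h2 h3 h0 (hG.cross_ne_zero h1)
      (hG.exterior (h.ray_left 0) h1) (hG.exterior (h.ray_right 0) h1)
      (hG.exterior (h1.ray_left 0) h) (hG.exterior (h1.ray_right 0) h) h4 h5

theorem stableAlong_fan_symm (h : G.IsFan A B C E F x) (hB : latNorm (wordDisp B) = N)
    (hE : latNorm (wordDisp E) = N) (c : ℤ × ℤ) :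
    StableAlong G.dom c (wordDisp E) (wordDisp B) := by
  have h0 := hG.cross_ne_zero h
  have h0' : cross (wordDisp E) (wordDisp B) ≠ 0 := by rw [cross_comm]; exact neg_ne_zero.2 h0
  refine hG.stableAlong_dom hI ?_ ?_ ?_ c
  · obtain ⟨w, h1, h2, -⟩ := exists_sep_fan_ray hI.pos hE hB h0'
      (hG.exterior (h.ray_left 0) h).symm (by rintro h1; rw [h1] at h0; simp at h0)
    exact ⟨w, h1, h2⟩
  · intro U' V' W' x' h1 h2 h3
    exact exists_sep_fan_ray hI.pos hE h2 h0' (hG.exterior h1 h).symm h3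
  · intro A' B' C' E' F' x' h1 h2 h3 h4 h5
    exact exists_sep_fan_fan hI.pos hE h2 h3 h0' (hG.cross_ne_zero h1)
      (hG.exterior (h.ray_right 0) h1) (hG.exterior (h.ray_left 0) h1)
      (hG.exterior (h1.ray_left 0) h).symm (hG.exterior (h1.ray_right 0) h).symm h4 h5

end IsQuipu

/-! ### Closed runs in the coordinates of a ray or fan -/

namespace IsQuipu

variable {Γ : Type*} {S : TAS Γ} {G : LGraph Γ} (hG : IsQuipu S G)
  {U V W A B C E F : List Dir} {x v : G.V}
include hG

theorem coordinates_unique (h : G.IsFan A B C E F x) {a b a' b' : ℤ}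
    (h' : a • wordDisp B + b • wordDisp E = a' • wordDisp B + b' • wordDisp E) :
    a = a' ∧ b = b' := by
  have h0 := hG.cross_ne_zero h
  constructor
  · have := congrArg (cross (wordDisp E)) h'
    simp only [cross_add_right, cross_zsmul_right, cross_same, mul_zero, add_zero] at this
    exact mul_right_cancel₀ (by rw [cross_comm]; exact neg_ne_zero.2 h0) this
  · have := congrArg (cross (wordDisp B)) h'
    simp only [cross_add_right, cross_zsmul_right, cross_same, mul_zero, zero_add] at this
    exact mul_right_cancel₀ h0 this

/-- A closed run that can be inserted into the words of a fan is described by two natural numbers,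
one of which is zero. -/
theorem closed_coordinates (h : G.IsFan A B C E F x)
    (hall : ∀ l, G.Run G.root l x → ∃ m k, l = A ++ wordPow B m ++ C ++ wordPow E k ++ F)
    {w l w' : List Dir} (hw : G.Run G.root w v) (hl : G.Run v l v) (hw' : G.Run v w' x) :
    ∃ a b : ℕ, wordDisp l = a • wordDisp B + b • wordDisp E ∧
      l.length = a * B.length + b * E.length ∧ (a = 0 ∨ b = 0) := by
  have key : ∀ n, ∃ m k : ℕ, w ++ wordPow l n ++ w' = A ++ wordPow B m ++ C ++ wordPow E k ++ F :=
    fun n => hall _ ((hw.append (hl.pow n)).append hw')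
  choose m k hmk using key
  have hd : ∀ n, wordDisp w + wordDisp w' + n • wordDisp l =
      wordDisp A + wordDisp C + wordDisp F + m n • wordDisp B + k n • wordDisp E := fun n => by
    rw [← disp_fan, ← hmk, disp_ray]
  have hlen : ∀ n, w.length + n * l.length + w'.length =
      A.length + m n * B.length + C.length + k n * E.length + F.length := fun n => by
    have := congrArg List.length (hmk n)
    simpa only [List.length_append, length_wordPow] using this
  have hz : wordDisp l = ((m 1 : ℤ) - m 0) • wordDisp B + ((k 1 : ℤ) - k 0) • wordDisp E := by
    have h1 := hd 1
    have h0 := hd 0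
    rw [zero_smul, add_zero] at h0
    rw [h0, one_smul] at h1
    have : wordDisp l = (m 1 • wordDisp B + k 1 • wordDisp E) -
        (m 0 • wordDisp B + k 0 • wordDisp E) := by
      rw [eq_sub_iff_add_eq]
      refine add_left_cancel (a := wordDisp A + wordDisp C + wordDisp F) ?_
      rw [← add_assoc _ (m 1 • _), ← h1]
      abel
    rw [this, sub_smul, sub_smul, natCast_zsmul, natCast_zsmul, natCast_zsmul, natCast_zsmul]
    abel
  -- The numbers of turns are affine in the number `n` of insertions. Being nonnegative for all `n`,
  -- they do not decrease.
  have hn : ∀ n : ℕ, (m n : ℤ) = m 0 + n * ((m 1 : ℤ) - m 0) ∧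
      (k n : ℤ) = k 0 + n * ((k 1 : ℤ) - k 0) := by
    intro n
    refine hG.coordinates_unique h (add_left_cancel (a := wordDisp A + wordDisp C + wordDisp F) ?_)
    have h1 := hd n
    have h0 := hd 0
    rw [zero_smul, add_zero] at h0
    rw [h0, hz] at h1
    rw [natCast_zsmul, natCast_zsmul, ← add_assoc, ← h1]
    module
  have hm0 : (m 0 : ℤ) ≤ m 1 := by
    have := (hn (m 0 + 1)).1
    push_cast at this
    by_contra hc
    nlinarith
  have hk0 : (k 0 : ℤ) ≤ k 1 := by
    have := (hn (k 0 + 1)).2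
    push_cast at this
    by_contra hc
    nlinarith
  have hz' : wordDisp l = (m 1 - m 0) • wordDisp B + (k 1 - k 0) • wordDisp E := by
    rw [hz, ← natCast_zsmul, ← natCast_zsmul _ (k 1 - k 0)]
    push_cast [Nat.cast_sub (Int.ofNat_le.1 hm0), Nat.cast_sub (Int.ofNat_le.1 hk0)]
    rfl
  refine ⟨m 1 - m 0, k 1 - k 0, hz', ?_, ?_⟩
  · have h1 := hlen 1
    have h0 := hlen 0
    obtain ⟨i, hi⟩ := Nat.exists_eq_add_of_le (Int.ofNat_le.1 hm0)
    obtain ⟨j, hj⟩ := Nat.exists_eq_add_of_le (Int.ofNat_le.1 hk0)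
    rw [hi, hj] at h1 ⊢
    rw [Nat.add_sub_cancel_left, Nat.add_sub_cancel_left]
    rw [add_mul, add_mul] at h1
    omega
  -- If both numbers were positive, the inserted run would be a ray into the interior of the fan.
  · by_contra! hc
    have hl0 : l ≠ [] := by
      rintro rfl
      rw [wordDisp_nil] at hz
      have := hG.coordinates_unique h (a := 0) (b := 0) (by rw [← hz]; simp)
      omega
    have h0 := hG.cross_ne_zero h
    have hδ := mul_self_pos.2 h0
    refine hG.exterior ⟨v, hw, hl, hl0, hw'⟩ h ⟨?_, ?_⟩
    · rw [cross_comm, hz, cross_add_right, cross_zsmul_right, cross_zsmul_right, cross_same,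
        cross_comm (wordDisp E)]
      have : 0 < (m 1 : ℤ) - m 0 := by omega
      have := mul_pos this hδ
      linarith
    · rw [hz, cross_add_right, cross_zsmul_right, cross_zsmul_right, cross_same]
      have : 0 < (k 1 : ℤ) - k 0 := by omega
      have := mul_pos this hδ
      linarith

end IsQuipu

namespace IsQuipu

variable {Γ : Type*} {S : TAS Γ} {G : LGraph Γ} (hG : IsQuipu S G)
  {U V W A B C E F : List Dir} {x v : G.V}

theorem closed_coordinates_ray (h : G.IsRay U V W x)
    (hall : ∀ l, G.Run G.root l x → ∃ n, l = U ++ wordPow V n ++ W)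
    {w l w' : List Dir} (hw : G.Run G.root w v) (hl : G.Run v l v) (hw' : G.Run v w' x) :
    ∃ a : ℕ, wordDisp l = a • wordDisp V ∧ l.length = a * V.length := by
  obtain ⟨n, hn⟩ := hall _ (hw.append hw')
  obtain ⟨m, hm⟩ := hall _ ((hw.append hl).append hw')
  obtain ⟨e, -, -, hV, -⟩ := h
  have hV0 := List.length_pos_iff.2 hV
  have h1 := congrArg List.length hn
  have h2 := congrArg List.length hm
  simp only [List.length_append, length_wordPow] at h1 h2
  have hmn : n ≤ m := by
    have : n * V.length ≤ m * V.length := by omega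
    exact Nat.le_of_mul_le_mul_right this hV0
  obtain ⟨a, rfl⟩ := Nat.exists_eq_add_of_le hmn
  refine ⟨a, ?_, ?_⟩
  · have h3 := congrArg wordDisp hn
    have h4 := congrArg wordDisp hm
    simp only [wordDisp_append, wordDisp_wordPow] at h3 h4
    refine add_left_cancel (a := wordDisp w + wordDisp w') ?_
    rw [add_right_comm, h4, h3, add_smul]
    abel
  · rw [add_mul] at h2
    omega

include hG

theorem ray_periodic {N : ℕ} {I : Set (G.V × Piece)} (hI : G.IsDecomposition N I)
    (h : G.IsRay U V W x) (hV : latNorm (wordDisp V) ∣ N) (c : ℤ × ℤ) :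
    ∃ K, ∀ m ≥ K, ∀ n : ℕ, (c + m • wordDisp V ∈ G.dom ↔ c + (m + N * n) • wordDisp V ∈ G.dom) := by
  obtain ⟨a, ha⟩ := hV
  have ha0 : 0 < a := Nat.pos_of_ne_zero (by rintro rfl; have := hI.pos; omega)
  obtain ⟨e, h1, h2, h3, h4⟩ := h
  have hr : G.IsRay U (wordPow V a) W x := ⟨e, h1, h2.pow a, wordPow_ne_nil h3 ha0.ne', h4⟩
  obtain ⟨K, hK⟩ := StableAlong.residues (T := G.dom) (p := wordDisp V) (q := 0) ha0 one_pos
    (fun c => by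
      have := hG.stableAlong_ray hI hr
        (by rw [wordDisp_wordPow, latNorm_nsmul, ha, mul_comm]) c
      simpa only [wordDisp_wordPow, smul_zero] using this) c
  refine ⟨K, fun m hm n => ?_⟩
  have := hK m hm (latNorm (wordDisp V) * n) 0
  rw [zero_smul, add_zero, add_zero] at this
  rw [this, ha, ← mul_assoc, mul_comm a]

theorem fan_periodic {N : ℕ} {I : Set (G.V × Piece)} (hI : G.IsDecomposition N I)
    (h : G.IsFan A B C E F x) (hB : latNorm (wordDisp B) ∣ N) (hE : latNorm (wordDisp E) ∣ N)
    (c : ℤ × ℤ) :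
    ∃ K, ∀ m ≥ K, ∀ n k : ℕ,
      (c + m • wordDisp B + k • wordDisp E ∈ G.dom ↔
        c + (m + N * n) • wordDisp B + k • wordDisp E ∈ G.dom) ∧
      (c + k • wordDisp B + m • wordDisp E ∈ G.dom ↔
        c + k • wordDisp B + (m + N * n) • wordDisp E ∈ G.dom) := by
  obtain ⟨a, ha⟩ := hB
  obtain ⟨b, hb⟩ := hE
  have ha0 : 0 < a := Nat.pos_of_ne_zero (by rintro rfl; have := hI.pos; omega)
  have hb0 : 0 < b := Nat.pos_of_ne_zero (by rintro rfl; have := hI.pos; omega)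
  obtain ⟨e₁, e₂, h1, h2, h3, h4, h5, h6, h7, h8⟩ := h
  have hf : G.IsFan A (wordPow B a) C (wordPow E b) F x :=
    ⟨e₁, e₂, h1, h2.pow a, wordPow_ne_nil h3 ha0.ne', h4, h5.pow b, wordPow_ne_nil h6 hb0.ne', h7,
      h8⟩
  have hBa : latNorm (wordDisp (wordPow B a)) = N := by
    rw [wordDisp_wordPow, latNorm_nsmul, ha, mul_comm]
  have hEb : latNorm (wordDisp (wordPow E b)) = N := by
    rw [wordDisp_wordPow, latNorm_nsmul, hb, mul_comm]
  obtain ⟨K, hK⟩ := StableAlong.residues (T := G.dom) (p := wordDisp B) (q := wordDisp E) ha0 hb0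
    (fun c => by
      have := hG.stableAlong_fan hI hf hBa hEb c
      simpa only [wordDisp_wordPow] using this) c
  obtain ⟨K', hK'⟩ := StableAlong.residues (T := G.dom) (p := wordDisp E) (q := wordDisp B) hb0 ha0
    (fun c => by
      have := hG.stableAlong_fan_symm hI hf hBa hEb c
      simpa only [wordDisp_wordPow] using this) c
  refine ⟨max K K', fun m hm n k => ⟨?_, ?_⟩⟩
  · rw [hK m ((le_max_left _ _).trans hm) (latNorm (wordDisp B) * n) k, ha, ← mul_assoc,
      mul_comm a]
  · have := hK' m ((le_max_right _ _).trans hm) (latNorm (wordDisp E) * n) k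
    rw [add_right_comm c (k • _), add_right_comm c (k • _), this, hb, ← mul_assoc, mul_comm b]

/-- The closed run `l` moves along the ray or along one edge of the fan, and the `N`-th power moves
by a multiple of the period. The earlier closed run `z` has already carried the same coordinate past
the preperiod. -/
theorem exists_eventuallyPeriodic (d : ℤ × ℤ) :
    ∃ L N, 0 < L ∧ G.EventuallyPeriodic (fun v => v + d ∈ G.dom) L N := by
  obtain ⟨N, ⟨hN, hcases⟩, I, hI⟩ := hG.exists_pieces
  have hfin' := G.finite
  have hfin := Fintype.ofFinite G.V
  have key : ∀ x : G.V, ∃ K, ∀ v w z l w', G.Run G.root w v → G.Run v z v → K ≤ z.length →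
      G.Run v l v → G.Run v w' x → (wordDisp (w ++ z ++ w') + d ∈ G.dom ↔
        wordDisp (w ++ z ++ wordPow l N ++ w') + d ∈ G.dom) := by
    intro x
    rcases hcases x with ⟨A, h1, h2⟩ | ⟨U, V, W, h1, hV, h2⟩ | ⟨A, B, C, E, F, h1, hB, hE, h2⟩
    · refine ⟨0, fun v w z l w' k1 k2 k3 k4 k5 => ?_⟩
      have e1 := h2 _ (k1.append k5)
      have e2 := h2 _ ((k1.append k4).append k5)
      have : l = [] := by
        have e3 := congrArg List.length (e1.trans e2.symm)
        simp only [List.length_append] at e3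
        exact List.length_eq_zero_iff.1 (by omega)
      simp [this]
    · obtain ⟨K, hK⟩ := hG.ray_periodic hI h1 hV (wordDisp U + wordDisp W + d)
      refine ⟨K * V.length, fun v w z l w' k1 k2 k3 k4 k5 => ?_⟩
      obtain ⟨n, hn⟩ := h2 _ (k1.append k5)
      obtain ⟨a, ha, ha'⟩ := closed_coordinates_ray h1 h2 k1 k2 k5
      obtain ⟨b, hb, -⟩ := closed_coordinates_ray h1 h2 k1 k4 k5
      have hV0 := List.length_pos_iff.2 h1.choose_spec.2.2.1
      have hKa : K ≤ a := Nat.le_of_mul_le_mul_right (ha' ▸ k3) hV0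
      have e0 : wordDisp w + wordDisp w' = wordDisp U + wordDisp W + n • wordDisp V := by
        rw [← disp_ray, ← hn, wordDisp_append]
      have e1 : wordDisp (w ++ z ++ w') + d =
          wordDisp U + wordDisp W + d + (n + a) • wordDisp V := by
        simp only [wordDisp_append, ha]
        rw [add_right_comm (wordDisp w), e0]
        module
      have e2 : wordDisp (w ++ z ++ wordPow l N ++ w') + d =
          wordDisp U + wordDisp W + d + (n + a + N * b) • wordDisp V := by
        simp only [wordDisp_append, wordDisp_wordPow, ha, hb]
        rw [add_right_comm _ _ (wordDisp w'), add_right_comm _ _ (wordDisp w'), e0]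
        module
      rw [e1, e2]
      exact hK _ (by omega) b
    · obtain ⟨K, hK⟩ := hG.fan_periodic hI h1 hB hE (wordDisp A + wordDisp C + wordDisp F + d)
      -- As `z` moves along one edge only, this length forces its number of turns there to exceed
      -- `K`; the extra `1` makes the inequality strict.
      refine ⟨K * B.length + K * E.length + 1, fun v w z l w' k1 k2 k3 k4 k5 => ?_⟩
      obtain ⟨m, k, hmk⟩ := h2 _ (k1.append k5)
      obtain ⟨a, b, hab, hab', hab0⟩ := hG.closed_coordinates h1 h2 k1 k2 k5
      obtain ⟨a', b', hab1, -, hab2⟩ := hG.closed_coordinates h1 h2 k1 k4 k5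
      -- Since `z ++ l` is closed too, it moves along one edge only; hence `z` and `l` do not move
      -- along different edges.
      obtain ⟨a'', b'', hab3, -, hab4⟩ := hG.closed_coordinates h1 h2 k1 (k2.append k4) k5
      have hadd : a'' = a + a' ∧ b'' = b + b' := by
        have := hG.coordinates_unique h1 (a := a'') (b := b'') (a' := a + a') (b' := b + b') (by
          rw [natCast_zsmul, natCast_zsmul, ← hab3, wordDisp_append, hab, hab1]
          module)
        omega
      have e0 : wordDisp w + wordDisp w' =
          wordDisp A + wordDisp C + wordDisp F + m • wordDisp B + k • wordDisp E := by
        rw [← disp_fan, ← hmk, wordDisp_append]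
      have e1 : wordDisp (w ++ z ++ w') + d = wordDisp A + wordDisp C + wordDisp F + d +
          (m + a) • wordDisp B + (k + b) • wordDisp E := by
        simp only [wordDisp_append, hab]
        rw [add_right_comm (wordDisp w), e0]
        module
      have e2 : wordDisp (w ++ z ++ wordPow l N ++ w') + d =
          wordDisp A + wordDisp C + wordDisp F + d +
          (m + a + N * a') • wordDisp B + (k + b + N * b') • wordDisp E := by
        simp only [wordDisp_append, wordDisp_wordPow, hab, hab1]
        rw [add_right_comm _ _ (wordDisp w'), add_right_comm _ _ (wordDisp w'), e0]
        module
      rw [e1, e2]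
      rcases hab4 with h | h
      · have ha : a = 0 := by omega
        have ha' : a' = 0 := by omega
        subst ha ha'
        rw [mul_zero, add_zero (m + 0)]
        refine (hK _ ?_ b' (m + 0)).2
        have : K * E.length < b * E.length := by omega
        have := Nat.lt_of_mul_lt_mul_right this
        omega
      · have hb : b = 0 := by omega
        have hb' : b' = 0 := by omega
        subst hb hb'
        rw [mul_zero, add_zero (k + 0)]
        refine (hK _ ?_ a' (k + 0)).1
        have : K * B.length < a * B.length := by omega
        have := Nat.lt_of_mul_lt_mul_right this
        omega
  choose K hK using key
  refine ⟨N, ∑ x, K x, hN, fun v w z l w' x k1 k2 k3 k4 k5 => ?_⟩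
  exact hK x v w z l w' k1 k2 ((Finset.single_le_sum (fun x _ => Nat.zero_le (K x))
    (Finset.mem_univ x)).trans k3) k4 k5

end IsQuipu

/-! ### Single-direction extensions -/

namespace IsQuipu

variable {Γ : Type*} {S : TAS Γ} {G H : LGraph Γ} {φ : H.V → G.V} {Y : Set H.V} {d : Dir}
  {t : Tile Γ}

theorem isExtension_addLeaves (hG : IsQuipu S G) (hφ : IsCovering H G φ)
    (hH : IsQuipu S (H.addLeaves Y d t)) : Quipu.IsExtension hG.toQuipu hH.toQuipu := by
  constructor
  · intro x w
    obtain ⟨y, hy, -⟩ := hφ.lift_run_root w.run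
    obtain ⟨w', hw'⟩ := (addLeaves_run_inl (Y := Y) (d := d) (t := t) |>.2 hy).exists_walk
    exact ⟨Sum.inl y, w', hw'.trans (List.reverse_reverse _)⟩
  · intro c
    obtain ⟨c', k, r, hk, hlen, hc⟩ := hφ.exists_cycle hG c
    refine ⟨⟨c'.len, c'.len_pos, fun i => Sum.inl (c'.vert i),
      Sum.inl_injective.comp c'.injective, c'.arc⟩, k, r, hk, hlen, fun i => ⟨?_, ?_⟩⟩
    · change H.tile (c'.vert i) = G.tile _
      rw [hφ.tile, hc]
    · change H.lab (c'.vert i) (c'.vert (i + 1 : ℕ)) = G.lab _ _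
      rw [hφ.lab _ _ (by rw [Nat.cast_add, Nat.cast_one]; exact c'.arc i), hc, hc, add_assoc]

/-- After reshaping, the translate by `d` of the cover of a vertex lies either inside or outside the
domain as a whole. Leaves are attached to those copies of vertices labelled `t` for which it lies
outside. -/
theorem exists_isSingleDirExt (hG : IsQuipu S G) {t t' : Tile Γ} (ht' : t' ∈ S.tiles) {d : Dir}
    (ht : t d = t' d.opp) : ∃ Q' : Quipu S,
      Quipu.IsSingleDirExt hG.toQuipu {x | G.tile x = t} d t Q' ∧ G.dom ⊆ Q'.dom := by
  obtain ⟨L, N, hL, hP⟩ := hG.exists_eventuallyPeriodic d.vec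
  have : NeZero L := ⟨hL.ne'⟩
  obtain ⟨H, φ, hr, hH, hφ, hn⟩ := exists_reshape_neutral hG {x | G.tile x = t} hP
  set Y : Set H.V := {y | G.tile (φ y) = t ∧ ∀ v ∈ H.cover y, v + d.vec ∉ H.dom} with hY
  have hH' : IsQuipu S (H.addLeaves Y d t') := addLeaves_isQuipu hH ht'
    (fun y hy => by rw [hφ.tile, hy.1, ht]) fun y hy => hy.2
  have hdom : G.dom ⊆ (H.addLeaves Y d t').dom := by
    rw [← hφ.dom_eq]
    rintro v hv
    obtain ⟨x, l, hl, rfl⟩ := mem_dom.1 hv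
    exact (addLeaves_run_inl.2 hl).mem_dom
  refine ⟨hH'.toQuipu, ⟨fun x hx => hx, ⟨t', ht', ht, H, φ ⁻¹' {x | G.tile x = t}, hr, Y,
    fun y hy => hy.1, rfl⟩, isExtension_addLeaves hG hφ hH', ?_⟩, hdom⟩
  intro x hx v hv
  obtain ⟨l, hl, rfl⟩ := mem_cover.1 hv
  obtain ⟨y, hy, rfl⟩ := hφ.lift_run_root hl
  by_cases hd : wordDisp l + d.vec ∈ G.dom
  · exact hdom hd
  · have hyY : y ∈ Y := by
      refine ⟨hx, fun v' hv' => ?_⟩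
      obtain ⟨l', hl', rfl⟩ := mem_cover.1 hv'
      rw [hφ.dom_eq]
      exact fun h => hd ((iff_of_neutral hH hn hl' hy).1 h)
    have := (addLeaves_run_inr (Y := Y) (d := d) (t := t') (y := ⟨y, hyY⟩)).2 ⟨l, rfl, hy⟩
    have := this.mem_dom
    rw [wordDisp_append, wordDisp_cons, wordDisp_nil, add_zero] at this
    exact this

end IsQuipu

/-! ### Growing parts of the maximal assembly -/

namespace TAS

variable {Γ : Type*} {S : TAS Γ} (hS : S.Confluent)

open Classical in
/-- The restriction of the maximal assembly to `K`. -/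
noncomputable def restr (S : TAS Γ) (K : Set (ℤ × ℤ)) : PartialTiling Γ :=
  fun v => if v ∈ K then S.alphaMax v else none

/-- The restriction of the maximal assembly to `K` is producible, with domain `K`. -/
def Grown (S : TAS Γ) (K : Set (ℤ × ℤ)) : Prop := S.Producible (S.restr K) ∧ K ⊆ S.alphaMax.dom

theorem restr_of_mem {K : Set (ℤ × ℤ)} {v : ℤ × ℤ} (h : v ∈ K) : S.restr K v = S.alphaMax v :=
  if_pos h

theorem restr_of_notMem {K : Set (ℤ × ℤ)} {v : ℤ × ℤ} (h : v ∉ K) : S.restr K v = none :=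
  if_neg h

theorem Grown.dom {K : Set (ℤ × ℤ)} (h : S.Grown K) : (S.restr K).dom = K := by
  ext v
  by_cases hv : v ∈ K
  · obtain ⟨t, ht⟩ := h.2 hv
    exact iff_of_true ⟨t, by rw [restr_of_mem hv, ht]⟩ hv
  · refine iff_of_false ?_ hv
    rintro ⟨t, ht⟩
    rw [restr_of_notMem hv] at ht
    cases ht

theorem exists_producible {v : ℤ × ℤ} {t : Tile Γ} (h : S.alphaMax v = some t) :
    ∃ α, S.Producible α ∧ α v = some t := by
  rw [alphaMax] at h
  split_ifs at h with h1
  · rw [← Option.some_inj.1 h]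
    exact h1.choose_spec

theorem tile_mem_of_ne_zero {v : ℤ × ℤ} {t : Tile Γ} (h : S.alphaMax v = some t) (hv : v ≠ 0) :
    t ∈ S.tiles := by
  obtain ⟨α, hα, hαv⟩ := exists_producible h
  by_contra ht
  have h1 := (hα.1.1 v t hαv).resolve_left ht
  subst h1
  exact hv (hα.1.2 ht hαv hα.2.2)

include hS

theorem grown_singleton : S.alphaMax 0 = some S.seed ∧ S.Grown {0} := by
  classical
  let β : PartialTiling Γ := fun v => if v = 0 then some S.seed else none
  have hβ0 : β 0 = some S.seed := if_pos rfl
  have hβ1 : ∀ v t, β v = some t → v = 0 ∧ t = S.seed := by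
    intro v t h
    simp only [β] at h
    split_ifs at h with h1
    exact ⟨h1, (Option.some_inj.1 h).symm⟩
  have hβ : S.Producible β := by
    refine ⟨⟨fun v t h => Or.inr (hβ1 v t h).2, fun _ v hv w hw => ?_⟩, ⟨⟨0, _, hβ0⟩, ?_⟩, hβ0⟩
    · rw [(hβ1 v _ hv).1, (hβ1 w _ hw).1]
    · rintro v ⟨t, hv⟩ w ⟨t', hw⟩
      rw [(hβ1 v _ hv).1, (hβ1 w _ hw).1]
  have h0 : S.alphaMax 0 = some S.seed := by rw [alphaMax_eq hS hβ ⟨_, hβ0⟩, hβ0]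
  refine ⟨h0, ?_, by rintro v rfl; exact ⟨_, h0⟩⟩
  convert hβ using 1
  ext v
  simp only [restr, β, Set.mem_singleton_iff]
  split_ifs with h
  · rw [h, h0]
  · rfl

/-- The enlarged assembly is producible, so by confluence its new tile is the tile of the maximal
assembly. -/
theorem grown_insert {K : Set (ℤ × ℤ)} (hK : S.Grown K) {z : ℤ × ℤ} {d : Dir} {t t' : Tile Γ}
    (hz : z ∈ K) (ht : S.alphaMax z = some t) (ht' : t' ∈ S.tiles) (hg : t d = t' d.opp)
    (hn : z + d.vec ∉ K) :
    S.alphaMax (z + d.vec) = some t' ∧ S.Grown (insert (z + d.vec) K) := by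
  classical
  let β : PartialTiling Γ := Function.update (S.restr K) (z + d.vec) (some t')
  have hne : ∀ v ∈ K, v ≠ z + d.vec := fun v hv h => hn (h ▸ hv)
  have hβ0 : β (z + d.vec) = some t' := Function.update_self ..
  have hβ1 : ∀ v ∈ K, β v = S.alphaMax v := fun v hv => by
    rw [show β v = S.restr K v from Function.update_of_ne (hne v hv) .., restr_of_mem hv]
  have hβ2 : ∀ v, v ≠ z + d.vec → β v = S.restr K v := fun v hv => Function.update_of_ne hv ..
  have hle : (S.restr K).bindingGraph ≤ β.bindingGraph := by
    rintro v w ⟨e, s, s', h1, h2, h3, h4⟩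
    have hv : v ∈ K := hK.dom ▸ ⟨s, h2⟩
    have hw : w ∈ K := hK.dom ▸ ⟨s', h3⟩
    exact ⟨e, s, s', h1, by rw [hβ2 v (hne v hv), h2], by rw [hβ2 w (hne w hw), h3], h4⟩
  have hreach : ∀ v ∈ β.dom, β.bindingGraph.Reachable v z := by
    rintro v ⟨s, hv⟩
    by_cases h : v = z + d.vec
    · subst h
      refine (SimpleGraph.Adj.reachable ?_).symm
      exact ⟨d, t, t', rfl, by rw [hβ1 z hz, ht], hβ0, hg⟩
    · rw [hβ2 v h] at hv
      exact (hK.1.2.1.2 v ⟨s, hv⟩ z (hK.dom.symm ▸ hz)).mono hle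
  have h0K : (0 : ℤ × ℤ) ∈ K := hK.dom ▸ ⟨_, hK.1.2.2⟩
  have hβ : S.Producible β := by
    refine ⟨⟨fun v s hv => ?_, fun hseed v hv w hw => ?_⟩, ⟨⟨z + d.vec, _, hβ0⟩,
      fun v hv w hw => (hreach v hv).trans (hreach w hw).symm⟩, ?_⟩
    · by_cases h : v = z + d.vec
      · subst h
        rw [hβ0] at hv
        exact Or.inl (Option.some_inj.1 hv ▸ ht')
      · rw [hβ2 v h] at hv
        exact hK.1.1.1 v s hv
    · have key : ∀ u, β u = some S.seed → S.restr K u = some S.seed := by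
        intro u hu
        by_cases h : u = z + d.vec
        · subst h
          rw [hβ0] at hu
          exact absurd (Option.some_inj.1 hu ▸ ht') hseed
        · rwa [hβ2 u h] at hu
      exact hK.1.1.2 hseed (key v hv) (key w hw)
    · rw [hβ2 0 (hne 0 h0K)]
      exact hK.1.2.2
  have h1 : S.alphaMax (z + d.vec) = some t' := by rw [alphaMax_eq hS hβ ⟨_, hβ0⟩, hβ0]
  refine ⟨h1, ?_, Set.insert_subset ⟨_, h1⟩ hK.2⟩
  convert hβ using 1
  ext v
  by_cases h : v = z + d.vec
  · subst h
    rw [hβ0, restr_of_mem (Set.mem_insert _ _), h1]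
  · rw [hβ2 v h]
    by_cases hv : v ∈ K
    · rw [restr_of_mem hv, restr_of_mem (Set.mem_insert_of_mem _ hv)]
    · rw [restr_of_notMem hv, restr_of_notMem (by simp [h, hv])]

omit hS in
theorem adj_translate {v w g : ℤ × ℤ} (h : S.alphaMax.bindingGraph.Adj v w)
    (hv : S.alphaMax (v + g) = S.alphaMax v) (hw : S.alphaMax (w + g) = S.alphaMax w) :
    S.alphaMax.bindingGraph.Adj (v + g) (w + g) := by
  obtain ⟨d, t, t', h1, h2, h3, h4⟩ := h
  exact ⟨d, t, t', by rw [h1, add_right_comm], hv.trans h2, hw.trans h3, h4⟩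

/-- A translate of a walk in the maximal assembly grows from a grown set that it does not meet. -/
theorem grown_walk {K : Set (ℤ × ℤ)} (hK : S.Grown K) {f : ℕ → ℤ × ℤ} {g : ℤ × ℤ} {n : ℕ}
    (hf : ∀ i < n, S.alphaMax.bindingGraph.Adj (f i) (f (i + 1)))
    (h0 : f 0 + g ∈ K) (h00 : S.alphaMax (f 0 + g) = S.alphaMax (f 0))
    (hne : ∀ i, 0 < i → i ≤ n → f i ≠ 0) (hn : ∀ i, 0 < i → i ≤ n → f i + g ∈ K → f i = f 0) :
    (∀ i ≤ n, S.alphaMax (f i + g) = S.alphaMax (f i)) ∧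
      S.Grown (K ∪ (fun i => f i + g) '' Set.Iic n) := by
  induction n with
  | zero =>
    refine ⟨fun i hi => by rw [Nat.le_zero.1 hi, h00], ?_⟩
    convert hK using 1
    refine Set.union_eq_self_of_subset_right ?_
    rintro _ ⟨i, hi, rfl⟩
    rw [Set.mem_Iic, Nat.le_zero] at hi
    exact hi ▸ h0
  | succ n ih =>
    obtain ⟨ih1, ih2⟩ := ih (fun i hi => hf i (by omega)) (fun i h1 h2 => hne i h1 (by omega))
      fun i h1 h2 => hn i h1 (by omega)
    have hset : K ∪ (fun i => f i + g) '' Set.Iic (n + 1) =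
        insert (f (n + 1) + g) (K ∪ (fun i => f i + g) '' Set.Iic n) := by
      have : Set.Iic (n + 1) = insert (n + 1) (Set.Iic n) := by
        ext i; simp only [Set.mem_Iic, Set.mem_insert_iff]; omega
      rw [this, Set.image_insert_eq, Set.union_insert]
    rw [hset]
    have hcases : ∀ P : ℕ → Prop, (∀ i ≤ n, P i) → P (n + 1) → ∀ i ≤ n + 1, P i := by
      intro P h1 h2 i hi
      rcases Nat.le_succ_iff.1 hi with h | h
      · exact h1 i h
      · exact h ▸ h2
    -- A point already filled belongs to `K`, hence is the translated start, or was filled earlier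
    -- along the walk. Otherwise the tile of the walk is attached; it belongs to `S.tiles` because
    -- the walk avoids the origin.
    by_cases hmem : f (n + 1) + g ∈ K ∪ (fun i => f i + g) '' Set.Iic n
    · rw [Set.insert_eq_of_mem hmem]
      refine ⟨hcases _ ih1 ?_, ih2⟩
      rcases hmem with h | ⟨i, hi, h⟩
      · rw [hn (n + 1) (by omega) le_rfl h, h00]
      · have : f (n + 1) = f i := (add_right_cancel h).symm
        rw [this]
        exact ih1 i hi
    · obtain ⟨d, t, t', h1, h2, h3, h4⟩ := hf n (by omega)
      have e : f (n + 1) + g = f n + g + d.vec := by rw [h1, add_right_comm]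
      rw [e] at hmem ⊢
      obtain ⟨h5, h6⟩ := grown_insert hS ih2 (Set.mem_union_right _ ⟨n, Set.mem_Iic.2 le_rfl, rfl⟩)
        ((ih1 n le_rfl).trans h2) (tile_mem_of_ne_zero h3 (hne _ (by omega) le_rfl)) h4 hmem
      exact ⟨hcases _ ih1 (by rw [e, h5, h3]), h6⟩

end TAS

/-- The lattice points visited by a word. -/
def prefixPts (l : List Dir) : Set (ℤ × ℤ) := {v | ∃ l', l' <+: l ∧ wordDisp l' = v}

theorem prefixPts_append_singleton (l : List Dir) (d : Dir) :
    prefixPts (l ++ [d]) = insert (wordDisp l + d.vec) (prefixPts l) := by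
  ext v
  simp only [prefixPts, Set.mem_insert_iff, Set.mem_ofPred_eq, List.prefix_concat_iff]
  constructor
  · rintro ⟨l', rfl | h, rfl⟩
    · left; simp
    · exact Or.inr ⟨l', h, rfl⟩
  · rintro (rfl | ⟨l', h, rfl⟩)
    · exact ⟨l ++ [d], Or.inl rfl, by simp⟩
    · exact ⟨l', Or.inr h, rfl⟩

namespace IsQuipu

variable {Γ : Type*} {S : TAS Γ} {G : LGraph Γ} (hS : S.Confluent) (hG : IsQuipu S G)
include hG

theorem tile_mem_of_ne_root {x : G.V} (hx : x ≠ G.root) : G.tile x ∈ S.tiles := by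
  rcases hG.tile_mem x with h | h
  · exact h
  · by_contra h1
    exact hx (hG.tile_seed (h ▸ h1) x h)

include hS

/-- Uniqueness of displacements keeps the points of a run distinct, so the run is assembled tile by
tile. -/
theorem grown_run {l : List Dir} {x : G.V} (h : G.Run G.root l x) :
    S.alphaMax (wordDisp l) = some (G.tile x) ∧ S.Grown (prefixPts l) := by
  induction l using List.reverseRecOn generalizing x with
  | nil =>
    rw [run_nil] at h
    subst h
    obtain ⟨h1, h2⟩ := TAS.grown_singleton hS
    refine ⟨by rw [hG.tile_root]; exact h1, ?_⟩
    convert h2 using 1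
    ext v
    simp [prefixPts, eq_comm]
  | append_singleton l d ih =>
    obtain ⟨y, h1, h2⟩ := run_append.1 h
    obtain ⟨h3, h4⟩ := run_singleton.1 h2
    obtain ⟨h5, h6⟩ := ih h1
    rw [prefixPts_append_singleton, wordDisp_append]
    have hd : wordDisp [d] = d.vec := by simp
    rw [hd]
    refine TAS.grown_insert hS h6 ⟨l, List.prefix_refl l, rfl⟩ h5
      (hG.tile_mem_of_ne_root ?_) (h4 ▸ hG.glue _ _ h3) ?_
    · rintro rfl
      exact hG.root_no_in _ h3
    · rintro ⟨l', h7, h8⟩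
      obtain ⟨z, hz⟩ := h1.exists_of_prefix h7
      have := hG.uniq _ _ _ _ hz h (by rw [h8, wordDisp_append, hd])
      have h9 := h7.length_le
      rw [this] at h9
      simp at h9

theorem dom_subset : G.dom ⊆ S.alphaMax.dom := by
  intro v hv
  obtain ⟨x, l, hl, rfl⟩ := mem_dom.1 hv
  exact ⟨_, (hG.grown_run hS hl).1⟩

theorem adj_run {l : List Dir} {d : Dir} {x : G.V} (h : G.Run G.root (l ++ [d]) x) :
    S.alphaMax.bindingGraph.Adj (wordDisp l) (wordDisp (l ++ [d])) := by
  obtain ⟨y, h1, h2⟩ := run_append.1 h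
  obtain ⟨h3, h4⟩ := run_singleton.1 h2
  exact ⟨d, _, _, by simp, (hG.grown_run hS h1).1, (hG.grown_run hS h).1, h4 ▸ hG.glue _ _ h3⟩

theorem adj_take {l : List Dir} {x : G.V} (h : G.Run G.root l x) {i : ℕ} (hi : i < l.length) :
    S.alphaMax.bindingGraph.Adj (wordDisp (l.take i)) (wordDisp (l.take (i + 1))) := by
  obtain ⟨y, hy⟩ := h.exists_of_prefix (List.take_prefix (i + 1) l)
  rw [List.take_succ_eq_append_getElem hi] at hy ⊢
  exact hG.adj_run hS hy

end IsQuipu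

/-! ### Infinite words -/

/-- König's lemma: a word with arbitrarily long continuations keeps this property for some next
letter, the alphabet being finite. -/
theorem exists_infinite_branch {α : Type*} [Finite α] {T : Set (List α)}
    (hT : ∀ l a, l ++ [a] ∈ T → l ∈ T) (hlong : ∀ n, ∃ l ∈ T, n ≤ l.length) :
    ∃ w : ℕ → α, ∀ n, (List.range n).map w ∈ T := by
  have hpre : ∀ l l', l ++ l' ∈ T → l ∈ T := by
    intro l l'
    induction l' using List.reverseRecOn with
    | nil => simp
    | append_singleton l' a ih => exact fun h => ih (hT _ a (by simpa using h))
  let E : Set (List α) := {l | ∀ n, ∃ l', l ++ l' ∈ T ∧ n ≤ l'.length}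
  have hstep : ∀ l : E, ∃ a, l.1 ++ [a] ∈ E := by
    rintro ⟨l, hl⟩
    by_contra! hc
    have : ∀ a, ∃ n, ∀ l', l ++ [a] ++ l' ∈ T → l'.length < n := by
      intro a
      have := hc a
      simp only [E, Set.mem_ofPred_eq, not_forall, not_exists, not_and, not_le] at this
      exact this
    choose n hn using this
    have hfin := Fintype.ofFinite α
    obtain ⟨l', h1, h2⟩ := hl (∑ a, n a + 1)
    cases l' with
    | nil => simp at h2
    | cons a l' =>
      have h3 := hn a l' (by simpa using h1)
      have h4 := Finset.single_le_sum (fun a _ => Nat.zero_le (n a)) (Finset.mem_univ a)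
      simp only [List.length_cons] at h2
      omega
  choose a ha using hstep
  let s : ℕ → E := fun n => Nat.rec ⟨[], fun n => by simpa using hlong n⟩
    (fun _ l => ⟨l.1 ++ [a l], ha l⟩) n
  refine ⟨fun n => a (s n), fun n => ?_⟩
  have hs : (List.range n).map (fun n => a (s n)) = (s n).1 := by
    induction n with
    | zero => rfl
    | succ n ih => rw [List.range_succ, List.map_append, ih]; rfl
  rw [hs]
  obtain ⟨l', h, -⟩ := (s n).2 0
  exact hpre _ _ h

/-- The point that is reached from the origin by the first `n` letters of an infinite word. -/
def wordPt (w : ℕ → Dir) (n : ℕ) : ℤ × ℤ := wordDisp ((List.range n).map w)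

@[simp] theorem wordPt_zero (w : ℕ → Dir) : wordPt w 0 = 0 := rfl

theorem wordPt_succ (w : ℕ → Dir) (n : ℕ) : wordPt w (n + 1) = wordPt w n + (w n).vec := by
  simp [wordPt, List.range_succ]

theorem take_map_range (w : ℕ → Dir) {i n : ℕ} (h : i ≤ n) :
    ((List.range n).map w).take i = (List.range i).map w := by
  rw [← List.map_take, List.take_range, min_eq_left h]

theorem wordDisp_take_map_range (w : ℕ → Dir) {i n : ℕ} (h : i ≤ n) :
    wordDisp (((List.range n).map w).take i) = wordPt w i := by
  rw [take_map_range w h, wordPt]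

theorem exists_word_of_steps {f : ℕ → ℤ × ℤ} {n : ℕ}
    (h : ∀ i < n, ∃ d : Dir, f (i + 1) = f i + d.vec) :
    ∃ l : List Dir, l.length = n ∧ ∀ i ≤ n, f i = f 0 + wordDisp (l.take i) := by
  induction n with
  | zero => exact ⟨[], rfl, fun i hi => by simp [Nat.le_zero.1 hi]⟩
  | succ n ih =>
    obtain ⟨l, hl, h1⟩ := ih fun i hi => h i (by omega)
    obtain ⟨d, hd⟩ := h n (by omega)
    refine ⟨l ++ [d], by simp [hl], fun i hi => ?_⟩
    rcases Nat.le_succ_iff.1 hi with h2 | rfl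
    · rw [List.take_append_of_le_length (by omega)]
      exact h1 i h2
    · rw [hd, h1 n le_rfl, List.take_of_length_le (by omega),
        List.take_of_length_le (by simp; omega), wordDisp_append]
      simp [add_assoc]

/-! ### Excursions -/

namespace TAS

variable {Γ : Type*} {S : TAS Γ} {D : Set (ℤ × ℤ)}

/-- Infinite paths of the maximal assembly that are not contained in `D` meet `D` infinitely
often. -/
def PathCondition (S : TAS Γ) (D : Set (ℤ × ℤ)) : Prop :=
  ∀ π : ℕ → ℤ × ℤ, Function.Injective π →
    (∀ n, S.alphaMax.bindingGraph.Adj (π n) (π (n + 1))) →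
    ¬ Set.range π ⊆ D → (Set.range π ∩ D).Infinite

/-- A path of length `n` in the maximal assembly that does not meet `D` after its start. -/
structure IsExcursion (S : TAS Γ) (D : Set (ℤ × ℤ)) (f : ℕ → ℤ × ℤ) (n : ℕ) : Prop where
  adj : ∀ i < n, S.alphaMax.bindingGraph.Adj (f i) (f (i + 1))
  notMem : ∀ i, 0 < i → i ≤ n → f i ∉ D
  inj : ∀ i j, i ≤ n → j ≤ n → f i = f j → i = j

theorem IsExcursion.mono {f : ℕ → ℤ × ℤ} {n m : ℕ} (h : S.IsExcursion D f n) (hm : m ≤ n) :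
    S.IsExcursion D f m :=
  ⟨fun i hi => h.adj i (by omega), fun i h1 h2 => h.notMem i h1 (by omega),
    fun i j hi hj => h.inj i j (by omega) (by omega)⟩

theorem IsExcursion.congr {f g : ℕ → ℤ × ℤ} {n : ℕ} (h : S.IsExcursion D f n)
    (hfg : ∀ i ≤ n, f i = g i) : S.IsExcursion D g n := by
  refine ⟨fun i hi => ?_, fun i h1 h2 => ?_, fun i j hi hj hij => ?_⟩
  · rw [← hfg i (by omega), ← hfg (i + 1) (by omega)]
    exact h.adj i hi
  · rw [← hfg i h2]
    exact h.notMem i h1 h2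
  · rw [← hfg i hi, ← hfg j hj] at hij
    exact h.inj i j hi hj hij

theorem exists_dir_of_adj {v w : ℤ × ℤ} (h : S.alphaMax.bindingGraph.Adj v w) :
    ∃ d : Dir, w = v + d.vec := by
  obtain ⟨d, -, -, h, -⟩ := h
  exact ⟨d, h⟩

theorem IsExcursion.steps {f : ℕ → ℤ × ℤ} {n : ℕ} (h : S.IsExcursion D f n) :
    ∀ i < n, ∃ d : Dir, f (i + 1) = f i + d.vec := fun i hi => exists_dir_of_adj (h.adj i hi)

instance : Finite Dir := by
  refine Finite.of_surjective (α := Fin 4) (fun i => match i with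
    | 0 => .east | 1 => .north | 2 => .south | 3 => .west) fun d => ?_
  cases d
  exacts [⟨0, rfl⟩, ⟨1, rfl⟩, ⟨2, rfl⟩, ⟨3, rfl⟩]

/-- A family of paths that is closed under initial segments and contains arbitrarily long paths has
an infinite word all of whose initial segments occur. -/
theorem exists_wordPt {V : Set (ℤ × ℤ)} (h : ∀ n, ∃ f : ℕ → ℤ × ℤ, f 0 ∈ V ∧ S.IsExcursion D f n) :
    ∃ w : ℕ → Dir, ∀ n, ∃ v ∈ V, S.IsExcursion D (fun i => v + wordPt w i) n := by
  obtain ⟨w, hw⟩ := exists_infinite_branch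
    (T := {l : List Dir | ∃ v ∈ V, S.IsExcursion D (fun i => v + wordDisp (l.take i)) l.length})
    (by
      rintro l a ⟨v, hv, h1⟩
      refine ⟨v, hv, (h1.mono (m := l.length) (by simp)).congr fun i hi => ?_⟩
      rw [List.take_append_of_le_length hi])
    (fun n => by
      obtain ⟨f, hf0, hf⟩ := h n
      obtain ⟨l, rfl, hl⟩ := exists_word_of_steps hf.steps
      exact ⟨l, ⟨f 0, hf0, hf.congr hl⟩, le_rfl⟩)
  refine ⟨w, fun n => ?_⟩
  obtain ⟨v, hv, h1⟩ := hw n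
  rw [List.length_map, List.length_range] at h1
  exact ⟨v, hv, h1.congr fun i hi => by rw [wordDisp_take_map_range w hi]⟩

/-- The excursions from a given point have bounded length. -/
theorem PathCondition.bounded (hpath : S.PathCondition D) (κ : ℤ × ℤ) :
    ∃ L, ∀ f n, f 0 = κ → S.IsExcursion D f n → n ≤ L := by
  by_contra! hc
  obtain ⟨w, hw⟩ := exists_wordPt (S := S) (D := D) (V := {κ}) fun n => by
    obtain ⟨f, m, h1, h2, h3⟩ := hc n
    exact ⟨f, h1, h2.mono h3.le⟩
  have hw' : ∀ n, S.IsExcursion D (fun i => κ + wordPt w i) n := fun n => by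
    obtain ⟨v, rfl, h⟩ := hw n
    exact h
  have hnot : ∀ i, κ + wordPt w (i + 1) ∉ D := fun i => (hw' (i + 1)).notMem _ i.succ_pos le_rfl
  -- The start is dropped because it may lie in `D`.
  have := hpath (fun i => κ + wordPt w (i + 1)) (fun i j hij => by
      have := (hw' (i + j + 1)).inj (i + 1) (j + 1) (by omega) (by omega) hij
      omega) (fun i => (hw' (i + 2)).adj (i + 1) (by omega)) fun h => hnot 0 (h ⟨0, rfl⟩)
  refine this ?_
  convert Set.finite_empty
  rw [Set.eq_empty_iff_forall_notMem]
  rintro _ ⟨⟨i, rfl⟩, h⟩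
  exact hnot i h

theorem PathCondition.bounded_of_finite (hpath : S.PathCondition D) {K : Set (ℤ × ℤ)}
    (hK : K.Finite) : ∃ L, ∀ f n, f 0 ∈ K → S.IsExcursion D f n → n ≤ L := by
  choose L hL using hpath.bounded
  obtain ⟨b, hb⟩ := (hK.image L).bddAbove
  exact ⟨b, fun f n h0 h => (hL _ f n rfl h).trans (hb ⟨_, h0, rfl⟩)⟩

/-- Jumping from each point to the last visit of it extracts an injective path that still starts at
`f 0`. -/
theorem PathCondition.infinite_inter (hpath : S.PathCondition D) {f : ℕ → ℤ × ℤ}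
    (hf : ∀ n, S.alphaMax.bindingGraph.Adj (f n) (f (n + 1)))
    (hfin : ∀ v, {n | f n = v}.Finite) (h0 : f 0 ∉ D) : (Set.range f ∩ D).Infinite := by
  have hlast : ∀ m, ∃ n, m ≤ n ∧ f n = f m ∧ ∀ k, f k = f m → k ≤ n := by
    intro m
    obtain ⟨n, h1, h2⟩ := (hfin (f m)).exists_maximal ⟨m, rfl⟩
    exact ⟨n, (le_total m n).elim id fun h => h2 rfl h, h1,
      fun k hk => (le_total k n).elim id fun h => h2 hk h⟩
  choose last hl1 hl2 hl3 using hlast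
  let s : ℕ → ℕ := fun n => Nat.rec (last 0) (fun _ k => last (k + 1)) n
  have hs : ∀ n, s (n + 1) = last (s n + 1) := fun n => rfl
  have hmono : StrictMono s := strictMono_nat_of_lt_succ fun n => by
    have := hl1 (s n + 1)
    rw [hs]; omega
  have hmax : ∀ n k, f k = f (s n) → k ≤ s n := by
    intro n k hk
    cases n with
    | zero => exact hl3 0 k (hk.trans (hl2 0))
    | succ n => exact hl3 _ k (hk.trans (hl2 (s n + 1)))
  have := hpath (fun n => f (s n)) (fun i j hij => hmono.injective
      (le_antisymm (hmax j _ hij) (hmax i _ hij.symm))) (fun n => by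
    change S.alphaMax.bindingGraph.Adj _ (f (last (s n + 1)))
    rw [hl2]
    exact hf _) fun h => h0 (by
      have := h ⟨0, rfl⟩
      change f (last 0) ∈ D at this
      rwa [hl2] at this)
  refine this.mono ?_
  rintro _ ⟨⟨n, rfl⟩, h⟩
  exact ⟨⟨s n, rfl⟩, h⟩

end TAS

open Filter

/-! ### Linear forms -/

/-- The linear form `z ↦ s * cross p z`. -/
def form (s : ℤ) (p : ℤ × ℤ) : ℤ × ℤ →+ ℤ :=
  AddMonoidHom.mk' (fun z => s * cross p z) fun a b => by rw [cross_add_right, mul_add]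

theorem exists_natCast_gt (z : ℤ) : ∃ n : ℕ, z < n := ⟨(z + 1).toNat, by omega⟩

theorem eventually_map_lt {φ : ℤ × ℤ →+ ℤ} {p : ℤ × ℤ} (h : φ p < 0) (a z : ℤ × ℤ) (M : ℤ) :
    ∀ᶠ m : ℕ in atTop, φ (a + m • p + z) < M := by
  obtain ⟨n, hn⟩ := exists_natCast_gt (φ a + φ z - M)
  refine (eventually_ge_atTop n).mono fun m hm => ?_
  rw [map_add, map_add, map_nsmul, nsmul_eq_mul]
  have : (n : ℤ) ≤ m := by exact_mod_cast hm
  nlinarith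

theorem eventually_lt_map {φ : ℤ × ℤ →+ ℤ} {p : ℤ × ℤ} (h : 0 < φ p) (a z : ℤ × ℤ) (M : ℤ) :
    ∀ᶠ m : ℕ in atTop, M < φ (a + m • p + z) := by
  refine (eventually_map_lt (φ := -φ) (p := p) (by simpa using h) a z (-M)).mono fun m hm => ?_
  rw [AddMonoidHom.neg_apply] at hm
  linarith

theorem form_apply (s : ℤ) (p z : ℤ × ℤ) : form s p z = s * cross p z := rfl

@[simp] theorem form_self (s : ℤ) (p : ℤ × ℤ) : form s p p = 0 := by simp [form_apply]

theorem form_nsmul (s : ℤ) (p z : ℤ × ℤ) (n : ℕ) : form s p (n • z) = n * form s p z := by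
  rw [map_nsmul, nsmul_eq_mul]

theorem form_zsmul (s : ℤ) (p z : ℤ × ℤ) (n : ℤ) : form s p (n • z) = n * form s p z := by
  rw [map_zsmul, smul_eq_mul]

theorem abs_form_take_le (s : ℤ) (p : ℤ × ℤ) (l : List Dir) (i : ℕ) :
    |form s p (wordDisp (l.take i))| ≤ |s| * (latNorm p * l.length) := by
  rw [form_apply, abs_mul]
  exact mul_le_mul_of_nonneg_left (abs_cross_take_le p l i) (abs_nonneg s)

theorem form_linePoint (s : ℤ) (p : ℤ × ℤ) (U V : List Dir) (j : ℤ) (k : ℕ) :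
    form s p (linePoint U V j k) = form s p (wordDisp U) + j * form s p (wordDisp V) +
      form s p (wordDisp (V.take k)) := by
  rw [linePoint, map_add, map_add, form_zsmul]

theorem form_linePoint_le {s : ℤ} {p : ℤ × ℤ} {U V : List Dir} {j : ℤ} (hj : j < 0) (k : ℕ)
    (h : 0 ≤ form s p (wordDisp V)) :
    form s p (linePoint U V j k) ≤ form s p (wordDisp U) + |s| * (latNorm p * V.length) := by
  have := le_of_abs_le (abs_form_take_le s p V k)
  rw [form_linePoint]
  nlinarith

theorem finite_box {p q : ℤ × ℤ} (h : cross p q ≠ 0) {s s' : ℤ} (hs : s ≠ 0) (hs' : s' ≠ 0)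
    (a b a' b' : ℤ) : {z | (a ≤ form s p z ∧ form s p z ≤ b) ∧
      (a' ≤ form s' q z ∧ form s' q z ≤ b')}.Finite := by
  have hinj : Function.Injective fun z : ℤ × ℤ => (form s p z, form s' q z) := by
    rintro ⟨x, y⟩ ⟨x', y'⟩ hz
    simp only [Prod.mk.injEq, form_apply, mul_eq_mul_left_iff, hs, hs', or_false, cross] at hz h
    obtain ⟨h1, h2⟩ := hz
    have e1 : (p.1 * q.2 - p.2 * q.1) * (x - x') = 0 := by linear_combination q.1 * h1 - p.1 * h2
    have e2 : (p.1 * q.2 - p.2 * q.1) * (y - y') = 0 := by linear_combination q.2 * h1 - p.2 * h2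
    have e3 := (mul_eq_zero.1 e1).resolve_left h
    have e4 := (mul_eq_zero.1 e2).resolve_left h
    rw [Prod.mk.injEq]
    omega
  exact ((Set.finite_Icc a b).prod (Set.finite_Icc a' b')).preimage hinj.injOn

/-- A lattice path that changes sides of a line of words meets this line. -/
theorem exists_mem_line_form {V : List Dir} (hV : wordDisp V ≠ 0) {s : ℤ} (hs : s ≠ 0) :
    ∃ c : ℤ, 0 ≤ c ∧ (∀ U j k, |form s (wordDisp V) (linePoint U V j k) -
      form s (wordDisp V) (wordDisp U)| ≤ c) ∧
    ∀ (U : List Dir) (y : ℕ → ℤ × ℤ), (∀ j, ∃ d : Dir, y (j + 1) = y j + d.vec) →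
      ∀ i₀ i₁, i₀ ≤ i₁ →
      ((form s (wordDisp V) (y i₀) < form s (wordDisp V) (wordDisp U) - c ∧
          form s (wordDisp V) (wordDisp U) + c < form s (wordDisp V) (y i₁)) ∨
        (form s (wordDisp V) (wordDisp U) + c < form s (wordDisp V) (y i₀) ∧
          form s (wordDisp V) (y i₁) < form s (wordDisp V) (wordDisp U) - c)) →
      ∃ i, i₀ < i ∧ i < i₁ ∧ ∃ j k, y i = linePoint U V j k := by
  obtain ⟨c, h0, h1, h2⟩ := exists_mem_line hV hs
  refine ⟨c, h0, fun U j k => ?_, fun U y hy i₀ i₁ hi h => ?_⟩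
  · rw [form_linePoint, form_self, mul_zero, add_zero, add_sub_cancel_left]
    exact h1 k
  · obtain ⟨n, rfl⟩ := Nat.exists_eq_add_of_le hi
    obtain ⟨i, h3, h4, h5⟩ := h2 U (fun j => y (i₀ + j)) n (fun j _ => hy (i₀ + j)) h
    exact ⟨i₀ + i, by omega, by omega, h5⟩

/-! ### Translated infinite words -/

/-- From the points `a + m p` an infinite word is followed until the set `D` is met, which happens
after `τ m` steps; for `m ∈ R` this happens earlier than for all larger numbers. -/
structure Chase (D : Set (ℤ × ℤ)) (a p : ℤ × ℤ) (w : ℕ → Dir) (τ : ℕ → ℕ) (R : Set ℕ) : Prop where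
  pos : ∀ m, 0 < τ m
  hit : ∀ m, a + m • p + wordPt w (τ m) ∈ D
  notMem : ∀ m i, 0 < i → i < τ m → a + m • p + wordPt w i ∉ D
  lt : ∀ m ∈ R, ∀ m', m < m' → τ m < τ m'
  frequently : ∃ᶠ m in atTop, m ∈ R
  far : ∀ K : Set (ℤ × ℤ), K.Finite →
    ∀ᶠ m in atTop, ∀ i, 0 < i → i ≤ τ m → a + m • p + wordPt w i ∉ K

namespace Chase

variable {D : Set (ℤ × ℤ)} {a p : ℤ × ℤ} {w : ℕ → Dir} {τ : ℕ → ℕ} {R : Set ℕ}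
  (hc : Chase D a p w τ R)
include hc

omit hc in
theorem steps (v : ℤ × ℤ) (w : ℕ → Dir) (j : ℕ) :
    ∃ d : Dir, v + wordPt w (j + 1) = v + wordPt w j + d.vec :=
  ⟨w j, by rw [wordPt_succ, add_assoc]⟩

/-- The translate by `n p` is the chase from `m + n` at the same time, and this chase is still
running because it lasts longer. -/
theorem add_notMem {m : ℕ} (hm : m ∈ R) {i : ℕ} (hi : 0 < i) (hi' : i ≤ τ m) {n : ℕ} (hn : 0 < n) :
    a + m • p + wordPt w i + n • p ∉ D := by
  have := hc.notMem (m + n) i hi (hi'.trans_lt (hc.lt m hm (m + n) (by omega)))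
  rwa [add_smul, ← add_assoc, add_right_comm _ (n • p)] at this

theorem not_frequently_singleton (z : ℤ × ℤ) :
    ¬ ∃ᶠ m in atTop, m ∈ R ∧ a + m • p + wordPt w (τ m) = z := by
  intro h
  obtain ⟨m, ⟨-, h1⟩, h2⟩ := (h.and_eventually (hc.far {z} (Set.finite_singleton z))).exists
  exact h2 (τ m) (hc.pos m) le_rfl h1

/-- The next point of the ray would be the translate of the hit by `p`. -/
theorem not_frequently_raySet_self (b : ℤ × ℤ) (hb : raySet b p ⊆ D) :
    ¬ ∃ᶠ m in atTop, m ∈ R ∧ a + m • p + wordPt w (τ m) ∈ raySet b p := by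
  intro h
  obtain ⟨m, hm, n, hn⟩ := h.exists
  refine hc.add_notMem hm (hc.pos m) le_rfl one_pos (hb ⟨n + 1, ?_⟩)
  rw [hn, add_smul, add_assoc]

/-- Here the preceding point of the ray is the translate of the hit by `p`; only the first point has
no predecessor. -/
theorem not_frequently_raySet_neg (b : ℤ × ℤ) (hb : raySet b (-p) ⊆ D) :
    ¬ ∃ᶠ m in atTop, m ∈ R ∧ a + m • p + wordPt w (τ m) ∈ raySet b (-p) := by
  intro h
  refine hc.not_frequently_singleton b (h.mono ?_)
  rintro m ⟨hm, n, hn⟩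
  refine ⟨hm, ?_⟩
  cases n with
  | zero => rw [hn, zero_smul, add_zero]
  | succ n =>
    refine absurd (hb ⟨n, ?_⟩) (hc.add_notMem hm (hc.pos m) le_rfl one_pos)
    rw [hn, add_smul, one_smul, one_smul]
    abel

variable {Γ : Type*} {S : TAS Γ} {G : LGraph Γ} {U V W A B C E F : List Dir} {x x' : G.V}

omit hc in
theorem neg_of_notMem (hr : G.IsRay U V W x) {j : ℤ} {k : ℕ}
    (h : linePoint U V j k ∉ G.dom) : j < 0 := by
  by_contra hj
  exact h (hr.linePoint_mem' (not_lt.1 hj) k)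

end Chase

/-! ### Chases that end deep inside a fan -/

namespace IsQuipu

variable {Γ : Type*} {S : TAS Γ} {G : LGraph Γ} (hG : IsQuipu S G)
  {U V W A B C E F : List Dir} {x x' : G.V} {N : ℕ} (hN : 0 < N)
  {a : ℤ × ℤ} {w : ℕ → Dir} {τ : ℕ → ℕ} {R : Set ℕ}
include hG hN

/-- In the coordinates `X`, `Y` of the fan, such a chase has to cross the line with period `E`
through `T`, and outside the domain this happens only at negative indices, where `Y` is bounded
above. The line with period `B` through `A`, considered after its last visit, bounds `Y` below. So
the crossing lies in a fixed finite box, which late chases avoid. -/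
theorem not_frequently_fan (hr : G.IsRay U V W x') (hV : latNorm (wordDisp V) = N)
    (hc : Chase G.dom a (wordDisp V) w τ R)
    (hf : G.IsFan A B C E F x) (hB : latNorm (wordDisp B) = N) (hE : latNorm (wordDisp E) = N)
    {b : ℤ × ℤ} (hb : fanSet b (wordDisp B) (wordDisp E) ⊆ G.dom) :
    ¬ ∀ K : ℕ, ∃ᶠ m in atTop, m ∈ R ∧ ∃ i ≥ K, ∃ j ≥ K, a + m • wordDisp V + wordPt w (τ m) =
      b + i • wordDisp B + j • wordDisp E := by
  intro hfr
  have hδ := hG.cross_ne_zero hf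
  have hp0 := hG.disp_ne_zero (hf.ray_left 0)
  have hq0 := hG.disp_ne_zero (hf.ray_right 0)
  have hcases : cross (wordDisp V) (wordDisp E) * cross (wordDisp B) (wordDisp E) < 0 ∨
      cross (wordDisp B) (wordDisp V) * cross (wordDisp B) (wordDisp E) < 0 := by
    obtain ⟨m, hm, i, -, j, -, hij⟩ := (hfr 0).exists
    refine fan_cases hN hV hB hE hδ (hG.exterior hr hf) ?_ ?_ <;> intro h <;>
      refine hc.add_notMem hm (hc.pos m) le_rfl one_pos (hb ?_) <;> rw [hij, h]
    · exact ⟨i + 1, j, by module⟩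
    · exact ⟨i, j + 1, by module⟩
  obtain ⟨cS, hcS0, hcS, hcrossS⟩ := exists_mem_line_form hp0 hδ
  obtain ⟨cW, hcW0, hcW, hcrossW⟩ := exists_mem_line_form hq0 (neg_ne_zero.2 hδ)
  generalize hp : wordDisp V = p at *
  generalize hp' : wordDisp B = p' at *
  generalize hq' : wordDisp E = q' at *
  set δ := cross p' q' with hδd
  have hδ2 : 0 < δ * δ := mul_self_pos.2 hδ
  set X := form (-δ) q' with hX
  set Y := form δ p' with hY
  have hXp' : X p' = δ * δ := by rw [hX, form_apply, cross_comm]; ring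
  have hYq' : Y q' = δ * δ := rfl
  have hYp' : Y p' = 0 := form_self ..
  have hXq' : X q' = 0 := form_self ..
  set XS := X (wordDisp A) + |(-δ)| * (latNorm q' * B.length) with hXS
  obtain ⟨t, ht⟩ : ∃ t : ℕ, XS + cW - X (wordDisp A) - X (wordDisp C) < t :=
    exists_natCast_gt _
  set T := A ++ wordPow B t ++ C with hT
  have hXT : X (wordDisp T) = X (wordDisp A) + t * (δ * δ) + X (wordDisp C) := by
    rw [hT, wordDisp_append, wordDisp_append, wordDisp_wordPow, map_add, map_add, hp', form_nsmul,
      hXp']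
  have hXT' : XS < X (wordDisp T) - cW := by
    have : (t : ℤ) ≤ t * (δ * δ) := by nlinarith
    linarith
  have hfin := finite_box hδ hδ (neg_ne_zero.2 hδ) (Y (wordDisp A) - cS)
    (Y (wordDisp T) + |δ| * (latNorm p' * E.length)) (X (wordDisp T) - cW) (X (wordDisp T) + cW)
  have hfar := hc.far _ hfin
  obtain ⟨K, hK⟩ : ∃ K : ℕ, |X (wordDisp T)| + cW + |X b| + (|Y (wordDisp A)| + cS + |Y b|) < K :=
    exists_natCast_gt _
  have a1 := le_abs_self (X (wordDisp T))
  have a2 := neg_abs_le (X b)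
  have a3 := le_abs_self (Y (wordDisp A))
  have a4 := neg_abs_le (Y b)
  have a5 := abs_nonneg (X (wordDisp T))
  have a6 := abs_nonneg (X b)
  have a7 := abs_nonneg (Y (wordDisp A))
  have a8 := abs_nonneg (Y b)
  have hend : ∀ m, (∃ i ≥ K, ∃ j ≥ K, a + m • p + wordPt w (τ m) = b + i • p' + j • q') →
      X (wordDisp T) + cW < X (a + m • p + wordPt w (τ m)) ∧
      Y (wordDisp A) + cS < Y (a + m • p + wordPt w (τ m)) := by
    rintro m ⟨i, hi, j, hj, h⟩
    rw [h]
    simp only [map_add, form_nsmul, hX, hY]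
    rw [← hX, ← hY, hXp', hXq', hYp', hYq']
    have hi' : (K : ℤ) ≤ i := by exact_mod_cast hi
    have hj' : (K : ℤ) ≤ j := by exact_mod_cast hj
    constructor <;> nlinarith
  -- The time `i₀` begins a final stretch that starts with small `X` and never visits the line with
  -- period `B`.
  have finish : ∀ m i₀, 0 < i₀ → i₀ < τ m →
      (∀ i, i₀ < i → i < τ m → ∀ j k, a + m • p + wordPt w i ≠ linePoint A B j k) →
      X (a + m • p + wordPt w i₀) < X (wordDisp T) - cW →
      X (wordDisp T) + cW < X (a + m • p + wordPt w (τ m)) →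
      Y (wordDisp A) + cS < Y (a + m • p + wordPt w (τ m)) →
      ¬ ∀ i, 0 < i → i ≤ τ m → a + m • p + wordPt w i ∉ {z |
        (Y (wordDisp A) - cS ≤ Y z ∧ Y z ≤ Y (wordDisp T) + |δ| * (latNorm p' * E.length)) ∧
        (X (wordDisp T) - cW ≤ X z ∧ X z ≤ X (wordDisp T) + cW)} := by
    intro m i₀ h1 h2 h3 h4 h5 h6 h7
    obtain ⟨i, h8, h9, j, k, hjk⟩ := hcrossW T (fun i => a + m • p + wordPt w i) (Chase.steps _ w)
      i₀ (τ m) h2.le (Or.inl ⟨h4, h5⟩)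
    have hj : j < 0 := Chase.neg_of_notMem (hf.ray_right t)
      (hjk ▸ hc.notMem m i (by omega) h9)
    refine h7 i (by omega) h9.le ⟨⟨?_, ?_⟩, ?_⟩
    · by_contra h10
      obtain ⟨i', h11, h12, j', k', h13⟩ := hcrossS A (fun i => a + m • p + wordPt w i)
        (Chase.steps _ w) i (τ m) h9.le (Or.inl ⟨not_le.1 h10, h6⟩)
      exact h3 i' (by omega) h12 j' k' h13
    · have : (0 : ℤ) ≤ form δ p' (wordDisp E) := by rw [hq']; exact hδ2.le
      change Y _ ≤ _
      rw [hjk]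
      exact form_linePoint_le hj k this
    · have := abs_le.1 (hcW T j k)
      rw [← hjk] at this
      exact ⟨by linarith, by linarith⟩
  -- If that line is visited, the last visit has a negative index, hence small `X`, and serves as
  -- `i₀`. If not, then `X p < 0`, and for large `m` one may take `i₀ = 1`.
  by_cases hvisit : ∃ᶠ m in atTop, (m ∈ R ∧ ∃ i ≥ K, ∃ j ≥ K, a + m • p + wordPt w (τ m) =
      b + i • p' + j • q') ∧ ∃ i, 0 < i ∧ i < τ m ∧ ∃ j k, a + m • p + wordPt w i = linePoint A B j k
  · obtain ⟨m, ⟨⟨hm, h1⟩, h2⟩, h3⟩ := (hvisit.and_eventually hfar).exists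
    obtain ⟨h4, h5⟩ := hend m h1
    obtain ⟨i₀, ⟨h6, h7, j, k, h8⟩, h9⟩ : ∃ i, (0 < i ∧ i < τ m ∧ ∃ j k,
        a + m • p + wordPt w i = linePoint A B j k) ∧ ∀ i', (0 < i' ∧ i' < τ m ∧ ∃ j k,
        a + m • p + wordPt w i' = linePoint A B j k) → i' ≤ i := by
      obtain ⟨i, h6, h7⟩ := Set.Finite.exists_maximal (s := {i | 0 < i ∧ i < τ m ∧ ∃ j k,
        a + m • p + wordPt w i = linePoint A B j k})
        ((Set.finite_Iio (τ m)).subset fun i hi => hi.2.1) h2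
      exact ⟨i, h6, fun i' hi' => (le_total i' i).elim id fun h => h7 hi' h⟩
    refine finish m i₀ h6 h7 (fun i h10 h11 j k h12 => ?_) ?_ h4 h5 h3
    · have := h9 i ⟨by omega, h11, j, k, h12⟩
      omega
    · have hj : j < 0 := Chase.neg_of_notMem (hf.ray_left 0) (h8 ▸ hc.notMem m i₀ h6 h7)
      refine lt_of_le_of_lt ?_ hXT'
      rw [h8]
      exact form_linePoint_le hj k (by rw [hp', ← hX, hXp']; exact hδ2.le)
  · have hfr' := ((hfr K).and_eventually (not_frequently.1 hvisit)).and_eventually hfar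
    have hnv : ∀ m, ((m ∈ R ∧ ∃ i ≥ K, ∃ j ≥ K, a + m • p + wordPt w (τ m) =
        b + i • p' + j • q') ∧ ¬ ((m ∈ R ∧ ∃ i ≥ K, ∃ j ≥ K, a + m • p + wordPt w (τ m) =
        b + i • p' + j • q') ∧ ∃ i, 0 < i ∧ i < τ m ∧ ∃ j k, a + m • p + wordPt w i =
        linePoint A B j k)) → ∀ i, 0 < i → i < τ m → ∀ j k, a + m • p + wordPt w i ≠
        linePoint A B j k := fun m hm i h1 h2 j k h3 => hm.2 ⟨hm.1, i, h1, h2, j, k, h3⟩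
    have hY1 : ∀ m, (∃ i ≥ K, ∃ j ≥ K, a + m • p + wordPt w (τ m) = b + i • p' + j • q') →
        (∀ i, 0 < i → i < τ m → ∀ j k, a + m • p + wordPt w i ≠ linePoint A B j k) →
        Y (wordDisp A) - cS ≤ Y (a + m • p + wordPt w 1) := by
      intro m h1 h2
      by_contra h3
      obtain ⟨i', h11, h12, j', k', h13⟩ := hcrossS A (fun i => a + m • p + wordPt w i)
        (Chase.steps _ w) 1 (τ m) (hc.pos m) (Or.inl ⟨not_le.1 h3, (hend m h1).2⟩)
      exact h2 i' (by omega) h12 j' k' h13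
    -- If `Y p < 0`, late chases would start below the line with period `B` and end above it without
    -- visiting it.
    have hXp : X p < 0 := by
      have hXp : X p = cross p q' * δ := by rw [hX, form_apply, cross_comm p]; ring
      have hYp : Y p = cross p' p * δ := by rw [hY, form_apply, mul_comm]
      rw [hXp]
      refine hcases.resolve_right fun h => ?_
      obtain ⟨m, ⟨h1, -⟩, h2⟩ := (hfr'.and_eventually
        (eventually_map_lt (φ := Y) (by rw [hYp]; exact h) a (wordPt w 1)
          (Y (wordDisp A) - cS))).exists
      exact absurd (hY1 m h1.1.2 (hnv m h1)) (not_le.2 h2)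
    obtain ⟨m, ⟨⟨h1, h2⟩, h3⟩, h4⟩ := (hfr'.and_eventually
      (eventually_map_lt hXp a (wordPt w 1) (X (wordDisp T) - cW))).and_eventually
      (eventually_ge_atTop 0) |>.exists
    obtain ⟨h5, h6⟩ := hend m h1.1.2
    have hτ : 1 < τ m := by
      refine lt_of_le_of_ne (hc.pos m) fun h => ?_
      rw [← h] at h5
      linarith
    exact finish m 1 one_pos hτ (fun i h7 => hnv m h1 i (by omega)) h3 h5 h6 h2

end IsQuipu

/-! ### Assembling continuations of a chase -/

namespace IsQuipu

variable {Γ : Type*} {S : TAS Γ} {G : LGraph Γ} (hS : S.Confluent) (hG : IsQuipu S G)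
  {U V W U' V' W' A B C E F : List Dir} {x x' : G.V} {N : ℕ} {I : Set (G.V × Piece)}
  {w : ℕ → Dir} {τ : ℕ → ℕ} {R : Set ℕ}
include hS hG

/-- From a point of a ray one goes back to the cycle and then follows the cycle forever. -/
theorem exists_walk_of_isRay (hr : G.IsRay U V W x) {j : ℕ} (hj : 0 < j) :
    ∃ f : ℕ → ℤ × ℤ, f 0 = wordDisp U + wordDisp W + j • wordDisp V ∧
      (∀ i, S.alphaMax.bindingGraph.Adj (f i) (f (i + 1))) ∧ (∀ v, {n | f n = v}.Finite) ∧
      (∀ i, f i ∈ G.dom) ∧ (∀ i, f i ≠ 0) ∧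
      (∀ i, ∃ n ≥ j, ∃ l : List Dir, l.length ≤ U.length + V.length + W.length ∧
        f i = n • wordDisp V + wordDisp l) ∧
      ∃ M, ∀ i ≥ M, ∃ n k : ℕ, k ≤ V.length ∧ f i = linePoint U V n k := by
  have hV0 : 0 < V.length := by
    obtain ⟨-, -, -, h, -⟩ := hr
    exact List.length_pos_iff.2 h
  -- First `W.length` steps back along `W`, then forward along `V` forever; `wordPow V i` has at
  -- least `i` letters.
  let g : ℕ → List Dir := fun i => if i ≤ W.length then U ++ wordPow V j ++ W.take (W.length - i)
    else U ++ wordPow V j ++ (wordPow V i).take (i - W.length)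
  have hjl : 0 < (U ++ wordPow V j).length := by
    rw [List.length_append, length_wordPow]
    positivity
  have hpre : ∀ i, i ≤ (wordPow V i).length := fun i => by
    rw [length_wordPow]
    exact Nat.le_mul_of_pos_right i hV0
  have hg1 : ∀ i, W.length ≤ i → ∀ n ≥ i, g i = U ++ wordPow V j ++ (wordPow V n).take
      (i - W.length) := by
    intro i hi n hn
    rcases hi.eq_or_lt with rfl | hi
    · simp [g]
    · simp only [g, if_neg (not_le.2 hi)]
      obtain ⟨k, rfl⟩ := Nat.exists_eq_add_of_le hn
      rw [wordPow_add, List.take_append_of_le_length]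
      have := hpre i
      omega
  have hrun : ∀ n, ∃ z, G.Run G.root (U ++ wordPow V j ++ wordPow V n) z := by
    obtain ⟨e, h1, h2, -, -⟩ := hr
    exact fun n => ⟨e, (h1.append (h2.pow j)).append (h2.pow n)⟩
  have hgrun : ∀ i, ∃ z, G.Run G.root (g i) z := by
    intro i
    by_cases hi : i ≤ W.length
    · refine ⟨_, ((hr.run j).exists_of_prefix ?_).choose_spec⟩
      simp only [g, if_pos hi]
      exact (List.prefix_append_right_inj _).2 (List.take_prefix _ _)
    · obtain ⟨z, hz⟩ := hrun i
      refine ⟨_, (hz.exists_of_prefix ?_).choose_spec⟩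
      simp only [g, if_neg hi]
      exact (List.prefix_append_right_inj _).2 (List.take_prefix _ _)
  have hglen : ∀ i, W.length ≤ i → (g i).length = (U ++ wordPow V j).length + (i - W.length) := by
    intro i hi
    rw [hg1 i hi i le_rfl, List.length_append, List.length_take, min_eq_left]
    have := hpre i
    omega
  have hgpos : ∀ i, (U ++ wordPow V j) <+: g i := by
    intro i
    simp only [g]
    split_ifs <;> exact List.prefix_append _ _
  have hinj : ∀ i k, wordDisp (g i) = wordDisp (g k) → g i = g k := fun i k h =>
    hG.uniq _ _ _ _ (hgrun i).choose_spec (hgrun k).choose_spec h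
  have hline : ∀ i, W.length ≤ i → ∃ n k : ℕ, k ≤ V.length ∧
      g i = U ++ wordPow V (j + n) ++ V.take k := by
    intro i hi
    have : g i <+: U ++ wordPow V j ++ wordPow V i := by
      rw [hg1 i hi i le_rfl]
      exact (List.prefix_append_right_inj _).2 (List.take_prefix _ _)
    rcases prefix_append_wordPow this with h | ⟨n, k, -, h⟩
    · refine ⟨0, 0, Nat.zero_le _, ?_⟩
      simpa using h.eq_of_length (le_antisymm h.length_le (hgpos i).length_le)
    · refine ⟨n, min k V.length, min_le_right .., ?_⟩
      rw [h, wordPow_add, ← List.take_eq_take_min]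
      simp
  refine ⟨fun i => wordDisp (g i), ?_, fun i => ?_, fun v => ?_, fun i => ?_, fun i h => ?_,
    fun i => ?_, W.length, fun i hi => ?_⟩
  · simp only [g, if_pos (Nat.zero_le _), Nat.sub_zero, List.take_length]
    exact disp_ray ..
  · by_cases hi : i + 1 ≤ W.length
    · have := hG.adj_take hS (hr.run j) (i := (U ++ wordPow V j).length + (W.length - (i + 1)))
        (by simp only [List.length_append]; omega)
      rw [add_assoc, List.take_length_add_append, List.take_length_add_append] at this
      simp only [g, if_pos hi, if_pos (Nat.le_of_succ_le hi)]
      convert this.symm using 4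
      omega
    · obtain ⟨z, hz⟩ := hrun (i + 1)
      have := hG.adj_take hS hz (i := (U ++ wordPow V j).length + (i - W.length))
        (by have := hpre (i + 1); simp only [List.length_append]; omega)
      rw [add_assoc, List.take_length_add_append, List.take_length_add_append] at this
      dsimp only
      rw [hg1 i (by omega) (i + 1) (by omega), hg1 (i + 1) (by omega) (i + 1) le_rfl]
      convert this using 4
      omega
  · refine ((Set.finite_Iio W.length).union (Set.Subsingleton.finite
      (s := {n | W.length ≤ n ∧ wordDisp (g n) = v}) ?_)).subset fun n hn => ?_
    · rintro n ⟨h1, h2⟩ k ⟨h3, h4⟩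
      have := congrArg List.length (hinj n k (h2.trans h4.symm))
      rw [hglen n h1, hglen k h3] at this
      omega
    · exact (lt_or_ge n W.length).imp id fun h => ⟨h, hn⟩
  · obtain ⟨z, hz⟩ := hgrun i
    exact hz.mem_dom
  · obtain ⟨z, hz⟩ := hgrun i
    have h1 := hG.uniq _ _ _ _ hz (run_nil.2 rfl) (by simpa using h)
    have h2 := (hgpos i).length_le
    rw [h1] at h2
    simp only [List.length_nil] at h2
    omega
  · by_cases hi : i ≤ W.length
    · refine ⟨j, le_rfl, U ++ W.take (W.length - i), by simp; omega, ?_⟩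
      simp only [g, if_pos hi, wordDisp_append, wordDisp_wordPow]
      abel
    · obtain ⟨n, k, h1, h2⟩ := hline i (by omega)
      refine ⟨j + n, by omega, U ++ V.take k, by simp; omega, ?_⟩
      dsimp only
      rw [h2]
      simp only [wordDisp_append, wordDisp_wordPow]
      abel
  · obtain ⟨n, k, h1, h2⟩ := hline i hi
    exact ⟨j + n, k, h1, by rw [linePoint_natCast, ← h2]⟩

theorem alphaMax_of_mem_cover {v : ℤ × ℤ} (h : v ∈ G.cover x) :
    S.alphaMax v = some (G.tile x) := by
  obtain ⟨l, hl, rfl⟩ := mem_cover.1 h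
  exact (hG.grown_run hS hl).1

/-- An excursion can be repeated at all words that lead to the same vertex, unless it runs into the
word. -/
theorem grown_excursion {l : List Dir} (hl : G.Run G.root l x) {v : ℤ × ℤ} (hv : v ∈ G.cover x)
    {n : ℕ} (h : S.IsExcursion G.dom (fun i => v + wordPt w i) n)
    (hn : ∀ i, 0 < i → i ≤ n → wordDisp l + wordPt w i ∉ prefixPts l) :
    (∀ i ≤ n, S.alphaMax (wordDisp l + wordPt w i) = S.alphaMax (v + wordPt w i)) ∧
      S.Grown (prefixPts l ∪ (fun i => wordDisp l + wordPt w i) '' Set.Iic n) := by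
  have e : ∀ i, v + wordPt w i + (wordDisp l - v) = wordDisp l + wordPt w i := fun i => by abel
  have := TAS.grown_walk hS (hG.grown_run hS hl).2 (f := fun i => v + wordPt w i)
    (g := wordDisp l - v) (n := n) h.adj ?_ ?_ ?_ ?_
  · simpa only [e] using this
  · rw [e, wordPt_zero, add_zero]
    exact ⟨l, List.prefix_refl l, rfl⟩
  · rw [e, wordPt_zero, add_zero, add_zero, hG.alphaMax_of_mem_cover hS hv,
      (hG.grown_run hS hl).1]
  · intro i h1 h2 h3
    refine h.notMem i h1 h2 ?_
    rw [h3]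
    exact Run.mem_dom (l := []) (run_nil.2 rfl)
  · intro i h1 h2 h3
    rw [e] at h3
    exact absurd h3 (hn i h1 h2)

end IsQuipu

theorem abs_cross_le_of_mem_prefixPts {U V W : List Dir} {n : ℕ} {z : ℤ × ℤ}
    (h : z ∈ prefixPts (U ++ wordPow V n ++ W)) :
    |cross (wordDisp V) z| ≤ latNorm (wordDisp V) * (U.length + V.length + W.length) := by
  obtain ⟨l, hl, rfl⟩ := h
  rcases prefix_append_cases hl with h | ⟨t, h, rfl⟩
  · refine (abs_cross_prefix_le h).trans ?_
    have : (0 : ℤ) ≤ latNorm (wordDisp V) * W.length := by positivity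
    linarith
  · have h1 := abs_cross_wordDisp_le (wordDisp V) U
    have h2 := abs_cross_wordDisp_le (wordDisp V) t
    have h3 := abs_add_le (cross (wordDisp V) (wordDisp U)) (cross (wordDisp V) (wordDisp t))
    have h4 : (latNorm (wordDisp V) : ℤ) * t.length ≤ latNorm (wordDisp V) * W.length := by
      have := h.length_le
      gcongr
    have h5 : (0 : ℤ) ≤ latNorm (wordDisp V) * V.length := by positivity
    simp only [wordDisp_append, wordDisp_wordPow, cross_add_right, cross_nsmul_right, cross_same,
      mul_zero, add_zero]
    linarith

/-! ### Translates of rays that return to the domain -/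

namespace IsQuipu

variable {Γ : Type*} {S : TAS Γ} {G : LGraph Γ} (hS : S.Confluent) (hG : IsQuipu S G)
  {U V W U' V' W' A B C E F : List Dir} {x x' : G.V} {N : ℕ} {I : Set (G.V × Piece)}
  {w : ℕ → Dir} {τ : ℕ → ℕ} {R : Set ℕ}
include hS hG

/-- From the hit one can walk back to the cycle of the second ray and around it forever. Translated
by `c p`, this walk grows from the chase of `m + c`, which at time `τ m` is still outside the
domain. The path condition therefore makes it meet the domain infinitely often, and all but finitely
many of its points lie on the translated line. -/
theorem exists_frequently_linePoint (hpath : S.PathCondition G.dom) (hr : G.IsRay U V W x)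
    (hc : Chase G.dom (wordDisp U + wordDisp W) (wordDisp V) w τ R)
    (hexc : ∀ n, ∃ v ∈ G.cover x, S.IsExcursion G.dom (fun i => v + wordPt w i) n)
    (hr' : G.IsRay U' V' W' x') (hδ : cross (wordDisp V) (wordDisp V') ≠ 0)
    (hfr : ∀ K : ℕ, ∃ᶠ m in atTop, m ∈ R ∧ ∃ j ≥ K, wordDisp U + wordDisp W + m • wordDisp V +
      wordPt w (τ m) = wordDisp U' + wordDisp W' + j • wordDisp V') {c : ℕ} (hc0 : 0 < c) :
    ∃ k ≤ V'.length, ∃ᶠ n : ℕ in atTop, linePoint U' V' n k + c • wordDisp V ∈ G.dom := by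
  set a := wordDisp U + wordDisp W with ha
  set p := wordDisp V with hp
  let b : ℤ := latNorm p * (U.length + V.length + W.length)
  let b' : ℤ := latNorm p * (U'.length + V'.length + W'.length)
  -- On words of the first ray `cross p` is bounded by `b`, and on the bounded remainders along the
  -- walk by `b'`. Beyond `K` turns the walk is too far from the first ray to meet it.
  obtain ⟨K, hK⟩ := exists_natCast_gt (b + b')
  obtain ⟨m, hm, j, hj, hu⟩ := (hfr (K + 1)).exists
  obtain ⟨f, hf0, hfadj, hffin, hfD, hfne, hfl, M, hfM⟩ :=
    hG.exists_walk_of_isRay hS hr' (j := j) (by omega)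
  rw [← hu] at hf0
  have hbig : ∀ i, b < |cross p (f i)| := by
    intro i
    obtain ⟨n, hn, l, hl, h⟩ := hfl i
    have h1 : |cross p (wordDisp l)| ≤ b' := by
      refine (abs_cross_wordDisp_le _ _).trans ?_
      simp only [b']
      gcongr
      exact_mod_cast hl
    have h2 : (n : ℤ) ≤ |n * cross p (wordDisp V')| := by
      rw [abs_mul, Nat.abs_cast]
      exact le_mul_of_one_le_right (by positivity) (Int.one_le_abs hδ)
    have h3 : f i = n • wordDisp V' + wordDisp l := h
    have h4 := abs_sub_abs_le_abs_add (n * cross p (wordDisp V')) (cross p (wordDisp l))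
    rw [h3, cross_add_right, cross_nsmul_right]
    have h5 : (K : ℤ) < n := by exact_mod_cast hj.trans hn
    linarith
  obtain ⟨v, hv, hexcv⟩ := hexc (τ m)
  have hword : ∀ n, wordDisp (U ++ wordPow V n ++ W) = a + n • p := fun n => disp_ray ..
  obtain ⟨h1, -⟩ := hG.grown_excursion hS (hr.run m) hv hexcv fun i hi hi' h => by
    rw [hword] at h
    rcases hi'.lt_or_eq with hlt | rfl
    · obtain ⟨l, hl, hl'⟩ := h
      obtain ⟨y, hy⟩ := (hr.run m).exists_of_prefix hl
      exact hc.notMem m i hi hlt (hl' ▸ hy.mem_dom)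
    · rw [← hf0] at h
      exact absurd (abs_cross_le_of_mem_prefixPts h) (not_le.2 (hbig 0))
  obtain ⟨h2, h3⟩ := hG.grown_excursion hS (hr.run (m + c)) hv hexcv fun i hi hi' h => by
    rw [hword] at h
    obtain ⟨l, hl, hl'⟩ := h
    obtain ⟨y, hy⟩ := (hr.run (m + c)).exists_of_prefix hl
    exact hc.notMem (m + c) i hi (hi'.trans_lt (hc.lt m hm _ (by omega))) (hl' ▸ hy.mem_dom)
  simp only [hword] at h1 h2 h3
  have e : ∀ i, a + (m + c) • p + wordPt w i = a + m • p + wordPt w i + c • p := fun i => by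
    rw [add_smul]; abel
  have hinf := hpath.infinite_inter (f := fun i => f i + c • p) (fun i => ?_) (fun z => ?_) ?_
  · by_contra hcon
    push Not at hcon
    have hfin : ∀ k ∈ Set.Iic V'.length, {z | ∃ n : ℕ, linePoint U' V' n k + c • p ∈ G.dom ∧
        linePoint U' V' n k + c • p = z}.Finite := by
      intro k hk
      obtain ⟨n₀, hn₀⟩ := eventually_atTop.1 (hcon k hk)
      refine ((Set.finite_Iio n₀).image fun n : ℕ => linePoint U' V' n k + c • p).subset ?_
      rintro z ⟨n, hn, rfl⟩
      exact ⟨n, not_le.1 fun h => hn₀ n h hn, rfl⟩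
    refine hinf ((((Set.finite_Iio M).image fun i => f i + c • p).union
      ((Set.finite_Iic V'.length).biUnion hfin)).subset ?_)
    · rintro _ ⟨⟨i, rfl⟩, hi⟩
      rcases lt_or_ge i M with h | h
      · exact Or.inl ⟨i, h, rfl⟩
      · obtain ⟨n, k, hk, h4⟩ := hfM i h
        refine Or.inr (Set.mem_biUnion (Set.mem_Iic.2 hk) ⟨n, ?_, ?_⟩) <;> rw [← h4]
        exact hi
  · have key := fun n => TAS.grown_walk hS h3 (f := f) (g := c • p) (n := n)
      (fun i _ => hfadj i) ?_ ?_ (fun i _ _ => hfne i) ?_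
    · exact TAS.adj_translate (hfadj i) ((key (i + 1)).1 i (by omega))
        ((key (i + 1)).1 (i + 1) le_rfl)
    · rw [hf0, ← e]
      exact Or.inr ⟨τ m, Set.mem_Iic.2 le_rfl, rfl⟩
    · rw [hf0, ← e, h2 _ le_rfl, h1 _ le_rfl]
    -- The translated walk meets the grown set only at translates of its starting point: the run is
    -- too far away, and before time `τ m` the chase is outside the domain, whereas `f` stays
    -- inside.
    · rintro i hi - (h | ⟨s, hs, h⟩)
      · have h4 := abs_cross_le_of_mem_prefixPts h
        rw [cross_add_right, cross_nsmul_right, cross_same, mul_zero, add_zero] at h4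
        exact absurd h4 (not_le.2 (hbig i))
      · dsimp only at h
        rw [e] at h
        have h4 := add_right_cancel h
        rcases Nat.eq_zero_or_pos s with rfl | h5
        · rw [wordPt_zero, add_zero, ← hword] at h4
          have h6 := abs_cross_le_of_mem_prefixPts (z := f i) ⟨_, List.prefix_refl _, h4⟩
          exact absurd h6 (not_le.2 (hbig i))
        · rcases (Set.mem_Iic.1 hs).lt_or_eq with h6 | rfl
          · exact absurd (h4 ▸ hfD i) (hc.notMem m s h5 h6)
          · rw [hf0, h4]
  · exact (hffin (z - c • p)).subset fun n hn => eq_sub_of_add_eq hn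
  · rw [hf0]
    exact hc.add_notMem hm (hc.pos m) le_rfl hc0

end IsQuipu

/-! ### Chases that end on a transversal ray -/

theorem frequently_exists_finite {α ι : Type*} {l : Filter α} {I : Set ι} (hI : I.Finite)
    {P : ι → α → Prop} (h : ∃ᶠ n in l, ∃ i ∈ I, P i n) : ∃ i ∈ I, ∃ᶠ n in l, P i n := by
  by_contra hc
  push Not at hc
  refine h (((eventually_all_finite hI).2 hc).mono fun n hn => ?_)
  rintro ⟨i, hi, h⟩
  exact hn i hi h

theorem linePoint_add_nsmul (U V : List Dir) (j : ℤ) (k n : ℕ) :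
    linePoint U V j k + n • wordDisp V = linePoint U V (j + n) k := by
  rw [linePoint, linePoint, add_smul, natCast_zsmul]
  abel

theorem not_frequently_of_sep {T : Set (ℤ × ℤ)} {u p b : ℤ × ℤ} (h1 : cross u p < 0)
    (h : ∀ z ∈ T, cross u b ≤ cross u z) (a : ℤ × ℤ) : ¬ ∃ᶠ n : ℕ in atTop, a + n • p ∈ T := by
  intro hf
  obtain ⟨n, h2, h3⟩ := (hf.and_eventually
    (eventually_map_lt (φ := form 1 u) (p := p) (by simpa [form_apply] using h1) a 0
      (cross u b))).exists
  rw [form_apply, one_mul, add_zero] at h3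
  exact absurd (h _ h2) (not_le.2 h3)

namespace IsQuipu

variable {Γ : Type*} {S : TAS Γ} {G : LGraph Γ} (hS : S.Confluent) (hG : IsQuipu S G)
  {U V W U' V' W' A B C E F : List Dir} {x x' : G.V} {N : ℕ} {I : Set (G.V × Piece)}
  {w : ℕ → Dir} {τ : ℕ → ℕ} {R : Set ℕ}
include hG

/-- A piece that is met again and again in the direction of `V` cannot be separated from it, so it
is a ray with this vector or a fan with this edge. On such a ray `φ` is constant, but the values `φ
(g c)` are unbounded; so it is a fan, and its other vector has positive `φ`. -/
theorem exists_fan_of_frequently (hI : G.IsDecomposition N I) (hr : G.IsRay U V W x')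
    (hV : latNorm (wordDisp V) = N) {φ : ℤ × ℤ →+ ℤ} (hφ : φ (wordDisp V) = 0) {g : ℕ → ℤ × ℤ}
    (hg : Tendsto (fun c => φ (g c)) atTop atTop)
    (h : ∃ᶠ c in atTop, ∃ᶠ n : ℕ in atTop, g c + n • wordDisp V ∈ G.dom) :
    ∃ A B C E F x, G.IsFan A B C E F x ∧ latNorm (wordDisp B) = N ∧ latNorm (wordDisp E) = N ∧
      ∃ r, 0 < φ r ∧ (wordDisp B = wordDisp V ∧ wordDisp E = r ∨
        wordDisp E = wordDisp V ∧ wordDisp B = r) ∧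
      ∃ c n : ℕ, g c + n • wordDisp V ∈
        fanSet (wordDisp A + wordDisp C + wordDisp F) (wordDisp V) r := by
  have h1 : ∃ᶠ c : ℕ in atTop, ∃ i ∈ I, ∃ᶠ n : ℕ in atTop, g c + n • wordDisp V ∈ i.2.pts := by
    refine h.mono fun c hc => frequently_exists_finite hI.finite (hc.mono fun n hn => ?_)
    rw [hI.dom_eq] at hn
    simpa using hn
  obtain ⟨⟨x, P⟩, hi, h3⟩ := frequently_exists_finite hI.finite h1
  have hv := hI.valid _ hi
  obtain ⟨c, hc⟩ := h3.exists
  have hlarge : ∀ β : ℤ, ∃ c n : ℕ, β < φ (g c) ∧ g c + n • wordDisp V ∈ P.pts := fun β => by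
    obtain ⟨c, h4, h5⟩ := (h3.and_eventually (hg.eventually_gt_atTop β)).exists
    obtain ⟨n, hn⟩ := h4.exists
    exact ⟨c, n, h5, hn⟩
  have hval : ∀ c n : ℕ, φ (g c + n • wordDisp V) = φ (g c) := by
    intro c n
    rw [map_add, map_nsmul, hφ, smul_zero, add_zero]
  cases P with
  | point A =>
    exfalso
    obtain ⟨u, hu⟩ := exists_cross_neg (ne_zero_of_latNorm hI.pos hV)
    exact not_frequently_of_sep hu (b := wordDisp A) (fun z hz => by
      rw [Set.mem_singleton_iff.1 hz]) _ hc
  | ray U' V' W' =>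
    exfalso
    by_cases hV' : wordDisp V' = wordDisp V
    · obtain ⟨c, n, h4, l, h5⟩ := hlarge (φ (wordDisp U' + wordDisp W'))
      rw [← hval c n, h5, hV'] at h4
      simp only [map_add, map_nsmul, hφ, smul_zero, add_zero] at h4
      exact lt_irrefl _ h4
    · obtain ⟨u, h4, h5⟩ := exists_sep_ray hI.pos hV hv.2 hV'
      exact not_frequently_of_sep h4 (fun z hz => cross_le_of_mem_raySet h5 hz) _ hc
  | fan A B C E F =>
    obtain ⟨hf, hB, hE⟩ := hv
    refine ⟨A, B, C, E, F, x, hf, hB, hE, ?_⟩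
    have key : ∀ r, fanSet (wordDisp A + wordDisp C + wordDisp F) (wordDisp B) (wordDisp E) =
        fanSet (wordDisp A + wordDisp C + wordDisp F) (wordDisp V) r → 0 < φ r ∧ ∃ c n : ℕ,
        g c + n • wordDisp V ∈
          fanSet (wordDisp A + wordDisp C + wordDisp F) (wordDisp V) r := by
      intro r h4
      obtain ⟨c, n, h5, h6⟩ := hlarge (φ (wordDisp A + wordDisp C + wordDisp F))
      rw [Piece.pts, h4] at h6
      refine ⟨?_, c, n, h6⟩
      obtain ⟨l, l', h7⟩ := h6
      rw [← hval c n, h7] at h5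
      simp only [map_add, map_nsmul, hφ, smul_zero, add_zero, lt_add_iff_pos_right] at h5
      rw [nsmul_eq_mul] at h5
      exact pos_of_mul_pos_right h5 (by positivity)
    by_cases h4 : wordDisp B = wordDisp V
    · obtain ⟨h5, h6⟩ := key (wordDisp E) (by rw [h4])
      exact ⟨_, h5, Or.inl ⟨h4, rfl⟩, h6⟩
    by_cases h5 : wordDisp E = wordDisp V
    · obtain ⟨h6, h7⟩ := key (wordDisp B) (by rw [h5, fanSet_symm])
      exact ⟨_, h6, Or.inr ⟨h5, rfl⟩, h7⟩
    exfalso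
    obtain ⟨u, h6, h7, h8⟩ := exists_sep_fan hI.pos hV hB hE (hG.cross_ne_zero hf)
      (hG.exterior hr hf) (Ne.symm h4) (Ne.symm h5)
    exact not_frequently_of_sep h6 (fun z hz => cross_le_of_mem_fanSet h7 h8 hz) _ hc

include hS in
-- The translates of the second ray by multiples of `p` return to the domain, so there is a fan with
-- edge `p'` on the side of `p`. Late chases start far out in direction `p` and end on the second
-- ray; they have to cross a line of this fan, at a negative index. The line of the first ray, in
-- one case together with that of the second, confines a crossing to a finite box, against
-- `Chase.far`.
theorem not_frequently_ray (hpath : S.PathCondition G.dom) (hI : G.IsDecomposition N I)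
    (hr : G.IsRay U V W x)
    (hc : Chase G.dom (wordDisp U + wordDisp W) (wordDisp V) w τ R)
    (hexc : ∀ n, ∃ v ∈ G.cover x, S.IsExcursion G.dom (fun i => v + wordPt w i) n)
    (hr' : G.IsRay U' V' W' x') (hVN' : latNorm (wordDisp V') = N)
    (hδ : cross (wordDisp V) (wordDisp V') ≠ 0) :
    ¬ ∀ K : ℕ, ∃ᶠ m in atTop, m ∈ R ∧ ∃ j ≥ K, wordDisp U + wordDisp W + m • wordDisp V +
      wordPt w (τ m) = wordDisp U' + wordDisp W' + j • wordDisp V' := by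
  intro hfr
  have hδ' : 0 < cross (wordDisp V') (wordDisp V) * cross (wordDisp V') (wordDisp V) :=
    mul_self_pos.2 (by rw [cross_comm]; exact neg_ne_zero.2 hδ)
  choose! k hk hkn using fun c => hG.exists_frequently_linePoint hS hpath hr hc hexc hr' hδ hfr (c := c)
  obtain ⟨A, B, C, E, F, y, hf, -, -, r, hr0, hfan, -⟩ := hG.exists_fan_of_frequently hI hr' hVN'
    (φ := form (cross (wordDisp V') (wordDisp V)) (wordDisp V')) (form_self ..)
    (g := fun c => wordDisp U' + c • wordDisp V + wordDisp (V'.take (k c))) (by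
      refine tendsto_atTop.2 fun β => ?_
      obtain ⟨n, hn⟩ := exists_natCast_gt (β - form (cross (wordDisp V') (wordDisp V)) (wordDisp V')
        (wordDisp U') + |cross (wordDisp V') (wordDisp V)| * (latNorm (wordDisp V') * V'.length))
      refine (eventually_ge_atTop n).mono fun c hc => ?_
      rw [map_add, map_add, form_nsmul]
      have h1 := neg_le_of_abs_le (abs_form_take_le (cross (wordDisp V') (wordDisp V))
        (wordDisp V') V' (k c))
      have h2 : (n : ℤ) ≤ c := by exact_mod_cast hc
      have h3 : (c : ℤ) ≤ c * form (cross (wordDisp V') (wordDisp V)) (wordDisp V')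
        (wordDisp V) := le_mul_of_one_le_right (by positivity) hδ'
      linarith)
    ((eventually_gt_atTop 0).mono fun c hc => (hkn c hc).mono fun n hn => by
      convert hn using 1
      rw [linePoint, natCast_zsmul]
      abel).frequently
  replace hfan : (wordDisp B = wordDisp V' ∧
      0 < cross (wordDisp V') (wordDisp V) * cross (wordDisp V') (wordDisp E)) ∨
      (wordDisp E = wordDisp V' ∧
      0 < cross (wordDisp V') (wordDisp V) * cross (wordDisp V') (wordDisp B)) := by
    rcases hfan with ⟨h1, rfl⟩ | ⟨h1, rfl⟩
    · exact Or.inl ⟨h1, hr0⟩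
    · exact Or.inr ⟨h1, hr0⟩
  clear hδ' hkn hk hr0
  have hp0 := hG.disp_ne_zero hr
  have hp0' := hG.disp_ne_zero hr'
  have hq0 := hG.disp_ne_zero (hf.ray_right 0)
  have hextp := hG.exterior hr hf
  -- Even at negative indices a chase does not meet the line of its own ray: a translate by a
  -- multiple of `p` would have nonnegative index and lie in the domain.
  have hline : ∀ m ∈ R, ∀ i, 0 < i → i ≤ τ m → ∀ j k, wordDisp U + wordDisp W + m • wordDisp V +
      wordPt w i ≠ linePoint U V j k := by
    intro m hm i hi hi' j k h
    have h1 := hc.add_notMem hm hi hi' (n := j.natAbs + 1) (by omega)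
    refine h1 ?_
    rw [h]
    rw [linePoint_add_nsmul]
    exact hr.linePoint_mem' (by omega) k
  generalize hp : wordDisp V = p at *
  generalize hp' : wordDisp V' = p' at *
  generalize ha : wordDisp U + wordDisp W = a at *
  generalize wordDisp U' + wordDisp W' = b' at *
  set δ := cross p p' with hδd
  have hδ2 : 0 < δ * δ := mul_self_pos.2 hδ
  obtain ⟨cS, hcS0, hcS, hcrossS⟩ := exists_mem_line_form (V := V) (by rwa [hp]) hδ
  obtain ⟨cZ, hcZ0, hcZ, hcrossZ⟩ := exists_mem_line_form (V := V') (by rwa [hp'])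
    (neg_ne_zero.2 hδ)
  rw [hp] at hcS hcrossS
  rw [hp'] at hcZ hcrossZ
  set X := form (-δ) p' with hX
  set Y := form δ p with hY
  have hXp : X p = δ * δ := by rw [hX, form_apply, cross_comm]; ring
  have hYp' : Y p' = δ * δ := rfl
  have hYp : Y p = 0 := form_self ..
  have hXp' : X p' = 0 := form_self ..
  have hXr : ∀ r, 0 < cross p' p * cross p' r ↔ 0 < X r := fun r => by
    rw [hX, form_apply, cross_comm p' p]
  have hsteps := fun m : ℕ => Chase.steps (a + m • p) w
  have hYlow : ∀ m ∈ R, Y (wordDisp U) + cS < Y (a + m • p + wordPt w (τ m)) →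
      ∀ i, 0 < i → i ≤ τ m → Y (wordDisp U) - cS ≤ Y (a + m • p + wordPt w i) := by
    intro m hm h1 i hi hi'
    by_contra h2
    obtain ⟨i', h3, h4, j, k, h5⟩ := hcrossS U (fun i => a + m • p + wordPt w i) (hsteps m)
      i (τ m) hi' (Or.inl ⟨not_le.1 h2, h1⟩)
    exact hline m hm i' (by omega) h4.le j k h5
  have hYend : ∀ β : ℤ, ∃ K : ℕ, ∀ m, (∃ j ≥ K, a + m • p + wordPt w (τ m) = b' + j • p') →
      β < Y (a + m • p + wordPt w (τ m)) := by
    intro β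
    obtain ⟨K, hK⟩ := exists_natCast_gt (β - Y b')
    refine ⟨K, ?_⟩
    rintro m ⟨j, hj, h⟩
    have hj' : (K : ℤ) ≤ j := by exact_mod_cast hj
    rw [h, map_add, map_nsmul, nsmul_eq_mul, hYp']
    nlinarith
  have hXstart : ∀ β : ℤ, ∀ᶠ m : ℕ in atTop, β < X (a + m • p + wordPt w 1) := fun β =>
    eventually_lt_map (by rw [hXp]; exact hδ2) a _ β
  obtain ⟨K₀, hK₀⟩ := hYend (Y (wordDisp U) + cS)
  have hXT : ∀ (φ : ℤ × ℤ →+ ℤ) (t : ℕ), φ (wordDisp (A ++ wordPow B t ++ C)) =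
      φ (wordDisp A) + t * φ (wordDisp B) + φ (wordDisp C) := fun φ t => by
    rw [wordDisp_append, wordDisp_append, wordDisp_wordPow, map_add, map_add, map_nsmul,
      nsmul_eq_mul]
  obtain ⟨cE, hcE0, hcE, hcrossE⟩ := exists_mem_line_form hq0 (neg_ne_zero.2 hδ)
  rcases hfan with ⟨hB, hr0⟩ | ⟨hE, hr0⟩
  · have hXr0 := (hXr _).1 hr0
    rw [hB] at hextp
    generalize hr1 : wordDisp E = r at *
    rw [hB] at hXT
    -- Otherwise `p` would lie in the interior of the cone spanned by `p'` and `r`.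
    have hYr : 0 ≤ Y r := by
      have h1 : ¬ 0 < cross p r * cross p' r := fun h => hextp ⟨h, hr0⟩
      have h2 : Y r * X r = δ * δ * -(cross p r * cross p' r) := by
        rw [hX, hY, form_apply, form_apply]; ring
      refine nonneg_of_mul_nonneg_left ?_ hXr0
      rw [h2]
      exact mul_nonneg hδ2.le (by linarith)
    set Z := form (-δ) r with hZ
    have hZp : Z p = Y r := by rw [hZ, hY, form_apply, form_apply, cross_comm]; ring
    have hZp' : Z p' = -X r := by rw [hZ, hX, form_apply, form_apply, cross_comm]; ring
    have hne : cross p' r ≠ 0 := by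
      intro h
      rw [h, mul_zero] at hr0
      exact lt_irrefl _ hr0
    -- Turns along `p'` lower `Z`, and `p` does not, so with many turns the line through `T` lies
    -- below the starts of all chases at once.
    obtain ⟨t, ht⟩ := exists_natCast_gt
      (Z (wordDisp A) + Z (wordDisp C) + cE - Z a - Z (wordPt w 1))
    have hT := hXT Z t
    have hray := hf.ray_right t
    generalize A ++ wordPow B t ++ C = T at hT hray
    obtain ⟨K, hK⟩ := exists_natCast_gt (Z b' - Z (wordDisp T) + cE)
    have hfin1 := hc.far _ (finite_box hδ hδ (neg_ne_zero.2 hδ) (Y (wordDisp U) - cS)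
      (Y (wordDisp U') + |δ| * (latNorm p * V'.length)) (X (wordDisp U') - cZ)
      (X (wordDisp U') + cZ))
    have hfin2 := hc.far _ (finite_box hne (neg_ne_zero.2 hδ) (neg_ne_zero.2 hδ)
      (X (wordDisp U') - cZ) (X (wordDisp T) + |(-δ)| * (latNorm p' * E.length))
      (Z (wordDisp T) - cE) (Z (wordDisp T) + cE))
    obtain ⟨m, ⟨⟨⟨hm, j, hj, hu⟩, h1⟩, h2⟩, h3⟩ := (((hfr (max K K₀)).and_eventually
      hfin1).and_eventually hfin2).and_eventually (hXstart (X (wordDisp U') + cZ)) |>.exists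
    have hYl := hYlow m hm (hK₀ m ⟨j, (le_max_right _ _).trans hj, hu⟩)
    -- A chase that came below the line with period `V'` would cross it at a negative index, inside
    -- the first box.
    have hXl : ∀ i, 0 < i → i ≤ τ m → i < τ m →
        X (wordDisp U') - cZ ≤ X (a + m • p + wordPt w i) := by
      intro i hi _ hi'
      by_contra h4
      obtain ⟨i', h5, h6, j, k, h7⟩ := hcrossZ U' (fun i => a + m • p + wordPt w i) (hsteps m)
        1 i hi (Or.inr ⟨h3, not_le.1 h4⟩)
      have hj : j < 0 := Chase.neg_of_notMem hr' (h7 ▸ hc.notMem m i' (by omega) (by omega))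
      have h8 := abs_le.1 (hcZ U' j k)
      rw [← h7] at h8
      refine h1 i' (by omega) (by omega) ⟨⟨hYl i' (by omega) (by omega), ?_⟩, ?_, ?_⟩
      · rw [h7]
        exact form_linePoint_le hj k (by rw [hp', ← hY, hYp']; exact hδ2.le)
      · change X _ - _ ≤ X _
        linarith
      · change X _ ≤ X _ + _
        linarith
    have hstart : Z (wordDisp T) + cE < Z (a + m • p + wordPt w 1) := by
      rw [map_add, map_add, map_nsmul, nsmul_eq_mul, hZp, hT, hZp']
      have : 0 ≤ (m : ℤ) * Y r := by positivity
      nlinarith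
    have hend : Z (a + m • p + wordPt w (τ m)) < Z (wordDisp T) - cE := by
      rw [hu, map_add, map_nsmul, nsmul_eq_mul, hZp']
      have : (K : ℤ) ≤ j := by exact_mod_cast (le_max_left _ _).trans hj
      nlinarith
    obtain ⟨i, h5, h6, j, k, h7⟩ := hcrossE T (fun i => a + m • p + wordPt w i) (hsteps m)
      1 (τ m) (hc.pos m) (Or.inr ⟨hstart, hend⟩)
    have hj : j < 0 := Chase.neg_of_notMem hray (h7 ▸ hc.notMem m i (by omega) h6)
    have h8 := abs_le.1 (hcE T j k)
    rw [← h7] at h8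
    refine h2 i (by omega) h6.le ⟨⟨hXl i (by omega) h6.le h6, ?_⟩, ?_, ?_⟩
    · rw [h7]
      exact form_linePoint_le hj k (by rw [hr1]; exact hXr0.le)
    · change Z _ - _ ≤ Z _
      linarith
    · change Z _ ≤ Z _ + _
      linarith
  · have hXr0 := (hXr _).1 hr0
    rw [hE] at hcE hcrossE
    -- In this case the line through `T` is parallel to the ray that is hit and lies between it and
    -- the starts of late chases.
    obtain ⟨t, ht⟩ := exists_natCast_gt (X b' + cE - X (wordDisp A) - X (wordDisp C))
    have hT := hXT X t
    have hray := hf.ray_right t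
    generalize A ++ wordPow B t ++ C = T at hT hray
    obtain ⟨m, ⟨⟨hm, j, hj, hu⟩, h1⟩, h3⟩ := ((hfr K₀).and_eventually (hc.far _ (finite_box hδ hδ
      (neg_ne_zero.2 hδ) (Y (wordDisp U) - cS) (Y (wordDisp T) + |δ| * (latNorm p * E.length))
      (X (wordDisp T) - cE) (X (wordDisp T) + cE)))).and_eventually
      (hXstart (X (wordDisp T) + cE)) |>.exists
    have hYl := hYlow m hm (hK₀ m ⟨j, hj, hu⟩)
    have hend : X (a + m • p + wordPt w (τ m)) < X (wordDisp T) - cE := by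
      rw [hu, map_add, map_nsmul, hXp', smul_zero, add_zero, hT]
      nlinarith
    obtain ⟨i, h5, h6, j, k, h7⟩ := hcrossE T (fun i => a + m • p + wordPt w i) (hsteps m)
      1 (τ m) (hc.pos m) (Or.inr ⟨h3, hend⟩)
    have hj : j < 0 := Chase.neg_of_notMem hray (h7 ▸ hc.notMem m i (by omega) h6)
    have h8 := abs_le.1 (hcE T j k)
    refine h1 i (by omega) h6.le ⟨⟨hYl i (by omega) h6.le, ?_⟩, ?_, ?_⟩
    · rw [h7]
      exact form_linePoint_le hj k (by rw [hE, ← hY, hYp']; exact hδ2.le)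
    · rw [h7]
      change X _ - _ ≤ X _
      linarith
    · rw [h7]
      change X _ ≤ X _ + _
      linarith

end IsQuipu

/-! ### Existence of chases, and excursions from a ray -/

theorem eventually_add_nsmul_notMem {K : Set (ℤ × ℤ)} (hK : K.Finite) {p : ℤ × ℤ} (hp : p ≠ 0)
    (a z : ℤ × ℤ) : ∀ᶠ m : ℕ in atTop, a + m • p + z ∉ K := by
  rw [← Nat.cofinite_eq_atTop]
  refine (hK.preimage (f := fun m : ℕ => a + m • p + z) ?_).compl_mem_cofinite
  intro m _ n _ h
  have h1 : m • p = n • p := add_left_cancel (add_right_cancel h)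
  rw [← natCast_zsmul, ← natCast_zsmul p] at h1
  exact_mod_cast smul_left_injective ℤ hp h1

/-- Beyond any `M`, take the last index at which `τ` attains its minimum over the indices from `M`
on. -/
theorem frequently_lt_of_tendsto {τ : ℕ → ℕ} (h : Tendsto τ atTop atTop) :
    ∃ᶠ m in atTop, ∀ m', m < m' → τ m < τ m' := by
  rw [frequently_atTop]
  intro M
  have hne : ∃ v, ∃ m ≥ M, τ m = v := ⟨_, M, le_rfl, rfl⟩
  classical
  have hfin : {m | M ≤ m ∧ τ m = Nat.find hne}.Finite := by
    obtain ⟨n, hn⟩ := eventually_atTop.1 (h.eventually_gt_atTop (Nat.find hne))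
    exact (Set.finite_Iio n).subset fun m hm => not_le.1 fun h => (hn m h).ne' hm.2
  obtain ⟨m, ⟨h1, h2⟩, h3⟩ := hfin.exists_maximal (Nat.find_spec hne)
  refine ⟨m, h1, fun m' hm' => ?_⟩
  have h4 : Nat.find hne ≤ τ m' := Nat.find_min' hne ⟨m', by omega, rfl⟩
  refine lt_of_le_of_ne (h2 ▸ h4) fun h5 => ?_
  have := h3 (y := m') ⟨by omega, by omega⟩ hm'.le
  omega

namespace IsQuipu

variable {Γ : Type*} {S : TAS Γ} {G : LGraph Γ} (hS : S.Confluent) (hG : IsQuipu S G)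
  {U V W U' V' W' A B C E F : List Dir} {x x' : G.V} {N : ℕ} {I : Set (G.V × Piece)}
  {w : ℕ → Dir} {τ : ℕ → ℕ} {R : Set ℕ}
include hS hG

theorem isExcursion_of_notMem {l : List Dir} (hl : G.Run G.root l x) {v : ℤ × ℤ}
    (hv : v ∈ G.cover x) {n : ℕ} (h : S.IsExcursion G.dom (fun i => v + wordPt w i) n)
    (hn : ∀ i, 0 < i → i ≤ n → wordDisp l + wordPt w i ∉ G.dom) :
    S.IsExcursion G.dom (fun i => wordDisp l + wordPt w i) n := by
  have h1 := (hG.grown_excursion hS hl hv h fun i h1 h2 ⟨l', h3, h4⟩ => by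
    obtain ⟨y, hy⟩ := hl.exists_of_prefix h3
    exact hn i h1 h2 (h4 ▸ hy.mem_dom)).1
  have e : ∀ i, v + wordPt w i + (wordDisp l - v) = wordDisp l + wordPt w i := fun i => by abel
  refine ⟨fun i hi => ?_, hn, fun i j hi hj hij => h.inj i j hi hj ?_⟩
  · have := TAS.adj_translate (g := wordDisp l - v) (h.adj i hi) (by rw [e]; exact h1 i hi.le)
      (by rw [e]; exact h1 (i + 1) hi)
    rwa [e, e] at this
  · have := add_left_cancel hij
    rw [this]

/-- A chase ends because excursions from one point are bounded, and by `h1` it ends later and later.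
Read backwards, a chase that meets a finite set late is a long excursion from this set, and those
are bounded too; this gives `Chase.far`. -/
theorem exists_chase (hpath : S.PathCondition G.dom) (hr : G.IsRay U V W x)
    (h1 : ∀ s, 0 < s → ∀ᶠ m : ℕ in atTop,
      wordDisp U + wordDisp W + m • wordDisp V + wordPt w s ∉ G.dom)
    (h2 : ∀ n, ∃ v ∈ G.cover x, S.IsExcursion G.dom (fun i => v + wordPt w i) n) :
    ∃ τ R, Chase G.dom (wordDisp U + wordDisp W) (wordDisp V) w τ R := by
  classical
  have hp0 := hG.disp_ne_zero hr
  have hword : ∀ n, wordDisp (U ++ wordPow V n ++ W) = wordDisp U + wordDisp W + n • wordDisp V :=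
    fun n => disp_ray ..
  set a := wordDisp U + wordDisp W
  set p := wordDisp V
  have hexc : ∀ m n : ℕ, (∀ i, 0 < i → i ≤ n → a + m • p + wordPt w i ∉ G.dom) →
      S.IsExcursion G.dom (fun i => a + m • p + wordPt w i) n := by
    intro m n h
    obtain ⟨v, hv, h3⟩ := h2 n
    have := hG.isExcursion_of_notMem hS (hr.run m) hv h3
    rw [hword] at this
    exact this h
  have hex : ∀ m : ℕ, ∃ i, 0 < i ∧ a + m • p + wordPt w i ∈ G.dom := by
    intro m
    by_contra! h
    obtain ⟨L, hL⟩ := hpath.bounded (a + m • p)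
    have := hL _ (L + 1) (by simp) (hexc m (L + 1) fun i hi _ => h i hi)
    omega
  let τ := fun m => Nat.find (hex m)
  have hpos : ∀ m, 0 < τ m := fun m => (Nat.find_spec (hex m)).1
  have hhit : ∀ m, a + m • p + wordPt w (τ m) ∈ G.dom := fun m => (Nat.find_spec (hex m)).2
  have hnot : ∀ m i, 0 < i → i < τ m → a + m • p + wordPt w i ∉ G.dom := fun m i h3 h4 h5 =>
    Nat.find_min (hex m) h4 ⟨h3, h5⟩
  have hτ : Tendsto τ atTop atTop := by
    rw [tendsto_atTop]
    intro s
    have : ∀ᶠ m : ℕ in atTop, ∀ i ∈ Set.Ioo 0 s, a + m • p + wordPt w i ∉ G.dom :=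
      (eventually_all_finite (Set.finite_Ioo 0 s)).2 fun i hi => h1 i hi.1
    refine this.mono fun m hm => not_lt.1 fun h => hm (τ m) ⟨hpos m, h⟩ (hhit m)
  refine ⟨τ, {m | ∀ m', m < m' → τ m < τ m'}, hpos, hhit, hnot, fun m hm => hm,
    frequently_lt_of_tendsto hτ, fun K hK => ?_⟩
  -- The hit lies in the domain and cannot start a backward excursion; the neighbours of `K` are
  -- added so that the step before the hit can be used.
  let K' : Set (ℤ × ℤ) := K ∪ ⋃ d : Dir, (fun z => z - d.vec) '' K
  have hK' : K'.Finite := hK.union (Set.finite_iUnion fun d => hK.image _)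
  obtain ⟨L, hL⟩ := hpath.bounded_of_finite hK'
  have hlen : ∀ m i : ℕ, i < τ m → a + m • p + wordPt w i ∈ K' → i ≤ L + 1 := by
    intro m i hi h3
    have h4 := hexc m i fun k h5 h6 => hnot m k h5 (by omega)
    have h5 := hL (fun k => a + m • p + wordPt w (i - k)) (i - 1) h3
      ⟨fun k hk => ?_, fun k h6 h7 => hnot m _ (by omega) (by omega), fun k k' h6 h7 h8 => ?_⟩
    · omega
    · have := (h4.adj (i - (k + 1)) (by omega)).symm
      convert this using 3
      omega
    · have := h4.inj (i - k) (i - k') (by omega) (by omega) h8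
      omega
  have h3 : ∀ᶠ m : ℕ in atTop, ∀ i ∈ Set.Iic (L + 1), a + m • p + wordPt w i ∉ K' :=
    (eventually_all_finite (Set.finite_Iic (L + 1))).2 fun i _ =>
      eventually_add_nsmul_notMem hK' hp0 a _
  refine h3.mono fun m h4 i hi hi' h6 => ?_
  rcases hi'.lt_or_eq with h7 | rfl
  · exact h4 i (hlen m i h7 (Or.inl h6)) (Or.inl h6)
  · obtain ⟨n, hn⟩ := Nat.exists_eq_add_of_le' hi
    have h7 : a + m • p + wordPt w n ∈ K' := by
      refine Or.inr (Set.mem_iUnion.2 ⟨w n, _, h6, ?_⟩)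
      dsimp only
      rw [hn, wordPt_succ]
      abel
    exact h4 n (hlen m n (by omega) h7) h7

theorem not_frequently_mem_ray (hpath : S.PathCondition G.dom) (hI : G.IsDecomposition N I)
    (hr : G.IsRay U V W x) (hV : latNorm (wordDisp V) = N)
    (hc : Chase G.dom (wordDisp U + wordDisp W) (wordDisp V) w τ R)
    (hexc : ∀ n, ∃ v ∈ G.cover x, S.IsExcursion G.dom (fun i => v + wordPt w i) n)
    (hr' : G.IsRay U' V' W' x') (hV' : latNorm (wordDisp V') = N) :
    ¬ ∃ᶠ m : ℕ in atTop, m ∈ R ∧ wordDisp U + wordDisp W + m • wordDisp V + wordPt w (τ m) ∈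
      raySet (wordDisp U' + wordDisp W') (wordDisp V') := by
  intro h
  have hsub : raySet (wordDisp U' + wordDisp W') (wordDisp V') ⊆ G.dom := by
    rintro z ⟨n, rfl⟩
    rw [← disp_ray]
    exact (hr'.run n).mem_dom
  by_cases hδ : cross (wordDisp V) (wordDisp V') = 0
  · rcases eq_or_eq_neg_of_cross_eq_zero hδ hI.pos hV hV' with h1 | h1 <;> rw [h1] at h hsub
    · exact hc.not_frequently_raySet_self _ hsub h
    · exact hc.not_frequently_raySet_neg _ hsub h
  · refine hG.not_frequently_ray hS hpath hI hr hc hexc hr' hV' hδ fun K => ?_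
    refine (h.and_eventually (hc.far _ ((Set.finite_Iio K).image fun j =>
      wordDisp U' + wordDisp W' + j • wordDisp V'))).mono ?_
    rintro m ⟨⟨hm, j, hj⟩, h2⟩
    refine ⟨hm, j, ?_, hj⟩
    by_contra h3
    exact h2 (τ m) (hc.pos m) le_rfl ⟨j, not_le.1 h3, hj.symm⟩

/-- There is no infinite word that can be followed arbitrarily far outside the domain from the
points of a ray. -/
theorem not_excursions_ray (hpath : S.PathCondition G.dom) (hI : G.IsDecomposition N I)
    (hr : G.IsRay U V W x) (hV : latNorm (wordDisp V) = N)
    (h1 : ∀ s, 0 < s → ∀ᶠ m : ℕ in atTop,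
      wordDisp U + wordDisp W + m • wordDisp V + wordPt w s ∉ G.dom) :
    ¬ ∀ n, ∃ v ∈ G.cover x, S.IsExcursion G.dom (fun i => v + wordPt w i) n := by
  intro h2
  obtain ⟨τ, R, hc⟩ := hG.exists_chase hS hpath hr h1 h2
  -- Infinitely many hits of chases with `m ∈ R` fall into one piece; each kind of piece is
  -- excluded.
  obtain ⟨⟨y, P⟩, hi, h3⟩ := frequently_exists_finite hI.finite (l := atTop) (P := fun i (m : ℕ) => m ∈ R ∧
    wordDisp U + wordDisp W + m • wordDisp V + wordPt w (τ m) ∈ i.2.pts)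
    (hc.frequently.mono fun m hm => by
      have := hc.hit m
      rw [hI.dom_eq] at this
      obtain ⟨i, hi, h⟩ := Set.mem_iUnion₂.1 this
      exact ⟨i, hi, hm, h⟩)
  have hv := hI.valid _ hi
  cases P with
  | point A => exact hc.not_frequently_singleton _ h3
  | ray U' V' W' => exact hG.not_frequently_mem_ray hS hpath hI hr hV hc h2 hv.1 hv.2 h3
  | fan A B C E F =>
    obtain ⟨hf, hB, hE⟩ := hv
    refine hG.not_frequently_fan hI.pos hr hV hc hf hB hE (b := wordDisp A + wordDisp C + wordDisp F)
      ?_ fun K => ?_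
    · rintro z ⟨m, k, rfl⟩
      rw [← disp_fan]
      exact (hf.run m k).mem_dom
    -- Hits that are not deep in the fan lie on finitely many rays along its two edges.
    by_contra h4
    have h5 := (h3.and_eventually (not_frequently.1 h4)).mono (q := fun m =>
      (∃ i ∈ Set.Iio K, m ∈ R ∧ wordDisp U + wordDisp W + m • wordDisp V + wordPt w (τ m) ∈
        raySet (wordDisp (A ++ wordPow B i ++ C) + wordDisp F) (wordDisp E)) ∨
      (∃ j ∈ Set.Iio K, m ∈ R ∧ wordDisp U + wordDisp W + m • wordDisp V + wordPt w (τ m) ∈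
        raySet (wordDisp A + wordDisp (C ++ wordPow E j ++ F)) (wordDisp B))) fun m hm => by
      obtain ⟨⟨hm, i, j, hij⟩, h6⟩ := hm
      by_cases h7 : i < K
      · refine Or.inl ⟨i, h7, hm, j, ?_⟩
        rw [hij, wordDisp_append, wordDisp_append, wordDisp_wordPow]
        abel
      · refine Or.inr ⟨j, ?_, hm, i, ?_⟩
        · by_contra h8
          exact h6 ⟨hm, i, not_lt.1 h7, j, not_lt.1 h8, hij⟩
        · rw [hij, wordDisp_append, wordDisp_append, wordDisp_wordPow]
          abel
    rcases frequently_or_distrib.1 h5 with h5 | h5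
    · obtain ⟨i, -, h6⟩ := frequently_exists_finite (Set.finite_Iio K) h5
      exact hG.not_frequently_mem_ray hS hpath hI hr hV hc h2 (hf.ray_right i) hE h6
    · obtain ⟨i, -, h6⟩ := frequently_exists_finite (Set.finite_Iio K) h5
      exact hG.not_frequently_mem_ray hS hpath hI hr hV hc h2 (hf.ray_left i) hB h6

end IsQuipu

/-! ### Excursions from a fan -/

namespace IsQuipu

variable {Γ : Type*} {S : TAS Γ} {G : LGraph Γ} (hS : S.Confluent) (hG : IsQuipu S G)
  {U V W U' V' W' A B C E F : List Dir} {x x' : G.V} {N : ℕ} {I : Set (G.V × Piece)}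
  {w : ℕ → Dir}
include hS hG

/-- There is no infinite word that can be followed arbitrarily far outside the domain from the
points of a fan. -/
theorem not_excursions_fan (hpath : S.PathCondition G.dom) (hI : G.IsDecomposition N I)
    (hf : G.IsFan A B C E F x) (hB : latNorm (wordDisp B) = N) (hE : latNorm (wordDisp E) = N)
    (h1 : ∀ s, 0 < s → ∃ M : ℕ, ∀ m ≥ M, ∀ k ≥ M, wordDisp A + wordDisp C + wordDisp F +
      m • wordDisp B + k • wordDisp E + wordPt w s ∉ G.dom) :
    ¬ ∀ n, ∃ v ∈ G.cover x, S.IsExcursion G.dom (fun i => v + wordPt w i) n := by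
  intro h2
  obtain ⟨a, ha⟩ : ∃ a, a = wordDisp A + wordDisp C + wordDisp F := ⟨_, rfl⟩
  -- For fixed `m` the fan contains a ray, and `not_excursions_ray` must fail to apply to it; `s m`
  -- will be the first time at which it does.
  have hone : ∀ m : ℕ, ∃ s, 0 < s ∧ ¬ ∀ᶠ k : ℕ in atTop,
      a + m • wordDisp B + k • wordDisp E + wordPt w s ∉ G.dom := by
    intro m
    by_contra! h
    refine hG.not_excursions_ray hS hpath hI (hf.ray_right m) hE (fun s hs => ?_) h2
    refine (h s hs).mono fun k hk => ?_
    convert hk using 3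
    rw [ha, wordDisp_append, wordDisp_append, wordDisp_wordPow]
    abel
  classical
  let s : ℕ → ℕ := fun m => Nat.find (hone m)
  have hs0 : ∀ m, 0 < s m := fun m => (Nat.find_spec (hone m)).1
  have hs1 : ∀ m : ℕ, ∃ᶠ k : ℕ in atTop, a + m • wordDisp B + k • wordDisp E + wordPt w (s m) ∈ G.dom :=
    fun m h => (Nat.find_spec (hone m)).2 h
  have hs2 : ∀ m i : ℕ, 0 < i → i < s m → ∀ᶠ k : ℕ in atTop,
      a + m • wordDisp B + k • wordDisp E + wordPt w i ∉ G.dom := fun m i hi hi' =>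
    not_not.1 fun h => Nat.find_min (hone m) hi' ⟨hi, h⟩
  have hδ := hG.cross_ne_zero hf
  have hp0 := hG.disp_ne_zero (hf.ray_left 0)
  have hq0 := hG.disp_ne_zero (hf.ray_right 0)
  obtain ⟨p, hp⟩ : ∃ p, p = wordDisp B := ⟨_, rfl⟩
  obtain ⟨q, hq⟩ : ∃ q, q = wordDisp E := ⟨_, rfl⟩
  obtain ⟨δ, hδd⟩ : ∃ δ, δ = cross p q := ⟨_, rfl⟩
  have hδ0 : δ ≠ 0 := by rw [hδd, hp, hq]; exact hδ
  have hδ2 : 0 < δ * δ := mul_self_pos.2 hδ0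
  obtain ⟨c, hc0, hc, hcross⟩ := exists_mem_line_form hq0 (neg_ne_zero.2 hδ0)
  rw [← hq] at hc hcross
  set X := form (-δ) q with hX
  have hXp : X p = δ * δ := by rw [hX, form_apply, cross_comm, ← hδd]; ring
  have hXq : X q = 0 := form_self ..
  set Y := form δ p with hY
  have hYp : Y p = 0 := form_self ..
  have hYq : Y q = δ * δ := by rw [hY, form_apply, ← hδd]
  obtain ⟨h, hh⟩ := exists_natCast_gt (c - X (wordDisp F))
  -- The line through `T`, `h` turns of `B` back, cannot be crossed before time `s m`: for large `k`
  -- the word stays outside the domain and at large `Y`, but outside the domain `Y` is bounded above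
  -- on that line.
  have hlow : ∀ m : ℕ, h ≤ m → X (wordDisp A) + X (wordDisp C) + (m - h) * (δ * δ) - c ≤
      X (a + m • p + wordPt w (s m)) := by
    intro m hm
    obtain ⟨T, hT⟩ : ∃ T, T = A ++ wordPow B (m - h) ++ C := ⟨_, rfl⟩
    have hray := hf.ray_right (m - h)
    rw [← hT] at hray
    have hXT : X (wordDisp T) = X (wordDisp A) + (m - h) * (δ * δ) + X (wordDisp C) := by
      rw [hT, wordDisp_append, wordDisp_append, wordDisp_wordPow, map_add, map_add, map_nsmul,
        nsmul_eq_mul, ← hp, hXp, Nat.cast_sub hm]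
    by_contra hcon
    have h3 : ∀ᶠ k : ℕ in atTop, ∀ i ∈ Set.Ioo 0 (s m),
        a + m • p + k • q + wordPt w i ∉ G.dom := by
      rw [hp, hq]
      exact (eventually_all_finite (Set.finite_Ioo _ _)).2 fun i hi => hs2 m i hi.1 hi.2
    have h4 : ∀ᶠ k : ℕ in atTop, ∀ i ∈ Set.Ioo 0 (s m), Y (wordDisp T) +
        |δ| * (latNorm p * E.length) < Y (a + m • p + k • q + wordPt w i) :=
      (eventually_all_finite (Set.finite_Ioo _ _)).2 fun i hi =>
        eventually_lt_map (by rw [hYq]; exact hδ2) _ _ _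
    obtain ⟨k, h5, h6⟩ := (h3.and h4).exists
    have hXk : ∀ i, X (a + m • p + k • q + wordPt w i) = X (a + m • p + wordPt w i) := by
      intro i
      simp only [map_add, map_nsmul, hXq, smul_zero, add_zero]
    obtain ⟨i, h7, h8, j, l, h9⟩ := hcross T (fun i => a + m • p + k • q + wordPt w i)
      (Chase.steps _ w) 0 (s m) (Nat.zero_le _) (Or.inr ⟨by
        rw [hXk, wordPt_zero, add_zero, ha, hXT]
        simp only [map_add, map_nsmul, hXp]
        rw [nsmul_eq_mul]
        nlinarith, by
        rw [hXk, hXT]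
        linarith⟩)
    have hj : j < 0 := Chase.neg_of_notMem hray (h9 ▸ h5 i ⟨h7, h8⟩)
    refine absurd (h6 i ⟨h7, h8⟩) (not_lt.2 ?_)
    rw [h9]
    exact form_linePoint_le hj l (by rw [← hq, ← hY, hYq]; exact hδ2.le)
  obtain ⟨A', B', C', E', F', y, hf', hB', hE', r, hr0, hfan, m, n, hmn⟩ :=
    hG.exists_fan_of_frequently hI (hf.ray_right 0) hE (φ := X) (by rw [← hq]; exact hXq)
      (g := fun m => a + m • p + wordPt w (s m)) (by
        refine tendsto_atTop.2 fun β => ?_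
        obtain ⟨n, hn⟩ := exists_natCast_gt (β + c - X (wordDisp A) - X (wordDisp C))
        refine (eventually_ge_atTop (n + h)).mono fun m hm => le_trans ?_ (hlow m (by omega))
        have h3 : (n : ℤ) + h ≤ m := by exact_mod_cast hm
        nlinarith)
      (Eventually.frequently (Eventually.of_forall fun m => (hs1 m).mono fun k hk => by
        convert hk using 1
        rw [hp]
        abel))
  rw [← hq] at hfan hmn
  have hrN : latNorm r = N := by
    rcases hfan with ⟨-, rfl⟩ | ⟨-, rfl⟩
    exacts [hE', hB']
  -- The fan found shares the edge `q` and lies on the same side. Exteriority in both directions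
  -- makes `r` parallel to `p`, and the sign of `X r` excludes the opposite vector.
  have hrp : r = p := by
    have hX' : ∀ z, X z = δ * cross z q := fun z => by
      rw [hX, form_apply, cross_comm]; ring
    have e1 : Exterior r p q := by
      rw [hp, hq]
      rcases hfan with ⟨-, rfl⟩ | ⟨-, rfl⟩
      · exact hG.exterior (hf'.ray_right 0) hf
      · exact hG.exterior (hf'.ray_left 0) hf
    have e2 : Exterior p r q := by
      have := hG.exterior (hf.ray_left 0) hf'
      rw [← hp] at this
      rcases hfan with ⟨h3, rfl⟩ | ⟨h3, rfl⟩ <;> rw [h3] at this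
      · exact this.symm
      · exact this
    rw [hX'] at hr0
    have h3 : ¬ 0 < cross p r * δ := fun h => e1 ⟨by rw [← hδd]; linarith, by rwa [← hδd]⟩
    have h4 : ¬ 0 < cross r p * cross r q := fun h => e2 ⟨by rw [← hδd]; exact hr0, h⟩
    have h5 : cross p r = 0 := by
      rw [cross_comm r p] at h4
      have h6 : cross r q ≠ 0 := by rintro h; rw [h, mul_zero] at hr0; exact lt_irrefl _ hr0
      rcases lt_trichotomy (cross p r) 0 with h7 | h7 | h7
      · exfalso
        rcases lt_or_gt_of_ne hδ0 with h8 | h8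
        · exact h3 (mul_pos_of_neg_of_neg h7 h8)
        · exact h4 (mul_pos (by linarith) (pos_of_mul_pos_right hr0 h8.le))
      · exact h7
      · exfalso
        rcases lt_or_gt_of_ne hδ0 with h8 | h8
        · exact h4 (mul_pos_of_neg_of_neg (by linarith) (by nlinarith))
        · exact h3 (mul_pos h7 h8)
    refine (eq_or_eq_neg_of_cross_eq_zero h5 hI.pos (hp ▸ hB) hrN).resolve_right ?_
    rintro rfl
    rw [cross_neg_left, ← hδd] at hr0
    linarith
  subst hrp
  -- The new fan has the same two vectors, so adding `M` times both keeps the point in the domain,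
  -- where `h1` forbids it.
  obtain ⟨M, hM⟩ := h1 (s m) (hs0 m)
  rw [← ha, ← hp, ← hq] at hM
  obtain ⟨l, l', h3⟩ := hmn
  refine hM (M + m) (by omega) (M + n) (by omega) ?_
  have h4 : a + (M + m) • r + (M + n) • q + wordPt w (s m) =
      wordDisp A' + wordDisp C' + wordDisp F' + (l' + M) • r + (l + M) • q := by
    rw [add_smul, add_smul, add_smul, add_smul]
    have : a + (M • r + m • r) + (M • q + n • q) + wordPt w (s m) =
      (a + m • r + wordPt w (s m) + n • q) + M • r + M • q := by abel
    rw [this, h3]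
    abel
  rw [h4]
  rcases hfan with ⟨h5, h6⟩ | ⟨h5, h6⟩ <;> rw [← h5, ← h6]
  · rw [add_right_comm, ← disp_fan]
    exact (hf'.run _ _).mem_dom
  · rw [← disp_fan]
    exact (hf'.run _ _).mem_dom

end IsQuipu

/-! ### Distance from the domain -/

namespace TAS

variable {Γ : Type*} {S : TAS Γ}

/-- The points of the maximal assembly at distance at most `n` from `D`. -/
def level (S : TAS Γ) (D : Set (ℤ × ℤ)) : ℕ → Set (ℤ × ℤ)
  | 0 => D
  | n + 1 => S.level D n ∪ {v | ∃ u ∈ S.level D n, S.alphaMax.bindingGraph.Adj u v}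

variable {D : Set (ℤ × ℤ)}

theorem exists_walk_of_level {n : ℕ} {v : ℤ × ℤ} (hv : v ∈ S.level D n)
    (hv' : ∀ j < n, v ∉ S.level D j) : ∃ f : ℕ → ℤ × ℤ, f n = v ∧
      (∀ i < n, S.alphaMax.bindingGraph.Adj (f i) (f (i + 1))) ∧
      ∀ i ≤ n, f i ∈ S.level D i ∧ ∀ j < i, f i ∉ S.level D j := by
  induction n generalizing v with
  | zero =>
    refine ⟨fun _ => v, rfl, fun i hi => absurd hi (Nat.not_lt_zero _), fun i hi => ?_⟩
    rw [Nat.le_zero.1 hi]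
    exact ⟨hv, hv'⟩
  | succ n ih =>
    obtain ⟨u, hu, huv⟩ := hv.resolve_left (hv' n n.lt_succ_self)
    obtain ⟨f, h1, h2, h3⟩ := ih hu fun j hj hu' =>
      hv' (j + 1) (by omega) (Or.inr ⟨u, hu', huv⟩)
    refine ⟨fun i => if i ≤ n then f i else v, if_neg (by omega), fun i hi => ?_, fun i hi => ?_⟩
    · rcases Nat.lt_succ_iff_lt_or_eq.1 hi with h | rfl
      · simp only [if_pos h.le, if_pos (Nat.succ_le_of_lt h)]
        exact h2 i h
      · simp only [le_refl, if_true, if_neg (Nat.not_succ_le_self i), h1]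
        exact huv
    · by_cases h : i ≤ n
      · simp only [if_pos h]
        exact h3 i h
      · obtain rfl : i = n + 1 := by omega
        simp only [if_neg h]
        exact ⟨hv, hv'⟩

/-- A shortest walk from `D` leaves `D` at once and repeats no point. -/
theorem exists_excursion_of_level {n : ℕ} {v : ℤ × ℤ} (hv : v ∈ S.level D n)
    (hv' : ∀ j < n, v ∉ S.level D j) : ∃ f : ℕ → ℤ × ℤ, f 0 ∈ D ∧ S.IsExcursion D f n := by
  obtain ⟨f, -, h2, h3⟩ := exists_walk_of_level hv hv'
  refine ⟨f, (h3 0 (Nat.zero_le _)).1, h2, fun i h4 h5 => (h3 i h5).2 0 h4,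
    fun i j hi hj hij => ?_⟩
  rcases lt_trichotomy i j with h | h | h
  · exact absurd (hij ▸ (h3 i hi).1) ((h3 j hj).2 i h)
  · exact h
  · exact absurd (hij ▸ (h3 j hj).1) ((h3 i hi).2 j h)

theorem exists_mem_level (hS : S.Confluent) (h0 : 0 ∈ D) {v : ℤ × ℤ} (hv : v ∈ S.alphaMax.dom) :
    ∃ n, v ∈ S.level D n := by
  obtain ⟨t, ht⟩ := hv
  obtain ⟨α, hα, hαv⟩ := exists_producible ht
  have hle : α.bindingGraph ≤ S.alphaMax.bindingGraph := by
    rintro v w ⟨d, t, t', h1, h2, h3, h4⟩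
    exact ⟨d, t, t', h1, by rw [alphaMax_eq hS hα ⟨_, h2⟩, h2],
      by rw [alphaMax_eq hS hα ⟨_, h3⟩, h3], h4⟩
  have h := (hα.2.1.2 0 ⟨_, hα.2.2⟩ v ⟨t, hαv⟩).mono hle
  rw [SimpleGraph.reachable_iff_reflTransGen] at h
  clear ht hαv
  induction h with
  | refl => exact ⟨0, h0⟩
  | tail _ h ih =>
    obtain ⟨n, hn⟩ := ih
    exact ⟨n + 1, Or.inr ⟨_, hn, h⟩⟩

end TAS

/-! ### Excursions have bounded length -/

namespace IsQuipu

variable {Γ : Type*} {S : TAS Γ} {G : LGraph Γ} (hS : S.Confluent) (hG : IsQuipu S G)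
  {U V W A B C E F : List Dir} {x : G.V} {N : ℕ} {I : Set (G.V × Piece)} {w : ℕ → Dir}
include hS hG

/-- If a prefix of the word led into the domain from infinitely many points of the ray, stability
would extend this to almost all of them, and long excursions would start in a finite set. So
`not_excursions_ray` applies. -/
theorem not_excursions_of_mem_ray (hpath : S.PathCondition G.dom) (hI : G.IsDecomposition N I)
    (hr : G.IsRay U V W x) (hV : latNorm (wordDisp V) = N) :
    ¬ ∀ n, ∃ v ∈ raySet (wordDisp U + wordDisp W) (wordDisp V),
      S.IsExcursion G.dom (fun i => v + wordPt w i) n := by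
  intro h
  refine hG.not_excursions_ray hS hpath hI hr hV (w := w) (fun s hs => ?_) fun n => ?_
  · by_contra hcon
    obtain ⟨K, hK⟩ := (hG.stableAlong_ray hI hr hV
      (wordDisp U + wordDisp W + wordPt w s)).iff
    have e : ∀ m : ℕ, wordDisp U + wordDisp W + wordPt w s + m • wordDisp V + 0 • (0 : ℤ × ℤ) =
        wordDisp U + wordDisp W + m • wordDisp V + wordPt w s := fun m => by
      rw [smul_zero, add_zero]; abel
    obtain ⟨m, hm, hmK⟩ := ((not_eventually.1 hcon).and_eventually (eventually_ge_atTop K)).exists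
    rw [not_not] at hm
    obtain ⟨L, hL⟩ := hpath.bounded_of_finite ((Set.finite_Iio K).image fun m =>
      wordDisp U + wordDisp W + m • wordDisp V)
    obtain ⟨v, ⟨m', rfl⟩, h1⟩ := h (max (L + 1) s)
    have h2 : m' < K := by
      by_contra h3
      refine h1.notMem s hs (le_max_right _ _) ?_
      rw [← e, ← hK m hmK m' (not_lt.1 h3), e]
      exact hm
    have := hL _ _ ⟨m', h2, by simp⟩ h1
    omega
  · obtain ⟨v, ⟨m, rfl⟩, h1⟩ := h n
    refine ⟨_, ?_, h1⟩
    rw [← disp_ray, mem_cover]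
    exact ⟨_, hr.run m, rfl⟩

/-- A prefix that leads into the domain from points arbitrarily deep in the fan does so, by
stability along both edges, from all deep points. Long excursions would then start on finitely many
rays near the edges. -/
theorem not_excursions_of_mem_fan (hpath : S.PathCondition G.dom) (hI : G.IsDecomposition N I)
    (hf : G.IsFan A B C E F x) (hB : latNorm (wordDisp B) = N) (hE : latNorm (wordDisp E) = N) :
    ¬ ∀ n, ∃ v ∈ fanSet (wordDisp A + wordDisp C + wordDisp F) (wordDisp B) (wordDisp E),
      S.IsExcursion G.dom (fun i => v + wordPt w i) n := by
  intro h
  refine hG.not_excursions_fan hS hpath hI hf hB hE (w := w) (fun s hs => ?_) fun n => ?_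
  · by_contra! hcon
    set a := wordDisp A + wordDisp C + wordDisp F with ha
    obtain ⟨K₁, hK₁⟩ := (hG.stableAlong_fan hI hf hB hE (a + wordPt w s)).iff
    obtain ⟨K₂, hK₂⟩ := (hG.stableAlong_fan_symm hI hf hB hE (a + wordPt w s)).iff
    set K := max K₁ K₂
    have e1 : ∀ m k : ℕ, a + wordPt w s + m • wordDisp B + k • wordDisp E =
        a + m • wordDisp B + k • wordDisp E + wordPt w s := fun m k => by abel
    have e2 : ∀ m k : ℕ, a + wordPt w s + k • wordDisp E + m • wordDisp B =
        a + m • wordDisp B + k • wordDisp E + wordPt w s := fun m k => by abel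
    simp only [e1] at hK₁
    simp only [e2] at hK₂
    obtain ⟨m, hm, k, hk, hmk⟩ := hcon K
    have hall : ∀ m' k', K ≤ m' → K ≤ k' →
        a + m' • wordDisp B + k' • wordDisp E + wordPt w s ∈ G.dom := by
      intro m' k' hm' hk'
      rw [hK₁ m' (by omega) m (by omega), hK₂ k' (by omega) k (by omega)]
      exact hmk
    have h1 : ∃ᶠ n in atTop,
        (∃ i ∈ Set.Iio K, ∃ v ∈ raySet (wordDisp (A ++ wordPow B i ++ C) + wordDisp F) (wordDisp E),
          S.IsExcursion G.dom (fun i => v + wordPt w i) n) ∨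
        (∃ j ∈ Set.Iio K, ∃ v ∈ raySet (wordDisp A + wordDisp (C ++ wordPow E j ++ F)) (wordDisp B),
          S.IsExcursion G.dom (fun i => v + wordPt w i) n) := by
      refine ((eventually_ge_atTop s).mono fun n hn => ?_).frequently
      obtain ⟨v, ⟨i, j, rfl⟩, h1⟩ := h n
      by_cases h2 : i < K
      · refine Or.inl ⟨i, h2, _, ⟨j, ?_⟩, h1⟩
        rw [ha, wordDisp_append, wordDisp_append, wordDisp_wordPow]
        abel
      · refine Or.inr ⟨j, ?_, _, ⟨i, ?_⟩, h1⟩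
        · by_contra h3
          exact h1.notMem s hs hn (hall i j (not_lt.1 h2) (not_lt.1 h3))
        · rw [ha, wordDisp_append, wordDisp_append, wordDisp_wordPow]
          abel
    have hmono : ∀ V : Set (ℤ × ℤ), (∃ᶠ n in atTop, ∃ v ∈ V,
        S.IsExcursion G.dom (fun i => v + wordPt w i) n) → ∀ n, ∃ v ∈ V,
        S.IsExcursion G.dom (fun i => v + wordPt w i) n := fun V hV n => by
      obtain ⟨m, hm, v, hv, h2⟩ := frequently_atTop.1 hV n
      exact ⟨v, hv, h2.mono hm⟩
    rcases frequently_or_distrib.1 h1 with h1 | h1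
    · obtain ⟨i, -, h2⟩ := frequently_exists_finite (Set.finite_Iio K) h1
      exact hG.not_excursions_of_mem_ray hS hpath hI (hf.ray_right i) hE (hmono _ h2)
    · obtain ⟨i, -, h2⟩ := frequently_exists_finite (Set.finite_Iio K) h1
      exact hG.not_excursions_of_mem_ray hS hpath hI (hf.ray_left i) hB (hmono _ h2)
  · obtain ⟨v, ⟨m, k, rfl⟩, h1⟩ := h n
    refine ⟨_, ?_, h1⟩
    rw [← disp_fan, mem_cover]
    exact ⟨_, hf.run m k, rfl⟩

/-- Unbounded excursions would start in one piece, and by compactness there would be one infinite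
word for all lengths; every kind of piece excludes this. -/
theorem bounded_excursions (hpath : S.PathCondition G.dom) :
    ∃ L, ∀ f n, f 0 ∈ G.dom → S.IsExcursion G.dom f n → n ≤ L := by
  obtain ⟨N, -, I, hI⟩ := hG.exists_pieces
  by_contra! h
  have h1 : ∃ᶠ n in atTop, ∃ i ∈ I, ∃ f : ℕ → ℤ × ℤ, f 0 ∈ i.2.pts ∧ S.IsExcursion G.dom f n := by
    refine (Eventually.of_forall fun n => ?_).frequently
    obtain ⟨f, m, h2, h3, h4⟩ := h n
    rw [hI.dom_eq] at h2
    obtain ⟨i, hi, h5⟩ := Set.mem_iUnion₂.1 h2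
    exact ⟨i, hi, f, h5, h3.mono h4.le⟩
  obtain ⟨⟨x, P⟩, hi, h2⟩ := frequently_exists_finite hI.finite h1
  have hlong : ∀ n, ∃ f : ℕ → ℤ × ℤ, f 0 ∈ P.pts ∧ S.IsExcursion G.dom f n := fun n => by
    obtain ⟨m, hm, f, h3, h4⟩ := frequently_atTop.1 h2 n
    exact ⟨f, h3, h4.mono hm⟩
  obtain ⟨w, hw⟩ := TAS.exists_wordPt hlong
  have hv := hI.valid _ hi
  cases P with
  | point A =>
    obtain ⟨L, hL⟩ := hpath.bounded_of_finite (Set.finite_singleton (wordDisp A))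
    obtain ⟨f, h3, h4⟩ := hlong (L + 1)
    have := hL f _ h3 h4
    omega
  | ray U V W => exact hG.not_excursions_of_mem_ray hS hpath hI hv.1 hv.2 hw
  | fan A B C E F => exact hG.not_excursions_of_mem_fan hS hpath hI hv.1 hv.2.1 hv.2.2 hw

theorem exists_subset_level (hpath : S.PathCondition G.dom) :
    ∃ n, S.alphaMax.dom ⊆ S.level G.dom n := by
  classical
  obtain ⟨L, hL⟩ := hG.bounded_excursions hS hpath
  refine ⟨L, fun v hv => ?_⟩
  have hex := TAS.exists_mem_level hS (D := G.dom) (Run.mem_dom (l := []) (run_nil.2 rfl)) hv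
  obtain ⟨f, h1, h2⟩ := TAS.exists_excursion_of_level (Nat.find_spec hex)
    fun j hj => Nat.find_min hex hj
  have h3 : Nat.find hex ≤ L := hL f _ h1 h2
  have hmono : Monotone (S.level G.dom) := monotone_nat_of_le_succ fun n => Set.subset_union_left
  exact hmono h3 (Nat.find_spec hex)

end IsQuipu

/-! ### Iterating the extensions -/

namespace Quipu

variable {Γ : Type*} {S : TAS Γ}

/-- Some single-direction extension leads from `Q` to `Q'`. -/
def Extends (Q Q' : Quipu S) : Prop :=
  ∃ (X : Set Q.V) (d : Dir) (t : Tile Γ), IsSingleDirExt Q X d t Q'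

/-- One extension is made for each pair in the list. By confluence the tile at a covered point is
the label of the covering vertex, so the extension for a pair reaches the neighbours of all covered
points with this tile. -/
theorem exists_extends (hS : S.Confluent) (l : List (Tile Γ × Dir))
    (hl : ∀ p ∈ l, ∃ t' ∈ S.tiles, p.1 p.2 = t' p.2.opp) (Q : Quipu S) :
    ∃ Q' : Quipu S, Relation.ReflTransGen Extends Q Q' ∧ Q.dom ⊆ Q'.dom ∧
      ∀ p ∈ l, ∀ u ∈ Q.dom, S.alphaMax u = some p.1 → u + p.2.vec ∈ Q'.dom := by
  induction l generalizing Q with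
  | nil => exact ⟨Q, .refl, subset_rfl, by simp⟩
  | cons p l ih =>
    obtain ⟨t', ht', hg⟩ := hl p List.mem_cons_self
    obtain ⟨Q₁, h1, h2⟩ := Q.isQuipu.exists_isSingleDirExt ht' hg
    obtain ⟨Q₂, h3, h4, h5⟩ := ih (fun p hp => hl p (List.mem_cons_of_mem _ hp)) Q₁
    refine ⟨Q₂, .head ⟨_, _, _, h1⟩ h3, h2.trans h4, fun p' hp' u hu hup => ?_⟩
    rcases List.mem_cons.1 hp' with rfl | hp'
    · obtain ⟨x, hx⟩ := hu
      have h6 := Q.isQuipu.alphaMax_of_mem_cover hS hx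
      rw [hup, Option.some_inj] at h6
      exact h4 (h1.2.2.2 x h6.symm u hx)
    · exact h5 p' hp' u (h2 hu) hup

theorem exists_extends_level [Finite Γ] (hS : S.Confluent) (Q : Quipu S) (n : ℕ) :
    ∃ Q' : Quipu S, Relation.ReflTransGen Extends Q Q' ∧ S.level Q.dom n ⊆ Q'.dom := by
  induction n with
  | zero => exact ⟨Q, .refl, subset_rfl⟩
  | succ n ih =>
    obtain ⟨Q₁, h1, h2⟩ := ih
    have hfin := Set.toFinite {p : Tile Γ × Dir | ∃ t' ∈ S.tiles, p.1 p.2 = t' p.2.opp}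
    obtain ⟨Q₂, h3, h4, h5⟩ := exists_extends hS hfin.toFinset.toList (fun p hp => by
      simpa using hp) Q₁
    refine ⟨Q₂, h1.trans h3, ?_⟩
    rintro v (hv | ⟨u, hu, d, t, t', rfl, h6, h7, h8⟩)
    · exact h4 (h2 hv)
    -- The tile at the origin need not belong to `S.tiles`, but the origin is always in the domain.
    · by_cases h9 : u + d.vec = 0
      · rw [h9]
        exact LGraph.Run.mem_dom (l := []) (LGraph.run_nil.2 rfl)
      · exact h5 (t, d) (by simpa using ⟨t', TAS.tile_mem_of_ne_zero h7 h9, h8⟩) u (h2 hu) h6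

end Quipu

theorem mainTheorem4 {Γ : Type*} [Finite Γ] (S : TAS Γ) (hS : S.Confluent) (Q : Quipu S)
    (hQ : Q.dom ⊂ S.alphaMax.dom)
    (hpath : ∀ π : ℕ → ℤ × ℤ, Function.Injective π →
      (∀ n, S.alphaMax.bindingGraph.Adj (π n) (π (n + 1))) →
      ¬ Set.range π ⊆ Q.dom → (Set.range π ∩ Q.dom).Infinite) :
    ∃ Q' : Quipu S,
      Relation.TransGen
        (fun Q₁ Q₂ : Quipu S => ∃ (X : Set Q₁.V) (d : Dir) (t : Tile Γ),
          Quipu.IsSingleDirExt Q₁ X d t Q₂) Q Q' ∧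
      Q'.dom = S.alphaMax.dom := by
  obtain ⟨n, hn⟩ := Q.isQuipu.exists_subset_level hS hpath
  obtain ⟨Q', h1, h2⟩ := Q.exists_extends_level hS n
  have h3 : Q'.dom = S.alphaMax.dom := (Q'.isQuipu.dom_subset hS).antisymm (hn.trans h2)
  -- Properness of the inclusion guarantees at least one extension.
  rcases Relation.reflTransGen_iff_eq_or_transGen.1 h1 with rfl | h1
  · exact absurd h3 hQ.ne
  · exact ⟨Q', h1, h3⟩
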